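/- **Conventions.** Let $\mathbb K$ be $\mathbb C$ or $\mathbb R$. Spaces are complete Hausdorff locally convex (clc) $\mathbb K$-vector spaces, $\hat\otimes$ is the completed projective tensor product, and for $\mathbb Z$-graded clc spaces $(E\hat\otimes F)^n=\prod_{a+b=n}E^a\hat\otimes F^b$. A *clct cdg-algebra* $(A,d,B)$ is a $\mathbb Z$-graded clc space with an associative unital product given by a continuous linear map $A\hat\otimes A\to A$ of degree $0$, a continuous derivation $d$ of degree $1$ and an element $B\in A^2$ with $dB=0$ and $d^2x=Bx-xB$. A (right) *clct cdg-module* $M$ is a graded clc space with a unital associative action given by a continuous map $M\hat\otimes A\to M$ of degree $0$ and a continuous $d$ of degree $1$ with $d(xa)=(dx)a+(-1)^{|x|}x\,da$ and $d^2x=-xB$. Let $Z^0(A\text{-Mod})$ be the category of clct cdg-modules and continuous $A$-linear maps of degree $0$ commuting with $d$, and $H^0(A\text{-Mod})$ its quotient by continuous $A$-linear homotopies. A short exact sequence in $Z^0(A\text{-Mod})$ is one which in each degree has a continuous $\mathbb K$-linear contracting homotopy. The *contraderived category* $D^{ctr}(A)$ is the Verdier quotient of $H^0(A\text{-Mod})$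 by the smallest thick triangulated subcategory that contains the totalizations of short exact sequences and is closed under products. Let $Q:Z^0(A\text{-Mod})\to D^{ctr}(A)$ be the canonical functor. The shift is $N[n]^i=N^{i+n}$, $d_{N[n]}=(-1)^nd_N$. A graded clc space $E$ *carries the discrete topology* if its total space $\prod_nE^n$ carries the finest locally convex topology, i.e. every seminorm on $\prod_nE^n$ is continuous (equivalently, each $E^n$ has the finest locally convex topology and only finitely many $E^n$ are non-zero); it has a *countable basis* if every $E^n$ has countable dimension. Forgetting topologies, clct cdg-algebras and modules become ordinary (discrete) ones. For a discrete cdg-algebra $A$ and discrete cdg-modules $M,N$, let $\cdots\to F_1\to F_0\xrightarrow{\varepsilon}M\to0$ be a resolution by cdg-modules and closed morphisms of degree $0$, exact in every degree, with all $F_k$ graded-projective (projective as graded modules over the graded algebra underlying $A$). *Ext of the second kind* in the sense of Polishchuk and Positselski is $\mathrm{Ext}^{II,PP,n}(M,N)=H^n\big(\mathrm{Tot}^{\oplus}\,\mathrm{Hom}^*_A(F_*,N)\big)$. The *Polishchuk–Positselski Hochschild cohomology* is $HH^{PP,n}(A,A)=\mathrm{Ext}^{II,PP,n}(A,A)$ over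 the algebraic enveloping algebra $A^{op}\otimes A$. For a clct cdg-algebra $A$ put $A^e=A^{op}\hat\otimes A$ (with curvature $-B\otimes1+1\otimes B$), which acts on $A$ from the right by $a(x\otimes y)=(-1)^{|a||x|}xay$; the *continuous Hochschild cohomology* is $HH^n_{cont}(A,A)=\mathrm{Hom}_{D^{ctr}(A^e)}(A,A[n])$. **Theorem.** Let $A$ be a clct cdg-algebra over $\mathbb K$ which carries the discrete topology and has a countable basis. 1. Let $M$ be a clct cdg-module over $A$ which carries the discrete topology and has a countable basis. Then resolutions $F_*$ as above of the discrete cdg-module $M$ exist. For every such resolution, every clct cdg-module $N$ over $A$ carrying the discrete topology and every $n\in\mathbb Z$, there is an isomorphism of $\mathbb K$-vector spaces $$\mathrm{Hom}_{D^{ctr}(A)}(M,N[n])\;\cong\;\mathrm{Ext}^{II,PP,n}(M,N)$$ (the right-hand side computed with $F_*$) which sends $Q(f)$ to the class of $f\circ\varepsilon\in\mathrm{Hom}^n_A(F_0,N)$, for every morphism $f:M\to N[n]$ of $Z^0(A\text{-Mod})$. 2. The discrete cdg-module $A$ over $A^{op}\otimes A$ has resolutions $F_*$ as above. For every such resolution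 and every $n\in\mathbb Z$ there is an isomorphism of $\mathbb K$-vector spaces $$HH^n_{cont}(A,A)=\mathrm{Hom}_{D^{ctr}(A^e)}(A,A[n])\;\cong\;HH^{PP,n}(A,A)$$ (the right-hand side computed with $F_*$) which sends $Q(f)$ to the class of $f\circ\varepsilon$, for every morphism $f:A\to A[n]$ of $Z^0(A^e\text{-Mod})$. -/

import Mathlib

open scoped TensorProduct
open Filter Topology

universe u

/-! ### Discrete cdg-algebras and their modules -/

/-- The sign `(-1) ^ n` in the ground field. -/
def sgn (𝕜 : Type) [Field 𝕜] (n : ℤ) : 𝕜 := ((n.negOnePow : ℤ) : 𝕜)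

section Sign

variable {𝕜 : Type} [Field 𝕜]

theorem sgn_add (m n : ℤ) : sgn 𝕜 (m + n) = sgn 𝕜 m * sgn 𝕜 n := by
  simp [sgn, Int.negOnePow_add]

theorem sgn_even {n : ℤ} (h : Even n) : sgn 𝕜 n = 1 := by
  simp [sgn, Int.negOnePow_even n h]

theorem sgn_odd {n : ℤ} (h : Odd n) : sgn 𝕜 n = -1 := by
  simp [sgn, Int.negOnePow_odd n h]

theorem sgn_congr {m n : ℤ} (h : Even (m - n)) : sgn 𝕜 m = sgn 𝕜 n := by
  have : m = (m - n) + n := by ring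
  rw [this, sgn_add, sgn_even h, one_mul]

theorem sgn_congr' {m n : ℤ} (h : Odd (m - n)) : sgn 𝕜 m = -sgn 𝕜 n := by
  have : m = (m - n) + n := by ring
  rw [this, sgn_add, sgn_odd h, neg_one_mul]

end Sign

/-- A (discrete, `ℤ`-graded, unital, associative) cdg-algebra `(A, d, B)` over `𝕜`.  The operations
`mul` and `d` are indexed by all triples (pairs) of degrees together with a proof that the degrees
match. -/
structure CDGAlg (𝕜 : Type) [Field 𝕜] where
  /-- the homogeneous components -/
  C : ℤ → Type u
  [grp : ∀ i, AddCommGroup (C i)]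
  [mod : ∀ i, Module 𝕜 (C i)]
  mul : ∀ {i j n : ℤ}, i + j = n → (C i →ₗ[𝕜] C j →ₗ[𝕜] C n)
  one : C 0
  /-- the derivation of degree `1` -/
  d : ∀ {i j : ℤ}, i + 1 = j → (C i →ₗ[𝕜] C j)
  /-- the curvature element -/
  B : C 2
  one_mul : ∀ {i : ℤ} (x : C i), mul (zero_add i) one x = x
  mul_one : ∀ {i : ℤ} (x : C i), mul (add_zero i) x one = x
  mul_assoc : ∀ {i j k a b n : ℤ} (h₁ : i + j = a) (h₂ : a + k = n) (h₃ : j + k = b)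
    (h₄ : i + b = n) (x : C i) (y : C j) (z : C k),
    mul h₂ (mul h₁ x y) z = mul h₄ x (mul h₃ y z)
  leibniz : ∀ {i j n i' j' n' : ℤ} (h : i + j = n) (hn : n + 1 = n') (hi : i + 1 = i')
    (hj : j + 1 = j') (h₁ : i' + j = n') (h₂ : i + j' = n') (x : C i) (y : C j),
    d hn (mul h x y) = mul h₁ (d hi x) y + sgn 𝕜 i • mul h₂ x (d hj y)
  bianchi : ∀ {k : ℤ} (h : 2 + 1 = k), d h B = 0
  d_d : ∀ {i j k : ℤ} (h₁ : i + 1 = j) (h₂ : j + 1 = k) (h₃ : 2 + i = k) (h₄ : i + 2 = k) (x : C i),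
    d h₂ (d h₁ x) = mul h₃ B x - mul h₄ x B

attribute [instance] CDGAlg.grp CDGAlg.mod

/-- A graded right module over the graded algebra underlying a cdg-algebra. -/
structure GrMod {𝕜 : Type} [Field 𝕜] (A : CDGAlg.{u} 𝕜) where
  C : ℤ → Type u
  [grp : ∀ i, AddCommGroup (C i)]
  [mod : ∀ i, Module 𝕜 (C i)]
  act : ∀ {i j n : ℤ}, i + j = n → (C i →ₗ[𝕜] A.C j →ₗ[𝕜] C n)
  act_one : ∀ {i : ℤ} (x : C i), act (add_zero i) x A.one = x
  act_act : ∀ {i j k a b n : ℤ} (h₁ : i + j = a) (h₂ : a + k = n) (h₃ : j + k = b)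
    (h₄ : i + b = n) (x : C i) (y : A.C j) (z : A.C k),
    act h₂ (act h₁ x y) z = act h₄ x (A.mul h₃ y z)

attribute [instance] GrMod.grp GrMod.mod

/-- A (discrete) right cdg-module: `d (x a) = d x a + (-1)^|x| x d a` and `d² x = - x B`. -/
structure CDGMod {𝕜 : Type} [Field 𝕜] (A : CDGAlg.{u} 𝕜) extends GrMod.{u} A where
  d : ∀ {i j : ℤ}, i + 1 = j → (C i →ₗ[𝕜] C j)
  leibniz : ∀ {i j n i' j' n' : ℤ} (h : i + j = n) (hn : n + 1 = n') (hi : i + 1 = i')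
    (hj : j + 1 = j') (h₁ : i' + j = n') (h₂ : i + j' = n') (x : C i) (y : A.C j),
    d hn (act h x y) = act h₁ (d hi x) y + sgn 𝕜 i • act h₂ x (A.d hj y)
  d_d : ∀ {i j k : ℤ} (h₁ : i + 1 = j) (h₂ : j + 1 = k) (h₃ : i + 2 = k) (x : C i),
    d h₂ (d h₁ x) = - act h₃ x A.B

section Discrete

variable {𝕜 : Type} [Field 𝕜] {A : CDGAlg.{u} 𝕜}

/-- Families of linear maps `M^i → N^j`, one for each pair of degrees with `i + k = j`. -/
abbrev DegMaps (M N : GrMod.{u} A) (k : ℤ) : Type u :=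
  ∀ p : {p : ℤ × ℤ // p.1 + k = p.2}, M.C p.1.1 →ₗ[𝕜] N.C p.1.2

/-- The `𝕜`-module of `A`-linear maps of degree `k`. -/
def homsSubmodule (M N : GrMod.{u} A) (k : ℤ) : Submodule 𝕜 (DegMaps M N k) where
  carrier := {f | ∀ {i j n i' n' : ℤ} (h : i + j = n) (hi : i + k = i') (hn : n + k = n')
    (h' : i' + j = n') (x : M.C i) (a : A.C j),
    f ⟨(n, n'), hn⟩ (M.act h x a) = N.act h' (f ⟨(i, i'), hi⟩ x) a}
  zero_mem' := by simp
  add_mem' := by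
    intro f g hf hg i j n i' n' h hi hn h' x a
    simp [hf h hi hn h', hg h hi hn h']
  smul_mem' := by
    intro c f hf i j n i' n' h hi hn h' x a
    simp [hf h hi hn h']

/-- `A`-linear maps of degree `k`. -/
abbrev Homs (M N : GrMod.{u} A) (k : ℤ) : Type u := homsSubmodule M N k

/-- The component `M^i → N^j` of an `A`-linear map of degree `k`. -/
def Homs.app {M N : GrMod.{u} A} {k : ℤ} (f : Homs M N k) {i j : ℤ} (h : i + k = j) :
    M.C i →ₗ[𝕜] N.C j :=
  f.1 ⟨(i, j), h⟩

theorem Homs.app_act {M N : GrMod.{u} A} {k : ℤ} (f : Homs M N k) {i j n i' n' : ℤ}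
    (h : i + j = n) (hi : i + k = i') (hn : n + k = n') (h' : i' + j = n') (x : M.C i)
    (a : A.C j) : f.app hn (M.act h x a) = N.act h' (f.app hi x) a :=
  f.2 h hi hn h' x a

/-- The differential `δ f = d f - (-1)^k f d` of the Hom-complex of two cdg-modules. -/
def homD (M N : CDGMod.{u} A) {k l : ℤ} (hkl : k + 1 = l) :
    Homs M.toGrMod N.toGrMod k →ₗ[𝕜] Homs M.toGrMod N.toGrMod l where
  toFun f := ⟨fun p =>
      N.d (i := p.1.1 + k) (j := p.1.2) (by have := p.2; omega) ∘ₗ f.app rfl -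
      sgn 𝕜 k • (f.app (j := p.1.2) (by have := p.2; omega) ∘ₗ M.d (i := p.1.1) rfl), by
    intro i j n i' n' h hi hn h' x a
    have h1 := f.app_act h (i' := i + k) (n' := n + k) rfl rfl (by omega) x a
    have h2 := M.leibniz h (n' := n + 1) (i' := i + 1) (j' := j + 1) rfl rfl rfl (by omega)
      (by omega) x a
    have h3 := N.leibniz (i := i + k) (j := j) (n := n + k) (n' := n') (i' := i') (j' := j + 1)
      (by omega) (by omega) (by omega) rfl (by omega) (by omega) (f.app rfl x) a
    have h4 := f.app_act (i := i + 1) (j := j) (n := n + 1) (i' := i') (n' := n') (by omega)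
      (by omega) (by omega) (by omega) (M.d rfl x) a
    have h5 := f.app_act (i := i) (j := j + 1) (n := n + 1) (i' := i + k) (n' := n') (by omega)
      (by omega) (by omega) (by omega) x (A.d rfl a)
    simp only [LinearMap.sub_apply, LinearMap.comp_apply, LinearMap.smul_apply, map_sub, map_smul]
    rw [h1, h3, h2, map_add, map_smul, h4, h5, sgn_add]
    module⟩
  map_add' f g := by
    apply Subtype.ext
    funext p
    ext x
    simp only [Homs.app, Submodule.coe_add, Pi.add_apply, LinearMap.sub_apply,
      LinearMap.comp_apply, LinearMap.smul_apply, LinearMap.add_apply, map_add, smul_add]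
    abel
  map_smul' c f := by
    apply Subtype.ext
    funext p
    ext x
    simp only [Homs.app, Submodule.coe_smul, Pi.smul_apply, LinearMap.sub_apply,
      LinearMap.comp_apply, LinearMap.smul_apply, map_smul, RingHom.id_apply]
    module

/-- `f` is a closed morphism of degree `0`. -/
def IsClosedHom {M N : CDGMod.{u} A} (f : Homs M.toGrMod N.toGrMod 0) : Prop :=
  homD M N (zero_add 1) f = 0

/-- Composition `g ↦ g ∘ f` with an `A`-linear map `f` of degree `0`. -/
def Homs.precomp {L M : GrMod.{u} A} (f : Homs L M 0) (N : GrMod.{u} A) {k l : ℤ} (hkl : k = l) :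
    Homs M N k →ₗ[𝕜] Homs L N l where
  toFun g := ⟨fun p => g.app (j := p.1.2) (by have := p.2; omega) ∘ₗ f.app (add_zero p.1.1), by
    intro i j n i' n' h hi hn h' x a
    simp only [LinearMap.comp_apply]
    rw [f.app_act h (add_zero i) (add_zero n) h, g.app_act h (by omega) (by omega) h']⟩
  map_add' _ _ := rfl
  map_smul' _ _ := rfl

/-- A graded module is graded-projective if it has the lifting property against all
(degreewise) surjective `A`-linear maps of graded modules. -/
def IsGradedProjective (P : GrMod.{u} A) : Prop :=
  ∀ (X Y : GrMod.{u} A) (p : Homs X Y 0) (f : Homs P Y 0),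
    (∀ i, Function.Surjective (p.app (add_zero i))) →
      ∃ g : Homs P X 0, Homs.precomp g Y rfl p = f

/-- A resolution `⋯ → F 2 → F 1 → F 0 → M → 0` of a discrete cdg-module by graded-projective
cdg-modules and closed morphisms, exact in every internal degree. -/
structure GPResolution (M : CDGMod.{u} A) where
  F : ℕ → CDGMod.{u} A
  del : ∀ n, Homs (F (n + 1)).toGrMod (F n).toGrMod 0
  aug : Homs (F 0).toGrMod M.toGrMod 0
  proj : ∀ n, IsGradedProjective (F n).toGrMod
  del_closed : ∀ n, IsClosedHom (del n)
  aug_closed : IsClosedHom aug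
  aug_surj : ∀ i, Function.Surjective (aug.app (add_zero i))
  exact_zero : ∀ i, Function.Exact ((del 0).app (add_zero i)) (aug.app (add_zero i))
  exact_succ : ∀ n i,
    Function.Exact ((del (n + 1)).app (add_zero i)) ((del n).app (add_zero i))

namespace GPResolution

variable {M : CDGMod.{u} A} (R : GPResolution M) (N : CDGMod.{u} A)

/-- Families `φ n ∈ Hom^{k-n}(F n, N)`: the degree `k` part of the product totalization. -/
abbrev Fam (k : ℤ) : Type u := ∀ n : ℕ, Homs (R.F n).toGrMod N.toGrMod (k - n)

/-- The total differential `(D φ) n = (-1)^n δ (φ n) + φ (n-1) ∘ ∂`. -/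
def totD {k l : ℤ} (h : k + 1 = l) : R.Fam N k →ₗ[𝕜] R.Fam N l :=
  LinearMap.pi fun n => match n with
    | 0 => homD (R.F 0) N (by omega) ∘ₗ LinearMap.proj 0
    | n + 1 => sgn 𝕜 ((n : ℤ) + 1) • (homD (R.F (n + 1)) N (by push_cast; omega) ∘ₗ
          LinearMap.proj (n + 1)) +
        Homs.precomp (R.del n) N.toGrMod (by push_cast; omega) ∘ₗ LinearMap.proj n

/-- The degree `k` part of the direct sum totalization `Tot^⊕ Hom(F, N)`: the families with only
finitely many non-zero members. -/
def tot (k : ℤ) : Submodule 𝕜 (R.Fam N k) where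
  carrier := {φ | {n | φ n ≠ 0}.Finite}
  zero_mem' := by simp
  add_mem' := by
    intro a b ha hb
    refine (ha.union hb).subset fun n hn => ?_
    by_contra hc
    simp only [Set.mem_union, Set.mem_setOf_eq, not_or, not_not] at hc
    exact hn (by simp [hc.1, hc.2])
  smul_mem' := by
    intro c a ha
    refine ha.subset fun n hn hc => hn (by simp [hc])

/-- Cocycles of degree `k` in `Tot^⊕ Hom(F, N)`. -/
def cocycles (k : ℤ) : Submodule 𝕜 (R.Fam N k) :=
  R.tot N k ⊓ LinearMap.ker (R.totD N (k := k) rfl)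

/-- Coboundaries of degree `k` in `Tot^⊕ Hom(F, N)`. -/
def coboundaries (k : ℤ) : Submodule 𝕜 (R.Fam N k) :=
  (R.tot N (k - 1)).map (R.totD N (sub_add_cancel k 1))

instance (k : ℤ) : AddCommGroup (R.cocycles N k) := Submodule.addCommGroup _

/-- `Ext` of the second kind, `H^k (Tot^⊕ Hom(F, N))`, computed with the resolution `F` of `M`. -/
abbrev ExtII (k : ℤ) : Type u :=
  R.cocycles N k ⧸ (R.coboundaries N k).comap (R.cocycles N k).subtype

/-- The family concentrated at `n = 0` given by an `A`-linear map `M → N` of degree `k` composed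
with the augmentation. -/
def ofHom {k : ℤ} (f : Homs M.toGrMod N.toGrMod k) : R.Fam N k
  | 0 => Homs.precomp R.aug N.toGrMod (by push_cast; omega) f
  | _ + 1 => 0

end GPResolution

end Discrete


/-! ### Opposites and tensor products of cdg-algebras -/

section Operations

variable {𝕜 : Type} [Field 𝕜]

theorem sgn_mul_sgn (n : ℤ) : sgn 𝕜 n * sgn 𝕜 n = 1 := by
  rw [← sgn_add, sgn_even ⟨n, rfl⟩]

theorem CDGAlg.d_one (A : CDGAlg.{u} 𝕜) {k : ℤ} (h : 0 + 1 = k) : A.d h A.one = 0 := by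
  obtain rfl : k = 1 := by omega
  have := A.leibniz (zero_add 0) h h h (by norm_num) (by norm_num) A.one A.one
  rw [A.one_mul, A.one_mul, A.mul_one, sgn_even Even.zero, one_smul] at this
  simpa using this

/-- The opposite cdg-algebra: `x *ᵒᵖ y = (-1)^(|x||y|) y x`, same derivation, curvature `-B`. -/
def CDGAlg.op (A : CDGAlg.{u} 𝕜) : CDGAlg.{u} 𝕜 where
  C := A.C
  mul {i j _} h := sgn 𝕜 (i * j) • (A.mul (by omega : j + i = _)).flip
  one := A.one
  d := A.d
  B := -A.B
  one_mul x := by simp [sgn_even, A.mul_one]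
  mul_one x := by simp [sgn_even, A.one_mul]
  mul_assoc {i j k a b n} h₁ h₂ h₃ h₄ x y z := by
    simp only [LinearMap.smul_apply, LinearMap.flip_apply, map_smul]
    rw [← A.mul_assoc (a := b) (b := a) (by omega) (by omega) (by omega) (by omega) z y x]
    rw [smul_smul, smul_smul, ← sgn_add, ← sgn_add]
    subst h₁ h₃
    congr 2
    ring
  leibniz {i j n i' j' n'} h hn hi hj h₁ h₂ x y := by
    simp only [LinearMap.smul_apply, LinearMap.flip_apply, map_smul]
    rw [A.leibniz (n' := n') (i' := j') (j' := i') (by omega) hn hj hi (by omega) (by omega) y x]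
    have e₁ : sgn 𝕜 (i' * j) = sgn 𝕜 (i * j) * sgn 𝕜 j := by
      rw [← sgn_add, ← hi]
      exact congrArg _ (by ring)
    have e₂ : sgn 𝕜 (i * j') = sgn 𝕜 (i * j) * sgn 𝕜 i := by
      rw [← sgn_add, ← hj]
      exact congrArg _ (by ring)
    have e₃ : sgn 𝕜 i * (sgn 𝕜 (i * j) * sgn 𝕜 i) = sgn 𝕜 (i * j) := by
      linear_combination sgn 𝕜 (i * j) * sgn_mul_sgn (𝕜 := 𝕜) i
    rw [e₁, e₂, smul_add, smul_smul, smul_smul, e₃, add_comm]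
  bianchi h := by simp [A.bianchi h]
  d_d {i j k} h₁ h₂ h₃ h₄ x := by
    rw [A.d_d h₁ h₂ h₃ h₄ x]
    simp only [LinearMap.smul_apply, LinearMap.flip_apply, map_neg, LinearMap.neg_apply]
    rw [sgn_even ⟨i, by ring⟩, sgn_even ⟨i, by ring⟩]
    module

/-- Auxiliary: spaces `T n` spanned, in the sense of the field `ext`, by elementary tensors
`x ⊗ y` with `|x| + |y| = n`, with a product and a derivation given by the usual formulas on
elementary tensors. It serves to verify the axioms of a cdg-algebra simultaneously for the
algebraic and for the completed tensor product. -/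
structure TensorData (A B : CDGAlg.{u} 𝕜) where
  T : ℤ → Type u
  [grp : ∀ i, AddCommGroup (T i)]
  [mod : ∀ i, Module 𝕜 (T i)]
  tm : ∀ {a b n : ℤ}, a + b = n → (A.C a →ₗ[𝕜] B.C b →ₗ[𝕜] T n)
  /-- the maps under consideration: all linear maps, or the continuous ones -/
  good : ∀ i j, Submodule 𝕜 (T i →ₗ[𝕜] T j)
  good_id : ∀ i, LinearMap.id ∈ good i i
  good_comp : ∀ {i j k} {g : T j →ₗ[𝕜] T k} {f : T i →ₗ[𝕜] T j}, g ∈ good j k → f ∈ good i j →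
    g ∘ₗ f ∈ good i k
  ext : ∀ {i j} {f g : T i →ₗ[𝕜] T j}, f ∈ good i j → g ∈ good i j →
    (∀ {a b : ℤ} (h : a + b = i) (x : A.C a) (y : B.C b), f (tm h x y) = g (tm h x y)) → f = g
  mul : ∀ {i j n : ℤ}, i + j = n → (T i →ₗ[𝕜] T j →ₗ[𝕜] T n)
  mul_good : ∀ {i j n} (h : i + j = n) (u : T i), mul h u ∈ good j n
  mul_flip_good : ∀ {i j n} (h : i + j = n) (v : T j), (mul h).flip v ∈ good i n
  mul_tm : ∀ {a b i a' b' j n s t : ℤ} (hi : a + b = i) (hj : a' + b' = j) (h : i + j = n)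
    (hs : a + a' = s) (ht : b + b' = t) (hst : s + t = n) (x : A.C a) (y : B.C b) (x' : A.C a')
    (y' : B.C b'),
    mul h (tm hi x y) (tm hj x' y') = sgn 𝕜 (b * a') • tm hst (A.mul hs x x') (B.mul ht y y')
  d : ∀ {i j : ℤ}, i + 1 = j → (T i →ₗ[𝕜] T j)
  d_good : ∀ {i j} (h : i + 1 = j), d h ∈ good i j
  d_tm : ∀ {a b i j a' b' : ℤ} (hi : a + b = i) (h : i + 1 = j) (ha : a + 1 = a')
    (hb : b + 1 = b') (h₁ : a' + b = j) (h₂ : a + b' = j) (x : A.C a) (y : B.C b),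
    d h (tm hi x y) = tm h₁ (A.d ha x) y + sgn 𝕜 a • tm h₂ x (B.d hb y)

attribute [instance] TensorData.grp TensorData.mod

namespace TensorData

variable {A B : CDGAlg.{u} 𝕜} (D : TensorData A B)

/-- The tensor product cdg-algebra, with curvature `B_A ⊗ 1 + 1 ⊗ B_B`. -/
def toCDGAlg : CDGAlg.{u} 𝕜 where
  C := D.T
  mul := D.mul
  one := D.tm (zero_add 0) A.one B.one
  d := D.d
  B := D.tm (add_zero 2) A.B B.one + D.tm (zero_add 2) A.one B.B
  one_mul {i} u := by
    refine LinearMap.congr_fun (D.ext (D.mul_good _ _) (D.good_id i) fun {a b} h x y => ?_) u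
    rw [D.mul_tm _ h _ (zero_add a) (zero_add b) h, A.one_mul, B.one_mul, sgn_even (by simp),
      one_smul]
    rfl
  mul_one {i} u := by
    refine LinearMap.congr_fun (D.ext (D.mul_flip_good _ _) (D.good_id i) fun {a b} h x y => ?_) u
    rw [LinearMap.flip_apply, D.mul_tm h _ _ (add_zero a) (add_zero b) h, A.mul_one, B.mul_one,
      sgn_even (by simp), one_smul]
    rfl
  mul_assoc {i j k p q n} h₁ h₂ h₃ h₄ u v w := by
    refine LinearMap.congr_fun (f := (D.mul h₂).flip w ∘ₗ (D.mul h₁).flip v)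
      (g := (D.mul h₄).flip (D.mul h₃ v w)) (D.ext
      (D.good_comp (D.mul_flip_good _ _) (D.mul_flip_good _ _)) (D.mul_flip_good _ _)
      fun {a b} hx x y => ?_) u
    refine LinearMap.congr_fun (f := (D.mul h₂).flip w ∘ₗ D.mul h₁ (D.tm hx x y))
      (g := D.mul h₄ (D.tm hx x y) ∘ₗ (D.mul h₃).flip w) (D.ext
      (D.good_comp (D.mul_flip_good _ _) (D.mul_good _ _))
      (D.good_comp (D.mul_good _ _) (D.mul_flip_good _ _)) fun {a' b'} hx' x' y' => ?_) v
    refine LinearMap.congr_fun (f := D.mul h₂ (D.mul h₁ (D.tm hx x y) (D.tm hx' x' y')))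
      (g := D.mul h₄ (D.tm hx x y) ∘ₗ D.mul h₃ (D.tm hx' x' y')) (D.ext (D.mul_good _ _)
      (D.good_comp (D.mul_good _ _) (D.mul_good _ _)) fun {a'' b''} hx'' x'' y'' => ?_) w
    rw [LinearMap.comp_apply,
      D.mul_tm hx hx' h₁ rfl rfl (by omega), D.mul_tm hx' hx'' h₃ rfl rfl (by omega),
      map_smul, LinearMap.smul_apply, map_smul,
      D.mul_tm (s := a + a' + a'') (t := b + b' + b'') _ hx'' h₂ rfl rfl (by omega),
      D.mul_tm (s := a + a' + a'') (t := b + b' + b'') hx _ h₄ (by omega) (by omega) (by omega),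
      A.mul_assoc rfl rfl rfl (by omega), B.mul_assoc rfl rfl rfl (by omega),
      smul_smul, smul_smul, ← sgn_add, ← sgn_add]
    congr 2
    ring
  leibniz {i j n i' j' n'} h hn hi hj h₁ h₂ u v := by
    refine LinearMap.congr_fun (f := D.d hn ∘ₗ (D.mul h).flip v)
      (g := (D.mul h₁).flip v ∘ₗ D.d hi + sgn 𝕜 i • (D.mul h₂).flip (D.d hj v)) (D.ext
      (D.good_comp (D.d_good _) (D.mul_flip_good _ _))
      (Submodule.add_mem _ (D.good_comp (D.mul_flip_good _ _) (D.d_good _))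
        (Submodule.smul_mem _ _ (D.mul_flip_good _ _))) fun {a b} hx x y => ?_) u
    refine LinearMap.congr_fun (f := D.d hn ∘ₗ D.mul h (D.tm hx x y))
      (g := D.mul h₁ (D.d hi (D.tm hx x y)) + sgn 𝕜 i • D.mul h₂ (D.tm hx x y) ∘ₗ D.d hj) (D.ext
      (D.good_comp (D.d_good _) (D.mul_good _ _))
      (Submodule.add_mem _ (D.mul_good _ _) (Submodule.smul_mem _ _
        (D.good_comp (D.mul_good _ _) (D.d_good _)))) fun {a' b'} hx' x' y' => ?_) v
    simp only [LinearMap.comp_apply, LinearMap.add_apply, LinearMap.smul_apply]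
    rw [D.mul_tm hx hx' h rfl rfl (by omega), map_smul,
      D.d_tm (a' := a + a' + 1) (b' := b + b' + 1) _ hn rfl rfl (by omega) (by omega),
      D.d_tm (a' := a + 1) (b' := b + 1) hx hi rfl rfl (by omega) (by omega),
      D.d_tm (a' := a' + 1) (b' := b' + 1) hx' hj rfl rfl (by omega) (by omega),
      A.leibniz (i' := a + 1) (j' := a' + 1) rfl rfl rfl rfl (by omega) (by omega),
      B.leibniz (i' := b + 1) (j' := b' + 1) rfl rfl rfl rfl (by omega) (by omega)]
    simp only [map_add, map_smul, LinearMap.add_apply, LinearMap.smul_apply]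
    rw [D.mul_tm (s := a + a' + 1) (t := b + b') _ hx' h₁ (by omega) (by omega) (by omega),
      D.mul_tm (s := a + a') (t := b + b' + 1) _ hx' h₁ (by omega) (by omega) (by omega),
      D.mul_tm (s := a + a' + 1) (t := b + b') hx _ h₂ (by omega) (by omega) (by omega),
      D.mul_tm (s := a + a') (t := b + b' + 1) hx _ h₂ (by omega) (by omega) (by omega)]
    have e₁ : sgn 𝕜 i = sgn 𝕜 a * sgn 𝕜 b := by rw [← sgn_add, hx]
    have e₂ : sgn 𝕜 (a + a') = sgn 𝕜 a * sgn 𝕜 a' := sgn_add _ _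
    have e₃ : sgn 𝕜 ((b + 1) * a') = sgn 𝕜 (b * a') * sgn 𝕜 a' := by
      rw [← sgn_add]
      exact congrArg _ (by ring)
    have e₄ : sgn 𝕜 (b * (a' + 1)) = sgn 𝕜 (b * a') * sgn 𝕜 b := by
      rw [← sgn_add]
      exact congrArg _ (by ring)
    have e₅ := sgn_mul_sgn (𝕜 := 𝕜) b
    simp only [e₁, e₂, e₃, e₄, smul_add, smul_smul]
    have e₆ : sgn 𝕜 a * sgn 𝕜 b * (sgn 𝕜 (b * a') * sgn 𝕜 b) = sgn 𝕜 (b * a') * sgn 𝕜 a := by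
      linear_combination (sgn 𝕜 (b * a') * sgn 𝕜 a) * e₅
    rw [e₆]
    module
  bianchi h := by
    rw [map_add, D.d_tm (a' := 3) (b' := 1) _ h rfl rfl (by omega) (by omega),
      D.d_tm (a' := 1) (b' := 3) _ h rfl rfl (by omega) (by omega), A.bianchi, B.bianchi, A.d_one,
      B.d_one]
    simp
  d_d {i j k} h₁ h₂ h₃ h₄ u := by
    refine LinearMap.congr_fun (f := D.d h₂ ∘ₗ D.d h₁)
      (g := D.mul h₃ (D.tm (add_zero 2) A.B B.one + D.tm (zero_add 2) A.one B.B) -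
        (D.mul h₄).flip (D.tm (add_zero 2) A.B B.one + D.tm (zero_add 2) A.one B.B)) (D.ext
      (D.good_comp (D.d_good _) (D.d_good _)) (Submodule.sub_mem _ (D.mul_good _ _)
        (D.mul_flip_good _ _)) fun {a b} hx x y => ?_) u
    simp only [LinearMap.comp_apply, LinearMap.sub_apply, LinearMap.flip_apply, map_add,
      LinearMap.add_apply]
    rw [D.d_tm (a' := a + 1) (b' := b + 1) hx h₁ rfl rfl (by omega) (by omega), map_add, map_smul,
      D.d_tm (a' := a + 2) (b' := b + 1) _ h₂ (by omega) rfl (by omega) (by omega),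
      D.d_tm (a' := a + 1) (b' := b + 2) _ h₂ rfl (by omega) (by omega) (by omega),
      D.mul_tm (s := a + 2) (t := b) _ hx h₃ (by omega) (by omega) (by omega),
      D.mul_tm (s := a) (t := b + 2) _ hx h₃ (by omega) (by omega) (by omega),
      D.mul_tm (s := a + 2) (t := b) hx _ h₄ (by omega) (by omega) (by omega),
      D.mul_tm (s := a) (t := b + 2) hx _ h₄ (by omega) (by omega) (by omega),
      A.d_d _ _ (by omega) (by omega), B.d_d _ _ (by omega) (by omega),
      map_sub, map_sub, LinearMap.sub_apply]
    have e₁ : sgn 𝕜 (a + 1) = - sgn 𝕜 a := by rw [sgn_add, sgn_odd odd_one, mul_neg_one]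
    have e₂ : sgn 𝕜 (0 * a) = 1 := sgn_even (by simp)
    have e₃ : sgn 𝕜 (2 * a) = 1 := sgn_even (by simp)
    have e₄ : sgn 𝕜 (b * 2) = 1 := sgn_even (by simp)
    have e₅ : sgn 𝕜 (b * 0) = 1 := sgn_even (by simp)
    simp only [e₁, e₂, e₃, e₄, e₅, A.one_mul, A.mul_one, B.one_mul, B.mul_one, smul_add, smul_smul,
      sgn_mul_sgn]
    module

end TensorData
end Operations

section Diagonal

variable {𝕜 : Type} [Field 𝕜] {A : CDGAlg.{u} 𝕜}

/-- The elementary tensors `x ⊗ y` in a tensor product of `Aᵒᵖ` and `A`. -/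
def TensorData.tmo (D : TensorData A.op A) {a b n : ℤ} (h : a + b = n) :
    A.C a →ₗ[𝕜] A.C b →ₗ[𝕜] D.T n :=
  D.tm h

theorem TensorData.mul_tmo (D : TensorData A.op A) {a b i a' b' j n s t : ℤ} (hi : a + b = i)
    (hj : a' + b' = j) (h : i + j = n) (hs : a' + a = s) (ht : b + b' = t) (hst : s + t = n)
    (x : A.C a) (y : A.C b) (x' : A.C a') (y' : A.C b') :
    D.mul h (D.tmo hi x y) (D.tmo hj x' y') =
      (sgn 𝕜 (b * a') * sgn 𝕜 (a * a')) • D.tmo hst (A.mul hs x' x) (A.mul ht y y') := by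
  refine (D.mul_tm hi hj h (by omega) ht hst x y x' y').trans ?_
  rw [mul_smul]
  refine congrArg _ ?_
  exact (LinearMap.congr_fun ((D.tmo hst).map_smul (sgn 𝕜 (a * a')) (A.mul hs x' x)) _ : _)

theorem TensorData.d_tmo (D : TensorData A.op A) {a b i j a' b' : ℤ} (hi : a + b = i)
    (h : i + 1 = j) (ha : a + 1 = a') (hb : b + 1 = b') (h₁ : a' + b = j) (h₂ : a + b' = j)
    (x : A.C a) (y : A.C b) :
    D.d h (D.tmo hi x y) = D.tmo h₁ (A.d ha x) y + sgn 𝕜 a • D.tmo h₂ x (A.d hb y) :=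
  D.d_tm hi h ha hb h₁ h₂ x y

/-- Auxiliary: an action on `A` of a tensor product of `Aᵒᵖ` and `A`, given by the formula
`a (x ⊗ y) = (-1)^(|a||x|) x a y` on elementary tensors. -/
structure DiagData (D : TensorData A.op A) where
  good₁ : ∀ i j, Submodule 𝕜 (D.T i →ₗ[𝕜] A.C j)
  good₂ : ∀ i j, Submodule 𝕜 (A.C i →ₗ[𝕜] A.C j)
  comp_good : ∀ {i j k} {g : D.T j →ₗ[𝕜] A.C k} {f : D.T i →ₗ[𝕜] D.T j}, g ∈ good₁ j k →
    f ∈ D.good i j → g ∘ₗ f ∈ good₁ i k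
  good_comp : ∀ {i j k} {g : A.C j →ₗ[𝕜] A.C k} {f : D.T i →ₗ[𝕜] A.C j}, g ∈ good₂ j k →
    f ∈ good₁ i j → g ∘ₗ f ∈ good₁ i k
  ext : ∀ {i j} {f g : D.T i →ₗ[𝕜] A.C j}, f ∈ good₁ i j → g ∈ good₁ i j →
    (∀ {a b : ℤ} (h : a + b = i) (x : A.C a) (y : A.C b), f (D.tmo h x y) = g (D.tmo h x y)) → f = g
  d_good : ∀ {i j} (h : i + 1 = j), A.d h ∈ good₂ i j
  act : ∀ {i j n : ℤ}, i + j = n → (A.C i →ₗ[𝕜] D.T j →ₗ[𝕜] A.C n)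
  act_good : ∀ {i j n} (h : i + j = n) (x : A.C i), act h x ∈ good₁ j n
  act_flip_good : ∀ {i j n} (h : i + j = n) (u : D.T j), (act h).flip u ∈ good₂ i n
  act_tm : ∀ {i j n a b s : ℤ} (h : i + j = n) (hab : a + b = j) (hs : a + i = s) (hn : s + b = n)
    (z : A.C i) (x : A.C a) (y : A.C b),
    act h z (D.tmo hab x y) = sgn 𝕜 (i * a) • A.mul hn (A.mul hs x z) y

/-- `A` as a right cdg-module over the enveloping algebra. -/
def DiagData.toCDGMod {D : TensorData A.op A} (E : DiagData D) : CDGMod.{u} D.toCDGAlg where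
  C := A.C
  act := E.act
  act_one {i} x := by
    refine (E.act_tm (add_zero i) (zero_add 0) (zero_add i) (add_zero i) x A.one A.one).trans ?_
    rw [A.one_mul, A.mul_one, sgn_even (by simp), one_smul]
  act_act {i j k p q n} h₁ h₂ h₃ h₄ z u v := by
    refine LinearMap.congr_fun (f := (E.act h₂).flip v ∘ₗ E.act h₁ z)
      (g := E.act h₄ z ∘ₗ (D.mul h₃).flip v) (E.ext
      (E.good_comp (E.act_flip_good _ _) (E.act_good _ _))
      (E.comp_good (E.act_good _ _) (D.mul_flip_good _ _)) fun {a b} hx x y => ?_) u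
    refine LinearMap.congr_fun (f := E.act h₂ (E.act h₁ z (D.tmo hx x y)))
      (g := E.act h₄ z ∘ₗ D.mul h₃ (D.tmo hx x y)) (E.ext (E.act_good _ _)
      (E.comp_good (E.act_good _ _) (D.mul_good _ _)) fun {a' b'} hx' x' y' => ?_) v
    rw [LinearMap.comp_apply, D.mul_tmo hx hx' h₃ (add_comm a' a) rfl (by omega), map_smul,
      E.act_tm h₁ hx (s := a + i) rfl (by omega), map_smul, LinearMap.smul_apply,
      E.act_tm h₂ hx' (s := a' + p) rfl (by omega),
      E.act_tm h₄ _ (s := a + a' + i) rfl (by omega),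
      ← A.mul_assoc (a := a' + p) (by omega) (by omega) rfl (by omega) _ y y',
      ← A.mul_assoc (i := a') (j := a + i) (a := a + a' + i) (by omega) (by omega) (by omega)
        (by omega) x' _ y,
      ← A.mul_assoc (i := a') (j := a) (k := i) (add_comm a' a) (by omega) (by omega) (by omega)
        x' x z, smul_smul, smul_smul]
    congr 1
    have e : i * a + p * a' = b * a' + a * a' + i * (a + a') := by
      rw [← h₁, ← hx]
      ring
    rw [← sgn_add, ← sgn_add, ← sgn_add, e]
  d := A.d
  leibniz {i j n i' j' n'} h hn hi hj h₁ h₂ z u := by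
    refine LinearMap.congr_fun (f := A.d hn ∘ₗ E.act h z)
      (g := E.act h₁ (A.d hi z) + sgn 𝕜 i • E.act h₂ z ∘ₗ D.d hj) (E.ext
      (E.good_comp (E.d_good _) (E.act_good _ _))
      (Submodule.add_mem _ (E.act_good _ _) (Submodule.smul_mem _ _
        (E.comp_good (E.act_good _ _) (D.d_good _)))) fun {a b} hx x y => ?_) u
    simp only [LinearMap.comp_apply, LinearMap.add_apply, LinearMap.smul_apply]
    rw [D.d_tmo (a' := a + 1) (b' := b + 1) hx hj rfl rfl (by omega) (by omega),
      map_add, map_smul, E.act_tm (s := a + i) _ _ rfl (by omega), map_smul,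
      E.act_tm (s := a + i + 1) _ _ (by omega) (by omega),
      E.act_tm (s := a + i + 1) _ _ (by omega) (by omega),
      E.act_tm (s := a + i) _ _ (by omega) (by omega),
      A.leibniz (i' := a + i + 1) (j' := b + 1) _ _ rfl rfl (by omega) (by omega),
      A.leibniz (i' := a + 1) (j' := i') _ _ rfl hi (by omega) (by omega)]
    simp only [map_add, map_smul, LinearMap.add_apply, LinearMap.smul_apply]
    have e₁ : sgn 𝕜 (i' * a) = sgn 𝕜 (i * a) * sgn 𝕜 a := by
      rw [← sgn_add, ← hi]
      exact congrArg _ (by ring)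
    have e₂ : sgn 𝕜 (i * (a + 1)) = sgn 𝕜 (i * a) * sgn 𝕜 i := by
      rw [← sgn_add]
      exact congrArg _ (by ring)
    have e₃ : sgn 𝕜 i * (sgn 𝕜 (i * a) * sgn 𝕜 i) = sgn 𝕜 (i * a) := by
      linear_combination sgn 𝕜 (i * a) * sgn_mul_sgn (𝕜 := 𝕜) i
    simp only [e₁, e₂, e₃, sgn_add, smul_add, smul_smul]
    module
  d_d {i j k} h₁ h₂ h₃ z := by
    change _ = - E.act h₃ z (D.tmo (add_zero 2) (-A.B) A.one + D.tmo (zero_add 2) A.one A.B)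
    rw [map_add, E.act_tm (s := k) h₃ _ (by omega) (by omega),
      E.act_tm (s := i) h₃ _ (by omega) (by omega), A.d_d h₁ h₂ (by omega) (by omega)]
    simp only [map_neg, LinearMap.neg_apply, A.one_mul, A.mul_one]
    rw [sgn_even (by simp), sgn_even (by simp)]
    module

end Diagonal

section DiscreteTensor

variable {𝕜 : Type} [Field 𝕜]

namespace DTensor

variable {E F : ℤ → Type u} [∀ i, AddCommGroup (E i)] [∀ i, Module 𝕜 (E i)]
  [∀ i, AddCommGroup (F i)] [∀ i, Module 𝕜 (F i)]

variable (𝕜 E F) in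
/-- The graded tensor product `(E ⊗ F)^n = ⨁_{a+b=n} E^a ⊗ F^b`. -/
abbrev _root_.DTensor (n : ℤ) : Type u :=
  DirectSum {p : ℤ × ℤ // p.1 + p.2 = n} fun p => E p.1.1 ⊗[𝕜] F p.1.2

/-- The elementary tensor `x ⊗ y` of homogeneous elements. -/
noncomputable def tm {a b n : ℤ} (h : a + b = n) : E a →ₗ[𝕜] F b →ₗ[𝕜] DTensor 𝕜 E F n :=
  (TensorProduct.mk 𝕜 (E a) (F b)).compr₂
    (DirectSum.lof 𝕜 {p : ℤ × ℤ // p.1 + p.2 = n} (fun p => E p.1.1 ⊗[𝕜] F p.1.2) ⟨(a, b), h⟩)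

theorem hom_ext {n : ℤ} {G : Type*} [AddCommGroup G] [Module 𝕜 G] {f g : DTensor 𝕜 E F n →ₗ[𝕜] G}
    (h : ∀ {a b : ℤ} (h : a + b = n) (x : E a) (y : F b), f (tm h x y) = g (tm h x y)) :
    f = g := by
  refine DirectSum.linearMap_ext 𝕜 fun p => TensorProduct.ext' fun x y => ?_
  exact h p.2 x y

/-- The linear map on `(E ⊗ F)^n` given by a family of bilinear maps. -/
noncomputable def lift {n : ℤ} {G : Type*} [AddCommGroup G] [Module 𝕜 G]
    (f : ∀ {a b : ℤ}, a + b = n → (E a →ₗ[𝕜] F b →ₗ[𝕜] G)) : DTensor 𝕜 E F n →ₗ[𝕜] G :=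
  DirectSum.toModule 𝕜 _ _ fun p => TensorProduct.lift (f p.2)

@[simp] theorem lift_tm {n : ℤ} {G : Type*} [AddCommGroup G] [Module 𝕜 G]
    (f : ∀ {a b : ℤ}, a + b = n → (E a →ₗ[𝕜] F b →ₗ[𝕜] G)) {a b : ℤ} (h : a + b = n) (x : E a)
    (y : F b) : lift f (tm h x y) = f h x y := by
  refine (DirectSum.toModule_lof 𝕜 (ι := {p : ℤ × ℤ // p.1 + p.2 = n}) ⟨(a, b), h⟩ _).trans ?_
  exact TensorProduct.lift.tmul x y

end DTensor

/-- The algebraic tensor product of two cdg-algebras. -/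
noncomputable def CDGAlg.discreteTensorData (A B : CDGAlg.{u} 𝕜) : TensorData A B where
  T := DTensor 𝕜 A.C B.C
  tm h := DTensor.tm h
  good _ _ := ⊤
  good_id _ := trivial
  good_comp _ _ := trivial
  ext _ _ h := DTensor.hom_ext h
  mul {i j n} hij := DTensor.lift fun {a b} hab => LinearMap.mk₂ 𝕜
    (fun x y => DTensor.lift fun {a' b'} hab' => sgn 𝕜 (b * a') •
      (DTensor.tm (by omega : a + a' + (b + b') = n)).compl₁₂ (A.mul rfl x) (B.mul rfl y))
    (fun x x' y => DTensor.hom_ext fun h z w => by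
      simp only [DTensor.lift_tm, LinearMap.add_apply, LinearMap.smul_apply,
        LinearMap.compl₁₂_apply, map_add, smul_add])
    (fun c x y => DTensor.hom_ext fun h z w => by
      simp only [DTensor.lift_tm, LinearMap.smul_apply, LinearMap.compl₁₂_apply, map_smul]
      rw [smul_comm])
    (fun x y y' => DTensor.hom_ext fun h z w => by
      simp only [DTensor.lift_tm, LinearMap.add_apply, LinearMap.smul_apply,
        LinearMap.compl₁₂_apply, map_add, smul_add])
    (fun c x y => DTensor.hom_ext fun h z w => by
      simp only [DTensor.lift_tm, LinearMap.smul_apply, LinearMap.compl₁₂_apply, map_smul]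
      rw [smul_comm])
  mul_good _ _ := trivial
  mul_flip_good _ _ := trivial
  mul_tm hi hj h hs ht hst x y x' y' := by
    subst hs ht
    simp
  d {i j} hij := DTensor.lift fun {a b} hab =>
    (DTensor.tm (by omega : a + 1 + b = j)).compl₁₂ (A.d rfl) LinearMap.id +
      sgn 𝕜 a • (DTensor.tm (by omega : a + (b + 1) = j)).compl₁₂ LinearMap.id (B.d rfl)
  d_good _ := trivial
  d_tm hi h ha hb h₁ h₂ x y := by
    subst ha hb
    simp

/-- The algebraic enveloping cdg-algebra `Aᵒᵖ ⊗ A`. -/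
noncomputable def CDGAlg.discreteEnv (A : CDGAlg.{u} 𝕜) : CDGAlg.{u} 𝕜 :=
  (A.op.discreteTensorData A).toCDGAlg

/-- The map `z ⊗ (x ⊗ y) ↦ (-1)^(|z||x|) x z y`. -/
noncomputable def CDGAlg.diagAct (A : CDGAlg.{u} 𝕜) {i j n : ℤ} (h : i + j = n) :
    A.C i →ₗ[𝕜] DTensor 𝕜 A.C A.C j →ₗ[𝕜] A.C n :=
  LinearMap.flip <| DTensor.lift fun {a b} hab => LinearMap.mk₂ 𝕜
    (fun x y => sgn 𝕜 (i * a) • (A.mul (by omega : a + i + b = n)).flip y ∘ₗ A.mul rfl x)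
    (fun x x' y => by ext; simp)
    (fun c x y => by ext; simp [smul_comm c])
    (fun x y y' => by ext; simp)
    (fun c x y => by ext; simp [smul_comm c])

theorem CDGAlg.diagAct_tm (A : CDGAlg.{u} 𝕜) {i j n a b s : ℤ} (h : i + j = n) (hab : a + b = j)
    (hs : a + i = s) (hn : s + b = n) (z : A.C i) (x : A.C a) (y : A.C b) :
    A.diagAct h z (DTensor.tm hab x y) = sgn 𝕜 (i * a) • A.mul hn (A.mul hs x z) y := by
  subst hs
  simp [diagAct]

/-- The action of `Aᵒᵖ ⊗ A` on `A`. -/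
noncomputable def CDGAlg.discreteDiagData (A : CDGAlg.{u} 𝕜) :
    DiagData (A.op.discreteTensorData A) where
  good₁ _ _ := ⊤
  good₂ _ _ := ⊤
  comp_good _ _ := trivial
  good_comp _ _ := trivial
  ext _ _ h := DTensor.hom_ext h
  d_good _ := trivial
  act h := A.diagAct h
  act_good _ _ := trivial
  act_flip_good _ _ := trivial
  act_tm h hab hs hn z x y := A.diagAct_tm h hab hs hn z x y

/-- The algebra `A` as a right cdg-module over `Aᵒᵖ ⊗ A`. -/
noncomputable def CDGAlg.discreteDiag (A : CDGAlg.{u} 𝕜) : CDGMod.{u} A.discreteEnv :=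
  A.discreteDiagData.toCDGMod

end DiscreteTensor

/-! ### Complete locally convex spaces and the completed projective tensor product -/

/-- Complete Hausdorff locally convex topological vector spaces over `𝕜` (`ℝ` or `ℂ`).
`PolynormableSpace` says that the topology is defined by a family of seminorms. -/
class CompleteLC (𝕜 : Type) [RCLike 𝕜] (E : Type u) [AddCommGroup E] [Module 𝕜 E]
    [UniformSpace E] : Prop extends
  IsUniformAddGroup E, ContinuousSMul 𝕜 E, PolynormableSpace 𝕜 E, T2Space E, CompleteSpace E

section LC

variable {𝕜 : Type} [RCLike 𝕜]

instance {ι : Type*} (E : ι → Type*) [∀ i, AddCommGroup (E i)] [∀ i, Module 𝕜 (E i)]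
    [∀ i, UniformSpace (E i)] [∀ i, CompleteLC 𝕜 (E i)] : CompleteLC 𝕜 (∀ i, E i) where

instance (E F : Type*) [AddCommGroup E] [Module 𝕜 E] [AddCommGroup F] [Module 𝕜 F]
    [UniformSpace E] [UniformSpace F] [CompleteLC 𝕜 E] [CompleteLC 𝕜 F] :
    CompleteLC 𝕜 (E × F) where

theorem polynormable_of_basis {E : Type*} [AddCommGroup E] [Module 𝕜 E] [TopologicalSpace E]
    [IsTopologicalAddGroup E]
    (h : ∀ U ∈ 𝓝 (0 : E), ∃ p : Seminorm 𝕜 E, Continuous p ∧ ∃ r > 0, p.ball 0 r ⊆ U) :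
    PolynormableSpace 𝕜 E := by
  refine ⟨SeminormFamily.withSeminorms_of_hasBasis _ ⟨fun U => ⟨fun hU => ?_, ?_⟩⟩⟩
  · obtain ⟨p, hp, r, hr, hb⟩ := h U hU
    exact ⟨p.ball 0 r, (SeminormFamily.basisSets_iff _).2 ⟨{⟨p, hp⟩}, r, hr, by simp⟩, hb⟩
  · rintro ⟨V, hV, hVU⟩
    refine Filter.mem_of_superset ?_ hVU
    obtain ⟨s, r, hr, rfl⟩ := (SeminormFamily.basisSets_iff _).1 hV
    rw [id, Seminorm.ball_finset_sup_eq_iInter _ _ _ hr]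
    refine (Filter.biInter_finset_mem s).2 fun i _ => ?_
    have h0 : Tendsto i.1 (𝓝 0) (𝓝 0) := by simpa using i.2.tendsto 0
    filter_upwards [h0.eventually (gt_mem_nhds hr)] with y hy
    simpa [Seminorm.mem_ball] using hy

theorem continuous_seminorm_add {E : Type*} [AddCommGroup E] [Module 𝕜 E] [TopologicalSpace E]
    {p q : Seminorm 𝕜 E} (hp : Continuous p) (hq : Continuous q) :
    Continuous (p + q : Seminorm 𝕜 E) :=
  hp.add hq

theorem continuous_seminorm_sum {E : Type*} [AddCommGroup E] [Module 𝕜 E] [TopologicalSpace E]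
    {ι : Type*} (s : Finset ι) {p : ι → Seminorm 𝕜 E} (hp : ∀ i, Continuous (p i)) :
    Continuous (∑ i ∈ s, p i : Seminorm 𝕜 E) := by
  classical
  induction s using Finset.induction_on with
  | empty => exact continuous_const
  | insert a s ha ih => rw [Finset.sum_insert ha]; exact continuous_seminorm_add (hp a) ih

theorem seminorm_sum_apply {E : Type*} [AddCommGroup E] [Module 𝕜 E]
    {ι : Type*} (s : Finset ι) (p : ι → Seminorm 𝕜 E) (x : E) :
    (∑ i ∈ s, p i : Seminorm 𝕜 E) x = ∑ i ∈ s, p i x := by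
  classical
  induction s using Finset.induction_on with
  | empty => rfl
  | insert a s ha ih => rw [Finset.sum_insert ha, Finset.sum_insert ha, Seminorm.add_apply, ih]

theorem exists_seminorm_of_nhds {E : Type*} [AddCommGroup E] [Module 𝕜 E] [TopologicalSpace E]
    [PolynormableSpace 𝕜 E] {U : Set E} (hU : U ∈ 𝓝 (0 : E)) :
    ∃ p : Seminorm 𝕜 E, Continuous p ∧ ∃ r > 0, p.ball 0 r ⊆ U := by
  have hw := PolynormableSpace.withSeminorms 𝕜 E
  obtain ⟨s, r, hr, hs⟩ := (hw.mem_nhds_iff 0 U).1 hU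
  refine ⟨∑ i ∈ s, i.1, continuous_seminorm_sum s fun i => i.2, r, hr, fun x hx => hs ?_⟩
  exact Seminorm.ball_antitone (Seminorm.finset_sup_le_sum _ s) hx

/-- A linear map is continuous as soon as its composites with continuous seminorms are. -/
theorem continuous_of_seminorm {E F : Type*} [AddCommGroup E] [Module 𝕜 E] [TopologicalSpace E]
    [IsTopologicalAddGroup E] [AddCommGroup F] [Module 𝕜 F] [TopologicalSpace F]
    [IsTopologicalAddGroup F] [PolynormableSpace 𝕜 F] (f : E →ₗ[𝕜] F)
    (h : ∀ P : Seminorm 𝕜 F, Continuous P → ∃ Q : Seminorm 𝕜 E, Continuous Q ∧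
      ∀ x, P (f x) ≤ Q x) : Continuous f := by
  refine continuous_of_continuousAt_zero f ?_
  rw [ContinuousAt, map_zero]
  intro U hU
  obtain ⟨P, hP, r, hr, hb⟩ := exists_seminorm_of_nhds (𝕜 := 𝕜) hU
  obtain ⟨Q, hQ, hPQ⟩ := h P hP
  have h0 : Tendsto Q (𝓝 0) (𝓝 0) := by simpa using hQ.tendsto 0
  rw [Filter.mem_map]
  filter_upwards [h0.eventually (gt_mem_nhds hr)] with x hx
  exact hb (by simpa [Seminorm.mem_ball] using (hPQ x).trans_lt hx)

section Completion

open UniformSpace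

variable {X : Type*} [AddCommGroup X] [Module 𝕜 X] [UniformSpace X] [IsUniformAddGroup X]
  [UniformContinuousConstSMul 𝕜 X]

theorem seminorm_uniformContinuous {p : Seminorm 𝕜 X} (hp : Continuous p) :
    UniformContinuous p := by
  refine Seminorm.uniformContinuous (r := 1) ?_
  have h0 : Tendsto p (𝓝 0) (𝓝 0) := by simpa using hp.tendsto 0
  filter_upwards [h0.eventually (gt_mem_nhds one_pos)] with x hx
  simpa [Seminorm.mem_ball] using hx

/-- The extension of a continuous seminorm to the completion. -/
noncomputable def complSeminorm (p : Seminorm 𝕜 X) (hp : Continuous p) :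
    Seminorm 𝕜 (Completion X) :=
  Seminorm.ofSMulLE (Completion.extension p)
    (by
      rw [← Completion.coe_zero, Completion.extension_coe (seminorm_uniformContinuous hp), map_zero])
    (by
      intro x y
      induction x, y using Completion.induction_on₂ with
      | hp =>
        exact isClosed_le (Completion.continuous_extension.comp (continuous_fst.add continuous_snd))
          ((Completion.continuous_extension.comp continuous_fst).add
            (Completion.continuous_extension.comp continuous_snd))
      | ih a b =>
        rw [← Completion.coe_add]
        simp only [Completion.extension_coe (seminorm_uniformContinuous hp)]
        exact map_add_le_add p a b)
    (by
      intro c x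
      induction x using Completion.induction_on with
      | hp =>
        exact isClosed_le (Completion.continuous_extension.comp (continuous_const_smul c))
          (continuous_const.mul Completion.continuous_extension)
      | ih a =>
        rw [← Completion.coe_smul]
        simp only [Completion.extension_coe (seminorm_uniformContinuous hp)]
        exact (map_smul_eq_mul p c a).le)

@[simp] theorem complSeminorm_coe (p : Seminorm 𝕜 X) (hp : Continuous p) (x : X) :
    complSeminorm p hp (x : Completion X) = p x :=
  Completion.extension_coe (seminorm_uniformContinuous hp) x

theorem continuous_complSeminorm (p : Seminorm 𝕜 X) (hp : Continuous p) :
    Continuous (complSeminorm p hp) :=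
  Completion.continuous_extension (f := p)

instance [PolynormableSpace 𝕜 X] : PolynormableSpace 𝕜 (Completion X) := by
  refine polynormable_of_basis fun U hU => ?_
  obtain ⟨V, hV, hVc, hVU⟩ := exists_mem_nhds_isClosed_subset hU
  have hV' : ((↑) : X → Completion X) ⁻¹' V ∈ 𝓝 (0 : X) := by
    refine (Completion.continuous_coe X).continuousAt.preimage_mem_nhds ?_
    rwa [Completion.coe_zero]
  obtain ⟨p, hp, r, hr, hb⟩ := exists_seminorm_of_nhds (𝕜 := 𝕜) hV'
  refine ⟨complSeminorm p hp, continuous_complSeminorm p hp, r, hr, fun y hy => hVU ?_⟩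
  have hopen : IsOpen ((complSeminorm p hp).ball 0 r) := by
    simp only [Seminorm.ball_zero_eq]
    exact isOpen_lt (continuous_complSeminorm p hp) continuous_const
  have hy' := Completion.denseRange_coe.open_subset_closure_inter hopen hy
  refine closure_minimal ?_ hVc hy'
  rintro _ ⟨hz, x, rfl⟩
  refine hb ?_
  simpa [Seminorm.mem_ball] using hz

instance [PolynormableSpace 𝕜 X] : CompleteLC 𝕜 (Completion X) where
  toContinuousSMul := (PolynormableSpace.withSeminorms 𝕜 (Completion X)).continuousSMul

/-- The canonical map to the completion. -/
noncomputable def toComplLinear : X →L[𝕜] Completion X where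
  toFun := (↑)
  map_add' := Completion.coe_add
  map_smul' := Completion.coe_smul
  cont := Completion.continuous_coe X

end Completion

section Tensor

variable {E F : Type u} [AddCommGroup E] [Module 𝕜 E] [AddCommGroup F] [Module 𝕜 F]

/-- The ways of writing `u` as a finite sum of elementary tensors. -/
abbrev TensorRep (u : E ⊗[𝕜] F) : Type u :=
  {l : List (E × F) // (l.map fun z => z.1 ⊗ₜ[𝕜] z.2).sum = u}

instance (u : E ⊗[𝕜] F) : Nonempty (TensorRep u) := by
  induction u with
  | zero => exact ⟨⟨[], rfl⟩⟩
  | tmul x y => exact ⟨⟨[(x, y)], by simp⟩⟩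
  | add u v hu hv =>
    obtain ⟨l, hl⟩ := hu
    obtain ⟨m, hm⟩ := hv
    exact ⟨⟨l ++ m, by simp [hl, hm]⟩⟩

/-- `∑ p xₖ * q yₖ` for the representation `∑ xₖ ⊗ yₖ`. -/
noncomputable def repCost (p : Seminorm 𝕜 E) (q : Seminorm 𝕜 F) (l : List (E × F)) : ℝ :=
  (l.map fun z => p z.1 * q z.2).sum

theorem repCost_nonneg (p : Seminorm 𝕜 E) (q : Seminorm 𝕜 F) (l : List (E × F)) :
    0 ≤ repCost p q l := by
  refine List.sum_nonneg fun a ha => ?_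
  obtain ⟨z, -, rfl⟩ := List.mem_map.1 ha
  positivity

theorem repCost_bdd (p : Seminorm 𝕜 E) (q : Seminorm 𝕜 F) (u : E ⊗[𝕜] F) :
    BddBelow (Set.range fun l : TensorRep u => repCost p q l.1) :=
  ⟨0, by rintro _ ⟨l, rfl⟩; exact repCost_nonneg p q l.1⟩

/-- The projective tensor product of two seminorms,
`u ↦ inf {∑ p xₖ * q yₖ | u = ∑ xₖ ⊗ yₖ}`. -/
noncomputable def projSeminorm (p : Seminorm 𝕜 E) (q : Seminorm 𝕜 F) :
    Seminorm 𝕜 (E ⊗[𝕜] F) :=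
  Seminorm.ofSMulLE (fun u => ⨅ l : TensorRep u, repCost p q l.1)
    (le_antisymm (ciInf_le_of_le (repCost_bdd p q 0) ⟨[], rfl⟩ le_rfl)
      (le_ciInf fun l => repCost_nonneg p q l.1))
    (fun u v => le_ciInf_add_ciInf fun l m =>
      ciInf_le_of_le (repCost_bdd p q _) ⟨l.1 ++ m.1, by simp [l.2, m.2]⟩ (by simp [repCost]))
    (by
      intro c u
      rw [Real.mul_iInf_of_nonneg (norm_nonneg c)]
      refine le_ciInf fun ⟨l, hl⟩ => ciInf_le_of_le (repCost_bdd p q _)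
        ⟨l.map fun z => (c • z.1, z.2), ?_⟩ ?_
      · rw [← hl, List.smul_sum]
        simp [Function.comp_def, TensorProduct.smul_tmul']
      · simp [repCost, Function.comp_def, map_smul_eq_mul, mul_assoc, List.sum_map_mul_left])

theorem projSeminorm_tmul_le (p : Seminorm 𝕜 E) (q : Seminorm 𝕜 F) (x : E) (y : F) :
    projSeminorm p q (x ⊗ₜ y) ≤ p x * q y :=
  ciInf_le_of_le (repCost_bdd p q _) ⟨[(x, y)], by simp⟩ (by simp [repCost])

theorem le_projSeminorm {p : Seminorm 𝕜 E} {q : Seminorm 𝕜 F} {N : Seminorm 𝕜 (E ⊗[𝕜] F)} {c : ℝ}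
    (hc : 0 ≤ c) (h : ∀ x y, N (x ⊗ₜ y) ≤ c * (p x * q y)) (u : E ⊗[𝕜] F) :
    N u ≤ c * projSeminorm p q u := by
  change N u ≤ c * ⨅ l : TensorRep u, repCost p q l.1
  rw [Real.mul_iInf_of_nonneg hc]
  refine le_ciInf fun l => ?_
  obtain ⟨l, rfl⟩ := l
  induction l with
  | nil => simp [repCost]
  | cons z l ih =>
    simp only [List.map_cons, List.sum_cons, repCost] at ih ⊢
    refine (map_add_le_add N _ _).trans ?_
    rw [mul_add]
    exact add_le_add (h _ _) ih

variable [UniformSpace E] [UniformSpace F]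

variable (𝕜 E F) in
/-- The algebraic tensor product, to be equipped with the projective topology. -/
def PreProj : Type u := E ⊗[𝕜] F

noncomputable instance : AddCommGroup (PreProj 𝕜 E F) := inferInstanceAs (AddCommGroup (E ⊗[𝕜] F))
noncomputable instance : Module 𝕜 (PreProj 𝕜 E F) := inferInstanceAs (Module 𝕜 (E ⊗[𝕜] F))

variable (𝕜 E F) in
/-- The seminorms defining the projective topology, one for each pair of continuous seminorms. -/
noncomputable def projFamily :
    SeminormFamily 𝕜 (PreProj 𝕜 E F)
      ({p : Seminorm 𝕜 E // Continuous p} × {q : Seminorm 𝕜 F // Continuous q}) :=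
  fun i => projSeminorm i.1.1 i.2.1

noncomputable instance : TopologicalSpace (PreProj 𝕜 E F) :=
  (projFamily 𝕜 E F).moduleFilterBasis.topology

theorem withSeminorms_projFamily : WithSeminorms (projFamily 𝕜 E F) := ⟨rfl⟩

instance : IsTopologicalAddGroup (PreProj 𝕜 E F) := withSeminorms_projFamily.topologicalAddGroup
instance : ContinuousSMul 𝕜 (PreProj 𝕜 E F) := withSeminorms_projFamily.continuousSMul
instance : PolynormableSpace 𝕜 (PreProj 𝕜 E F) := withSeminorms_projFamily.toPolynormableSpace

noncomputable instance : UniformSpace (PreProj 𝕜 E F) :=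
  IsTopologicalAddGroup.rightUniformSpace (PreProj 𝕜 E F)
instance : IsUniformAddGroup (PreProj 𝕜 E F) := isUniformAddGroup_of_addCommGroup
instance : UniformContinuousConstSMul 𝕜 (PreProj 𝕜 E F) :=
  uniformContinuousConstSMul_of_continuousConstSMul 𝕜 _

/-- `projSeminorm p q` as a seminorm on `PreProj 𝕜 E F`. -/
noncomputable def preSeminorm (p : Seminorm 𝕜 E) (q : Seminorm 𝕜 F) :
    Seminorm 𝕜 (PreProj 𝕜 E F) :=
  projSeminorm p q

theorem continuous_preSeminorm {p : Seminorm 𝕜 E} {q : Seminorm 𝕜 F} (hp : Continuous p)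
    (hq : Continuous q) : Continuous (preSeminorm p q) :=
  withSeminorms_projFamily.continuous_seminorm (⟨⟨p, hp⟩, ⟨q, hq⟩⟩)

variable (𝕜 E F) in
/-- The completed projective tensor product `E ⊗̂ F`. -/
abbrev ProjTensor : Type u := UniformSpace.Completion (PreProj 𝕜 E F)

variable (𝕜 E F) in
/-- The canonical bilinear map to the uncompleted tensor product. -/
noncomputable def PreProj.mk : E →ₗ[𝕜] F →ₗ[𝕜] PreProj 𝕜 E F := TensorProduct.mk 𝕜 E F

/-- The elementary tensor `x ⊗ y` in `E ⊗̂ F`. -/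
noncomputable def ptmul (x : E) (y : F) : ProjTensor 𝕜 E F :=
  toComplLinear (𝕜 := 𝕜) (PreProj.mk 𝕜 E F x y)

theorem ptmul_add_left (x x' : E) (y : F) :
    (ptmul (x + x') y : ProjTensor 𝕜 E F) = ptmul x y + ptmul x' y := by simp [ptmul]
theorem ptmul_add_right (x : E) (y y' : F) :
    (ptmul x (y + y') : ProjTensor 𝕜 E F) = ptmul x y + ptmul x y' := by simp [ptmul]
theorem ptmul_smul_left (c : 𝕜) (x : E) (y : F) :
    (ptmul (c • x) y : ProjTensor 𝕜 E F) = c • ptmul x y := by simp [ptmul]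
theorem ptmul_smul_right (c : 𝕜) (x : E) (y : F) :
    (ptmul x (c • y) : ProjTensor 𝕜 E F) = c • ptmul x y := by simp [ptmul]

/-- The extension of `projSeminorm p q` to the completed tensor product. -/
noncomputable def projS {p : Seminorm 𝕜 E} {q : Seminorm 𝕜 F} (hp : Continuous p)
    (hq : Continuous q) : Seminorm 𝕜 (ProjTensor 𝕜 E F) :=
  complSeminorm (preSeminorm p q) (continuous_preSeminorm hp hq)

theorem continuous_projS {p : Seminorm 𝕜 E} {q : Seminorm 𝕜 F} (hp : Continuous p)
    (hq : Continuous q) : Continuous (projS (𝕜 := 𝕜) hp hq) :=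
  continuous_complSeminorm _ _

theorem seminorm_le_of_dense {X : Type*} {P Q : X → ℝ} [TopologicalSpace X]
    {Y : Type*} {f : Y → X} (hf : DenseRange f) (hP : Continuous P) (hQ : Continuous Q)
    (h : ∀ y, P (f y) ≤ Q (f y)) (x : X) : P x ≤ Q x :=
  hf.induction_on x (isClosed_le hP hQ) h

theorem denseRange_toCompl : DenseRange (toComplLinear (𝕜 := 𝕜) (X := PreProj 𝕜 E F)) :=
  UniformSpace.Completion.denseRange_coe

/-- Estimates for seminorms on `E ⊗̂ F` can be checked on elementary tensors. -/
theorem le_projS {p : Seminorm 𝕜 E} {q : Seminorm 𝕜 F} (hp : Continuous p)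
    (hq : Continuous q) {N : Seminorm 𝕜 (ProjTensor 𝕜 E F)} (hN : Continuous N) {c : ℝ}
    (hc : 0 ≤ c) (h : ∀ x y, N (ptmul x y) ≤ c * (p x * q y)) (u : ProjTensor 𝕜 E F) :
    N u ≤ c * projS hp hq u := by
  refine seminorm_le_of_dense (denseRange_toCompl (𝕜 := 𝕜) (E := E) (F := F)) hN
    (continuous_const.mul (continuous_projS hp hq)) (fun y => ?_) u
  have := le_projSeminorm (p := p) (q := q)
    (N := (N.comp (toComplLinear (𝕜 := 𝕜) (X := PreProj 𝕜 E F)).toLinearMap : )) hc h y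
  refine this.trans (le_of_eq ?_)
  congr 1
  exact (complSeminorm_coe (preSeminorm p q) (continuous_preSeminorm hp hq) y).symm

/-- Continuous seminorms on `E ⊗̂ F` are bounded on elementary tensors by a product. -/
theorem seminorm_ptmul_le {N : Seminorm 𝕜 (ProjTensor 𝕜 E F)} (hN : Continuous N) :
    ∃ (p : Seminorm 𝕜 E) (q : Seminorm 𝕜 F), Continuous p ∧ Continuous q ∧
      ∀ x y, N (ptmul x y) ≤ p x * q y := by
  have hN' : Continuous (N.comp (toComplLinear (𝕜 := 𝕜) (X := PreProj 𝕜 E F)).toLinearMap) :=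
    hN.comp (toComplLinear (𝕜 := 𝕜) (X := PreProj 𝕜 E F)).continuous
  obtain ⟨s, C, -, hs⟩ := Seminorm.bound_of_continuous withSeminorms_projFamily _ hN'
  refine ⟨C • ∑ i ∈ s, i.1.1, ∑ i ∈ s, i.2.1, ?_, continuous_seminorm_sum s fun i => i.2.2, ?_⟩
  · exact (continuous_seminorm_sum s fun i => i.1.2).const_smul C
  · intro x y
    refine (hs (PreProj.mk 𝕜 E F x y)).trans ?_
    rw [Seminorm.smul_apply, Seminorm.smul_apply, NNReal.smul_def, NNReal.smul_def, smul_eq_mul,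
      smul_eq_mul, mul_assoc]
    refine mul_le_mul_of_nonneg_left ?_ C.2
    refine (Seminorm.finset_sup_le_sum _ s _).trans ?_
    rw [seminorm_sum_apply, seminorm_sum_apply, seminorm_sum_apply, Finset.sum_mul]
    refine Finset.sum_le_sum fun i hi => (projSeminorm_tmul_le i.1.1 i.2.1 x y).trans ?_
    refine mul_le_mul_of_nonneg_left ?_ (apply_nonneg _ _)
    exact Finset.single_le_sum (f := fun i => i.2.1 y) (fun j _ => apply_nonneg _ _) hi

/-- A continuous bilinear map on the factors extends to the completed tensor product. -/
theorem exists_lift {G : Type*} [AddCommGroup G] [Module 𝕜 G] [UniformSpace G] [CompleteLC 𝕜 G]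
    (b : E →ₗ[𝕜] F →ₗ[𝕜] G)
    (hb : ∀ P : Seminorm 𝕜 G, Continuous P → ∃ (p : Seminorm 𝕜 E) (q : Seminorm 𝕜 F),
      Continuous p ∧ Continuous q ∧ ∀ x y, P (b x y) ≤ p x * q y) :
    ∃ Φ : ProjTensor 𝕜 E F →L[𝕜] G, ∀ x y, Φ (ptmul x y) = b x y := by
  let f : PreProj 𝕜 E F →ₗ[𝕜] G := TensorProduct.lift b
  have hf : Continuous f := by
    refine continuous_of_seminorm f fun P hP => ?_
    obtain ⟨p, q, hp, hq, h⟩ := hb P hP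
    refine ⟨preSeminorm p q, continuous_preSeminorm hp hq, fun u => ?_⟩
    have := le_projSeminorm (p := p) (q := q) (N := P.comp (TensorProduct.lift b)) zero_le_one
      (fun x y => by simpa using h x y) u
    rwa [one_mul] at this
  refine ⟨ContinuousLinearMap.extend ⟨f, hf⟩ (toComplLinear (𝕜 := 𝕜) (X := PreProj 𝕜 E F)), ?_⟩
  intro x y
  refine (ContinuousLinearMap.extend_eq _ denseRange_toCompl
    (UniformSpace.Completion.isUniformInducing_coe _) _).trans ?_
  exact TensorProduct.lift.tmul x y

/-- Continuous linear maps on `E ⊗̂ F` are determined by their values on elementary tensors. -/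
theorem ProjTensor.hom_ext {G : Type*} [AddCommGroup G] [Module 𝕜 G] [TopologicalSpace G]
    [T2Space G] {f g : ProjTensor 𝕜 E F →L[𝕜] G} (h : ∀ x y, f (ptmul x y) = g (ptmul x y)) :
    f = g := by
  have h' : f.toLinearMap ∘ₗ (toComplLinear (𝕜 := 𝕜) (X := PreProj 𝕜 E F)).toLinearMap =
      g.toLinearMap ∘ₗ (toComplLinear (𝕜 := 𝕜) (X := PreProj 𝕜 E F)).toLinearMap :=
    TensorProduct.ext' (M := E) (N := F) h
  ext u
  exact congrFun (denseRange_toCompl.equalizer f.continuous g.continuous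
    (funext fun u => LinearMap.congr_fun h' u)) u

end Tensor


section Families

variable {ι : Type*} {G : Type*} [AddCommGroup G] [Module 𝕜 G] [UniformSpace G] [CompleteLC 𝕜 G]

theorem seminorm_sum_le {E : Type*} [AddCommGroup E] [Module 𝕜 E] (P : Seminorm 𝕜 E)
    (t : Finset ι) (g : ι → E) : P (∑ k ∈ t, g k) ≤ ∑ k ∈ t, P (g k) := by
  classical
  induction t using Finset.induction_on with
  | empty => simp
  | insert a s ha ih =>
    rw [Finset.sum_insert ha, Finset.sum_insert ha]
    exact (map_add_le_add P _ _).trans (add_le_add le_rfl ih)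

theorem summable_of_seminorm {g : ι → G}
    (h : ∀ P : Seminorm 𝕜 G, Continuous P → {k | P (g k) ≠ 0}.Finite) : Summable g := by
  rw [summable_iff_vanishing]
  intro U hU
  obtain ⟨P, hP, r, hr, hb⟩ := exists_seminorm_of_nhds (𝕜 := 𝕜) hU
  refine ⟨(h P hP).toFinset, fun t ht => hb ?_⟩
  rw [Seminorm.mem_ball, sub_zero]
  refine lt_of_le_of_lt ?_ hr
  refine (seminorm_sum_le P t g).trans (le_of_eq (Finset.sum_eq_zero fun k hk => ?_))
  by_contra hc
  exact Finset.disjoint_left.1 ht hk (by simpa using hc)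

theorem seminorm_hasSum_le {g : ι → G} {a : G} (ha : HasSum g a) {P : Seminorm 𝕜 G}
    (hP : Continuous P) {S : Finset ι} (hS : ∀ k ∉ S, P (g k) = 0) : P a ≤ ∑ k ∈ S, P (g k) := by
  classical
  refine le_of_tendsto ((hP.tendsto a).comp ha) (Filter.Eventually.of_forall fun t => ?_)
  refine (seminorm_sum_le P t g).trans ?_
  rw [Finset.sum_subset (Finset.subset_union_right (s₁ := t) (s₂ := S))
    fun k _ hk => hS k hk]
  exact Finset.sum_le_sum_of_subset_of_nonneg Finset.subset_union_left
    fun _ _ _ => apply_nonneg _ _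

variable {X Y : ι → Type*} [∀ k, AddCommGroup (X k)] [∀ k, Module 𝕜 (X k)]
  [∀ k, UniformSpace (X k)] [∀ k, AddCommGroup (Y k)] [∀ k, Module 𝕜 (Y k)]
  [∀ k, UniformSpace (Y k)]

/-- Joint continuity of a family of bilinear maps with values in `G`: each continuous seminorm
of `G` vanishes on all but finitely many members and is bounded by products of continuous
seminorms on the remaining ones. -/
def FamBdd (m : ∀ k, X k →ₗ[𝕜] Y k →ₗ[𝕜] G) : Prop :=
  ∀ P : Seminorm 𝕜 G, Continuous P → ∃ (p : ∀ k, Seminorm 𝕜 (X k)) (q : ∀ k, Seminorm 𝕜 (Y k)),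
    (∀ k, Continuous (p k)) ∧ (∀ k, Continuous (q k)) ∧ {k | p k ≠ 0}.Finite ∧
      ∀ k x y, P (m k x y) ≤ p k x * q k y

theorem exists_finset_of_seminorm [∀ k, CompleteLC 𝕜 (X k)] {N : Seminorm 𝕜 (∀ k, X k)}
    (hN : Continuous N) : ∃ T : Finset ι, ∀ x, (∀ k ∈ T, x k = 0) → N x = 0 := by
  have h0 : {x | N x < 1} ∈ 𝓝 (0 : ∀ k, X k) :=
    (by simpa using hN.tendsto 0 : Tendsto N (𝓝 0) (𝓝 0)).eventually (gt_mem_nhds one_pos)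
  rw [nhds_pi, Filter.mem_pi] at h0
  obtain ⟨I, hI, t, ht, hsub⟩ := h0
  refine ⟨hI.toFinset, fun x hx => ?_⟩
  have key : ∀ c : 𝕜, ‖c‖ * N x < 1 := by
    intro c
    have : c • x ∈ {x | N x < 1} := hsub fun k hk => by
      have := hx k (by simpa using hk)
      simpa [this] using mem_of_mem_nhds (ht k)
    simpa [map_smul_eq_mul] using this
  by_contra hne
  have hpos : 0 < N x := lt_of_le_of_ne (apply_nonneg _ _) (Ne.symm hne)
  have := key ((N x : 𝕜)⁻¹)
  rw [norm_inv, RCLike.norm_ofReal, abs_of_pos hpos, inv_mul_cancel₀ hne] at this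
  exact lt_irrefl _ this

theorem seminorm_pi_le [∀ k, CompleteLC 𝕜 (X k)] {N : Seminorm 𝕜 (∀ k, X k)}
    (hN : Continuous N) : ∃ (T : Finset ι) (p : ∀ k, Seminorm 𝕜 (X k)), (∀ k, Continuous (p k)) ∧
      ∀ x, N x ≤ ∑ k ∈ T, p k (x k) := by
  classical
  obtain ⟨T, hT⟩ := exists_finset_of_seminorm hN
  refine ⟨T, fun k => N.comp (LinearMap.single 𝕜 X k),
    fun k => hN.comp (continuous_single k), fun x => ?_⟩
  have h1 : N (x - ∑ k ∈ T, Pi.single k (x k)) = 0 := by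
    refine hT _ fun k hk => ?_
    rw [Pi.sub_apply, Finset.sum_apply, Finset.sum_pi_single]
    simp [hk]
  have h2 : N x ≤ N (x - ∑ k ∈ T, Pi.single k (x k)) + N (∑ k ∈ T, Pi.single k (x k)) := by
    simpa using map_add_le_add N (x - ∑ k ∈ T, Pi.single k (x k)) (∑ k ∈ T, Pi.single k (x k))
  rw [h1, zero_add] at h2
  exact h2.trans (seminorm_sum_le N T _)

theorem FamBdd.pi {κ : Type*} {H : κ → Type*} [∀ k, AddCommGroup (H k)] [∀ k, Module 𝕜 (H k)]
    [∀ k, UniformSpace (H k)] [∀ k, CompleteLC 𝕜 (H k)]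
    {m : ∀ k, X k →ₗ[𝕜] Y k →ₗ[𝕜] (∀ c, H c)}
    (h : ∀ c, FamBdd fun k => (m k).compr₂ (LinearMap.proj c)) : FamBdd m := by
  intro P hP
  obtain ⟨T, r, hr, hPr⟩ := seminorm_pi_le hP
  choose p q hp hq hfin hb using fun c => h c (r c) (hr c)
  refine ⟨fun k => ∑ c ∈ T, p c k, fun k => ∑ c ∈ T, q c k,
    fun k => continuous_seminorm_sum T fun c => hp c k,
    fun k => continuous_seminorm_sum T fun c => hq c k, ?_, fun k x y => ?_⟩
  · refine (T.finite_toSet.biUnion fun c _ => hfin c).subset fun k hk => ?_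
    by_contra hc
    simp only [Finset.mem_coe, Set.mem_iUnion, Set.mem_setOf_eq, not_exists, not_not] at hc
    exact hk (Finset.sum_eq_zero fun c hcT => hc c hcT)
  · refine (hPr _).trans ?_
    rw [seminorm_sum_apply, seminorm_sum_apply, Finset.sum_mul]
    refine Finset.sum_le_sum fun c hc => (hb c k x y).trans ?_
    refine mul_le_mul_of_nonneg_left ?_ (apply_nonneg _ _)
    exact Finset.single_le_sum (f := fun c => q c k y) (fun j _ => apply_nonneg _ _) hc

/-- The sum of a jointly continuous family of bilinear maps, as a bilinear map on products. -/
theorem FamBdd.exists_sum {m : ∀ k, X k →ₗ[𝕜] Y k →ₗ[𝕜] G} (h : FamBdd m) :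
    ∃ B : (∀ k, X k) →ₗ[𝕜] (∀ k, Y k) →ₗ[𝕜] G,
      (∀ x y, HasSum (fun k => m k (x k) (y k)) (B x y)) ∧
      ∀ P : Seminorm 𝕜 G, Continuous P → ∃ (N : Seminorm 𝕜 (∀ k, X k))
        (N' : Seminorm 𝕜 (∀ k, Y k)), Continuous N ∧ Continuous N' ∧
          ∀ x y, P (B x y) ≤ N x * N' y := by
  have hs : ∀ (x : ∀ k, X k) (y : ∀ k, Y k), Summable fun k => m k (x k) (y k) := by
    refine fun x y => summable_of_seminorm (𝕜 := 𝕜) fun P hP => ?_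
    obtain ⟨p, q, -, -, hfin, hb⟩ := h P hP
    refine hfin.subset fun k hk hpk => hk (le_antisymm ?_ (apply_nonneg _ _))
    simpa [hpk] using hb k (x k) (y k)
  refine ⟨LinearMap.mk₂ 𝕜 (fun x y => ∑' k, m k (x k) (y k)) ?_ ?_ ?_ ?_,
    fun x y => (hs x y).hasSum, fun P hP => ?_⟩
  · intro x x' y
    simpa using (hs x y).tsum_add (hs x' y)
  · intro c x y
    simpa using (hs x y).tsum_const_smul c
  · intro x y y'
    simpa using (hs x y).tsum_add (hs x y')
  · intro c x y
    simpa using (hs x y).tsum_const_smul c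
  · obtain ⟨p, q, hp, hq, hfin, hb⟩ := h P hP
    refine ⟨∑ k ∈ hfin.toFinset, (p k).comp (LinearMap.proj k),
      ∑ k ∈ hfin.toFinset, (q k).comp (LinearMap.proj k),
      continuous_seminorm_sum _ fun k => (hp k).comp (continuous_apply k),
      continuous_seminorm_sum _ fun k => (hq k).comp (continuous_apply k), fun x y => ?_⟩
    refine (seminorm_hasSum_le (hs x y).hasSum hP (S := hfin.toFinset) fun k hk => ?_).trans ?_
    · have hpk : p k = 0 := by simpa using hk
      refine le_antisymm ?_ (apply_nonneg _ _)
      simpa [hpk] using hb k (x k) (y k)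
    · rw [seminorm_sum_apply, seminorm_sum_apply, Finset.sum_mul]
      refine Finset.sum_le_sum fun c hc => (hb c (x c) (y c)).trans ?_
      refine mul_le_mul_of_nonneg_left ?_ (apply_nonneg _ _)
      exact Finset.single_le_sum (f := fun k => ((q k).comp (LinearMap.proj k)) y)
        (fun j _ => apply_nonneg _ _) hc

theorem pi_hom_ext {Z : ι → Type*} [∀ k, AddCommGroup (Z k)] [∀ k, Module 𝕜 (Z k)]
    [∀ k, TopologicalSpace (Z k)] [DecidableEq ι]
    {H : Type*} [AddCommGroup H] [Module 𝕜 H] [TopologicalSpace H]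
    [T2Space H] {f g : (∀ k, Z k) →L[𝕜] H}
    (h : ∀ k x, f (Pi.single k x) = g (Pi.single k x)) : f = g := by
  ext x
  have hx : HasSum (fun k => Pi.single k (x k)) x := by
    rw [Pi.hasSum]
    intro k
    have := hasSum_single (f := fun j => (Pi.single j (x j) : ∀ k, Z k) k) k (by
      intro j hj; simp [Pi.single_apply, hj.symm])
    simpa using this
  have h1 := hx.mapL f
  have h2 := hx.mapL g
  simp only [h] at h1
  exact h1.unique h2

end Families

section GradedTensor

variable {E F : ℤ → Type u} [∀ i, AddCommGroup (E i)] [∀ i, Module 𝕜 (E i)]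
  [∀ i, UniformSpace (E i)] [∀ i, AddCommGroup (F i)] [∀ i, Module 𝕜 (F i)]
  [∀ i, UniformSpace (F i)]

variable (𝕜 E F) in
/-- The graded completed tensor product `(E ⊗̂ F)^n = ∏_{a+b=n} E^a ⊗̂ F^b`. -/
abbrev GTensor (n : ℤ) : Type u :=
  ∀ p : {p : ℤ × ℤ // p.1 + p.2 = n}, ProjTensor 𝕜 (E p.1.1) (F p.1.2)

/-- The elementary tensor `x ⊗ y` of homogeneous elements. -/
noncomputable def gtmul {a b n : ℤ} (h : a + b = n) (x : E a) (y : F b) : GTensor 𝕜 E F n :=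
  Pi.single (M := fun p : {p : ℤ × ℤ // p.1 + p.2 = n} => ProjTensor 𝕜 (E p.1.1) (F p.1.2))
    ⟨(a, b), h⟩ (ptmul x y)

variable {G : Type u} [AddCommGroup G] [Module 𝕜 G] [UniformSpace G]

/-- The bilinear maps `E^a × F^b → G` with `a + b = n` are induced by a continuous linear map
`(E ⊗̂ F)^n → G`. -/
def ExtendsToTensor {n : ℤ} (m : ∀ p : {p : ℤ × ℤ // p.1 + p.2 = n},
    E p.1.1 →ₗ[𝕜] F p.1.2 →ₗ[𝕜] G) : Prop :=
  ∃ Φ : GTensor 𝕜 E F n →L[𝕜] G, ∀ {a b : ℤ} (h : a + b = n) (x : E a) (y : F b),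
    Φ (gtmul h x y) = m ⟨(a, b), h⟩ x y

theorem GTensor.hom_ext {n : ℤ} {H : Type*} [AddCommGroup H] [Module 𝕜 H] [TopologicalSpace H]
    [T2Space H] {f g : GTensor 𝕜 E F n →L[𝕜] H}
    (h : ∀ {a b : ℤ} (h : a + b = n) (x : E a) (y : F b), f (gtmul h x y) = g (gtmul h x y)) :
    f = g := by
  refine pi_hom_ext fun k z => ?_
  have : f.comp (ContinuousLinearMap.single 𝕜 (fun p : {p : ℤ × ℤ // p.1 + p.2 = n} =>
      ProjTensor 𝕜 (E p.1.1) (F p.1.2)) k) = g.comp (ContinuousLinearMap.single 𝕜 _ k) :=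
    ProjTensor.hom_ext fun x y => h k.2 x y
  exact congrArg (fun f => f z) this

theorem FamBdd.extendsToTensor [CompleteLC 𝕜 G] {n : ℤ} {m : ∀ p : {p : ℤ × ℤ // p.1 + p.2 = n},
    E p.1.1 →ₗ[𝕜] F p.1.2 →ₗ[𝕜] G} (h : FamBdd m) : ExtendsToTensor m := by
  have hex : ∀ k, ∃ Φ : ProjTensor 𝕜 (E k.1.1) (F k.1.2) →L[𝕜] G,
      ∀ x y, Φ (ptmul x y) = m k x y := fun k => exists_lift (m k) fun P hP => by
    obtain ⟨p, q, hp, hq, -, hb⟩ := h P hP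
    exact ⟨p k, q k, hp k, hq k, hb k⟩
  choose ℓ hℓ using hex
  have hbdd : FamBdd (𝕜 := 𝕜) (Y := fun _ : {p : ℤ × ℤ // p.1 + p.2 = n} => 𝕜)
      fun k => (LinearMap.lsmul 𝕜 G).flip ∘ₗ (ℓ k).toLinearMap := by
    intro P hP
    obtain ⟨p, q, hp, hq, hfin, hb⟩ := h P hP
    refine ⟨fun k => P.comp (ℓ k).toLinearMap, fun _ => normSeminorm 𝕜 𝕜,
      fun k => hP.comp (ℓ k).continuous, fun _ => continuous_norm, ?_, fun k x c => ?_⟩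
    · refine hfin.subset fun k hk hpk => hk ?_
      ext u
      have := le_projS (hp k) (hq k) (N := P.comp (ℓ k).toLinearMap) (hP.comp (ℓ k).continuous)
        le_rfl (fun x y => by simpa [hℓ, hpk] using hb k x y) u
      rw [zero_mul] at this
      exact le_antisymm this (apply_nonneg _ _)
    · simp [map_smul_eq_mul, mul_comm]
  obtain ⟨B, hB, hcont⟩ := hbdd.exists_sum
  refine ⟨⟨B.flip fun _ => 1, ?_⟩, fun {a b} hab x y => ?_⟩
  · refine continuous_of_seminorm _ fun P hP => ?_
    obtain ⟨N, N', hN, hN', hb⟩ := hcont P hP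
    let c : NNReal := ⟨N' fun _ => 1, apply_nonneg _ _⟩
    refine ⟨c • N, hN.const_smul _, fun x => (hb x _).trans ?_⟩
    rw [mul_comm]
    rfl
  · refine (hB (gtmul hab x y) fun _ => 1).unique ?_
    have := hasSum_single (f := fun k : {p : ℤ × ℤ // p.1 + p.2 = n} =>
      ((LinearMap.lsmul 𝕜 G).flip ∘ₗ (ℓ k).toLinearMap) ((gtmul hab x y : GTensor 𝕜 E F n) k) 1)
      ⟨(a, b), hab⟩ (by intro j hj; simp [gtmul, hj])
    simpa [gtmul, hℓ] using this

theorem ExtendsToTensor.famBdd {n : ℤ} {m : ∀ p : {p : ℤ × ℤ // p.1 + p.2 = n},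
    E p.1.1 →ₗ[𝕜] F p.1.2 →ₗ[𝕜] G} (h : ExtendsToTensor m) : FamBdd m := by
  classical
  obtain ⟨Φ, hΦ⟩ := h
  intro P hP
  obtain ⟨T, p, hp, hT⟩ := seminorm_pi_le (𝕜 := 𝕜) (N := P.comp Φ.toLinearMap)
    (hP.comp Φ.continuous)
  choose q r hq hr hb using fun k => seminorm_ptmul_le (hp k)
  refine ⟨fun k => if k ∈ T then q k else 0, r, fun k => ?_, hr, ?_, fun k x y => ?_⟩
  · dsimp only
    split_ifs
    · exact hq k
    · exact continuous_const
  · refine T.finite_toSet.subset fun k hk => ?_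
    by_contra hc
    exact hk (if_neg hc)
  · rw [← hΦ k.2 x y]
    refine (hT _).trans ?_
    by_cases hk : k ∈ T
    · rw [Finset.sum_eq_single k]
      · simpa [gtmul, hk] using hb k x y
      · intro j _ hj
        simp [gtmul, hj]
      · exact fun h => absurd hk h
    · refine (Finset.sum_eq_zero fun j hj => ?_).le.trans (by simp [hk])
      have : j ≠ k := fun h => hk (h ▸ hj)
      simp [gtmul, this]

end GradedTensor

end LC

section FamBddLemmas

variable {𝕜 : Type} [RCLike 𝕜] {ι : Type*} {G : Type*} [AddCommGroup G] [Module 𝕜 G]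
  [UniformSpace G] [CompleteLC 𝕜 G]
  {X Y : ι → Type*} [∀ k, AddCommGroup (X k)] [∀ k, Module 𝕜 (X k)]
  [∀ k, UniformSpace (X k)] [∀ k, AddCommGroup (Y k)] [∀ k, Module 𝕜 (Y k)]
  [∀ k, UniformSpace (Y k)]

theorem FamBdd.reindex {m : ∀ k, X k →ₗ[𝕜] Y k →ₗ[𝕜] G} (h : FamBdd m) {κ : Type*} (e : κ → ι)
    (he : Function.Injective e) : FamBdd fun k => m (e k) := by
  intro P hP
  obtain ⟨p, q, hp, hq, hfin, hb⟩ := h P hP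
  exact ⟨fun k => p (e k), fun k => q (e k), fun k => hp _, fun k => hq _,
    hfin.preimage he.injOn, fun k => hb (e k)⟩

theorem FamBdd.comp {m : ∀ k, X k →ₗ[𝕜] Y k →ₗ[𝕜] G} (h : FamBdd m)
    {X' Y' : ι → Type*} [∀ k, AddCommGroup (X' k)] [∀ k, Module 𝕜 (X' k)]
    [∀ k, UniformSpace (X' k)] [∀ k, AddCommGroup (Y' k)] [∀ k, Module 𝕜 (Y' k)]
    [∀ k, UniformSpace (Y' k)] (f : ∀ k, X' k →L[𝕜] X k) (g : ∀ k, Y' k →L[𝕜] Y k)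
    {m' : ∀ k, X' k →ₗ[𝕜] Y' k →ₗ[𝕜] G} (hm : ∀ k x y, m' k x y = m k (f k x) (g k y)) :
    FamBdd m' := by
  intro P hP
  obtain ⟨p, q, hp, hq, hfin, hb⟩ := h P hP
  refine ⟨fun k => (p k).comp (f k).toLinearMap, fun k => (q k).comp (g k).toLinearMap,
    fun k => (hp k).comp (f k).continuous, fun k => (hq k).comp (g k).continuous,
    hfin.subset fun k hk hc => hk ?_, fun k x y => ?_⟩
  · ext x
    simp [hc]
  · rw [hm]
    exact hb k _ _

theorem FamBdd.flip {m : ∀ k, X k →ₗ[𝕜] Y k →ₗ[𝕜] G} (h : FamBdd m)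
    {m' : ∀ k, Y k →ₗ[𝕜] X k →ₗ[𝕜] G} (hm : ∀ k, ∃ c : 𝕜, ‖c‖ ≤ 1 ∧
      ∀ x y, m' k y x = c • m k x y) : FamBdd m' := by
  classical
  intro P hP
  obtain ⟨p, q, hp, hq, hfin, hb⟩ := h P hP
  refine ⟨fun k => if p k = 0 then 0 else q k, p, fun k => ?_, hp,
    hfin.subset fun k hk hc => hk (if_pos hc), fun k y x => ?_⟩
  · dsimp only
    split_ifs
    · exact continuous_const
    · exact hq k
  · obtain ⟨c, hc, hm⟩ := hm k
    rw [hm, map_smul_eq_mul]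
    refine (mul_le_of_le_one_left (apply_nonneg _ _) hc).trans ((hb k x y).trans ?_)
    dsimp only
    split_ifs with h0
    · simp [h0]
    · rw [mul_comm]

theorem FamBdd.prod {H : Type*} [AddCommGroup H] [Module 𝕜 H] [UniformSpace H] [CompleteLC 𝕜 H]
    {m : ∀ k, X k →ₗ[𝕜] Y k →ₗ[𝕜] G} {m' : ∀ k, X k →ₗ[𝕜] Y k →ₗ[𝕜] H} (h : FamBdd m)
    (h' : FamBdd m') {m'' : ∀ k, X k →ₗ[𝕜] Y k →ₗ[𝕜] G × H}
    (hm : ∀ k x y, m'' k x y = (m k x y, m' k x y)) : FamBdd m'' := by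
  intro P hP
  obtain ⟨p, q, hp, hq, hfin, hb⟩ := h (P.comp (LinearMap.inl 𝕜 G H))
    (hP.comp (continuous_id.prodMk continuous_const))
  obtain ⟨p', q', hp', hq', hfin', hb'⟩ := h' (P.comp (LinearMap.inr 𝕜 G H))
    (hP.comp (continuous_const.prodMk continuous_id))
  refine ⟨fun k => p k + p' k, fun k => q k + q' k,
    fun k => continuous_seminorm_add (hp k) (hp' k),
    fun k => continuous_seminorm_add (hq k) (hq' k), (hfin.union hfin').subset fun k hk => ?_,
    fun k x y => ?_⟩
  · by_contra hc
    simp only [Set.mem_union, Set.mem_setOf_eq, not_or, not_not] at hc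
    exact hk (by simp [hc.1, hc.2])
  · have h1 : m'' k x y = LinearMap.inl 𝕜 G H (m k x y) + LinearMap.inr 𝕜 G H (m' k x y) := by
      rw [hm]
      simp
    rw [h1]
    refine (map_add_le_add P _ _).trans ((add_le_add (hb k x y) (hb' k x y)).trans ?_)
    simp only [Seminorm.add_apply]
    have := apply_nonneg (p k) x
    have := apply_nonneg (p' k) x
    have := apply_nonneg (q k) y
    have := apply_nonneg (q' k) y
    nlinarith [mul_nonneg (apply_nonneg (p k) x) (apply_nonneg (q' k) y),
      mul_nonneg (apply_nonneg (p' k) x) (apply_nonneg (q k) y)]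

end FamBddLemmas

/-! ### Complete locally convex cdg-algebras and cdg-modules -/

/-- A complete locally convex (clct) cdg-algebra: the components are complete locally convex
spaces, the multiplication is a continuous linear map `A ⊗̂ A → A` of degree `0`, and the
derivation is continuous. -/
structure CLCTAlg (𝕜 : Type) [RCLike 𝕜] extends CDGAlg.{u} 𝕜 where
  [unif : ∀ i, UniformSpace (C i)]
  [clc : ∀ i, CompleteLC 𝕜 (C i)]
  mul_cont : ∀ n, ExtendsToTensor (n := n) fun p => mul p.2
  d_cont : ∀ {i j} (h : i + 1 = j), Continuous (d h)

attribute [instance] CLCTAlg.unif CLCTAlg.clc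

/-- A clct right cdg-module: the action is a continuous linear map `M ⊗̂ A → M` of degree `0`
and the differential is continuous. -/
structure CLCTMod {𝕜 : Type} [RCLike 𝕜] (A : CLCTAlg.{u} 𝕜) extends
    CDGMod.{u} A.toCDGAlg where
  [unif : ∀ i, UniformSpace (C i)]
  [clc : ∀ i, CompleteLC 𝕜 (C i)]
  act_cont : ∀ n, ExtendsToTensor (n := n) fun p => act p.2
  d_cont : ∀ {i j} (h : i + 1 = j), Continuous (d h)

attribute [instance] CLCTMod.unif CLCTMod.clc

/-- The total space `∏ E^n` carries the discrete topology, that is, its finest locally convex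
topology: every seminorm is continuous. -/
def IsDiscreteLC (𝕜 : Type) [RCLike 𝕜] (E : ℤ → Type u) [∀ i, AddCommGroup (E i)]
    [∀ i, Module 𝕜 (E i)] [∀ i, UniformSpace (E i)] : Prop :=
  ∀ p : Seminorm 𝕜 (∀ n, E n), Continuous p

/-- Every component has a countable basis as a vector space. -/
def IsCountableDim (𝕜 : Type) [Field 𝕜] (E : ℤ → Type u) [∀ i, AddCommGroup (E i)]
    [∀ i, Module 𝕜 (E i)] : Prop :=
  ∀ n, Module.rank 𝕜 (E n) ≤ Cardinal.aleph0

section CLCT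

variable {𝕜 : Type} [RCLike 𝕜]

theorem norm_sgn_le (n : ℤ) : ‖sgn 𝕜 n‖ ≤ 1 := by
  rcases Int.even_or_odd n with h | h
  · rw [sgn_even h, norm_one]
  · rw [sgn_odd h, norm_neg, norm_one]

theorem CLCTAlg.op_mul_cont (A : CLCTAlg.{u} 𝕜) (n : ℤ) :
    ExtendsToTensor (n := n) fun p => sgn 𝕜 (p.1.1 * p.1.2) •
      (A.mul ((add_comm p.1.2 p.1.1).trans p.2)).flip := by
  refine FamBdd.extendsToTensor (FamBdd.flip
    (FamBdd.reindex (A.mul_cont n).famBdd (fun p : {p : ℤ × ℤ // p.1 + p.2 = n} =>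
      (⟨(p.1.2, p.1.1), (add_comm _ _).trans p.2⟩ : {p : ℤ × ℤ // p.1 + p.2 = n})) ?_)
      fun k => ⟨_, norm_sgn_le (k.1.1 * k.1.2), fun x y => rfl⟩)
  rintro ⟨⟨a, b⟩, h⟩ ⟨⟨a', b'⟩, h'⟩ e
  simp_all

/-- The opposite clct cdg-algebra. -/
def CLCTAlg.op (A : CLCTAlg.{u} 𝕜) : CLCTAlg.{u} 𝕜 where
  toCDGAlg := A.toCDGAlg.op
  unif := A.unif
  clc := A.clc
  mul_cont n := A.op_mul_cont n
  d_cont := A.d_cont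

end CLCT

/-! ### The contraderived category -/

namespace CLCTMod

open CategoryTheory

variable {𝕜 : Type} [RCLike 𝕜] {A : CLCTAlg.{u} 𝕜}

/-- Closed morphisms of degree `0`: continuous `A`-linear maps commuting with the differentials. -/
@[ext] structure Hom (M N : CLCTMod.{u} A) where
  app : ∀ i, M.C i →L[𝕜] N.C i
  app_act : ∀ {i j n : ℤ} (h : i + j = n) (x : M.C i) (a : A.C j),
    app n (M.act h x a) = N.act h (app i x) a
  app_d : ∀ {i j : ℤ} (h : i + 1 = j) (x : M.C i), app j (M.d h x) = N.d h (app i x)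

/-- The category `Z⁰(A-Mod)`. -/
instance : Category (CLCTMod.{u} A) where
  Hom := Hom
  id M := ⟨fun _ => ContinuousLinearMap.id 𝕜 _, fun _ _ _ => rfl, fun _ _ => rfl⟩
  comp f g := ⟨fun i => (g.app i).comp (f.app i),
    fun h x a => by simp [f.app_act h, g.app_act h], fun h x => by simp [f.app_d h, g.app_d h]⟩

@[simp] theorem id_app (M : CLCTMod.{u} A) (i : ℤ) :
    Hom.app (𝟙 M) i = ContinuousLinearMap.id 𝕜 (M.C i) := rfl

@[simp] theorem comp_app {L M N : CLCTMod.{u} A} (f : L ⟶ M) (g : M ⟶ N) (i : ℤ) :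
    Hom.app (f ≫ g) i = (Hom.app g i).comp (Hom.app f i) := rfl

instance (M N : CLCTMod.{u} A) : Add (M ⟶ N) where
  add f g := ⟨fun i => Hom.app f i + Hom.app g i,
    fun h x a => by simp [Hom.app_act f h, Hom.app_act g h],
    fun h x => by simp [Hom.app_d f h, Hom.app_d g h]⟩

instance (M N : CLCTMod.{u} A) : SMul 𝕜 (M ⟶ N) where
  smul c f := ⟨fun i => c • Hom.app f i,
    fun h x a => by simp [Hom.app_act f h], fun h x => by simp [Hom.app_d f h]⟩

/-- Homotopies between closed morphisms: continuous `A`-linear maps `h` of degree `-1` with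
`f - g = d h + h d`. -/
structure Homotopy {M N : CLCTMod.{u} A} (f g : M ⟶ N) where
  h : ∀ {i j : ℤ}, j + 1 = i → (M.C i →L[𝕜] N.C j)
  h_act : ∀ {i j n i' n' : ℤ} (hn : i + j = n) (hi : i' + 1 = i) (hn' : n' + 1 = n)
    (h' : i' + j = n') (x : M.C i) (a : A.C j),
    h hn' (M.act hn x a) = N.act h' (h hi x) a
  comm : ∀ {i j k : ℤ} (hj : j + 1 = i) (hk : i + 1 = k) (x : M.C i),
    Hom.app f i x - Hom.app g i x = N.d hj (h hj x) + h hk (M.d hk x)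

/-- Being homotopic, as a relation on the morphisms of `Z⁰(A-Mod)`. -/
def Homotopic : HomRel (CLCTMod.{u} A) := fun _ _ f g => Nonempty (Homotopy f g)

/-- The shift: `M[k]^i = M^(i+k)`, `d_{M[k]} = (-1)^k d`, with the same action of `A`. -/
def shift (M : CLCTMod.{u} A) (k : ℤ) : CLCTMod.{u} A where
  C i := M.C (i + k)
  act {i j n} h := M.act (by omega : i + k + j = n + k)
  act_one x := M.act_one x
  act_act h₁ h₂ h₃ h₄ x y z := M.act_act _ _ h₃ (by omega) x y z
  d {i j} h := sgn 𝕜 k • M.d (by omega : i + k + 1 = j + k)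
  leibniz {i j n i' j' n'} h hn hi hj h₁ h₂ x y := by
    have e : sgn 𝕜 k * sgn 𝕜 (i + k) = sgn 𝕜 i := by
      rw [sgn_add]
      linear_combination sgn 𝕜 i * sgn_mul_sgn (𝕜 := 𝕜) k
    simp only [LinearMap.smul_apply, map_smul]
    rw [M.leibniz (i' := i' + k) (j' := j') _ _ _ hj (by omega) (by omega), smul_add, smul_smul, e]
  d_d {i j l} h₁ h₂ h₃ x := by
    simp only [LinearMap.smul_apply, map_smul]
    rw [M.d_d _ _ (by omega), smul_smul, sgn_mul_sgn, one_smul]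
  act_cont n := (FamBdd.reindex (M.act_cont (n + k)).famBdd
    (fun p : {p : ℤ × ℤ // p.1 + p.2 = n} => (⟨(p.1.1 + k, p.1.2), by have := p.2; omega⟩ :
      {p : ℤ × ℤ // p.1 + p.2 = n + k})) (by
      rintro ⟨⟨a, b⟩, h⟩ ⟨⟨a', b'⟩, h'⟩ e
      simp_all)).extendsToTensor
  d_cont h := (M.d_cont _).const_smul (sgn 𝕜 k)

/-- The component `M^i → N^j` of a closed morphism for `i = j`. -/
def Hom.appEq {M N : CLCTMod.{u} A} (f : M ⟶ N) {i j : ℤ} (h : i = j) : M.C i →L[𝕜] N.C j :=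
  h ▸ Hom.app f i

@[simp] theorem Hom.appEq_rfl {M N : CLCTMod.{u} A} (f : M ⟶ N) (i : ℤ) :
    Hom.appEq f (rfl : i = i) = Hom.app f i := rfl

theorem Hom.appEq_act {M N : CLCTMod.{u} A} (f : M ⟶ N) {i i' j n n' : ℤ} (hi : i = i')
    (hn : n = n') (h : i + j = n) (h' : i' + j = n') (x : M.C i) (a : A.C j) :
    Hom.appEq f hn (M.act h x a) = N.act h' (Hom.appEq f hi x) a := by
  subst hi hn
  exact Hom.app_act f h x a

theorem Hom.appEq_d {M N : CLCTMod.{u} A} (f : M ⟶ N) {i i' j j' : ℤ} (hi : i = i')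
    (hj : j = j') (h : i + 1 = j) (h' : i' + 1 = j') (x : M.C i) :
    Hom.appEq f hj (M.d h x) = N.d h' (Hom.appEq f hi x) := by
  subst hi hj
  exact Hom.app_d f h x

theorem extendsToTensor_prod {n : ℤ} {E F H : ℤ → Type u}
    [∀ i, AddCommGroup (E i)] [∀ i, Module 𝕜 (E i)] [∀ i, UniformSpace (E i)]
    [∀ i, AddCommGroup (F i)] [∀ i, Module 𝕜 (F i)] [∀ i, UniformSpace (F i)]
    [∀ i, AddCommGroup (H i)] [∀ i, Module 𝕜 (H i)] [∀ i, UniformSpace (H i)]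
    {G G' : Type u} [AddCommGroup G] [Module 𝕜 G] [UniformSpace G] [CompleteLC 𝕜 G]
    [AddCommGroup G'] [Module 𝕜 G'] [UniformSpace G'] [CompleteLC 𝕜 G']
    {m : ∀ p : {p : ℤ × ℤ // p.1 + p.2 = n}, E p.1.1 →ₗ[𝕜] F p.1.2 →ₗ[𝕜] G}
    {m' : ∀ p : {p : ℤ × ℤ // p.1 + p.2 = n}, H p.1.1 →ₗ[𝕜] F p.1.2 →ₗ[𝕜] G'}
    (h : FamBdd m) (h' : FamBdd m')
    {M : ∀ p : {p : ℤ × ℤ // p.1 + p.2 = n}, (E p.1.1 × H p.1.1) →ₗ[𝕜] F p.1.2 →ₗ[𝕜] G × G'}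
    (hM : ∀ p x y, M p x y = (m p x.1 y, m' p x.2 y)) :
    ExtendsToTensor (E := fun i => E i × H i) M := by
  have h1 : FamBdd fun p : {p : ℤ × ℤ // p.1 + p.2 = n} =>
      (m p) ∘ₗ LinearMap.fst 𝕜 (E p.1.1) (H p.1.1) :=
    h.comp (fun p => ContinuousLinearMap.fst 𝕜 (E p.1.1) (H p.1.1))
      (fun p => ContinuousLinearMap.id 𝕜 _) fun p x y => rfl
  have h2 : FamBdd fun p : {p : ℤ × ℤ // p.1 + p.2 = n} =>
      (m' p) ∘ₗ LinearMap.snd 𝕜 (E p.1.1) (H p.1.1) :=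
    h'.comp (fun p => ContinuousLinearMap.snd 𝕜 (E p.1.1) (H p.1.1))
      (fun p => ContinuousLinearMap.id 𝕜 _) fun p x y => rfl
  exact FamBdd.extendsToTensor (E := fun i => E i × H i) (h1.prod h2 hM)

/-- The differential `d (y, x) = (d y + f x, -d x)` of the cone. -/
def coneD {M N : CLCTMod.{u} A} (f : M ⟶ N) {i j : ℤ} (h : i + 1 = j) :
    (N.C i × M.C (i + 1)) →ₗ[𝕜] (N.C j × M.C (j + 1)) :=
  (N.d h ∘ₗ LinearMap.fst 𝕜 (N.C i) (M.C (i + 1)) +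
      (Hom.appEq f h).toLinearMap ∘ₗ LinearMap.snd 𝕜 (N.C i) (M.C (i + 1))).prod
    (-(M.d (by omega : i + 1 + 1 = j + 1) ∘ₗ LinearMap.snd 𝕜 (N.C i) (M.C (i + 1))))

/-- The cone of a closed morphism: `cone(f)^n = N^n × M^(n+1)` with
`d (y, x) = (d y + f x, -d x)`. -/
def cone {M N : CLCTMod.{u} A} (f : M ⟶ N) : CLCTMod.{u} A where
  C i := N.C i × M.C (i + 1)
  act {i j n} h := LinearMap.mk₂ 𝕜
    (fun x a => (N.act h x.1 a, M.act (by omega : i + 1 + j = n + 1) x.2 a))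
    (by intros; simp) (by intros; simp) (by intros; simp) (by intros; simp)
  act_one x := Prod.ext (N.act_one x.1) (M.act_one x.2)
  act_act h₁ h₂ h₃ h₄ x y z :=
    Prod.ext (N.act_act _ _ h₃ h₄ x.1 y z) (M.act_act _ _ h₃ (by omega) x.2 y z)
  d h := coneD f h
  leibniz {i j n i' j' n'} h hn hi hj h₁ h₂ x y := by
    have e : sgn 𝕜 (i + 1) = - sgn 𝕜 i := by rw [sgn_add, sgn_odd odd_one, mul_neg_one]
    refine Prod.ext ?_ ?_
    · have h1 := N.leibniz h hn hi hj h₁ h₂ x.1 y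
      have h2 := Hom.appEq_act f hi hn (by omega : i + 1 + j = n + 1) h₁ x.2 y
      simp [coneD, h1, h2]
      abel
    · have h1 := M.leibniz (i := i + 1) (n := n + 1) (n' := n' + 1) (i' := i' + 1)
        (by omega) (by omega) (by omega) hj (by omega) (by omega) x.2 y
      simp [coneD, h1, e, add_comm]
  d_d {i j l} h₁ h₂ h₃ x := by
    refine Prod.ext ?_ ?_
    · have h1 := N.d_d h₁ h₂ h₃ x.1
      have h2 := Hom.appEq_d f h₁ h₂ (by omega : i + 1 + 1 = j + 1) h₂ x.2
      simp [coneD, h1, h2]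
    · have h1 := M.d_d (i := i + 1) (j := j + 1) (k := l + 1) (by omega) (by omega) (by omega) x.2
      simp [coneD, h1]
  act_cont n := extendsToTensor_prod (E := N.C) (H := fun i => M.C (i + 1)) (N.act_cont n).famBdd
    ((FamBdd.reindex (M.act_cont (n + 1)).famBdd
      (fun p : {p : ℤ × ℤ // p.1 + p.2 = n} => (⟨(p.1.1 + 1, p.1.2), by have := p.2; omega⟩ :
        {p : ℤ × ℤ // p.1 + p.2 = n + 1})) (by
        rintro ⟨⟨a, b⟩, h⟩ ⟨⟨a', b'⟩, h'⟩ e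
        simp_all))) fun p x y => rfl
  d_cont h := (((N.d_cont h).comp continuous_fst).add
    ((Hom.appEq f h).continuous.comp continuous_snd)).prodMk
      ((M.d_cont _).comp continuous_snd).neg

/-- The product of a family of cdg-modules. -/
def pi {ι : Type u} (M : ι → CLCTMod.{u} A) : CLCTMod.{u} A where
  C n := ∀ c, (M c).C n
  act h := LinearMap.mk₂ 𝕜 (fun x a c => (M c).act h (x c) a)
    (by intros; ext; simp) (by intros; ext; simp) (by intros; ext; simp) (by intros; ext; simp)
  act_one x := funext fun c => (M c).act_one (x c)
  act_act h₁ h₂ h₃ h₄ x y z := funext fun c => (M c).act_act h₁ h₂ h₃ h₄ (x c) y z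
  d h := LinearMap.pi fun c => (M c).d h ∘ₗ LinearMap.proj c
  leibniz h hn hi hj h₁ h₂ x y := funext fun c => (M c).leibniz h hn hi hj h₁ h₂ (x c) y
  d_d h₁ h₂ h₃ x := funext fun c => (M c).d_d h₁ h₂ h₃ (x c)
  act_cont n := FamBdd.extendsToTensor (E := fun n => ∀ c, (M c).C n) (FamBdd.pi fun c =>
    ((M c).act_cont n).famBdd.comp (fun p => ContinuousLinearMap.proj c)
      (fun p => ContinuousLinearMap.id 𝕜 _) fun p x y => rfl)
  d_cont h := continuous_pi fun c => ((M c).d_cont h).comp (continuous_apply c)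

/-- The projections of a product. -/
def piProj {ι : Type u} (M : ι → CLCTMod.{u} A) (c : ι) : pi M ⟶ M c where
  app _ := ContinuousLinearMap.proj c
  app_act _ _ _ := rfl
  app_d _ _ := rfl

/-- Short exact sequences `0 → K → L → M → 0` in `Z⁰(A-Mod)`: in each degree the sequence admits a
continuous `𝕜`-linear contracting homotopy. -/
structure SES (K L M : CLCTMod.{u} A) where
  i : K ⟶ L
  p : L ⟶ M
  r : ∀ n, L.C n →L[𝕜] K.C n
  s : ∀ n, M.C n →L[𝕜] L.C n
  p_i : ∀ n x, Hom.app p n (Hom.app i n x) = 0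
  r_i : ∀ n x, r n (Hom.app i n x) = x
  p_s : ∀ n x, Hom.app p n (s n x) = x
  split : ∀ n x, Hom.app i n (r n x) + s n (Hom.app p n x) = x

/-- The closed morphism `cone(K → L) → M`, `(y, x) ↦ p y`. -/
def SES.fromCone {K L M : CLCTMod.{u} A} (S : SES K L M) : cone S.i ⟶ M where
  app n := (Hom.app S.p n).comp (ContinuousLinearMap.fst 𝕜 _ _)
  app_act h x a := Hom.app_act S.p h x.1 a
  app_d {i j} h x := by
    have h0 : ∀ {i j : ℤ} (h : i = j) (x : K.C i), Hom.app S.p j (Hom.appEq S.i h x) = 0 := by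
      intro i j h x
      subst h
      exact S.p_i _ x
    have h1 := Hom.app_d S.p h x.1
    change Hom.app S.p j (L.d h x.1 + Hom.appEq S.i h x.2) = _
    rw [map_add, h0, add_zero, h1]
    rfl

/-- The totalization of a short exact sequence. -/
def SES.tot {K L M : CLCTMod.{u} A} (S : SES K L M) : CLCTMod.{u} A := cone S.fromCone

/-- Contraacyclic modules: the smallest class containing the totalizations of short exact sequences
and closed under shifts, cones, products and direct summands in the homotopy category. -/
inductive Contraacyclic : CLCTMod.{u} A → Prop
  | tot {K L M : CLCTMod.{u} A} (S : SES K L M) : Contraacyclic S.tot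
  | shift (M : CLCTMod.{u} A) (k : ℤ) : Contraacyclic M → Contraacyclic (M.shift k)
  | cone {M N : CLCTMod.{u} A} (f : M ⟶ N) :
      Contraacyclic M → Contraacyclic N → Contraacyclic (cone f)
  | pi {ι : Type u} (M : ι → CLCTMod.{u} A) : (∀ c, Contraacyclic (M c)) → Contraacyclic (pi M)
  | retract {M N : CLCTMod.{u} A} (i : M ⟶ N) (r : N ⟶ M) : Homotopic (i ≫ r) (𝟙 M) →
      Contraacyclic N → Contraacyclic M

end CLCTMod

open CategoryTheory in
/-- The homotopy category `H⁰(A-Mod)`. -/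
abbrev H0 {𝕜 : Type} [RCLike 𝕜] (A : CLCTAlg.{u} 𝕜) : Type (u + 1) :=
  Quotient (CLCTMod.Homotopic (A := A))

open CategoryTheory in
/-- The morphisms of `H⁰(A-Mod)` with contraacyclic cone. -/
def H0.contraIso {𝕜 : Type} [RCLike 𝕜] (A : CLCTAlg.{u} 𝕜) : MorphismProperty (H0 A) :=
  fun X Y φ => ∃ f : X.as ⟶ Y.as, (Quotient.functor CLCTMod.Homotopic).map f = φ ∧
    (CLCTMod.cone f).Contraacyclic

/-- The contraderived category `D^ctr(A)`, the Verdier quotient of `H⁰(A-Mod)` by the contraacyclic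
modules. -/
abbrev DCtr {𝕜 : Type} [RCLike 𝕜] (A : CLCTAlg.{u} 𝕜) : Type (u + 1) :=
  (H0.contraIso A).Localization

namespace DCtr

open CategoryTheory

variable {𝕜 : Type} [RCLike 𝕜] {A : CLCTAlg.{u} 𝕜}

/-- The functor `Z⁰(A-Mod) → D^ctr(A)`. -/
noncomputable def Q (A : CLCTAlg.{u} 𝕜) : CLCTMod.{u} A ⥤ DCtr A :=
  Quotient.functor CLCTMod.Homotopic ⋙ (H0.contraIso A).Q

/-- The relation `α + β = γ` for morphisms of the additive category `D^ctr(A)`, expressed through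
the product `N × N`. -/
def IsSum {M N : CLCTMod.{u} A} (α β γ : (Q A).obj M ⟶ (Q A).obj N) : Prop :=
  ∃ δ : (Q A).obj M ⟶ (Q A).obj (CLCTMod.pi fun _ : ULift.{u} Bool => N),
    δ ≫ (Q A).map (CLCTMod.piProj _ ⟨true⟩) = α ∧ δ ≫ (Q A).map (CLCTMod.piProj _ ⟨false⟩) = β ∧
      δ ≫ (Q A).map (CLCTMod.piProj _ ⟨true⟩ + CLCTMod.piProj _ ⟨false⟩) = γ

end DCtr

section Classes

variable {𝕜 : Type} [Field 𝕜] {A : CDGAlg.{u} 𝕜}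

theorem IsClosedHom.app_d {M N : CDGMod.{u} A} {f : Homs M.toGrMod N.toGrMod 0}
    (hf : IsClosedHom f) {i j : ℤ} (h : i + 1 = j) (x : M.C i) :
    f.app (add_zero j) (M.d h x) = N.d h (f.app (add_zero i) x) := by
  subst h
  have h1 := congrArg (fun g : Homs M.toGrMod N.toGrMod 1 => g.app (rfl : i + 1 = i + 1) x) hf
  have h2 : N.d (rfl : i + 1 = i + 1) (f.app (add_zero i) x) -
      sgn 𝕜 0 • f.app (add_zero (i + 1)) (M.d rfl x) = 0 := by
    refine Eq.trans ?_ h1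
    change _ = N.d _ (f.app rfl x) - sgn 𝕜 0 • f.app _ (M.d rfl x)
    congr 1
    have : ∀ {l : ℤ} (h : i + 0 = l) (h' : l + 1 = i + 1),
      N.d h' (f.app h x) = N.d (by omega) (f.app (rfl : i + 0 = i + 0) x) := by
      intro l h h'
      subst h
      rfl
    exact this _ _
  rw [sgn_even Even.zero, one_smul, sub_eq_zero] at h2
  exact h2.symm

theorem homD_apply {M N : CDGMod.{u} A} {k l : ℤ} (hkl : k + 1 = l)
    (f : Homs M.toGrMod N.toGrMod k) {i j a b : ℤ} (h : i + l = j) (ha : i + k = a)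
    (ha' : a + 1 = j) (hb : i + 1 = b) (hb' : b + k = j) (x : M.C i) :
    (homD M N hkl f).app h x = N.d ha' (f.app ha x) - sgn 𝕜 k • f.app hb' (M.d hb x) := by
  subst ha hb
  rfl

theorem homD_precomp {L M : CDGMod.{u} A} (N : CDGMod.{u} A) {e : Homs L.toGrMod M.toGrMod 0}
    (he : IsClosedHom e) {k l k' : ℤ} (hk : k = k') (hl : k' + 1 = l) (hl' : k + 1 = l)
    (f : Homs M.toGrMod N.toGrMod k) :
    homD L N hl (Homs.precomp e N.toGrMod hk f) =
      Homs.precomp e N.toGrMod rfl (homD M N hl' f) := by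
  subst hk
  refine Subtype.ext (funext fun p => LinearMap.ext fun x => ?_)
  obtain ⟨⟨i, j⟩, h⟩ := p
  refine (homD_apply hl (Homs.precomp e N.toGrMod rfl f) h rfl (by omega) rfl (by omega) x).trans ?_
  refine Eq.trans ?_ (homD_apply hl' f h rfl (by omega) rfl (by omega)
    (e.app (add_zero i) x)).symm
  refine congrArg _ (congrArg _ ?_)
  change f.app _ (e.app _ (L.d rfl x)) = _
  rw [he.app_d]

theorem GPResolution.totD_zero {M : CDGMod.{u} A} (R : GPResolution M) (N : CDGMod.{u} A) {k l : ℤ}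
    (h : k + 1 = l) (x : R.Fam N k) :
    R.totD N h x 0 = homD (R.F 0) N (by omega) (x 0) := rfl

theorem GPResolution.totD_succ {M : CDGMod.{u} A} (R : GPResolution M) (N : CDGMod.{u} A) {k l : ℤ}
    (h : k + 1 = l) (x : R.Fam N k) (n : ℕ) :
    R.totD N h x (n + 1) =
      sgn 𝕜 ((n : ℤ) + 1) • homD (R.F (n + 1)) N (by push_cast; omega) (x (n + 1)) +
        Homs.precomp (R.del n) N.toGrMod (by push_cast; omega) (x n) := rfl

theorem GPResolution.ofHom_mem {M : CDGMod.{u} A} (R : GPResolution M) (N : CDGMod.{u} A) {k : ℤ}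
    (f : Homs M.toGrMod N.toGrMod k) (hf : homD M N rfl f = 0) :
    R.ofHom N f ∈ R.cocycles N k := by
  refine ⟨(Set.finite_singleton 0).subset fun n hn => ?_, LinearMap.mem_ker.2 ?_⟩
  · rcases n with _ | n
    · rfl
    · exact absurd rfl hn
  · funext n
    rcases n with _ | _ | n
    · have h0 : ∀ {l : ℤ} (h : k + 1 = l), homD M N h f = 0 := by
        intro l h
        subst h
        exact hf
      refine (R.totD_zero N rfl (R.ofHom N f)).trans ?_
      refine (homD_precomp N R.aug_closed (by push_cast; omega) (by omega)
        (by push_cast; omega) f).trans ?_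
      rw [h0, map_zero]
      rfl
    · refine (R.totD_succ N rfl (R.ofHom N f) 0).trans ?_
      have h1 : R.ofHom N f (0 + 1) = 0 := rfl
      rw [h1, map_zero, smul_zero]
      refine (zero_add _).trans (Subtype.ext (funext fun p => LinearMap.ext fun x => ?_))
      have h2 := (R.exact_zero p.1.1).apply_apply_eq_zero x
      change f.app _ (R.aug.app _ ((R.del 0).app _ x)) = 0
      rw [h2, map_zero]
    · refine (R.totD_succ N rfl (R.ofHom N f) (n + 1)).trans ?_
      have h1 : R.ofHom N f (n + 1 + 1) = 0 := rfl
      have h2 : R.ofHom N f (n + 1) = 0 := rfl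
      rw [h1, h2, map_zero, map_zero, smul_zero]
      exact zero_add _

/-- The class in `Ext` of the second kind of a closed `A`-linear map `M → N` of degree `k`. -/
def GPResolution.classOf {M : CDGMod.{u} A} (R : GPResolution M) (N : CDGMod.{u} A) {k : ℤ}
    (f : Homs M.toGrMod N.toGrMod k) (hf : homD M N rfl f = 0) : R.ExtII N k :=
  Submodule.Quotient.mk ⟨R.ofHom N f, R.ofHom_mem N f hf⟩

end Classes

namespace CLCTMod

open CategoryTheory

variable {𝕜 : Type} [RCLike 𝕜] {A : CLCTAlg.{u} 𝕜}

/-- A closed morphism `M → N[k]` as an `A`-linear map `M → N` of degree `k`. -/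
def toHoms {M N : CLCTMod.{u} A} {k : ℤ} (f : M ⟶ N.shift k) :
    Homs M.toGrMod N.toGrMod k :=
  ⟨fun p => p.2 ▸ (Hom.app f p.1.1).toLinearMap, by
    intro i j n i' n' h hi hn h' x a
    subst hi hn
    exact Hom.app_act f h x a⟩

theorem toHoms_app {M N : CLCTMod.{u} A} {k : ℤ} (f : M ⟶ N.shift k) (i : ℤ) (x : M.C i) :
    (toHoms f).app (rfl : i + k = i + k) x = Hom.app f i x := rfl

theorem toHoms_closed {M N : CLCTMod.{u} A} {k : ℤ} (f : M ⟶ N.shift k) :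
    homD M.toCDGMod N.toCDGMod rfl (toHoms f) = 0 := by
  refine Subtype.ext (funext fun p => LinearMap.ext fun x => ?_)
  obtain ⟨⟨i, j⟩, h⟩ := p
  have h1 := Hom.app_d f (rfl : i + 1 = i + 1) x
  have h2 := homD_apply rfl (toHoms f) h rfl (by omega) rfl (by omega) x
  refine h2.trans ?_
  have h3 : (toHoms f).app (by omega : i + 1 + k = j) (M.d rfl x) =
      sgn 𝕜 k • N.d (by omega : i + k + 1 = j) (Hom.app f i x) := by
    have h4 : ∀ {l : ℤ} (h : i + 1 + k = l), (toHoms f).app h (M.d rfl x) =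
        sgn 𝕜 k • N.d (by omega : i + k + 1 = l) (Hom.app f i x) := by
      intro l h
      subst h
      exact h1
    exact h4 _
  rw [h3, smul_smul, sgn_mul_sgn, one_smul, toHoms_app, sub_self]
  rfl

end CLCTMod

open CategoryTheory in
/-- `Φ` is an isomorphism of vector spaces from `Hom_{D^ctr(A)}(M, N)` to `V` which sends (the image
of) a closed morphism `f : M → N` to the class `cls f`. -/
structure IsComparison {𝕜 : Type} [RCLike 𝕜] {A : CLCTAlg.{u} 𝕜} {M N : CLCTMod.{u} A}
    {V : Type u} [AddCommGroup V] [Module 𝕜 V] (cls : (M ⟶ N) → V)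
    (Φ : ((DCtr.Q A).obj M ⟶ (DCtr.Q A).obj N) ≃ V) : Prop where
  add : ∀ α β γ, DCtr.IsSum α β γ ↔ Φ α + Φ β = Φ γ
  smul : ∀ (c : 𝕜) α, Φ (α ≫ (DCtr.Q A).map (c • 𝟙 N)) = c • Φ α
  map : ∀ f, Φ ((DCtr.Q A).map f) = cls f

section TensorExtension

variable {𝕜 : Type} [RCLike 𝕜] {E F E' F' : Type u} [AddCommGroup E] [Module 𝕜 E]
  [AddCommGroup F] [Module 𝕜 F] [UniformSpace E] [UniformSpace F]
  [AddCommGroup E'] [Module 𝕜 E'] [AddCommGroup F'] [Module 𝕜 F'] [UniformSpace E']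
  [UniformSpace F'] {G : Type u} [AddCommGroup G] [Module 𝕜 G] [UniformSpace G] [CompleteLC 𝕜 G]

theorem projS_ptmul_le {p : Seminorm 𝕜 E} {q : Seminorm 𝕜 F} (hp : Continuous p)
    (hq : Continuous q) (x : E) (y : F) : projS hp hq (ptmul x y) ≤ p x * q y :=
  (complSeminorm_coe (preSeminorm p q) (continuous_preSeminorm hp hq) _).le.trans
    (projSeminorm_tmul_le p q x y)

theorem projS_eq_zero {p : Seminorm 𝕜 E} {q : Seminorm 𝕜 F} (hp : Continuous p)
    (hq : Continuous q) (h : p = 0 ∨ q = 0) : projS (𝕜 := 𝕜) hp hq = 0 := by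
  ext u
  refine le_antisymm ?_ (apply_nonneg _ _)
  have := le_projS hp hq (continuous_projS hp hq) le_rfl (fun x y => by
    refine (projS_ptmul_le hp hq x y).trans (le_of_eq ?_)
    rcases h with h | h <;> simp [h]) u
  simpa using this

/-- Extension of trilinear maps to the completed tensor product of the last two factors. -/
theorem exists_lift₂ {X : Type*} [AddCommGroup X] [Module 𝕜 X] (r : X →ₗ[𝕜] E →ₗ[𝕜] F →ₗ[𝕜] G)
    (hr : ∀ z, ∀ P : Seminorm 𝕜 G, Continuous P → ∃ (p : Seminorm 𝕜 E) (q : Seminorm 𝕜 F),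
      Continuous p ∧ Continuous q ∧ ∀ x y, P (r z x y) ≤ p x * q y) :
    ∃ ρ : X →ₗ[𝕜] ProjTensor 𝕜 E F →ₗ[𝕜] G, (∀ z x y, ρ z (ptmul x y) = r z x y) ∧
      ∀ P : Seminorm 𝕜 G, Continuous P → ∀ (z : X) (c : ℝ), 0 ≤ c → ∀ (p : Seminorm 𝕜 E)
        (q : Seminorm 𝕜 F) (hp : Continuous p) (hq : Continuous q),
        (∀ x y, P (r z x y) ≤ c * (p x * q y)) → ∀ u, P (ρ z u) ≤ c * projS hp hq u := by
  choose ℓ hℓ using fun z => exists_lift (r z) (hr z)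
  refine ⟨{
    toFun z := (ℓ z).toLinearMap
    map_add' z z' := ?_
    map_smul' c z := ?_ }, fun z x y => hℓ z x y, fun P hP z c hc p q hp hq h u => ?_⟩
  · have : ℓ (z + z') = ℓ z + ℓ z' := ProjTensor.hom_ext fun x y => by simp [hℓ]
    rw [this]
    rfl
  · have : ℓ (c • z) = c • ℓ z := ProjTensor.hom_ext fun x y => by simp [hℓ]
    rw [this]
    rfl
  · exact le_projS hp hq (N := P.comp (ℓ z).toLinearMap) (hP.comp (ℓ z).continuous) hc
      (fun x y => by simpa [hℓ] using h x y) u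

/-- Extension of a quadrilinear map to completed tensor products. -/
theorem exists_lift₄ (b : E →ₗ[𝕜] F →ₗ[𝕜] E' →ₗ[𝕜] F' →ₗ[𝕜] G)
    (hb : ∀ P : Seminorm 𝕜 G, Continuous P → ∃ (p : Seminorm 𝕜 E) (q : Seminorm 𝕜 F)
      (p' : Seminorm 𝕜 E') (q' : Seminorm 𝕜 F'), Continuous p ∧ Continuous q ∧ Continuous p' ∧
      Continuous q' ∧ ∀ x y x' y', P (b x y x' y') ≤ p x * q y * (p' x' * q' y')) :
    ∃ β : ProjTensor 𝕜 E F →ₗ[𝕜] ProjTensor 𝕜 E' F' →ₗ[𝕜] G,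
      (∀ x y x' y', β (ptmul x y) (ptmul x' y') = b x y x' y') ∧
      ∀ P : Seminorm 𝕜 G, Continuous P → ∀ (p : Seminorm 𝕜 E) (q : Seminorm 𝕜 F)
        (p' : Seminorm 𝕜 E') (q' : Seminorm 𝕜 F') (hp : Continuous p) (hq : Continuous q)
        (hp' : Continuous p') (hq' : Continuous q'),
        (∀ x y x' y', P (b x y x' y') ≤ p x * q y * (p' x' * q' y')) →
        ∀ u v, P (β u v) ≤ projS hp hq u * projS hp' hq' v := by
  obtain ⟨ρ, hρ, hρb⟩ := exists_lift₂ (TensorProduct.lift b) (fun z P hP => by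
    obtain ⟨p, q, p', q', hp, hq, hp', hq', h⟩ := hb P hP
    induction z with
    | zero =>
      exact ⟨0, 0, continuous_const, continuous_const, fun x y => by simp⟩
    | tmul x y =>
      let c : NNReal := ⟨p x * q y, by positivity⟩
      refine ⟨c • p', q', hp'.const_smul _, hq',
        fun x' y' => ?_⟩
      refine (h x y x' y').trans (le_of_eq ?_)
      rw [← mul_assoc]
      rfl
    | add z z' hz hz' =>
      obtain ⟨p₁, q₁, hp₁, hq₁, h₁⟩ := hz
      obtain ⟨p₂, q₂, hp₂, hq₂, h₂⟩ := hz'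
      refine ⟨p₁ + p₂, q₁ + q₂, continuous_seminorm_add hp₁ hp₂, continuous_seminorm_add hq₁ hq₂,
        fun x y => ?_⟩
      rw [map_add, LinearMap.add_apply, LinearMap.add_apply]
      refine (map_add_le_add P _ _).trans ((add_le_add (h₁ x y) (h₂ x y)).trans ?_)
      simp only [Seminorm.add_apply]
      nlinarith [mul_nonneg (apply_nonneg p₁ x) (apply_nonneg q₂ y),
        mul_nonneg (apply_nonneg p₂ x) (apply_nonneg q₁ y)])
  have key : ∀ P : Seminorm 𝕜 G, Continuous P → ∀ (p : Seminorm 𝕜 E) (q : Seminorm 𝕜 F)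
        (p' : Seminorm 𝕜 E') (q' : Seminorm 𝕜 F') (hp' : Continuous p') (hq' : Continuous q'),
        (∀ x y x' y', P (b x y x' y') ≤ p x * q y * (p' x' * q' y')) →
        ∀ v x y, P (ρ (x ⊗ₜ y) v) ≤ projS hp' hq' v * (p x * q y) := by
    intro P hP p q p' q' hp' hq' h v x y
    rw [mul_comm]
    exact hρb P hP (x ⊗ₜ y) (p x * q y) (by positivity) p' q' hp' hq'
      (fun x' y' => by simpa using h x y x' y') v
  obtain ⟨β, hβ, hβb⟩ := exists_lift₂ (TensorProduct.lcurry (RingHom.id 𝕜) E F G ∘ₗ ρ.flip)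
    (fun v P hP => by
      obtain ⟨p, q, p', q', hp, hq, hp', hq', h⟩ := hb P hP
      let c : NNReal := ⟨projS hp' hq' v, apply_nonneg _ _⟩
      refine ⟨c • p, q, hp.const_smul _, hq,
        fun x y => ?_⟩
      refine (key P hP p q p' q' hp' hq' h v x y).trans (le_of_eq ?_)
      rw [← mul_assoc]
      rfl)
  refine ⟨β.flip, fun x y x' y' => ?_, fun P hP p q p' q' hp hq hp' hq' h u v => ?_⟩
  · rw [LinearMap.flip_apply, hβ]
    exact hρ (x ⊗ₜ y) x' y'
  · rw [mul_comm]
    exact hβb P hP v _ (apply_nonneg _ _) p q hp hq (key P hP p q p' q' hp' hq' h v) u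

end TensorExtension

/-! ### The completed tensor product of clct cdg-algebras -/

section CompletedTensor

variable {𝕜 : Type} [RCLike 𝕜]

/-- `ptmul` as a bilinear map. -/
noncomputable def ptm {E F : Type u} [AddCommGroup E] [Module 𝕜 E]
    [AddCommGroup F] [Module 𝕜 F] [UniformSpace E] [UniformSpace F] :
    E →ₗ[𝕜] F →ₗ[𝕜] ProjTensor 𝕜 E F :=
  LinearMap.mk₂ 𝕜 ptmul ptmul_add_left ptmul_smul_left ptmul_add_right ptmul_smul_right

/-- `gtmul` as a bilinear map. -/
noncomputable def gtm {E F : ℤ → Type u} [∀ i, AddCommGroup (E i)] [∀ i, Module 𝕜 (E i)]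
    [∀ i, UniformSpace (E i)] [∀ i, AddCommGroup (F i)] [∀ i, Module 𝕜 (F i)]
    [∀ i, UniformSpace (F i)] {a b n : ℤ} (h : a + b = n) : E a →ₗ[𝕜] F b →ₗ[𝕜] GTensor 𝕜 E F n :=
  ptm.compr₂ (LinearMap.single 𝕜 (fun p : {p : ℤ × ℤ // p.1 + p.2 = n} =>
    ProjTensor 𝕜 (E p.1.1) (F p.1.2)) ⟨(a, b), h⟩)

theorem gtm_eq {E F : ℤ → Type u} [∀ i, AddCommGroup (E i)] [∀ i, Module 𝕜 (E i)]
    [∀ i, UniformSpace (E i)] [∀ i, AddCommGroup (F i)] [∀ i, Module 𝕜 (F i)]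
    [∀ i, UniformSpace (F i)] {a b n : ℤ} (h : a + b = n) (x : E a) (y : F b) :
    gtm (𝕜 := 𝕜) h x y = gtmul h x y := rfl

theorem gtm_same {E F : ℤ → Type u} [∀ i, AddCommGroup (E i)] [∀ i, Module 𝕜 (E i)]
    [∀ i, UniformSpace (E i)] [∀ i, AddCommGroup (F i)] [∀ i, Module 𝕜 (F i)]
    [∀ i, UniformSpace (F i)] {a b n : ℤ} (h h' : a + b = n) (x : E a) (y : F b) :
    gtm (𝕜 := 𝕜) h x y ⟨(a, b), h'⟩ = ptmul x y :=
  Pi.single_eq_same _ _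

theorem gtm_ne {E F : ℤ → Type u} [∀ i, AddCommGroup (E i)] [∀ i, Module 𝕜 (E i)]
    [∀ i, UniformSpace (E i)] [∀ i, AddCommGroup (F i)] [∀ i, Module 𝕜 (F i)]
    [∀ i, UniformSpace (F i)] {a b n : ℤ} (h : a + b = n) (x : E a) (y : F b)
    {p : {p : ℤ × ℤ // p.1 + p.2 = n}} (hp : p.1 ≠ (a, b)) :
    gtm (𝕜 := 𝕜) h x y p = 0 :=
  Pi.single_eq_of_ne (fun e => hp (congrArg Subtype.val e)) _

variable (A B : CLCTAlg.{u} 𝕜)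

/-- The products `(A^a ⊗̂ B^b) × (A^(s-a) ⊗̂ B^(t-b)) → A^s ⊗̂ B^t`. -/
theorem exists_tensorMul (s t : ℤ) : ∃ m : ∀ k : ℤ × ℤ, ProjTensor 𝕜 (A.C k.1) (B.C k.2) →ₗ[𝕜]
      ProjTensor 𝕜 (A.C (s - k.1)) (B.C (t - k.2)) →ₗ[𝕜] ProjTensor 𝕜 (A.C s) (B.C t),
    (∀ k x y x' y', m k (ptmul x y) (ptmul x' y') = sgn 𝕜 (k.2 * (s - k.1)) •
      ptmul (A.mul (add_sub_cancel k.1 s) x x') (B.mul (add_sub_cancel k.2 t) y y')) ∧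
    FamBdd m := by
  classical
  have hA := (A.mul_cont s).famBdd
  have hB := (B.mul_cont t).famBdd
  let b : ∀ k : ℤ × ℤ, A.C k.1 →ₗ[𝕜] B.C k.2 →ₗ[𝕜] A.C (s - k.1) →ₗ[𝕜] B.C (t - k.2) →ₗ[𝕜]
      ProjTensor 𝕜 (A.C s) (B.C t) := fun k => LinearMap.mk₂ 𝕜
    (fun x y => sgn 𝕜 (k.2 * (s - k.1)) • ptm.compl₁₂ (A.mul (add_sub_cancel k.1 s) x)
      (B.mul (add_sub_cancel k.2 t) y))
    (fun x x' y => by ext; simp) (fun c x y => by ext; simp [smul_comm c])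
    (fun x y y' => by ext; simp) (fun c x y => by ext; simp [smul_comm c])
  have hbd : ∀ P : Seminorm 𝕜 (ProjTensor 𝕜 (A.C s) (B.C t)), Continuous P →
      ∃ (p : ∀ k : ℤ × ℤ, Seminorm 𝕜 (A.C k.1)) (q : ∀ k : ℤ × ℤ, Seminorm 𝕜 (B.C k.2))
        (p' : ∀ k : ℤ × ℤ, Seminorm 𝕜 (A.C (s - k.1)))
        (q' : ∀ k : ℤ × ℤ, Seminorm 𝕜 (B.C (t - k.2))),
        (∀ k, Continuous (p k)) ∧ (∀ k, Continuous (q k)) ∧ (∀ k, Continuous (p' k)) ∧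
        (∀ k, Continuous (q' k)) ∧ {k | ¬ (p k = 0 ∨ q k = 0)}.Finite ∧
        ∀ k x y x' y', P (b k x y x' y') ≤ p k x * q k y * (p' k x' * q' k y') := by
    intro P hP
    obtain ⟨f, g, hf, hg, hfg⟩ := seminorm_ptmul_le hP
    obtain ⟨p, p', hp, hp', hfin, hpb⟩ := hA f hf
    obtain ⟨q, q', hq, hq', hfin', hqb⟩ := hB g hg
    refine ⟨fun k => p ⟨(k.1, s - k.1), add_sub_cancel _ _⟩,
      fun k => q ⟨(k.2, t - k.2), add_sub_cancel _ _⟩,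
      fun k => p' ⟨(k.1, s - k.1), add_sub_cancel _ _⟩,
      fun k => q' ⟨(k.2, t - k.2), add_sub_cancel _ _⟩, fun k => hp _, fun k => hq _,
      fun k => hp' _, fun k => hq' _, ?_, fun k x y x' y' => ?_⟩
    · refine ((hfin.image fun k => k.1.1).prod (hfin'.image fun k => k.1.1)).subset fun k hk => ?_
      obtain ⟨h1, h2⟩ := not_or.1 hk
      exact ⟨⟨_, h1, rfl⟩, ⟨_, h2, rfl⟩⟩
    · have h1 := hpb ⟨(k.1, s - k.1), add_sub_cancel _ _⟩ x x'
      have h2 := hqb ⟨(k.2, t - k.2), add_sub_cancel _ _⟩ y y'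
      change P (sgn 𝕜 (k.2 * (s - k.1)) • ptmul _ _) ≤ _
      rw [map_smul_eq_mul]
      refine (mul_le_of_le_one_left (apply_nonneg _ _) (norm_sgn_le _)).trans ((hfg _ _).trans ?_)
      refine (mul_le_mul h1 h2 (apply_nonneg _ _) (by positivity)).trans (le_of_eq ?_)
      ring
  have hex := fun k => exists_lift₄ (b k) fun P hP => by
    obtain ⟨p, q, p', q', hp, hq, hp', hq', -, h⟩ := hbd P hP
    exact ⟨p k, q k, p' k, q' k, hp k, hq k, hp' k, hq' k, h k⟩
  choose m hm hmb using hex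
  refine ⟨m, fun k x y x' y' => hm k x y x' y', fun P hP => ?_⟩
  obtain ⟨p, q, p', q', hp, hq, hp', hq', hfin, h⟩ := hbd P hP
  refine ⟨fun k => projS (hp k) (hq k), fun k => projS (hp' k) (hq' k),
    fun k => continuous_projS _ _, fun k => continuous_projS _ _, hfin.subset fun k hk hc => ?_,
    fun k => hmb k P hP _ _ _ _ (hp k) (hq k) (hp' k) (hq' k) (h k)⟩
  exact hk (projS_eq_zero _ _ hc)

/-- The `(s, t)`-component of the product, as a bilinear map on the total spaces. -/
theorem exists_tensorSum (s t : ℤ) : ∃ β : (∀ k : ℤ × ℤ, ProjTensor 𝕜 (A.C k.1) (B.C k.2)) →ₗ[𝕜]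
      (∀ k : ℤ × ℤ, ProjTensor 𝕜 (A.C (s - k.1)) (B.C (t - k.2))) →ₗ[𝕜]
        ProjTensor 𝕜 (A.C s) (B.C t),
    (∀ (k : ℤ × ℤ) x y w w', (∀ j, j ≠ k → w j = 0) → w k = ptmul x y →
      (w' k = 0 → β w w' = 0) ∧ ∀ x' y', w' k = ptmul x' y' →
      β w w' = sgn 𝕜 (k.2 * (s - k.1)) •
      ptmul (A.mul (add_sub_cancel k.1 s) x x') (B.mul (add_sub_cancel k.2 t) y y')) ∧
    ∀ P : Seminorm 𝕜 (ProjTensor 𝕜 (A.C s) (B.C t)), Continuous P →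
      ∃ (N : Seminorm 𝕜 (∀ k : ℤ × ℤ, ProjTensor 𝕜 (A.C k.1) (B.C k.2)))
        (N' : Seminorm 𝕜 (∀ k : ℤ × ℤ, ProjTensor 𝕜 (A.C (s - k.1)) (B.C (t - k.2)))),
        Continuous N ∧ Continuous N' ∧ ∀ x y, P (β x y) ≤ N x * N' y := by
  obtain ⟨m, hm, hbd⟩ := exists_tensorMul A B s t
  obtain ⟨β, hβ, hb⟩ := hbd.exists_sum
  refine ⟨β, fun k x y w w' hw hk => ?_, hb⟩
  have h1 : β w w' = m k (w k) (w' k) :=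
    (hβ w w').unique (hasSum_single k fun j hj => by rw [hw j hj]; simp)
  refine ⟨fun h0 => by rw [h1, h0, map_zero], fun x' y' h2 => ?_⟩
  rw [h1, hk, h2, hm]

/-- The `(s, t)`-component of the product, as a bilinear map on the total spaces. -/
noncomputable def tensorSum (s t : ℤ) : (∀ k : ℤ × ℤ, ProjTensor 𝕜 (A.C k.1) (B.C k.2)) →ₗ[𝕜]
      (∀ k : ℤ × ℤ, ProjTensor 𝕜 (A.C (s - k.1)) (B.C (t - k.2))) →ₗ[𝕜]
        ProjTensor 𝕜 (A.C s) (B.C t) :=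
  (exists_tensorSum A B s t).choose

/-- Extension by zero of an element of degree `i`. -/
noncomputable def tensorEmb (i : ℤ) : GTensor 𝕜 A.C B.C i →L[𝕜]
    (∀ k : ℤ × ℤ, ProjTensor 𝕜 (A.C k.1) (B.C k.2)) :=
  ContinuousLinearMap.pi fun k =>
    if h : k.1 + k.2 = i then ContinuousLinearMap.proj (⟨k, h⟩ : {p : ℤ × ℤ // p.1 + p.2 = i}) else 0

/-- Extension by zero of an element of degree `j`, with the complementary indexing. -/
noncomputable def tensorEmb' (s t j : ℤ) : GTensor 𝕜 A.C B.C j →L[𝕜]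
    (∀ k : ℤ × ℤ, ProjTensor 𝕜 (A.C (s - k.1)) (B.C (t - k.2))) :=
  ContinuousLinearMap.pi fun k =>
    if h : (s - k.1) + (t - k.2) = j then
      ContinuousLinearMap.proj (⟨(s - k.1, t - k.2), h⟩ : {p : ℤ × ℤ // p.1 + p.2 = j}) else 0

/-- The product of the completed tensor product. -/
noncomputable def tensorMul (i j n : ℤ) :
    GTensor 𝕜 A.C B.C i →ₗ[𝕜] GTensor 𝕜 A.C B.C j →ₗ[𝕜] GTensor 𝕜 A.C B.C n :=
  LinearMap.mk₂ 𝕜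
    (fun u v γ => tensorSum A B γ.1.1 γ.1.2 (tensorEmb A B i u) (tensorEmb' A B γ.1.1 γ.1.2 j v))
    (by intros; ext; simp) (by intros; ext; simp) (by intros; ext; simp) (by intros; ext; simp)

theorem tensorMul_apply (i j n : ℤ) (u : GTensor 𝕜 A.C B.C i) (v : GTensor 𝕜 A.C B.C j)
    (γ : {p : ℤ × ℤ // p.1 + p.2 = n}) : tensorMul A B i j n u v γ =
      tensorSum A B γ.1.1 γ.1.2 (tensorEmb A B i u) (tensorEmb' A B γ.1.1 γ.1.2 j v) := rfl

theorem continuous_of_pure_bound {E G : Type*} [AddCommGroup E] [Module 𝕜 E]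
    [TopologicalSpace E] [IsTopologicalAddGroup E] [AddCommGroup G] [Module 𝕜 G]
    [UniformSpace G] [CompleteLC 𝕜 G] (f : E →ₗ[𝕜] G)
    (h : ∀ P : Seminorm 𝕜 G, Continuous P → ∃ (c : ℝ) (Q : Seminorm 𝕜 E), 0 ≤ c ∧ Continuous Q ∧
      ∀ x, P (f x) ≤ c * Q x) : Continuous f :=
  continuous_of_seminorm f fun P hP => by
    obtain ⟨c, Q, hc, hQ, hb⟩ := h P hP
    let c' : NNReal := ⟨c, hc⟩
    exact ⟨c' • Q, hQ.const_smul _, hb⟩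

theorem continuous_tensorMul (i j n : ℤ) (u : GTensor 𝕜 A.C B.C i) :
    Continuous (tensorMul A B i j n u) := by
  refine continuous_pi fun γ => ?_
  have hβ := (exists_tensorSum A B γ.1.1 γ.1.2).choose_spec.2
  exact continuous_of_pure_bound
    (LinearMap.proj γ ∘ₗ tensorMul A B i j n u) fun P hP => by
    obtain ⟨N, N', hN, hN', hb⟩ := hβ P hP
    exact ⟨N (tensorEmb A B i u), N'.comp (tensorEmb' A B γ.1.1 γ.1.2 j).toLinearMap,
      apply_nonneg _ _, hN'.comp (tensorEmb' A B γ.1.1 γ.1.2 j).continuous, fun x => hb _ _⟩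

theorem continuous_tensorMul_flip (i j n : ℤ) (v : GTensor 𝕜 A.C B.C j) :
    Continuous ((tensorMul A B i j n).flip v) := by
  refine continuous_pi fun γ => ?_
  have hβ := (exists_tensorSum A B γ.1.1 γ.1.2).choose_spec.2
  exact continuous_of_pure_bound
    (LinearMap.proj γ ∘ₗ (tensorMul A B i j n).flip v) fun P hP => by
    obtain ⟨N, N', hN, hN', hb⟩ := hβ P hP
    refine ⟨N' (tensorEmb' A B γ.1.1 γ.1.2 j v), N.comp (tensorEmb A B i).toLinearMap,
      apply_nonneg _ _, hN.comp (tensorEmb A B i).continuous, fun x => ?_⟩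
    rw [mul_comm]
    exact hb _ _

theorem tensorMul_extends (n : ℤ) : ExtendsToTensor (E := GTensor 𝕜 A.C B.C)
    (F := GTensor 𝕜 A.C B.C) (G := GTensor 𝕜 A.C B.C n) (n := n)
    fun p => tensorMul A B p.1.1 p.1.2 n := by
  refine FamBdd.extendsToTensor (FamBdd.pi fun γ P hP => ?_)
  have hβ := (exists_tensorSum A B γ.1.1 γ.1.2).choose_spec.2
  obtain ⟨N, N', hN, hN', hb⟩ := hβ P hP
  obtain ⟨T, hT⟩ := exists_finset_of_seminorm hN
  refine ⟨fun p => N.comp (tensorEmb A B p.1.1).toLinearMap,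
    fun p => N'.comp (tensorEmb' A B γ.1.1 γ.1.2 p.1.2).toLinearMap,
    fun p => hN.comp (tensorEmb A B p.1.1).continuous,
    fun p => hN'.comp (tensorEmb' A B γ.1.1 γ.1.2 p.1.2).continuous, ?_, fun p x y => hb _ _⟩
  refine Set.Finite.subset (Set.Finite.preimage (f := fun p : {p : ℤ × ℤ // p.1 + p.2 = n} => p.1.1)
    (fun p _ q _ h => ?_) (T.finite_toSet.image fun k => k.1 + k.2)) fun p hp => ?_
  · have h1 : p.1.1 = q.1.1 := h
    have h2 := p.2
    have h3 := q.2
    exact Subtype.ext (Prod.ext h1 (by omega))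
  · by_contra hc
    refine hp (Seminorm.ext fun x => hT _ fun k hk => ?_)
    have : ¬ k.1 + k.2 = p.1.1 := fun h => hc ⟨k, hk, h⟩
    simp [tensorEmb, this]

theorem tensorEmb_gtm {a b i : ℤ} (h : a + b = i) (x : A.C a) (y : B.C b) :
    (∀ k, k ≠ (a, b) → tensorEmb A B i (gtm h x y) k = 0) ∧
      tensorEmb A B i (gtm h x y) (a, b) = ptmul x y := by
  refine ⟨fun k hk => ?_, ?_⟩
  · by_cases hki : k.1 + k.2 = i
    · simp only [tensorEmb, ContinuousLinearMap.coe_pi', dif_pos hki, ContinuousLinearMap.proj_apply]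
      exact gtm_ne h x y hk
    · simp [tensorEmb, hki]
  · simp only [tensorEmb, ContinuousLinearMap.coe_pi', dif_pos h, ContinuousLinearMap.proj_apply]
    exact gtm_same h h x y

theorem tensorMul_gtm {a b i a' b' j n s t : ℤ} (hi : a + b = i) (hj : a' + b' = j)
    (hs : a + a' = s) (ht : b + b' = t) (hst : s + t = n) (x : A.C a) (y : B.C b)
    (x' : A.C a') (y' : B.C b') :
    tensorMul A B i j n (gtm hi x y) (gtm hj x' y') =
      sgn 𝕜 (b * a') • gtm hst (A.mul hs x x') (B.mul ht y y') := by
  obtain ⟨h0, h1⟩ := tensorEmb_gtm A B hi x y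
  funext γ
  have hβ := (exists_tensorSum A B γ.1.1 γ.1.2).choose_spec.1 (a, b) x y _
    (tensorEmb' A B γ.1.1 γ.1.2 j (gtm hj x' y')) h0 h1
  rw [tensorMul_apply]
  by_cases hγ : γ.1 = (s, t)
  · obtain ⟨⟨s', t'⟩, hst'⟩ := γ
    obtain ⟨rfl, rfl⟩ := Prod.mk.inj hγ
    obtain rfl : a' = s' - a := by omega
    obtain rfl : b' = t' - b := by omega
    refine (hβ.2 x' y' ?_).trans ?_
    · simp only [tensorEmb', ContinuousLinearMap.coe_pi', dif_pos hj,
        ContinuousLinearMap.proj_apply]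
      exact gtm_same hj hj x' y'
    · refine congrArg _ ?_
      exact (gtm_same hst hst _ _).symm
  · refine (hβ.1 ?_).trans ?_
    · by_cases hj' : (γ.1.1 - a) + (γ.1.2 - b) = j
      · simp only [tensorEmb', ContinuousLinearMap.coe_pi', dif_pos hj',
          ContinuousLinearMap.proj_apply]
        refine gtm_ne hj x' y' fun e => hγ ?_
        have e1 : γ.1.1 - a = a' := congrArg Prod.fst e
        have e2 : γ.1.2 - b = b' := congrArg Prod.snd e
        exact Prod.ext (by simp only; omega) (by simp only; omega)
      · simp [tensorEmb', hj']
    · rw [Pi.smul_apply, gtm_ne hst _ _ hγ, smul_zero]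



/-- The map `x ⊗ y ↦ f x ⊗ g y` on completed tensor products. -/
theorem exists_projMap {E F E' F' : Type u} [AddCommGroup E] [Module 𝕜 E]
    [AddCommGroup F] [Module 𝕜 F] [UniformSpace E] [UniformSpace F]
    [AddCommGroup E'] [Module 𝕜 E'] [AddCommGroup F'] [Module 𝕜 F'] [UniformSpace E']
    [UniformSpace F'] (f : E →L[𝕜] E') (g : F →L[𝕜] F') :
    ∃ Φ : ProjTensor 𝕜 E F →L[𝕜] ProjTensor 𝕜 E' F', ∀ x y, Φ (ptmul x y) = ptmul (f x) (g y) :=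
  exists_lift (ptm.compl₁₂ f.toLinearMap g.toLinearMap) fun P hP => by
    obtain ⟨p, q, hp, hq, h⟩ := seminorm_ptmul_le hP
    exact ⟨p.comp f.toLinearMap, q.comp g.toLinearMap, hp.comp f.continuous,
      hq.comp g.continuous, fun x y => h _ _⟩

/-- The map `x ⊗ y ↦ f x ⊗ g y` on completed tensor products. -/
noncomputable def projMap {E F E' F' : Type u} [AddCommGroup E] [Module 𝕜 E]
    [AddCommGroup F] [Module 𝕜 F] [UniformSpace E] [UniformSpace F]
    [AddCommGroup E'] [Module 𝕜 E'] [AddCommGroup F'] [Module 𝕜 F'] [UniformSpace E']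
    [UniformSpace F'] (f : E →L[𝕜] E') (g : F →L[𝕜] F') :
    ProjTensor 𝕜 E F →L[𝕜] ProjTensor 𝕜 E' F' :=
  (exists_projMap f g).choose

theorem projMap_ptmul {E F E' F' : Type u} [AddCommGroup E] [Module 𝕜 E]
    [AddCommGroup F] [Module 𝕜 F] [UniformSpace E] [UniformSpace F]
    [AddCommGroup E'] [Module 𝕜 E'] [AddCommGroup F'] [Module 𝕜 F'] [UniformSpace E']
    [UniformSpace F'] (f : E →L[𝕜] E') (g : F →L[𝕜] F') (x : E) (y : F) :
    projMap f g (ptmul x y) = ptmul (f x) (g y) :=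
  (exists_projMap f g).choose_spec x y

/-- The derivation of a clct cdg-algebra as a continuous linear map. -/
def CLCTAlg.dL (A : CLCTAlg.{u} 𝕜) {i j : ℤ} (h : i + 1 = j) : A.C i →L[𝕜] A.C j :=
  ⟨A.d h, A.d_cont h⟩

/-- `d ⊗ 1`. -/
noncomputable def tensorD₁ {i j : ℤ} (h : i + 1 = j) :
    GTensor 𝕜 A.C B.C i →L[𝕜] GTensor 𝕜 A.C B.C j :=
  ContinuousLinearMap.pi fun γ =>
    (projMap (A.dL (sub_add_cancel γ.1.1 1)) (ContinuousLinearMap.id 𝕜 (B.C γ.1.2))).comp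
      (ContinuousLinearMap.proj (⟨(γ.1.1 - 1, γ.1.2), by have := γ.2; omega⟩ :
        {p : ℤ × ℤ // p.1 + p.2 = i}))

/-- `1 ⊗ d`, with the Koszul sign. -/
noncomputable def tensorD₂ {i j : ℤ} (h : i + 1 = j) :
    GTensor 𝕜 A.C B.C i →L[𝕜] GTensor 𝕜 A.C B.C j :=
  ContinuousLinearMap.pi fun γ => sgn 𝕜 γ.1.1 •
    (projMap (ContinuousLinearMap.id 𝕜 (A.C γ.1.1)) (B.dL (sub_add_cancel γ.1.2 1))).comp
      (ContinuousLinearMap.proj (⟨(γ.1.1, γ.1.2 - 1), by have := γ.2; omega⟩ :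
        {p : ℤ × ℤ // p.1 + p.2 = i}))

theorem tensorD₁_apply {i j : ℤ} (h : i + 1 = j) (u : GTensor 𝕜 A.C B.C i)
    (γ : {p : ℤ × ℤ // p.1 + p.2 = j}) : tensorD₁ A B h u γ =
      projMap (A.dL (sub_add_cancel γ.1.1 1)) (ContinuousLinearMap.id 𝕜 (B.C γ.1.2))
        (u ⟨(γ.1.1 - 1, γ.1.2), by have := γ.2; omega⟩) := rfl

theorem tensorD₂_apply {i j : ℤ} (h : i + 1 = j) (u : GTensor 𝕜 A.C B.C i)
    (γ : {p : ℤ × ℤ // p.1 + p.2 = j}) : tensorD₂ A B h u γ = sgn 𝕜 γ.1.1 •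
      projMap (ContinuousLinearMap.id 𝕜 (A.C γ.1.1)) (B.dL (sub_add_cancel γ.1.2 1))
        (u ⟨(γ.1.1, γ.1.2 - 1), by have := γ.2; omega⟩) := rfl

theorem tensorD₁_gtm {a b i j a' : ℤ} (hi : a + b = i) (h : i + 1 = j) (ha : a + 1 = a')
    (h₁ : a' + b = j) (x : A.C a) (y : B.C b) :
    tensorD₁ A B h (gtm hi x y) = gtm h₁ (A.d ha x) y := by
  obtain rfl : a = a' - 1 := by omega
  funext γ
  by_cases hγ : γ.1 = (a', b)
  · obtain ⟨⟨s, t⟩, hst⟩ := γ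
    obtain ⟨rfl, rfl⟩ := Prod.mk.inj hγ
    rw [gtm_same h₁ hst]
    refine (congrArg _ (gtm_same hi _ x y)).trans ?_
    exact projMap_ptmul _ _ _ _
  · rw [gtm_ne h₁ _ _ hγ]
    rw [tensorD₁_apply, gtm_ne hi x y, map_zero]
    intro e
    have e1 : γ.1.1 - 1 = a' - 1 := congrArg Prod.fst e
    have e2 : γ.1.2 = b := congrArg Prod.snd e
    exact hγ (Prod.ext (by simp only; omega) e2)

theorem tensorD₂_gtm {a b i j b' : ℤ} (hi : a + b = i) (h : i + 1 = j) (hb : b + 1 = b')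
    (h₂ : a + b' = j) (x : A.C a) (y : B.C b) :
    tensorD₂ A B h (gtm hi x y) = sgn 𝕜 a • gtm h₂ x (B.d hb y) := by
  obtain rfl : b = b' - 1 := by omega
  funext γ
  by_cases hγ : γ.1 = (a, b')
  · obtain ⟨⟨s, t⟩, hst⟩ := γ
    obtain ⟨rfl, rfl⟩ := Prod.mk.inj hγ
    rw [Pi.smul_apply, gtm_same h₂ hst, tensorD₂_apply]
    refine congrArg _ ?_
    refine (congrArg _ (gtm_same hi _ x y)).trans ?_
    exact projMap_ptmul _ _ _ _
  · rw [Pi.smul_apply, gtm_ne h₂ _ _ hγ, smul_zero]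
    rw [tensorD₂_apply, gtm_ne hi x y, map_zero, smul_zero]
    intro e
    have e1 : γ.1.1 = a := congrArg Prod.fst e
    have e2 : γ.1.2 - 1 = b' - 1 := congrArg Prod.snd e
    exact hγ (Prod.ext e1 (by simp only; omega))

/-- The continuous maps among the linear maps. -/
def contMaps (𝕜 : Type) [RCLike 𝕜] (E F : Type*) [AddCommGroup E] [Module 𝕜 E]
    [TopologicalSpace E] [AddCommGroup F] [Module 𝕜 F] [UniformSpace F] [CompleteLC 𝕜 F] :
    Submodule 𝕜 (E →ₗ[𝕜] F) where
  carrier := {f | Continuous f}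
  zero_mem' := continuous_const
  add_mem' hf hg := hf.add hg
  smul_mem' c _ hf := hf.const_smul c

theorem contMaps_comp {E F G : Type*} [AddCommGroup E] [Module 𝕜 E] [TopologicalSpace E]
    [AddCommGroup F] [Module 𝕜 F] [UniformSpace F] [CompleteLC 𝕜 F] [AddCommGroup G] [Module 𝕜 G]
    [UniformSpace G] [CompleteLC 𝕜 G] {g : F →ₗ[𝕜] G} {f : E →ₗ[𝕜] F} (hg : g ∈ contMaps 𝕜 F G)
    (hf : f ∈ contMaps 𝕜 E F) : g ∘ₗ f ∈ contMaps 𝕜 E G := by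
  have hg' : Continuous g := hg
  have hf' : Continuous f := hf
  exact hg'.comp hf'

/-- The completed tensor product of two clct cdg-algebras. -/
noncomputable def CLCTAlg.tensorData : TensorData A.toCDGAlg B.toCDGAlg where
  T := GTensor 𝕜 A.C B.C
  tm h := gtm h
  good i j := contMaps 𝕜 (GTensor 𝕜 A.C B.C i) (GTensor 𝕜 A.C B.C j)
  good_id _ := continuous_id
  good_comp hg hf := contMaps_comp hg hf
  ext {i j f g} hf hg h := by
    have : (⟨f, hf⟩ : GTensor 𝕜 A.C B.C i →L[𝕜] GTensor 𝕜 A.C B.C j) = ⟨g, hg⟩ :=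
      GTensor.hom_ext fun h' x y => h h' x y
    exact congrArg ContinuousLinearMap.toLinearMap this
  mul {i j n} _ := tensorMul A B i j n
  mul_good _ u := continuous_tensorMul A B _ _ _ u
  mul_flip_good _ v := continuous_tensorMul_flip A B _ _ _ v
  mul_tm hi hj h hs ht hst x y x' y' := tensorMul_gtm A B hi hj hs ht hst x y x' y'
  d h := (tensorD₁ A B h + tensorD₂ A B h).toLinearMap
  d_good h := (tensorD₁ A B h + tensorD₂ A B h).continuous
  d_tm hi h ha hb h₁ h₂ x y :=
    congrArg₂ (· + ·) (tensorD₁_gtm A B hi h ha h₁ x y) (tensorD₂_gtm A B hi h hb h₂ x y)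

/-- The uniform structure of `A ⊗̂ B`. -/
noncomputable abbrev gtensorUnif (i : ℤ) : UniformSpace (GTensor 𝕜 A.C B.C i) := inferInstance

theorem gtensor_clc (i : ℤ) : @CompleteLC 𝕜 _ (GTensor 𝕜 A.C B.C i) _ _ (gtensorUnif A B i) :=
  inferInstanceAs (CompleteLC 𝕜 (GTensor 𝕜 A.C B.C i))

/-- The completed tensor product `A ⊗̂ B` of two clct cdg-algebras. -/
noncomputable def CLCTAlg.tensor : CLCTAlg.{u} 𝕜 where
  toCDGAlg := (A.tensorData B).toCDGAlg
  unif := gtensorUnif A B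
  clc := gtensor_clc A B
  mul_cont n := tensorMul_extends A B n
  d_cont h := (tensorD₁ A B h + tensorD₂ A B h).continuous

/-- The enveloping algebra `A^e = Aᵒᵖ ⊗̂ A`. -/
noncomputable def CLCTAlg.env : CLCTAlg.{u} 𝕜 := A.op.tensor A



/-- The maps `A^(n-a-b) × (A^a ⊗̂ A^b) → A^n`, `(z, x ⊗ y) ↦ (-1)^(|z||x|) x z y`. -/
theorem exists_diagMul (n : ℤ) : ∃ m : ∀ k : ℤ × ℤ, A.C (n - k.1 - k.2) →ₗ[𝕜]
      ProjTensor 𝕜 (A.C k.1) (A.C k.2) →ₗ[𝕜] A.C n,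
    (∀ k z x y, m k z (ptmul x y) = sgn 𝕜 ((n - k.1 - k.2) * k.1) •
      A.mul (sub_add_cancel n k.2) (A.mul (by omega : k.1 + (n - k.1 - k.2) = n - k.2) x z) y) ∧
    FamBdd m := by
  classical
  let r : ∀ k : ℤ × ℤ, A.C (n - k.1 - k.2) →ₗ[𝕜] A.C k.1 →ₗ[𝕜] A.C k.2 →ₗ[𝕜] A.C n := fun k =>
    LinearMap.mk₂ 𝕜 (fun z x => sgn 𝕜 ((n - k.1 - k.2) * k.1) • A.mul (sub_add_cancel n k.2)
      (A.mul (by omega : k.1 + (n - k.1 - k.2) = n - k.2) x z))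
    (fun x x' y => by simp) (fun c x y => by simp [smul_comm c])
    (fun x y y' => by simp) (fun c x y => by simp [smul_comm c])
  have hbd : ∀ P : Seminorm 𝕜 (A.C n), Continuous P →
      ∃ (f : ∀ k : ℤ × ℤ, Seminorm 𝕜 (A.C (n - k.1 - k.2)))
        (p : ∀ k : ℤ × ℤ, Seminorm 𝕜 (A.C k.1)) (q : ∀ k : ℤ × ℤ, Seminorm 𝕜 (A.C k.2)),
        (∀ k, Continuous (f k)) ∧ (∀ k, Continuous (p k)) ∧ (∀ k, Continuous (q k)) ∧
        {k | f k ≠ 0}.Finite ∧ ∀ k z x y, P (r k z x y) ≤ f k z * (p k x * q k y) := by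
    intro P hP
    obtain ⟨g, q, hg, hq, hfin, hgq⟩ := (A.mul_cont n).famBdd P hP
    choose p f hp hf hfin' hpf using fun b : ℤ =>
      (A.mul_cont (n - b)).famBdd (g ⟨(n - b, b), sub_add_cancel n b⟩) (hg _)
    let S : Set (ℤ × ℤ) := {k | g ⟨(n - k.2, k.2), sub_add_cancel n k.2⟩ ≠ 0 ∧
      p k.2 ⟨(k.1, n - k.1 - k.2), by simp only; omega⟩ ≠ 0}
    refine ⟨fun k => if k ∈ S then f k.2 ⟨(k.1, n - k.1 - k.2), by simp only; omega⟩ else 0,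
      fun k => p k.2 ⟨(k.1, n - k.1 - k.2), by simp only; omega⟩,
      fun k => q ⟨(n - k.2, k.2), sub_add_cancel n k.2⟩, fun k => ?_, fun k => hp _ _,
      fun k => hq _, ?_, fun k z x y => ?_⟩
    · dsimp only
      split_ifs
      · exact hf _ _
      · exact continuous_const
    · have hS : S.Finite := by
        refine Set.Finite.subset ((hfin.image fun k => k.1.2).biUnion fun b _ =>
          (((hfin' b).image fun k => k.1.1).prod (Set.finite_singleton b))) fun k hk => ?_
        refine Set.mem_biUnion (x := k.2) ⟨_, hk.1, rfl⟩ ⟨⟨_, hk.2, rfl⟩, rfl⟩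
      refine hS.subset fun k hk => ?_
      by_contra hc
      exact hk (if_neg hc)
    · change P (sgn 𝕜 _ • A.mul _ (A.mul _ x z) y) ≤ _
      rw [map_smul_eq_mul]
      refine (mul_le_of_le_one_left (apply_nonneg _ _) (norm_sgn_le _)).trans ?_
      have h1 := hgq ⟨(n - k.2, k.2), sub_add_cancel n k.2⟩
        (A.mul (by omega : k.1 + (n - k.1 - k.2) = n - k.2) x z) y
      have h2 := hpf k.2 ⟨(k.1, n - k.1 - k.2), by simp only; omega⟩ x z
      refine h1.trans ?_
      beta_reduce at h2 ⊢
      have h3 := apply_nonneg (q ⟨(n - k.2, k.2), sub_add_cancel n k.2⟩) y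
      by_cases hk : k ∈ S
      · rw [if_pos hk]
        refine (mul_le_mul_of_nonneg_right h2 h3).trans (le_of_eq ?_)
        ring
      · rw [if_neg hk]
        refine le_of_eq ?_
        rw [Seminorm.zero_apply, zero_mul]
        by_cases h0 : g ⟨(n - k.2, k.2), sub_add_cancel n k.2⟩ = 0
        · rw [h0, Seminorm.zero_apply, zero_mul]
        · have h4 : p k.2 ⟨(k.1, n - k.1 - k.2), by simp only; omega⟩ = 0 := by
            by_contra hc
            exact hk ⟨h0, hc⟩
          rw [h4, Seminorm.zero_apply, zero_mul] at h2
          rw [le_antisymm h2 (apply_nonneg _ _), zero_mul]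
  have hex := fun k => exists_lift₂ (r k) fun z P hP => by
    obtain ⟨f, p, q, hf, hp, hq, -, h⟩ := hbd P hP
    let c : NNReal := ⟨f k z, apply_nonneg _ _⟩
    refine ⟨c • p k, q k, (hp k).const_smul _, hq k, fun x y => (h k z x y).trans (le_of_eq ?_)⟩
    rw [← mul_assoc]
    rfl
  choose m hm hmb using hex
  refine ⟨m, fun k z x y => hm k z x y, fun P hP => ?_⟩
  obtain ⟨f, p, q, hf, hp, hq, hfin, h⟩ := hbd P hP
  exact ⟨f, fun k => projS (hp k) (hq k), hf, fun k => continuous_projS _ _, hfin,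
    fun k z u => hmb k P hP z (f k z) (apply_nonneg _ _) (p k) (q k) (hp k) (hq k) (h k z) u⟩

/-- The action of `A^e` on `A`, as a bilinear map on the total spaces. -/
theorem exists_diagSum (n : ℤ) : ∃ β : (∀ k : ℤ × ℤ, A.C (n - k.1 - k.2)) →ₗ[𝕜]
      (∀ k : ℤ × ℤ, ProjTensor 𝕜 (A.C k.1) (A.C k.2)) →ₗ[𝕜] A.C n,
    (∀ (k : ℤ × ℤ) x y w w', (∀ j, j ≠ k → w' j = 0) → w' k = ptmul x y →
      β w w' = sgn 𝕜 ((n - k.1 - k.2) * k.1) • A.mul (sub_add_cancel n k.2)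
        (A.mul (by omega : k.1 + (n - k.1 - k.2) = n - k.2) x (w k)) y) ∧
    ∀ P : Seminorm 𝕜 (A.C n), Continuous P →
      ∃ (N : Seminorm 𝕜 (∀ k : ℤ × ℤ, A.C (n - k.1 - k.2)))
        (N' : Seminorm 𝕜 (∀ k : ℤ × ℤ, ProjTensor 𝕜 (A.C k.1) (A.C k.2))),
        Continuous N ∧ Continuous N' ∧ ∀ x y, P (β x y) ≤ N x * N' y := by
  obtain ⟨m, hm, hbd⟩ := exists_diagMul A n
  obtain ⟨β, hβ, hb⟩ := hbd.exists_sum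
  refine ⟨β, fun k x y w w' hw hk => ?_, hb⟩
  have h1 : β w w' = m k (w k) (w' k) :=
    (hβ w w').unique (hasSum_single k fun j hj => by rw [hw j hj]; simp)
  rw [h1, hk, hm]

/-- The action of `A^e` on `A`, as a bilinear map on the total spaces. -/
noncomputable def diagSum (n : ℤ) : (∀ k : ℤ × ℤ, A.C (n - k.1 - k.2)) →ₗ[𝕜]
      (∀ k : ℤ × ℤ, ProjTensor 𝕜 (A.C k.1) (A.C k.2)) →ₗ[𝕜] A.C n :=
  (exists_diagSum A n).choose

/-- The homogeneous element `z` of degree `i`, extended by zero. -/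
noncomputable def diagEmb (i n : ℤ) : A.C i →L[𝕜] (∀ k : ℤ × ℤ, A.C (n - k.1 - k.2)) :=
  ContinuousLinearMap.pi fun k =>
    (ContinuousLinearMap.proj (n - k.1 - k.2)).comp (ContinuousLinearMap.single 𝕜 A.C i)

/-- The action of `A^e` on `A`. -/
noncomputable def diagMul (i j n : ℤ) : A.C i →ₗ[𝕜] GTensor 𝕜 A.C A.C j →ₗ[𝕜] A.C n :=
  (diagSum A n).compl₁₂ (diagEmb A i n).toLinearMap (tensorEmb A A j).toLinearMap

theorem diagMul_gtm {i j n a b s : ℤ} (h : i + j = n) (hab : a + b = j) (hs : a + i = s)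
    (hn : s + b = n) (z : A.C i) (x : A.C a) (y : A.C b) :
    diagMul A i j n z (gtm hab x y) = sgn 𝕜 (i * a) • A.mul hn (A.mul hs x z) y := by
  obtain ⟨h0, h1⟩ := tensorEmb_gtm A A hab x y
  obtain rfl : i = n - a - b := by omega
  obtain rfl : s = n - b := by omega
  have := (exists_diagSum A n).choose_spec.1 (a, b) x y (diagEmb A (n - a - b) n z) _ h0 h1
  refine this.trans ?_
  have h2 : diagEmb A (n - a - b) n z (a, b) = z := Pi.single_eq_same _ _
  rw [h2]

theorem continuous_diagMul (i j n : ℤ) (z : A.C i) : Continuous (diagMul A i j n z) :=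
  continuous_of_pure_bound _ fun P hP => by
    obtain ⟨N, N', hN, hN', hb⟩ := (exists_diagSum A n).choose_spec.2 P hP
    exact ⟨N (diagEmb A i n z), N'.comp (tensorEmb A A j).toLinearMap,
      apply_nonneg _ _, hN'.comp (tensorEmb A A j).continuous, fun x => hb _ _⟩

theorem continuous_diagMul_flip (i j n : ℤ) (u : GTensor 𝕜 A.C A.C j) :
    Continuous ((diagMul A i j n).flip u) :=
  continuous_of_pure_bound _ fun P hP => by
    obtain ⟨N, N', hN, hN', hb⟩ := (exists_diagSum A n).choose_spec.2 P hP
    refine ⟨N' (tensorEmb A A j u), N.comp (diagEmb A i n).toLinearMap,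
      apply_nonneg _ _, hN.comp (diagEmb A i n).continuous, fun x => ?_⟩
    rw [mul_comm]
    exact hb _ _

theorem diagMul_extends (n : ℤ) : ExtendsToTensor (E := A.C) (F := GTensor 𝕜 A.C A.C)
    (G := A.C n) (n := n) fun p => diagMul A p.1.1 p.1.2 n := by
  refine FamBdd.extendsToTensor fun P hP => ?_
  obtain ⟨N, N', hN, hN', hb⟩ := (exists_diagSum A n).choose_spec.2 P hP
  obtain ⟨T, hT⟩ := exists_finset_of_seminorm hN
  refine ⟨fun p => N.comp (diagEmb A p.1.1 n).toLinearMap,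
    fun p => N'.comp (tensorEmb A A p.1.2).toLinearMap,
    fun p => hN.comp (diagEmb A p.1.1 n).continuous,
    fun p => hN'.comp (tensorEmb A A p.1.2).continuous, ?_, fun p x y => hb _ _⟩
  refine Set.Finite.subset (Set.Finite.preimage (f := fun p : {p : ℤ × ℤ // p.1 + p.2 = n} => p.1.1)
    (fun p _ q _ h => ?_) (T.finite_toSet.image fun k => n - k.1 - k.2)) fun p hp => ?_
  · have h1 : p.1.1 = q.1.1 := h
    have h2 := p.2
    have h3 := q.2
    exact Subtype.ext (Prod.ext h1 (by omega))
  · by_contra hc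
    refine hp (Seminorm.ext fun x => hT _ fun k hk => ?_)
    have : n - k.1 - k.2 ≠ p.1.1 := fun h => hc ⟨k, hk, h⟩
    exact Pi.single_eq_of_ne this _

theorem continuous_diag_comp {i j k : ℤ} {g : GTensor 𝕜 A.op.C A.C j →ₗ[𝕜] A.C k}
    {f : GTensor 𝕜 A.op.C A.C i →ₗ[𝕜] GTensor 𝕜 A.op.C A.C j} (hg : Continuous g)
    (hf : Continuous f) : Continuous (g ∘ₗ f) :=
  hg.comp hf

/-- The action of `A^e` on `A`. -/
noncomputable def CLCTAlg.diagData : DiagData (A.op.tensorData A) where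
  good₁ i j := contMaps 𝕜 (GTensor 𝕜 A.op.C A.C i) (A.C j)
  good₂ i j := contMaps 𝕜 (A.C i) (A.C j)
  comp_good hg hf := continuous_diag_comp A hg hf
  good_comp {i j k _ _} hg hf := contMaps_comp (E := GTensor 𝕜 A.op.C A.C i)
    (F := A.C j) (G := A.C k) hg hf
  ext {i j f g} hf hg h := by
    have : (⟨f, hf⟩ : GTensor 𝕜 A.op.C A.C i →L[𝕜] A.C j) = ⟨g, hg⟩ :=
      GTensor.hom_ext fun h' x y => h h' x y
    exact congrArg ContinuousLinearMap.toLinearMap this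
  d_good h := A.d_cont h
  act {i j n} _ := diagMul A i j n
  act_good _ z := continuous_diagMul A _ _ _ z
  act_flip_good _ u := continuous_diagMul_flip A _ _ _ u
  act_tm h hab hs hn z x y := diagMul_gtm A h hab hs hn z x y

/-- The algebra `A` as a right module over `A^e = Aᵒᵖ ⊗̂ A`:
`a (x ⊗ y) = (-1)^(|a||x|) x a y`. -/
noncomputable def CLCTAlg.diag : CLCTMod.{u} A.env where
  toCDGMod := A.diagData.toCDGMod
  unif := A.unif
  clc := A.clc
  act_cont n := diagMul_extends A n
  d_cont := A.d_cont

end CompletedTensor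


section HochschildClasses

open CategoryTheory

variable {𝕜 : Type} [RCLike 𝕜] (A : CLCTAlg.{u} 𝕜)

/-- The components `A^i → A^(i+k)` of a closed morphism `A → A[k]` of modules over `Aᵒᵖ ⊗̂ A`. -/
noncomputable def CLCTAlg.diagApp {k : ℤ} (f : A.diag ⟶ A.diag.shift k) (i : ℤ) :
    A.C i →ₗ[𝕜] A.C (i + k) :=
  (CLCTMod.Hom.app f i).toLinearMap

variable {A}

theorem CLCTAlg.diagApp_act {k : ℤ} (f : A.diag ⟶ A.diag.shift k) {i j n a b : ℤ} (h : i + j = n)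
    (h' : i + k + j = n + k) (hab : a + b = j) (z : A.C i) (x : A.C a) (y : A.C b) :
    A.diagApp f n (A.diagAct h z (DTensor.tm hab x y)) =
      A.diagAct h' (A.diagApp f i z) (DTensor.tm hab x y) := by
  have h1 : A.diagApp f n (diagMul A i j n z (gtm hab x y)) =
      diagMul A (i + k) j (n + k) (A.diagApp f i z) (gtm hab x y) := CLCTMod.Hom.app_act f h z _
  rw [diagMul_gtm A h hab rfl (by omega), diagMul_gtm A h' hab rfl (by omega)] at h1
  rw [A.diagAct_tm h hab rfl (by omega), A.diagAct_tm h' hab rfl (by omega)]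
  exact h1

theorem CLCTAlg.diagApp_d {k : ℤ} (f : A.diag ⟶ A.diag.shift k) {i j : ℤ} (h : i + 1 = j)
    (h' : i + k + 1 = j + k) (x : A.C i) :
    A.diagApp f j (A.d h x) = sgn 𝕜 k • A.d h' (A.diagApp f i x) :=
  CLCTMod.Hom.app_d f h x

theorem eq_sgn_smul {E : Type*} [AddCommGroup E] [Module 𝕜 E] {k : ℤ} {x y : E}
    (h : x = sgn 𝕜 k • y) : y = sgn 𝕜 k • x := by
  rw [h, smul_smul, sgn_mul_sgn, one_smul]

variable (A)

/-- A closed morphism `A → A[k]` of modules over `Aᵒᵖ ⊗̂ A` as a map of degree `k` of modules over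
the algebraic enveloping algebra `Aᵒᵖ ⊗ A`. -/
noncomputable def CLCTAlg.diagHoms {k : ℤ} (f : A.diag ⟶ A.diag.shift k) :
    Homs A.discreteDiag.toGrMod A.discreteDiag.toGrMod k :=
  ⟨fun p => p.2 ▸ A.diagApp f p.1.1, by
    intro i j n i' n' h hi hn h' z u
    subst hi hn
    have key : A.diagApp f n ∘ₗ A.diagAct h z = A.diagAct h' (A.diagApp f i z) :=
      DTensor.hom_ext fun {a b} hab x y => CLCTAlg.diagApp_act f h h' hab z x y
    exact LinearMap.congr_fun key u⟩

theorem CLCTAlg.diagHoms_app {k : ℤ} (f : A.diag ⟶ A.diag.shift k) (i : ℤ) (x : A.C i) :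
    (A.diagHoms f).app (rfl : i + k = i + k) x = A.diagApp f i x := rfl

theorem CLCTAlg.diagHoms_closed {k : ℤ} (f : A.diag ⟶ A.diag.shift k) :
    homD A.discreteDiag A.discreteDiag rfl (A.diagHoms f) = 0 := by
  have h3 : ∀ {i j : ℤ} (h : i + 1 + k = j) (h' : i + k + 1 = j) (x : A.C i),
      A.d h' (A.diagApp f i x) = sgn 𝕜 k • (A.diagHoms f).app h (A.d rfl x) := by
    intro i j h h' x
    subst h
    have h1 : (A.diagHoms f).app rfl (A.d rfl x) = sgn 𝕜 k • A.d h' (A.diagApp f i x) :=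
      CLCTAlg.diagApp_d f rfl h' x
    exact eq_sgn_smul h1
  refine Subtype.ext (funext fun p => LinearMap.ext fun x => ?_)
  obtain ⟨⟨i, j⟩, h⟩ := p
  have h2 := homD_apply rfl (A.diagHoms f) h rfl (by omega) rfl (by omega) x
  exact h2.trans (sub_eq_zero.2 (h3 _ _ x))

end HochschildClasses

/-! ### The calculus of graded maps -/

section HomCalculus

variable {𝕜 : Type} [Field 𝕜] {A : CDGAlg.{u} 𝕜}

/-! Morphisms out of `M` in the localization can be computed with a map `P → M` whose cone is
contraacyclic, provided that `P` does not see contraacyclic modules: for contraacyclic `X` the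
complex of continuous `A`-linear maps `P → X` is acyclic (`CLCTMod.Orth`). Composition with the
localized morphisms is then bijective on homotopy classes of maps out of `P`, a Yoneda argument
(`bijective_map_of_colocal`) shows that localization does not change these classes, and morphisms `M
→ X` in the contraderived category become homotopy classes of closed continuous maps `P → X`
(`DCtr.bijective_precomp`). The orthogonality reduces, by induction over the generation of the
contraacyclic class, to the lifting of continuous `A`-linear maps out of `P` along linearly split
short exact sequences (`RelProjective.orth`).

The module `P` is the product totalization of a resolution `⋯ → B 1 → B 0 → M` by free cdg-modules
of countable dimension with the finest locally convex topology. Countability enters through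
`exists_le_mul`: a countable matrix of non-negative numbers is dominated by a product `α i * β j`.
Hence every bilinear map on spaces of countable dimension is jointly continuous for the finest
topologies (`exists_bilinear_bound`), so that the algebraic free resolution is a resolution by
complete modules, and its linear splittings are continuous.

The cone of `P → M` is contraacyclic for the following reason. The finite truncations of the
resolution are iterated cones, and each step changes the cone over `M` only by contraacyclic modules
(`SES.contraacyclic_coneDesc`). The product totalization is the limit of these truncations along
linearly split epimorphisms, and the sequence `0 → lim → ∏ → ∏ → 0` is short exact in the required
sense (`MLSystem.ses`). For the lifting property, a map out of `P` is lifted on the free generators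
of each `B n` through a continuous linear section. The lifts form a locally finite family, because a
continuous seminorm on a product ignores almost all factors and the action is jointly continuous
(`Tower.relProjective`).

The direct sum in the definition of Ext appears because a continuous map from the product `P` to a
discrete module depends on finitely many factors only (`Tower.exists_suppLT`), while every
`A`-linear map with this property is continuous (`Tower.cont_of_suppLT`). Continuous maps `P → N`
are therefore the direct sum totalization of the maps `B n → N`. Replacing this resolution by an
arbitrary one is pure algebra: the comparison maps and homotopies between product totalizations can
be chosen so that the `n`-th component of the value depends only on the components up to `n`, and
such maps preserve finite support (`Exact.exists_solution`, `GPResolution.exists_comparison`).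

For Hochschild cohomology, the same construction is applied over the completed enveloping algebra.
For discrete `A` of countable dimension this algebra is again discrete and of countable dimension,
and it coincides with the algebraic one (`GTensor.ofDTensor_bijective`). Restriction of scalars
along the isomorphism finishes the proof. -/

theorem sgn_zero : sgn 𝕜 0 = 1 := sgn_even Even.zero

theorem sgn_one : sgn 𝕜 1 = -1 := sgn_odd odd_one

theorem sgn_neg (n : ℤ) : sgn 𝕜 (-n) = sgn 𝕜 n := sgn_congr ⟨-n, by ring⟩

theorem sgn_sub (m n : ℤ) : sgn 𝕜 (m - n) = sgn 𝕜 m * sgn 𝕜 n := by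
  rw [sub_eq_add_neg, sgn_add, sgn_neg]

theorem sgn_ne_zero (n : ℤ) : sgn 𝕜 n ≠ 0 := fun h => by
  simpa [h] using sgn_mul_sgn (𝕜 := 𝕜) n

/-- The total space `∏ M^i`. -/
abbrev GrMod.Tot (M : GrMod.{u} A) : Type u := ∀ i, M.C i

namespace Homs

variable {K L M N : GrMod.{u} A} {k l m : ℤ}

theorem ext' {f g : Homs M N k} (h : ∀ {i j : ℤ} (h : i + k = j) (x : M.C i),
    f.app h x = g.app h x) : f = g :=
  Subtype.ext (funext fun p => LinearMap.ext fun x => h p.2 x)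

/-- An `A`-linear map of degree `k` as a map of total spaces. -/
def hat (f : Homs M N k) : M.Tot →ₗ[𝕜] N.Tot :=
  LinearMap.pi fun j => f.app (sub_add_cancel j k) ∘ₗ LinearMap.proj (j - k)

theorem hat_apply (f : Homs M N k) {i j : ℤ} (h : i + k = j) (x : M.Tot) :
    f.hat x j = f.app h (x i) := by
  obtain rfl : i = j - k := by omega
  rfl

theorem app_eq_hat (f : Homs M N k) {i j : ℤ} (h : i + k = j) (x : M.C i) :
    f.app h x = f.hat (Pi.single i x) j := by
  rw [hat_apply f h, Pi.single_eq_same]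

/-- Elements supported in one degree recover all components. Identities of graded maps can therefore
be checked on total spaces, where no equations between degrees occur in the terms. -/
theorem hat_inj {f g : Homs M N k} (h : ∀ x, f.hat x = g.hat x) : f = g :=
  ext' fun h' x => by rw [app_eq_hat, app_eq_hat, h]

@[simp] theorem hat_add (f g : Homs M N k) (x : M.Tot) : (f + g).hat x = f.hat x + g.hat x := rfl
@[simp] theorem hat_sub (f g : Homs M N k) (x : M.Tot) : (f - g).hat x = f.hat x - g.hat x := rfl
@[simp] theorem hat_neg (f : Homs M N k) (x : M.Tot) : (-f).hat x = -f.hat x := rfl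
@[simp] theorem hat_zero (x : M.Tot) : (0 : Homs M N k).hat x = 0 := rfl
@[simp] theorem hat_smul (c : 𝕜) (f : Homs M N k) (x : M.Tot) : (c • f).hat x = c • f.hat x := rfl

@[simp] theorem app_sub (f g : Homs M N k) {i j : ℤ} (h : i + k = j) (x : M.C i) :
    (f - g).app h x = f.app h x - g.app h x := rfl

/-- Construction of an `A`-linear map from its components. -/
def mk' (φ : ∀ {i j : ℤ}, i + k = j → (M.C i →ₗ[𝕜] N.C j))
    (h : ∀ {i j n i' n' : ℤ} (h : i + j = n) (hi : i + k = i') (hn : n + k = n') (h' : i' + j = n')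
      (x : M.C i) (a : A.C j), φ hn (M.act h x a) = N.act h' (φ hi x) a) : Homs M N k :=
  ⟨fun p => φ p.2, h⟩

/-- The identity. -/
def id (M : GrMod.{u} A) : Homs M M 0 :=
  mk' (fun {i j} h => ((add_zero i).symm.trans h) ▸ LinearMap.id) (by
    intro i j n i' n' h hi hn h' x a
    obtain rfl : i = i' := by omega
    obtain rfl : n = n' := by omega
    rfl)

@[simp] theorem id_hat (x : M.Tot) : (id M).hat x = x := by
  funext j
  rw [hat_apply _ (add_zero j)]
  rfl

/-- Composition of `A`-linear maps. -/
def comp (g : Homs M N l) (f : Homs L M k) (h : k + l = m) : Homs L N m :=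
  mk' (fun {i j} hij => g.app (by omega : i + k + l = j) ∘ₗ f.app rfl) (by
    intro i j n i' n' h₁ hi hn h' x a
    simp only [LinearMap.comp_apply]
    rw [f.app_act h₁ rfl rfl (by omega), g.app_act _ (by omega) _ h'])

theorem comp_app (g : Homs M N l) (f : Homs L M k) (h : k + l = m) {i a j : ℤ} (hij : i + m = j)
    (ha : i + k = a) (hj : a + l = j) (x : L.C i) :
    (comp g f h).app hij x = g.app hj (f.app ha x) := by
  subst ha
  rfl

@[simp] theorem comp_hat (g : Homs M N l) (f : Homs L M k) (h : k + l = m) (x : L.Tot) :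
    (comp g f h).hat x = g.hat (f.hat x) := by
  funext j
  rw [hat_apply _ (by omega : j - m + m = j), hat_apply _ (by omega : j - l + l = j),
    hat_apply _ (by omega : j - m + k = j - l), comp_app _ _ _ _ (by omega : j - m + k = j - l)]

theorem precomp_eq (f : Homs L M 0) (g : Homs M N k) (h : k = l) :
    precomp f N h g = comp g f (by omega : 0 + k = l) := by
  refine ext' fun {i j} hij x => ?_
  rw [comp_app _ _ _ _ (add_zero i) (by omega)]
  rfl

end Homs

namespace CDGMod

variable {L M N : CDGMod.{u} A} {k l m : ℤ}

/-- The differential on the total space. -/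
def dh (M : CDGMod.{u} A) : M.Tot →ₗ[𝕜] M.Tot :=
  LinearMap.pi fun j => M.d (sub_add_cancel j 1) ∘ₗ LinearMap.proj (j - 1)

theorem dh_apply (M : CDGMod.{u} A) {i j : ℤ} (h : i + 1 = j) (x : M.Tot) :
    M.dh x j = M.d h (x i) := by
  obtain rfl : i = j - 1 := by omega
  rfl

theorem hat_homD (h : k + 1 = l) (f : Homs M.toGrMod N.toGrMod k) (x : M.Tot) :
    (homD M N h f).hat x = N.dh (f.hat x) - sgn 𝕜 k • f.hat (M.dh x) := by
  funext j
  rw [Homs.hat_apply _ (by omega : j - l + l = j),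
    homD_apply h f _ (rfl : j - l + k = j - l + k) (by omega) (rfl : j - l + 1 = j - l + 1)
    (by omega), Pi.sub_apply, Pi.smul_apply, dh_apply _ (by omega : j - l + k + 1 = j),
    Homs.hat_apply f (rfl : j - l + k = j - l + k), Homs.hat_apply f (by omega : j - l + 1 + k = j),
    dh_apply _ (rfl : j - l + 1 = j - l + 1)]

/-- `f` is closed if and only if it commutes with the differentials. -/
theorem homD_eq_zero_iff (h : k + 1 = l) (f : Homs M.toGrMod N.toGrMod k) :
    homD M N h f = 0 ↔ ∀ x, N.dh (f.hat x) = sgn 𝕜 k • f.hat (M.dh x) := by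
  refine ⟨fun h0 x => ?_, fun h0 => Homs.hat_inj fun x => ?_⟩
  · have := hat_homD h f x
    rw [h0] at this
    exact (sub_eq_zero.1 this.symm)
  · rw [hat_homD, h0, sub_self]
    rfl

theorem dh_hat {h : k + 1 = l} {f : Homs M.toGrMod N.toGrMod k} (hf : homD M N h f = 0)
    (x : M.Tot) : N.dh (f.hat x) = sgn 𝕜 k • f.hat (M.dh x) :=
  (homD_eq_zero_iff h f).1 hf x

theorem hat_dh {h : k + 1 = l} {f : Homs M.toGrMod N.toGrMod k} (hf : homD M N h f = 0)
    (x : M.Tot) : f.hat (M.dh x) = sgn 𝕜 k • N.dh (f.hat x) := by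
  rw [dh_hat hf, smul_smul, sgn_mul_sgn, one_smul]

theorem dh_hat₀ {f : Homs M.toGrMod N.toGrMod 0} (hf : IsClosedHom f)
    (x : M.Tot) : N.dh (f.hat x) = f.hat (M.dh x) := by
  rw [dh_hat hf, sgn_zero, one_smul]

theorem dh_dh (M : CDGMod.{u} A) (x : M.Tot) {i j : ℤ} (h : i + 2 = j) :
    M.dh (M.dh x) j = - M.act h (x i) A.B := by
  rw [dh_apply M (by omega : i + 1 + 1 = j), dh_apply M rfl, M.d_d _ _ h]

/-- The operator `d²` is the action of `-B`, and `A`-linear maps commute with it. -/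
theorem hat_dh_dh (f : Homs M.toGrMod N.toGrMod k) (x : M.Tot) :
    f.hat (M.dh (M.dh x)) = N.dh (N.dh (f.hat x)) := by
  funext j
  rw [dh_dh N _ (by omega : j - 2 + 2 = j), f.hat_apply (by omega : j - k + k = j),
    dh_dh M _ (by omega : j - k - 2 + 2 = j - k), f.hat_apply (by omega : j - k - 2 + k = j - 2),
    map_neg, f.app_act _ (by omega : j - k - 2 + k = j - 2) _ (by omega)]

/-- The two `d²` terms cancel by `hat_dh_dh` and the mixed terms by their signs: although `d² ≠ 0`
on curved modules, the Hom-complexes are genuine complexes. -/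
theorem homD_homD (h : k + 1 = l) (h' : l + 1 = m) (f : Homs M.toGrMod N.toGrMod k) :
    homD M N h' (homD M N h f) = 0 := by
  refine Homs.hat_inj fun x => ?_
  have e : sgn 𝕜 l = - sgn 𝕜 k := by rw [← h, sgn_add, sgn_one, mul_neg_one]
  rw [hat_homD, hat_homD, hat_homD, hat_dh_dh, e, map_sub, map_smul, smul_sub, smul_smul]
  rw [neg_mul, sgn_mul_sgn, Homs.hat_zero]
  module

/-- The two terms with `d` between `g` and `f` cancel, so `δ` is a derivation for composition. -/
theorem homD_comp {p : ℤ} (g : Homs M.toGrMod N.toGrMod l) (f : Homs L.toGrMod M.toGrMod k)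
    (h : k + l = m) (hm : m + 1 = p) {k' l' : ℤ} (hk : k + 1 = k') (hl : l + 1 = l')
    (h₁ : k + l' = p) (h₂ : k' + l = p) :
    homD L N hm (Homs.comp g f h) = Homs.comp (homD M N hl g) f h₁ +
      sgn 𝕜 l • Homs.comp g (homD L M hk f) h₂ := by
  refine Homs.hat_inj fun x => ?_
  simp only [hat_homD, Homs.comp_hat, Homs.hat_add, Homs.hat_smul, map_sub, map_smul, ← h, sgn_add]
  module

/-- Closed maps are stable under composition. -/
theorem homD_comp_eq_zero {k' l' p : ℤ} {g : Homs M.toGrMod N.toGrMod l}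
    {f : Homs L.toGrMod M.toGrMod k} {hl : l + 1 = l'} {hk : k + 1 = k'}
    (hg : homD M N hl g = 0) (hf : homD L M hk f = 0) (h : k + l = m) (hm : m + 1 = p) :
    homD L N hm (Homs.comp g f h) = 0 := by
  refine (homD_eq_zero_iff _ _).2 fun x => ?_
  rw [Homs.comp_hat, Homs.comp_hat, dh_hat hg, hat_dh hf, map_smul, smul_smul, ← h, sgn_add]
  congr 1
  linear_combination (-sgn 𝕜 l) * sgn_mul_sgn (𝕜 := 𝕜) k

theorem isClosedHom_id (M : CDGMod.{u} A) : IsClosedHom (Homs.id M.toGrMod) :=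
  (homD_eq_zero_iff _ _).2 fun x => by simp [sgn_zero]

end CDGMod

end HomCalculus

/-! ### Continuous `A`-linear maps -/

namespace CLCTMod

open CategoryTheory

variable {𝕜 : Type} [RCLike 𝕜] {A : CLCTAlg.{u} 𝕜} {L M N : CLCTMod.{u} A} {k l m : ℤ}

/-- Continuity of an `A`-linear map of degree `k`. -/
structure Cont {M N : CLCTMod.{u} A} {k : ℤ} (f : Homs M.toGrMod N.toGrMod k) : Prop where
  cont : ∀ {i j : ℤ} (h : i + k = j), Continuous (f.app h)

theorem Cont.zero : Cont (0 : Homs M.toGrMod N.toGrMod k) := ⟨fun _ => continuous_const⟩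

theorem Cont.add {f g : Homs M.toGrMod N.toGrMod k} (hf : Cont f) (hg : Cont g) : Cont (f + g) :=
  ⟨fun h => (hf.cont h).add (hg.cont h)⟩

theorem Cont.sub {f g : Homs M.toGrMod N.toGrMod k} (hf : Cont f) (hg : Cont g) : Cont (f - g) :=
  ⟨fun h => (hf.cont h).sub (hg.cont h)⟩

theorem Cont.neg {f : Homs M.toGrMod N.toGrMod k} (hf : Cont f) : Cont (-f) :=
  ⟨fun h => (hf.cont h).neg⟩

theorem Cont.smul (c : 𝕜) {f : Homs M.toGrMod N.toGrMod k} (hf : Cont f) : Cont (c • f) :=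
  ⟨fun h => (hf.cont h).const_smul c⟩

theorem Cont.comp {g : Homs M.toGrMod N.toGrMod l} {f : Homs L.toGrMod M.toGrMod k}
    (hg : Cont g) (hf : Cont f) (h : k + l = m) : Cont (Homs.comp g f h) :=
  ⟨fun _ => (hg.cont _).comp (hf.cont rfl)⟩

theorem Cont.homD {f : Homs M.toGrMod N.toGrMod k} (hf : Cont f) (h : k + 1 = l) :
    Cont (homD M.toCDGMod N.toCDGMod h f) := ⟨fun {i j} _ =>
  ((N.d_cont (by omega : i + k + 1 = j)).comp (hf.cont rfl)).sub
    (((hf.cont (by omega : i + 1 + k = j)).comp (M.d_cont rfl)).const_smul (sgn 𝕜 k))⟩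

/-- The `A`-linear map of degree `0` underlying a closed morphism. -/
def homs (f : M ⟶ N) : Homs M.toGrMod N.toGrMod 0 :=
  Homs.mk' (fun {i j} h => (Hom.appEq f (by omega : i = j)).toLinearMap)
    fun h hi hn h' x a => Hom.appEq_act f _ _ h h' x a

theorem homs_app (f : M ⟶ N) (i : ℤ) (x : M.C i) :
    (homs f).app (add_zero i) x = Hom.app f i x := rfl

@[simp] theorem homs_hat (f : M ⟶ N) (x : M.Tot) (i : ℤ) :
    (homs f).hat x i = Hom.app f i (x i) := by
  rw [Homs.hat_apply _ (add_zero i), homs_app]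

theorem homs_closed (f : M ⟶ N) : IsClosedHom (homs f) := by
  refine (CDGMod.homD_eq_zero_iff _ _).2 fun x => ?_
  rw [sgn_zero, one_smul]
  funext j
  rw [homs_hat, CDGMod.dh_apply _ (sub_add_cancel j 1), CDGMod.dh_apply _ (sub_add_cancel j 1),
    homs_hat, Hom.app_d]

theorem homs_cont (f : M ⟶ N) : Cont (homs f) := ⟨fun {i j} h => by
  obtain rfl : i = j := by omega
  exact (Hom.app f i).continuous⟩

theorem hom_ext {f g : M ⟶ N} (h : ∀ i x, Hom.app f i x = Hom.app g i x) : f = g :=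
  Hom.ext (funext fun i => ContinuousLinearMap.ext (h i))

theorem homs_inj {f g : M ⟶ N} (h : homs f = homs g) : f = g :=
  hom_ext fun i x => by rw [← homs_app, ← homs_app, h]

theorem homs_comp (f : L ⟶ M) (g : M ⟶ N) :
    homs (f ≫ g) = Homs.comp (homs g) (homs f) (add_zero 0) :=
  Homs.hat_inj fun x => funext fun i => by simp

theorem homs_id : homs (𝟙 M) = Homs.id M.toGrMod :=
  Homs.hat_inj fun x => funext fun i => by simp

theorem homs_add (f g : M ⟶ N) : homs (f + g) = homs f + homs g :=
  Homs.hat_inj fun x => funext fun i => by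
    simp only [homs_hat, Homs.hat_add, Pi.add_apply]
    rfl

theorem homs_smul (c : 𝕜) (f : M ⟶ N) : homs (c • f) = c • homs f :=
  Homs.hat_inj fun x => funext fun i => by
    simp only [homs_hat, Homs.hat_smul, Pi.smul_apply]
    rfl

/-- The closed morphism with given underlying `A`-linear map. -/
def ofHoms (f : Homs M.toGrMod N.toGrMod 0) (hc : Cont f) (hf : IsClosedHom f) : M ⟶ N where
  app i := ⟨f.app (add_zero i), hc.cont _⟩
  app_act h x a := f.app_act h _ _ h x a
  app_d h x := hf.app_d h x

@[simp] theorem homs_ofHoms (f : Homs M.toGrMod N.toGrMod 0) (hc : Cont f) (hf : IsClosedHom f) :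
    homs (ofHoms f hc hf) = f :=
  Homs.hat_inj fun x => funext fun i => by
    rw [homs_hat, Homs.hat_apply _ (add_zero i)]
    rfl

/-- Since `(-1)^(-1) = -1`, the equation `f - g = d h + h d` says that `h` bounds `f - g` in the
Hom-complex. The homotopies constructed below are given in this form. -/
theorem homotopic_iff {f g : M ⟶ N} : Homotopic f g ↔ ∃ h : Homs M.toGrMod N.toGrMod (-1),
    Cont h ∧ homD M.toCDGMod N.toCDGMod (neg_add_cancel 1) h = homs f - homs g := by
  constructor
  · rintro ⟨H⟩
    refine ⟨Homs.mk' (fun {i j} h => (H.h (by omega : j + 1 = i)).toLinearMap)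
      fun h hi hn h' x a => H.h_act h _ _ h' x a, ⟨fun h => (H.h _).continuous⟩,
      Homs.hat_inj fun x => funext fun j => ?_⟩
    rw [CDGMod.hat_homD, Homs.hat_sub, Pi.sub_apply, Pi.sub_apply, homs_hat, homs_hat,
      H.comm (sub_add_cancel j 1) rfl, sgn_neg, sgn_one, neg_one_smul, Pi.neg_apply, sub_neg_eq_add,
      CDGMod.dh_apply _ (sub_add_cancel j 1), Homs.hat_apply _ (by omega : j + -1 = j - 1),
      Homs.hat_apply _ (by omega : j + 1 + -1 = j), CDGMod.dh_apply _ rfl]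
    rfl
  · rintro ⟨h, hc, hh⟩
    refine ⟨⟨fun {i j} hij => ⟨h.app (by omega : i + -1 = j), hc.cont (by omega : i + -1 = j)⟩, fun hn hi hn' h' x a =>
      h.app_act hn _ _ h' x a, fun {i j k} hj hk x => ?_⟩⟩
    have h1 := congrArg (fun f => f.app (add_zero i) x) hh
    simp only [Homs.app_sub, homs_app] at h1
    rw [← h1, homD_apply _ h (add_zero i) (by omega : i + -1 = j) hj hk (by omega : k + -1 = i),
      sgn_neg, sgn_one, neg_one_smul, sub_neg_eq_add]
    rfl

theorem homotopic_of_homD {f g : M ⟶ N} (h : Homs M.toGrMod N.toGrMod (-1)) (hc : Cont h)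
    (hh : homD M.toCDGMod N.toCDGMod (neg_add_cancel 1) h = homs f - homs g) : Homotopic f g :=
  homotopic_iff.2 ⟨h, hc, hh⟩

instance : HomRel.IsStableUnderPrecomp (Homotopic (A := A)) where
  comp_left := by
    intro L M N f g g' h
    obtain ⟨h, hc, hh⟩ := homotopic_iff.1 h
    refine homotopic_of_homD (Homs.comp h (homs f) (by omega)) (hc.comp (homs_cont f) _) ?_
    rw [CDGMod.homD_comp h (homs f) _ _ (zero_add 1) (neg_add_cancel 1) (add_zero 0) (by omega),
      homs_closed f, hh, homs_comp, homs_comp]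
    exact Homs.hat_inj fun x => by simp

instance : HomRel.IsStableUnderPostcomp (Homotopic (A := A)) where
  comp_right := by
    intro L M N f f' g h
    obtain ⟨h, hc, hh⟩ := homotopic_iff.1 h
    refine homotopic_of_homD (Homs.comp (homs g) h (by omega)) ((homs_cont g).comp hc _) ?_
    rw [CDGMod.homD_comp (homs g) h _ _ (neg_add_cancel 1) (zero_add 1) (by omega) (add_zero 0),
      homs_closed g, hh, homs_comp, homs_comp]
    exact Homs.hat_inj fun x => by simp [sgn_zero]

/-- For a congruence, equality in the quotient category is homotopy itself and not merely the
relation generated by it. -/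
instance : Congruence (Homotopic (A := A)) where
  equivalence := by
    refine ⟨fun f => homotopic_of_homD 0 Cont.zero (by simp), fun {f g} h => ?_,
      fun {f g k} h h' => ?_⟩
    · obtain ⟨h, hc, hh⟩ := homotopic_iff.1 h
      exact homotopic_of_homD (-h) hc.neg (by rw [map_neg, hh, neg_sub])
    · obtain ⟨h, hc, hh⟩ := homotopic_iff.1 h
      obtain ⟨h', hc', hh'⟩ := homotopic_iff.1 h'
      exact homotopic_of_homD (h + h') (hc.add hc') (by rw [map_add, hh, hh']; abel)

/-! ### The maps of the cone and the shift -/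

/-- The inclusion `N → cone f`. -/
def coneInl (f : M ⟶ N) : Homs N.toGrMod (cone f).toGrMod 0 :=
  Homs.mk' (fun {i j} h => ((add_zero i).symm.trans h) ▸ LinearMap.inl 𝕜 (N.C i) (M.C (i + 1))) (by
    intro i j n i' n' h hi hn h' x a
    obtain rfl : i = i' := by omega
    obtain rfl : n = n' := by omega
    exact Prod.ext rfl (by change 0 = M.act _ 0 a; simp))

/-- The projection `cone f → N`. -/
def coneFst (f : M ⟶ N) : Homs (cone f).toGrMod N.toGrMod 0 :=
  Homs.mk' (fun {i j} h => ((add_zero i).symm.trans h) ▸ LinearMap.fst 𝕜 (N.C i) (M.C (i + 1))) (by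
    intro i j n i' n' h hi hn h' x a
    obtain rfl : i = i' := by omega
    obtain rfl : n = n' := by omega
    rfl)

/-- The inclusion `M → cone f` of degree `-1`. -/
def coneInr (f : M ⟶ N) : Homs M.toGrMod (cone f).toGrMod (-1) :=
  Homs.mk' (fun {i j} h => (by omega : j + 1 = i) ▸ LinearMap.inr 𝕜 (N.C j) (M.C (j + 1))) (by
    intro i j n i' n' h hi hn h' x a
    obtain rfl : i = i' + 1 := by omega
    obtain rfl : n = n' + 1 := by omega
    exact Prod.ext (by change 0 = N.act _ 0 a; simp) rfl)

/-- The projection `cone f → M` of degree `1`. -/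
def coneSnd (f : M ⟶ N) : Homs (cone f).toGrMod M.toGrMod 1 :=
  Homs.mk' (fun {i j} h => h ▸ LinearMap.snd 𝕜 (N.C i) (M.C (i + 1))) (by
    intro i j n i' n' h hi hn h' x a
    subst hi hn
    rfl)


section ConeCalculus

variable (f : M ⟶ N)

theorem coneInl_hat (y : N.Tot) (j : ℤ) : (coneInl f).hat y j = (y j, 0) :=
  (coneInl f).hat_apply (add_zero j) y

theorem coneFst_hat (z : (cone f).Tot) (j : ℤ) : (coneFst f).hat z j = (z j).1 :=
  (coneFst f).hat_apply (add_zero j) z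

theorem coneInr_hat (x : M.Tot) (j : ℤ) : (coneInr f).hat x j = (0, x (j + 1)) :=
  (coneInr f).hat_apply (add_neg_cancel_right j 1) x

theorem coneSnd_hat (z : (cone f).Tot) (j : ℤ) : (coneSnd f).hat z (j + 1) = (z j).2 :=
  (coneSnd f).hat_apply rfl z

@[simp] theorem coneFst_coneInl (y : N.Tot) : (coneFst f).hat ((coneInl f).hat y) = y :=
  funext fun j => by rw [coneFst_hat, coneInl_hat]

@[simp] theorem coneFst_coneInr (x : M.Tot) : (coneFst f).hat ((coneInr f).hat x) = 0 :=
  funext fun j => by rw [coneFst_hat, coneInr_hat]; rfl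

@[simp] theorem coneSnd_coneInl (y : N.Tot) : (coneSnd f).hat ((coneInl f).hat y) = 0 :=
  funext fun j => by
    obtain ⟨i, rfl⟩ : ∃ i, j = i + 1 := ⟨j - 1, by omega⟩
    rw [coneSnd_hat, coneInl_hat]
    rfl

@[simp] theorem coneSnd_coneInr (x : M.Tot) : (coneSnd f).hat ((coneInr f).hat x) = x :=
  funext fun j => by
    obtain ⟨i, rfl⟩ : ∃ i, j = i + 1 := ⟨j - 1, by omega⟩
    rw [coneSnd_hat, coneInr_hat]

theorem cone_eta (z : (cone f).Tot) :
    (coneInl f).hat ((coneFst f).hat z) + (coneInr f).hat ((coneSnd f).hat z) = z :=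
  funext fun j => by
    rw [Pi.add_apply, coneInl_hat, coneFst_hat, coneInr_hat, coneSnd_hat]
    exact Prod.ext (add_zero _) (zero_add _)

/-- With the formulas for the differentials below, comparing the two projections reduces identities
in iterated cones to a simplification. -/
theorem cone_ext {z w : (cone f).Tot} (h₁ : (coneFst f).hat z = (coneFst f).hat w)
    (h₂ : (coneSnd f).hat z = (coneSnd f).hat w) : z = w := by
  rw [← cone_eta f z, ← cone_eta f w, h₁, h₂]

@[simp] theorem homs_dh (x : M.Tot) : (homs f).hat (M.dh x) = N.dh ((homs f).hat x) :=
  (CDGMod.dh_hat₀ (homs_closed f) x).symm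

theorem cone_dh_apply (z : (cone f).Tot) {i j : ℤ} (h : i + 1 = j) :
    (cone f).dh z j = (N.d h (z i).1 + Hom.appEq f h (z i).2,
      -M.d (by omega : i + 1 + 1 = j + 1) (z i).2) :=
  CDGMod.dh_apply _ h z

@[simp] theorem coneFst_dh (z : (cone f).Tot) : (coneFst f).hat ((cone f).dh z) =
    N.dh ((coneFst f).hat z) + (homs f).hat ((coneSnd f).hat z) :=
  funext fun j => by
    obtain ⟨i, rfl⟩ : ∃ i, j = i + 1 := ⟨j - 1, by omega⟩
    rw [coneFst_hat, cone_dh_apply f z rfl, Pi.add_apply, CDGMod.dh_apply _ rfl, coneFst_hat,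
      homs_hat, coneSnd_hat]
    rfl

@[simp] theorem coneSnd_dh (z : (cone f).Tot) : (coneSnd f).hat ((cone f).dh z) =
    -M.dh ((coneSnd f).hat z) :=
  funext fun j => by
    obtain ⟨i, rfl⟩ : ∃ i, j = i + 1 + 1 := ⟨j - 1 - 1, by omega⟩
    rw [coneSnd_hat, cone_dh_apply f z rfl, Pi.neg_apply, CDGMod.dh_apply _ rfl, coneSnd_hat]

@[simp] theorem dh_coneInl (y : N.Tot) :
    (cone f).dh ((coneInl f).hat y) = (coneInl f).hat (N.dh y) :=
  cone_ext f (by simp) (by simp)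

-- The inclusion of `M` is not closed: its boundary is `f` followed by the inclusion of `N`.
@[simp] theorem dh_coneInr (x : M.Tot) : (cone f).dh ((coneInr f).hat x) =
    (coneInl f).hat ((homs f).hat x) - (coneInr f).hat (M.dh x) :=
  cone_ext f (by simp) (by simp)

theorem cont_coneInl : Cont (coneInl f) := ⟨fun {i j} h => by
  obtain rfl : i = j := by omega
  exact continuous_id.prodMk continuous_const⟩

theorem cont_coneFst : Cont (coneFst f) := ⟨fun {i j} h => by
  obtain rfl : i = j := by omega
  exact continuous_fst⟩

theorem cont_coneInr : Cont (coneInr f) := ⟨fun {i j} h => by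
  obtain rfl : i = j + 1 := by omega
  exact continuous_const.prodMk continuous_id⟩

theorem cont_coneSnd : Cont (coneSnd f) := ⟨fun {i j} h => by
  subst h
  exact continuous_snd⟩

end ConeCalculus

section ShiftCalculus

variable (M) (k)

/-- The identity as a map `M[k] → M` of degree `k`. -/
def shOut : Homs (M.shift k).toGrMod M.toGrMod k :=
  Homs.mk' (fun {i j} h => h ▸ (LinearMap.id : M.C (i + k) →ₗ[𝕜] M.C (i + k))) (by
    intro i j n i' n' h hi hn h' x a
    subst hi hn
    rfl)

/-- The identity as a map `M → M[k]` of degree `-k`. -/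
def shIn : Homs M.toGrMod (M.shift k).toGrMod (-k) :=
  Homs.mk' (fun {i j} h => (by omega : j + k = i) ▸ (LinearMap.id : M.C (j + k) →ₗ[𝕜] M.C (j + k)))
    (by
      intro i j n i' n' h hi hn h' x a
      obtain rfl : i = i' + k := by omega
      obtain rfl : n = n' + k := by omega
      rfl)

theorem shOut_hat (z : (M.shift k).Tot) (i : ℤ) : (shOut M k).hat z (i + k) = z i :=
  (shOut M k).hat_apply rfl z

theorem shIn_hat (x : M.Tot) (i : ℤ) : (shIn M k).hat x i = x (i + k) :=
  (shIn M k).hat_apply (add_neg_cancel_right i k) x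

@[simp] theorem shIn_shOut (z : (M.shift k).Tot) : (shIn M k).hat ((shOut M k).hat z) = z :=
  funext fun i => by rw [shIn_hat, shOut_hat]

@[simp] theorem shOut_shIn (x : M.Tot) : (shOut M k).hat ((shIn M k).hat x) = x :=
  funext fun j => by
    obtain ⟨i, rfl⟩ : ∃ i, j = i + k := ⟨j - k, by omega⟩
    rw [shOut_hat, shIn_hat]

theorem shift_dh (z : (M.shift k).Tot) : (M.shift k).dh z =
    sgn 𝕜 k • (shIn M k).hat (M.dh ((shOut M k).hat z)) :=
  funext fun j => by
    obtain ⟨i, rfl⟩ : ∃ i, j = i + 1 := ⟨j - 1, by omega⟩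
    rw [CDGMod.dh_apply _ rfl, Pi.smul_apply, shIn_hat,
      CDGMod.dh_apply M.toCDGMod (by omega : i + k + 1 = i + 1 + k), shOut_hat]
    rfl

theorem shOut_dh (z : (M.shift k).Tot) : (shOut M k).hat ((M.shift k).dh z) =
    sgn 𝕜 k • M.dh ((shOut M k).hat z) := by
  rw [shift_dh, map_smul, shOut_shIn]

theorem shIn_dh (x : M.Tot) : (shIn M k).hat (M.dh x) =
    sgn 𝕜 k • (M.shift k).dh ((shIn M k).hat x) := by
  rw [shift_dh, smul_smul, sgn_mul_sgn, one_smul, shOut_shIn]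

theorem cont_shOut : Cont (shOut M k) := ⟨fun {i j} h => by
  subst h
  exact continuous_id⟩

theorem cont_shIn : Cont (shIn M k) := ⟨fun {i j} h => by
  obtain rfl : i = j + k := by omega
  exact continuous_id⟩

end ShiftCalculus

/-! ### Contraacyclic modules -/

theorem isClosedHom_zero : IsClosedHom (0 : Homs M.toGrMod N.toGrMod 0) := map_zero _

theorem contraacyclic_of_strict_retract (i : Homs M.toGrMod N.toGrMod 0) (hi : Cont i)
    (r : Homs N.toGrMod M.toGrMod 0) (hr : Cont r) (hi' : ∀ x, N.dh (i.hat x) = i.hat (M.dh x))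
    (hr' : ∀ x, M.dh (r.hat x) = r.hat (N.dh x)) (hri : ∀ x, r.hat (i.hat x) = x)
    (hN : N.Contraacyclic) : M.Contraacyclic := by
  have ci : IsClosedHom i := (CDGMod.homD_eq_zero_iff _ _).2 fun x => by
    rw [hi', sgn_zero, one_smul]
  have cr : IsClosedHom r := (CDGMod.homD_eq_zero_iff _ _).2 fun x => by
    rw [hr', sgn_zero, one_smul]
  refine Contraacyclic.retract (ofHoms i hi ci) (ofHoms r hr cr) ?_ hN
  have : ofHoms i hi ci ≫ ofHoms r hr cr = 𝟙 M := homs_inj (Homs.hat_inj fun x => by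
    rw [homs_comp, homs_id, homs_ofHoms, homs_ofHoms, Homs.comp_hat, hri, Homs.id_hat])
  rw [this]
  exact Congruence.equivalence.refl _

/-- Modules with a contracting homotopy are contraacyclic. -/
theorem contraacyclic_of_homotopic_zero (h : Homs M.toGrMod M.toGrMod (-1)) (hc : Cont h)
    (hh : ∀ x, M.dh (h.hat x) + h.hat (M.dh x) = x) : M.Contraacyclic := by
  -- The empty product is contraacyclic and zero, and a contracting homotopy makes `M` a retract of
  -- zero in the homotopy category. The homotopy below is `-h` because it has to bound `0 - 1`.
  refine Contraacyclic.retract (N := pi fun c : PEmpty.{u + 1} => c.elim)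
    (ofHoms (0 : Homs _ _ 0) Cont.zero isClosedHom_zero)
    (ofHoms (0 : Homs _ _ 0) Cont.zero isClosedHom_zero) ?_
    (Contraacyclic.pi _ fun c => c.elim)
  refine homotopic_of_homD (-h) hc.neg (Homs.hat_inj fun x => ?_)
  rw [CDGMod.hat_homD, homs_comp, homs_id, Homs.hat_sub, Homs.comp_hat, homs_ofHoms, homs_ofHoms,
    Homs.hat_zero, Homs.id_hat, Homs.hat_neg, Homs.hat_neg, sgn_neg, sgn_one, neg_one_smul, map_neg]
  conv_rhs => rw [← hh x]
  abel

/-- The inclusion `N → cone f` as a closed morphism. -/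
def coneInlHom (f : M ⟶ N) : N ⟶ cone f :=
  ofHoms (coneInl f) (cont_coneInl f) ((CDGMod.homD_eq_zero_iff _ _).2 fun x => by
    simp [sgn_zero])

@[simp] theorem homs_coneInlHom (f : M ⟶ N) : homs (coneInlHom f) = coneInl f := homs_ofHoms _ _ _

/-- The cone of `N → cone f` is contraacyclic, and its shift by `-1` contains `M` as a strict
retract. The inclusion is `x ↦ (inr x, -f x)`, where `-f x` compensates for `inr` not being closed;
the retraction projects to `cone f` and then to `M`. -/
theorem contraacyclic_of_cone (f : M ⟶ N) (hf : (cone f).Contraacyclic) (hN : N.Contraacyclic) :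
    M.Contraacyclic := by
  refine contraacyclic_of_strict_retract
    (Homs.comp (shIn (cone (coneInlHom f)) (-1)) (Homs.comp (coneInl (coneInlHom f)) (coneInr f)
      (add_zero (-1)) - Homs.comp (coneInr (coneInlHom f)) (homs f) (zero_add (-1)))
      (by omega : -1 + - -1 = 0))
    ((cont_shIn _ _).comp (((cont_coneInl _).comp (cont_coneInr f) _).sub
      ((cont_coneInr _).comp (homs_cont f) _)) _)
    (Homs.comp (coneSnd f) (Homs.comp (coneFst (coneInlHom f)) (shOut (cone (coneInlHom f)) (-1))
      (add_zero (-1))) (neg_add_cancel 1))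
    ((cont_coneSnd f).comp ((cont_coneFst _).comp (cont_shOut _ _) _) _) (fun x => ?_) (fun x => ?_)
    (fun x => ?_) (Contraacyclic.shift _ (-1) (Contraacyclic.cone (coneInlHom f) hN hf))
  · simp only [Homs.comp_hat, Homs.hat_sub, shift_dh, shOut_shIn, map_sub, dh_coneInl, dh_coneInr,
      homs_coneInlHom, homs_dh, sgn_neg, sgn_one]
    module
  · simp [shOut_dh, sgn_neg, sgn_one]
  · simp

/-- The totalization is the cone of `cone i → M`. Hence `cone i` is contraacyclic, and then so is
`K`, both times by `contraacyclic_of_cone`. -/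
theorem SES.contraacyclic_left {K : CLCTMod.{u} A} (S : SES K L M) (hL : L.Contraacyclic)
    (hM : M.Contraacyclic) : K.Contraacyclic :=
  contraacyclic_of_cone S.i (contraacyclic_of_cone S.fromCone (Contraacyclic.tot S) hM) hL

end CLCTMod

/-! ### Morphisms in a localization out of a colocal object -/

section Colocal

open CategoryTheory Opposite

universe v w

variable {C : Type w} [Category.{v} C] (W : MorphismProperty C)

/-- If composition with the morphisms in `W` is bijective on the morphisms out of `P`, then the
morphisms out of `P` are not changed by the localization with respect to `W`. -/
theorem bijective_map_of_colocal (P : C)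
    (hP : ∀ {X Y : C} (f : X ⟶ Y), W f → Function.Bijective fun g : P ⟶ X => g ≫ f) (X : C) :
    Function.Bijective fun g : P ⟶ X => W.Q.map g := by
  -- `F` is `Hom(P, -)`, lifted to the universe of the hom-types of the localization. It inverts
  -- `W`, and `G` is the induced functor on the localization.
  let F : C ⥤ Type (max v w) := coyoneda.obj (op P) ⋙ uliftFunctor.{w}
  have hF : W.IsInvertedBy F := fun Y Z f hf => by
    rw [isIso_iff_bijective]
    refine ⟨fun a b h => ?_, fun b => ?_⟩
    · exact ULift.down_injective ((hP f hf).1 (congrArg ULift.down h))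
    · obtain ⟨a, ha⟩ := (hP f hf).2 b.down
      exact ⟨⟨a⟩, ULift.down_injective ha⟩
  let G : W.Localization ⥤ Type (max v w) := Localization.lift F hF W.Q
  let e : W.Q ⋙ G ≅ F := Localization.fac F hF W.Q
  have hnat : ∀ {Y Z : C} (f : Y ⟶ Z) (x : G.obj (W.Q.obj Y)),
      e.hom.app Z (G.map (W.Q.map f) x) = F.map f (e.hom.app Y x) := fun f x =>
    congrArg (fun φ => φ x) (e.hom.naturality f)
  -- The element of `G` at `P` which corresponds to the identity of `P`.
  let one : G.obj (W.Q.obj P) := e.inv.app P ⟨𝟙 P⟩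
  have hone : e.hom.app P one = ⟨𝟙 P⟩ := congrArg (fun φ => φ (⟨𝟙 P⟩ : F.obj P))
    (e.inv_hom_id_app P)
  refine ⟨fun a b h => ?_, fun α => ?_⟩
  · have h1 := hnat a one
    have h2 := hnat b one
    have h' : W.Q.map a = W.Q.map b := h
    rw [h', h2, hone] at h1
    have h3 : 𝟙 P ≫ b = 𝟙 P ≫ a := congrArg ULift.down h1
    rwa [Category.id_comp, Category.id_comp, eq_comm] at h3
  -- The transformation `g ↦ Q g` from `F` to `Hom(Q P, Q -)` extends to `σ : G ⟶ H` on the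
  -- localization. Naturality of `σ` along `α`, evaluated at `one`, exhibits `α` as the image of a
  -- morphism of `C`.
  · let H : W.Localization ⥤ Type (max v w) := coyoneda.obj (op (W.Q.obj P))
    let τ : F ⟶ W.Q ⋙ H :=
      { app := fun Y => TypeCat.ofHom fun g => W.Q.map g.down
        naturality := fun Y Z f => by
          ext g
          exact W.Q.map_comp g.down f }
    let σ : G ⟶ H := Localization.Construction.natTransExtension (e.hom ≫ τ)
    have hσ : ∀ (Y : C) (x : G.obj (W.Q.obj Y)),
        σ.app (W.Q.obj Y) x = W.Q.map (e.hom.app Y x).down := fun Y x => by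
      have := Localization.Construction.NatTransExtension.app_eq (e.hom ≫ τ) Y
      exact congrArg (fun φ => φ x) this
    refine ⟨(e.hom.app X (G.map α one)).down, ?_⟩
    change W.Q.map _ = α
    rw [← hσ]
    have h1 : σ.app (W.Q.obj X) (G.map α one) = H.map α (σ.app (W.Q.obj P) one) :=
      congrArg (fun φ => φ one) (σ.naturality α)
    rw [h1, hσ, hone]
    change W.Q.map (𝟙 P) ≫ α = α
    rw [W.Q.map_id, Category.id_comp]

end Colocal

/-! ### Modules without maps to contraacyclic modules -/

namespace CLCTMod

open CategoryTheory

variable {𝕜 : Type} [RCLike 𝕜] {A : CLCTAlg.{u} 𝕜} {K L M N P X Y : CLCTMod.{u} A} {k l m : ℤ}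

/-- Every closed continuous `A`-linear map `P → X`, of any degree, is a coboundary. -/
def Orth (P X : CLCTMod.{u} A) : Prop :=
  ∀ ⦃k l : ℤ⦄ (h : k + 1 = l) (g : Homs P.toGrMod X.toGrMod l), Cont g →
    homD P.toCDGMod X.toCDGMod rfl g = 0 →
      ∃ f : Homs P.toGrMod X.toGrMod k, Cont f ∧ homD P.toCDGMod X.toCDGMod h f = g

/-- Continuous `A`-linear maps out of `P` lift along the surjections of short exact sequences. -/
def RelProjective (P : CLCTMod.{u} A) : Prop :=
  ∀ ⦃K L M : CLCTMod.{u} A⦄ (S : SES K L M) ⦃k : ℤ⦄ (g : Homs P.toGrMod M.toGrMod k), Cont g →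
    ∃ f : Homs P.toGrMod L.toGrMod k, Cont f ∧ ∀ x, (homs S.p).hat (f.hat x) = g.hat x

/-- The identity `X[n] → X` of degree `n` carries cocycles to cocycles. The differential of the
shift is `(-1)^n d`, so the primitive found in `X` is multiplied by `(-1)^n` on the way back. -/
theorem Orth.shift (h : Orth P X) (n : ℤ) : Orth P (X.shift n) := by
  intro k l hkl g hg hc
  obtain ⟨f, hf, hfg⟩ := h (by omega : k + n + 1 = l + n) (Homs.comp (shOut X n) g rfl)
    ((cont_shOut X n).comp hg _) ((CDGMod.homD_eq_zero_iff _ _).2 fun x => by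
      rw [Homs.comp_hat, Homs.comp_hat, CDGMod.hat_dh hc, map_smul, shOut_dh, smul_smul, smul_smul,
        sgn_add]
      have e : sgn 𝕜 l * sgn 𝕜 n * sgn 𝕜 l * sgn 𝕜 n = 1 := by
        rw [mul_assoc (_ * _), ← sgn_add, sgn_mul_sgn]
      rw [e, one_smul])
  refine ⟨sgn 𝕜 n • Homs.comp (shIn X n) f (by omega), ((cont_shIn X n).comp hf _).smul _,
    Homs.hat_inj fun x => ?_⟩
  have h1 := congrArg (fun f => (shIn X n).hat (f.hat x)) hfg
  simp only [Homs.comp_hat, shIn_shOut] at h1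
  rw [← h1, CDGMod.hat_homD, CDGMod.hat_homD, Homs.hat_smul, Homs.hat_smul, Homs.comp_hat,
    Homs.comp_hat, shift_dh, map_smul, shOut_shIn, map_sub, map_smul, map_smul, smul_smul,
    sgn_mul_sgn, one_smul, sgn_add, smul_smul, map_smul]

/-- Primitives are chosen componentwise, and a map to a product is continuous if its components are.
-/
theorem Orth.pi {ι : Type u} (X : ι → CLCTMod.{u} A) (h : ∀ c, Orth P (X c)) :
    Orth P (CLCTMod.pi X) := by
  intro k l hkl g hg hc
  choose f hf hfg using fun c => h c hkl (Homs.comp (homs (piProj X c)) g (add_zero l))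
    ((homs_cont _).comp hg _) (CDGMod.homD_comp_eq_zero (homs_closed _) hc _ _)
  refine ⟨Homs.mk' (fun hij => LinearMap.pi fun c => (f c).app hij)
    fun h hi hn h' x a => funext fun c => (f c).app_act h hi hn h' x a,
    ⟨fun hij => continuous_pi fun c => (hf c).cont hij⟩, Homs.ext' fun {i j} hij x => ?_⟩
  funext c
  have h1 := congrArg (fun f => f.app hij x) (hfg c)
  simp only [Homs.comp_app _ _ (add_zero l) hij hij (add_zero j)] at h1
  refine Eq.trans ?_ h1
  rw [homD_apply hkl _ hij rfl (by omega) rfl (by omega)]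
  exact (homD_apply hkl (f c) hij rfl (by omega) rfl (by omega) x).symm

/-- If `f` bounds `i g`, then `r f` bounds `r i g`, and the homotopy from `r i` to the identity,
composed with the cocycle `g`, bounds the difference `r i g - g`. -/
theorem Orth.retract (i : M ⟶ N) (r : N ⟶ M) (hri : Homotopic (i ≫ r) (𝟙 M)) (h : Orth P N) :
    Orth P M := by
  intro k l hkl g hg hc
  obtain ⟨H, hH, hHe⟩ := homotopic_iff.1 hri
  obtain ⟨f, hf, hfg⟩ := h hkl (Homs.comp (homs i) g (add_zero l)) ((homs_cont _).comp hg _)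
    (CDGMod.homD_comp_eq_zero (homs_closed _) hc _ _)
  refine ⟨Homs.comp (homs r) f (add_zero k) - Homs.comp H g (by omega),
    ((homs_cont r).comp hf _).sub (hH.comp hg _), ?_⟩
  rw [map_sub, CDGMod.homD_comp (homs r) f _ _ hkl (zero_add 1) (by omega) (by omega),
    CDGMod.homD_comp H g _ _ rfl (neg_add_cancel 1) (by omega) (by omega), homs_closed r, hfg, hHe,
    hc, homs_comp, homs_id]
  exact Homs.hat_inj fun x => by simp [sgn_zero]

/-- The `M`-component of the cocycle is bounded first, by `s`. Then the `N`-component corrected by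
`f s` is a cocycle, and it is bounded by `t`. The sign in `inl t - inr s` accounts for the
differential `-d` on the `M`-part of the cone. -/
theorem Orth.cone (f : M ⟶ N) (hM : Orth P M) (hN : Orth P N) : Orth P (CLCTMod.cone f) := by
  intro k l hkl g hg hc
  have hc' := CDGMod.dh_hat hc
  have el : sgn 𝕜 l = -sgn 𝕜 k := by rw [← hkl, sgn_add, sgn_one, mul_neg_one]
  obtain ⟨s, hs, hsg⟩ := hM (by omega : l + 1 = l + 1) (Homs.comp (coneSnd f) g rfl)
    ((cont_coneSnd f).comp hg _) ((CDGMod.homD_eq_zero_iff _ _).2 fun x => by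
      have := congrArg (coneSnd f).hat (hc' x)
      rw [coneSnd_dh, map_smul] at this
      rw [Homs.comp_hat, Homs.comp_hat, neg_eq_iff_eq_neg.1 this, sgn_add, sgn_one]
      module)
  have hs' : ∀ x, M.dh (s.hat x) = (coneSnd f).hat (g.hat x) + sgn 𝕜 l • s.hat (P.dh x) := by
    intro x
    rw [← Homs.comp_hat _ _ rfl, ← hsg, CDGMod.hat_homD, sub_add_cancel]
  obtain ⟨t, ht, htg⟩ := hN hkl (Homs.comp (coneFst f) g (add_zero l) +
      Homs.comp (homs f) s (add_zero l))
    (((cont_coneFst f).comp hg _).add ((homs_cont f).comp hs _))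
    ((CDGMod.homD_eq_zero_iff _ _).2 fun x => by
      have := congrArg (coneFst f).hat (hc' x)
      rw [coneFst_dh, map_smul] at this
      simp only [Homs.hat_add, Homs.comp_hat, map_add, ← homs_dh, hs', map_smul, smul_add]
      rw [← this]
      abel)
  have ht' : ∀ x, N.dh (t.hat x) = (coneFst f).hat (g.hat x) + (homs f).hat (s.hat x) +
      sgn 𝕜 k • t.hat (P.dh x) := by
    intro x
    rw [← Homs.comp_hat _ _ (add_zero l), ← Homs.comp_hat _ _ (add_zero l), ← Homs.hat_add, ← htg,
      CDGMod.hat_homD, sub_add_cancel]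
  refine ⟨Homs.comp (coneInl f) t (add_zero k) - Homs.comp (coneInr f) s (by omega),
    ((cont_coneInl f).comp ht _).sub ((cont_coneInr f).comp hs _), Homs.hat_inj fun x => ?_⟩
  refine cone_ext f ?_ ?_
  · simp [CDGMod.hat_homD, ht']
  · simp [CDGMod.hat_homD, hs', el]

@[simp] theorem homs_fromCone (S : SES K L M) (z : (CLCTMod.cone S.i).Tot) :
    (homs S.fromCone).hat z = (homs S.p).hat ((coneFst S.i).hat z) :=
  funext fun j => by
    rw [homs_hat, homs_hat, coneFst_hat]
    rfl

theorem SES.i_inj (S : SES K L M) {x : K.Tot} (h : (homs S.i).hat x = 0) : x = 0 :=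
  funext fun j => by
    have := congrFun h j
    rw [homs_hat] at this
    rw [← S.r_i j (x j), this]
    exact map_zero _

/-- Maps to the middle term which vanish in the quotient come from the kernel. -/
theorem SES.exists_lift (S : SES K L M) (g : Homs P.toGrMod L.toGrMod k) (hg : Cont g)
    (h : ∀ x, (homs S.p).hat (g.hat x) = 0) :
    ∃ f : Homs P.toGrMod K.toGrMod k, Cont f ∧ ∀ x, (homs S.i).hat (f.hat x) = g.hat x := by
  have hi : ∀ {i j : ℤ} (hij : i + k = j) (x : P.C i),
      Hom.app S.i j (S.r j (g.app hij x)) = g.app hij x := by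
    intro i j hij x
    have h1 := S.split j (g.app hij x)
    have h2 : Hom.app S.p j (g.app hij x) = 0 := by
      have := congrFun (h (Pi.single i x)) j
      rw [homs_hat] at this
      rw [Homs.app_eq_hat]
      exact this
    rwa [h2, map_zero, add_zero] at h1
  refine ⟨Homs.mk' (fun {i j} hij => (S.r j).toLinearMap ∘ₗ g.app hij) ?_,
    ⟨fun hij => (S.r _).continuous.comp (hg.cont hij)⟩, fun x => funext fun j => ?_⟩
  · intro i j n i' n' h hi' hn h' x a
    -- The retraction `r` is only linear. On the values of `g` it is compatible with the action, as
    -- one sees after applying `i`, which has `r` as a left inverse.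
    have h1 : Hom.app S.i n' (S.r n' (g.app hn (P.act h x a))) =
        Hom.app S.i n' (K.act h' (S.r i' (g.app hi' x)) a) := by
      rw [hi, Hom.app_act, hi, g.app_act h hi' hn h']
    have h2 := congrArg (S.r n') h1
    rw [S.r_i, S.r_i] at h2
    exact h2
  · rw [homs_hat, Homs.hat_apply _ (sub_add_cancel j k), Homs.hat_apply _ (sub_add_cancel j k)]
    exact hi _ _

/-- A cocycle with values in the totalization has components in `M`, `L` and `K`. Relative
projectivity gives a coboundary which removes the `M`-component. Closedness then puts the
`L`-component into the kernel of `p`, that is into `K`, and a second coboundary removes it.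
Closedness of what is left forces the `K`-component to vanish, since `i` is injective. -/
theorem Orth.tot (hP : RelProjective P) (S : SES K L M) : Orth P (CLCTMod.cone S.fromCone) := by
  intro k l hkl g hg hc
  have el : sgn 𝕜 l = -sgn 𝕜 k := by rw [← hkl, sgn_add, sgn_one, mul_neg_one]
  obtain ⟨a, ha, hap⟩ := hP S (Homs.comp (coneFst S.fromCone) g (add_zero l))
    ((cont_coneFst _).comp hg _)
  simp only [Homs.comp_hat] at hap
  let f₁ : Homs P.toGrMod (CLCTMod.cone S.fromCone).toGrMod k := Homs.comp (coneInr S.fromCone)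
    (Homs.comp (coneInl S.i) a (add_zero l)) (by omega)
  have hf₁ : Cont f₁ := (cont_coneInr _).comp ((cont_coneInl _).comp ha _) _
  let g₁ := g - homD P.toCDGMod (CLCTMod.cone S.fromCone).toCDGMod hkl f₁
  have hg₁ : Cont g₁ := hg.sub (hf₁.homD _)
  have hc₁ : homD P.toCDGMod (CLCTMod.cone S.fromCone).toCDGMod rfl g₁ = 0 := by
    rw [map_sub, hc, CDGMod.homD_homD, sub_zero]
  have hfst₁ : ∀ x, (coneFst S.fromCone).hat (g₁.hat x) = 0 := by
    intro x
    rw [Homs.hat_sub, CDGMod.hat_homD]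
    simp [f₁, hap]
  -- This is the `M`-component of the closedness of `g₁`, whose own `M`-component is already zero.
  have hp₁ : ∀ x, (homs S.p).hat ((coneFst S.i).hat ((coneSnd S.fromCone).hat (g₁.hat x))) = 0 := by
    intro x
    have := congrArg (coneFst S.fromCone).hat (CDGMod.dh_hat hc₁ x)
    rwa [coneFst_dh, map_smul, hfst₁, hfst₁, map_zero, smul_zero, zero_add, homs_fromCone] at this
  obtain ⟨b, hb, hbi⟩ := S.exists_lift (Homs.comp (coneFst S.i)
    (Homs.comp (coneSnd S.fromCone) g₁ rfl) (add_zero (l + 1)))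
    ((cont_coneFst _).comp ((cont_coneSnd _).comp hg₁ _) _) (fun x => by simpa using hp₁ x)
  simp only [Homs.comp_hat] at hbi
  let f₂ : Homs P.toGrMod (CLCTMod.cone S.fromCone).toGrMod k := Homs.comp (coneInr S.fromCone)
    (Homs.comp (coneInr S.i) b (by omega : l + 1 + -1 = l)) (by omega)
  have hf₂ : Cont f₂ := (cont_coneInr _).comp ((cont_coneInr _).comp hb _) _
  let g₂ := g₁ + homD P.toCDGMod (CLCTMod.cone S.fromCone).toCDGMod hkl f₂
  have hc₂ : homD P.toCDGMod (CLCTMod.cone S.fromCone).toCDGMod rfl g₂ = 0 := by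
    rw [map_add, hc₁, CDGMod.homD_homD, add_zero]
  have hfst₂ : ∀ x, (coneFst S.fromCone).hat (g₂.hat x) = 0 := by
    intro x
    rw [Homs.hat_add, CDGMod.hat_homD, map_add, hfst₁]
    simp [f₂]
  have hfs₂ : ∀ x, (coneFst S.i).hat ((coneSnd S.fromCone).hat (g₂.hat x)) = 0 := by
    intro x
    rw [Homs.hat_add, CDGMod.hat_homD, map_add, map_add, ← hbi]
    simp [f₂]
  -- Only the `K`-component is left, and the `L`-component of closedness says that `i` kills it.
  have hss₂ : ∀ x, (coneSnd S.i).hat ((coneSnd S.fromCone).hat (g₂.hat x)) = 0 := by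
    intro x
    refine S.i_inj ?_
    have := congrArg (fun z => (coneFst S.i).hat ((coneSnd S.fromCone).hat z))
      (CDGMod.dh_hat hc₂ x)
    simp only [coneSnd_dh, map_neg, map_smul, coneFst_dh, hfs₂, map_zero, smul_zero, zero_add,
      neg_eq_zero] at this
    exact this
  have h₂ : g₂ = 0 := Homs.hat_inj fun x => cone_ext _ ((hfst₂ x).trans (map_zero _).symm)
    (cone_ext _ ((hfs₂ x).trans (by simp)) ((hss₂ x).trans (by simp)))
  refine ⟨f₁ - f₂, hf₁.sub hf₂, ?_⟩
  have h₃ : g - homD P.toCDGMod (CLCTMod.cone S.fromCone).toCDGMod hkl f₁ + homD P.toCDGMod (CLCTMod.cone S.fromCone).toCDGMod hkl f₂ = 0 :=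
    h₂
  rw [map_sub, eq_comm, ← sub_eq_zero, ← h₃]
  abel

/-- Induction over the generation of the class; relative projectivity is needed only for the
totalizations, all other closure properties hold for orthogonality as such. -/
theorem RelProjective.orth (hP : RelProjective P) (hX : X.Contraacyclic) : Orth P X := by
  induction hX with
  | tot S => exact Orth.tot hP S
  | shift M k _ h => exact h.shift k
  | cone f _ _ hM hN => exact Orth.cone f hM hN
  | pi M _ h => exact Orth.pi M h
  | retract i r h _ hN => exact Orth.retract i r h hN

/-- Maps out of `P` see morphisms whose cone is orthogonal to `P` as homotopy equivalences. -/
theorem Orth.exists_lift {f : X ⟶ Y} (h : Orth P (CLCTMod.cone f)) (y : P ⟶ Y) :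
    ∃ x : P ⟶ X, Homotopic (x ≫ f) y := by
  -- The map `inl ∘ y` is a cocycle in the Hom-complex to the cone. The `X`-component of a primitive
  -- is the lift of `y`, and the `Y`-component is, up to sign, the homotopy.
  obtain ⟨g, hg, hgy⟩ := h (neg_add_cancel 1) (Homs.comp (coneInl f) (homs y) (add_zero 0))
    ((cont_coneInl f).comp (homs_cont y) _) ((CDGMod.homD_eq_zero_iff _ _).2 fun x => by
      simp [sgn_zero])
  have key : ∀ x, (CLCTMod.cone f).dh (g.hat x) + g.hat (P.dh x) =
      (coneInl f).hat ((homs y).hat x) := fun x => by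
    rw [← Homs.comp_hat _ _ (add_zero 0), ← hgy, CDGMod.hat_homD, sgn_neg, sgn_one]
    module
  have h₁ : ∀ x, -X.dh ((coneSnd f).hat (g.hat x)) + (coneSnd f).hat (g.hat (P.dh x)) = 0 :=
    fun x => by simpa using congrArg (coneSnd f).hat (key x)
  have h₂ : ∀ x, Y.dh ((coneFst f).hat (g.hat x)) + (homs f).hat ((coneSnd f).hat (g.hat x)) +
      (coneFst f).hat (g.hat (P.dh x)) = (homs y).hat x :=
    fun x => by simpa using congrArg (coneFst f).hat (key x)
  obtain ⟨x, hx⟩ : ∃ x : P ⟶ X, homs x = Homs.comp (coneSnd f) g (neg_add_cancel 1) :=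
    ⟨ofHoms _ ((cont_coneSnd f).comp hg _) ((CDGMod.homD_eq_zero_iff _ _).2 fun x => by
      rw [Homs.comp_hat, Homs.comp_hat, sgn_zero, one_smul, ← sub_eq_zero, ← neg_eq_zero, ← h₁ x]
      abel), homs_ofHoms _ _ _⟩
  refine ⟨x, homotopic_of_homD
    (-Homs.comp (coneFst f) g (add_zero (-1))) ((cont_coneFst f).comp hg _).neg
    (Homs.hat_inj fun x => ?_)⟩
  simp only [CDGMod.hat_homD, Homs.hat_neg, Homs.comp_hat, Homs.hat_sub, homs_comp, hx,
    ← h₂, sgn_neg, sgn_one, map_neg]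
  module

/-- A homotopy `H` from `a f` to `b f`, combined with `a - b`, is a cocycle of degree `-1` with
values in the cone. The `X`-component of a primitive is a homotopy from `a` to `b`. -/
theorem Orth.homotopic {f : X ⟶ Y} (h : Orth P (CLCTMod.cone f)) {a b : P ⟶ X}
    (hab : Homotopic (a ≫ f) (b ≫ f)) : Homotopic a b := by
  obtain ⟨H, hH, hHe⟩ := homotopic_iff.1 hab
  have hH' : ∀ x, Y.dh (H.hat x) = (homs f).hat ((homs a).hat x) - (homs f).hat ((homs b).hat x) -
      H.hat (P.dh x) := fun x => by
    have := congrArg (fun f => f.hat x) hHe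
    simp only [CDGMod.hat_homD, Homs.hat_sub, homs_comp, Homs.comp_hat, sgn_neg, sgn_one] at this
    rw [← this]
    module
  obtain ⟨u, hu, hue⟩ := h (by norm_num : (-2 : ℤ) + 1 = -1) (Homs.comp (coneInl f) H (add_zero _) -
      Homs.comp (coneInr f) (homs a - homs b) (zero_add _))
    (((cont_coneInl f).comp hH _).sub ((cont_coneInr f).comp ((homs_cont a).sub (homs_cont b)) _))
    ((CDGMod.homD_eq_zero_iff _ _).2 fun x => cone_ext f (by simp [hH', sgn_neg, sgn_one])
      (by simp [sgn_neg, sgn_one]; abel))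
  refine homotopic_of_homD (Homs.comp (coneSnd f) u (by norm_num)) ((cont_coneSnd f).comp hu _)
    (Homs.hat_inj fun x => ?_)
  have := congrArg (fun g => (coneSnd f).hat (g.hat x)) hue
  simp only [CDGMod.hat_homD, map_sub, map_smul, coneSnd_dh, Homs.hat_sub, Homs.comp_hat,
    coneSnd_coneInl, coneSnd_coneInr, zero_sub] at this
  simp only [CDGMod.hat_homD, Homs.comp_hat, Homs.hat_sub, sgn_neg, sgn_one] at this ⊢
  rw [sgn_even (by decide)] at this
  rw [← neg_inj, ← this]
  module

end CLCTMod

/-! ### Morphisms in the contraderived category -/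

namespace DCtr

open CategoryTheory

variable {𝕜 : Type} [RCLike 𝕜] {A : CLCTAlg.{u} 𝕜}

/-- The functor to the homotopy category. -/
abbrev toH0 (A : CLCTAlg.{u} 𝕜) : CLCTMod.{u} A ⥤ H0 A :=
  Quotient.functor CLCTMod.Homotopic

theorem toH0_map_eq_iff {M N : CLCTMod.{u} A} (f g : M ⟶ N) :
    (toH0 A).map f = (toH0 A).map g ↔ CLCTMod.Homotopic f g :=
  Quotient.functor_map_eq_iff _ _ _

/-- Morphisms out of a module with a relatively projective resolution `P → M`. -/
theorem bijective_precomp {P M : CLCTMod.{u} A} (hP : P.RelProjective) (e : P ⟶ M)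
    (he : (CLCTMod.cone e).Contraacyclic) (X : CLCTMod.{u} A) :
    (∀ α : (Q A).obj M ⟶ (Q A).obj X, ∃ f : P ⟶ X, (Q A).map e ≫ α = (Q A).map f) ∧
    (∀ f : P ⟶ X, ∃ α : (Q A).obj M ⟶ (Q A).obj X, (Q A).map e ≫ α = (Q A).map f) ∧
    (∀ α β : (Q A).obj M ⟶ (Q A).obj X, (Q A).map e ≫ α = (Q A).map e ≫ β → α = β) ∧
    (∀ f g : P ⟶ X, (Q A).map f = (Q A).map g ↔ CLCTMod.Homotopic f g) := by
  have hW : H0.contraIso A ((toH0 A).map e) := ⟨e, rfl, he⟩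
  have hiso : IsIso ((Q A).map e) := (H0.contraIso A).Q_inverts _ hW
  -- Colocality of `P`: orthogonality to the cone of `f` gives injectivity by `Orth.homotopic` and
  -- surjectivity by `Orth.exists_lift`.
  have hb := bijective_map_of_colocal (H0.contraIso A) ((toH0 A).obj P) (fun {X Y} f hf => by
    obtain ⟨f, rfl, hf⟩ := hf
    have ho := hP.orth hf
    refine ⟨fun a b hab => ?_, fun y => ?_⟩
    · obtain ⟨a, rfl⟩ := (toH0 A).map_surjective a
      obtain ⟨b, rfl⟩ := (toH0 A).map_surjective b
      exact (toH0_map_eq_iff _ _).2 (ho.homotopic ((toH0_map_eq_iff _ _).1 (by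
        rw [Functor.map_comp, Functor.map_comp]
        exact hab)))
    · obtain ⟨y, rfl⟩ := (toH0 A).map_surjective y
      obtain ⟨x, hx⟩ := ho.exists_lift y
      exact ⟨(toH0 A).map x, ((toH0 A).map_comp _ _).symm.trans ((toH0_map_eq_iff _ _).2 hx)⟩)
    ((toH0 A).obj X)
  refine ⟨fun α => ?_, fun f => ⟨inv ((Q A).map e) ≫ (Q A).map f, by simp⟩, fun α β h => ?_,
    fun f g => ⟨fun h => ?_, fun h => ?_⟩⟩
  · obtain ⟨g, hg⟩ := hb.2 ((Q A).map e ≫ α)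
    obtain ⟨f, rfl⟩ := (toH0 A).map_surjective g
    exact ⟨f, hg.symm⟩
  · exact (cancel_epi _).1 h
  · exact (toH0_map_eq_iff _ _).1 (hb.1 h)
  · exact congrArg (H0.contraIso A).Q.map ((toH0_map_eq_iff _ _).2 h)

end DCtr

/-! ### Lifting along surjections of graded modules -/

section Lifting

variable {𝕜 : Type} [Field 𝕜] {A : CDGAlg.{u} 𝕜}

/-- The graded module `M[k]`. -/
def GrMod.shift (M : GrMod.{u} A) (k : ℤ) : GrMod.{u} A where
  C i := M.C (i + k)
  act h := M.act (by omega)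
  act_one x := by
    have : ∀ {i j : ℤ} (h : i + 0 = j) (h' : i = j) (x : M.C i), M.act h x A.one = h' ▸ x := by
      intro i j h h' x
      subst h'
      exact M.act_one x
    exact this _ rfl x
  act_act _ _ h₃ _ x y z := M.act_act _ _ h₃ _ x y z

/-- The image of an `A`-linear map of degree `0`. -/
def GrMod.range {X Y : GrMod.{u} A} (p : Homs X Y 0) : GrMod.{u} A where
  C i := LinearMap.range (p.app (add_zero i))
  act {i j n} h := LinearMap.mk₂ 𝕜
    (fun x a => ⟨Y.act h x.1 a, by
      obtain ⟨_, y, rfl⟩ := x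
      exact ⟨X.act h y a, p.app_act h _ _ h y a⟩⟩)
    (fun x y a => Subtype.ext (by simp)) (fun c x a => Subtype.ext (by simp))
    (fun x a b => Subtype.ext (by simp)) (fun c x a => Subtype.ext (by simp))
  act_one x := Subtype.ext (Y.act_one x.1)
  act_act h₁ h₂ h₃ h₄ x y z := Subtype.ext (Y.act_act h₁ h₂ h₃ h₄ x.1 y z)

/-- The identity as a map `M[k] → M` of degree `k`. -/
def GrMod.shiftOut (M : GrMod.{u} A) (k : ℤ) : Homs (M.shift k) M k :=
  Homs.mk' (fun {i j} (h : i + k = j) => h ▸ (LinearMap.id : M.C (i + k) →ₗ[𝕜] M.C (i + k))) (by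
    intro i j n i' n' h hi hn h' x a
    subst hi hn
    rfl)

/-- The identity as a map `M → M[k]` of degree `-k`. -/
def GrMod.shiftIn (M : GrMod.{u} A) (k : ℤ) : Homs M (M.shift k) (-k) :=
  Homs.mk' (fun {i j} h => (show i = j + k by omega) ▸ (LinearMap.id : M.C i →ₗ[𝕜] M.C i)) (by
    intro i j n i' n' h hi hn h' x a
    obtain rfl : i = i' + k := by omega
    obtain rfl : n = n' + k := by omega
    rfl)

theorem GrMod.shiftOut_shiftIn (M : GrMod.{u} A) (k : ℤ) (x : M.Tot) :
    (M.shiftOut k).hat ((M.shiftIn k).hat x) = x := by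
  funext j
  obtain ⟨i, rfl⟩ : ∃ i, j = i + k := ⟨j - k, by omega⟩
  rw [Homs.hat_apply _ rfl, Homs.hat_apply _ (by omega : i + k + -k = i)]
  rfl

/-- Maps out of graded-projective modules lift along maps containing their values in the image. -/
theorem IsGradedProjective.exists_lift {P X Y : GrMod.{u} A} (hP : IsGradedProjective P) {k : ℤ}
    (p : Homs X Y 0) (f : Homs P Y k) (h : ∀ x, ∃ y, p.hat y = f.hat x) :
    ∃ g : Homs P X k, ∀ x, p.hat (g.hat x) = f.hat x := by
  -- Graded projectivity speaks of degree `0` and of surjections. Both are achieved by shifting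
  -- source and target by `k` and replacing the target by the image of `p'`.
  let p' : Homs (X.shift k) (Y.shift k) 0 :=
    Homs.mk' (fun {i j} hij => p.app (by omega)) fun h hi hn h' x a => p.app_act _ _ _ _ x a
  have hp' : ∀ x, (Y.shiftOut k).hat (p'.hat x) = p.hat ((X.shiftOut k).hat x) := fun x => by
    funext j
    obtain ⟨i, rfl⟩ : ∃ i, j = i + k := ⟨j - k, by omega⟩
    rw [Homs.hat_apply _ rfl, Homs.hat_apply _ (add_zero i), Homs.hat_apply _ (add_zero _),
      Homs.hat_apply _ rfl]
    rfl
  let q : Homs (X.shift k) (GrMod.range p') 0 :=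
    Homs.mk' (fun {i j} hij => (p'.app hij).codRestrict _ fun x => by
      obtain rfl : i = j := by omega
      exact ⟨x, rfl⟩) fun h hi hn h' x a => Subtype.ext (p'.app_act h hi hn h' x a)
  let f₁ : Homs P (Y.shift k) 0 := Homs.comp (Y.shiftIn k) f (by omega)
  have hf₁ : ∀ {i j : ℤ} (hij : i + 0 = j) (x : P.C i),
      f₁.app hij x ∈ LinearMap.range (p'.app (add_zero j)) := by
    intro i j hij x
    obtain ⟨y, hy⟩ := h (Pi.single i x)
    refine ⟨y (j + k), ?_⟩
    have h1 := congrFun hy (j + k)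
    rw [p.hat_apply (add_zero _), Homs.hat_apply f (by omega : i + k = j + k),
      Pi.single_eq_same] at h1
    refine h1.trans ?_
    rw [Homs.comp_app _ _ _ _ (by omega : i + k = j + k) (by omega : j + k + -k = j)]
    rfl
  let f' : Homs P (GrMod.range p') 0 :=
    Homs.mk' (fun {i j} hij => (f₁.app hij).codRestrict _ (hf₁ hij))
      fun h hi hn h' x a => Subtype.ext (f₁.app_act h hi hn h' x a)
  obtain ⟨g, hg⟩ := hP (X.shift k) _ q f' fun i y => by
    obtain ⟨_, x, rfl⟩ := y
    exact ⟨x, rfl⟩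
  rw [Homs.precomp_eq] at hg
  refine ⟨Homs.comp (X.shiftOut k) g (zero_add k), fun x => ?_⟩
  have h2 : p'.hat (g.hat x) = f₁.hat x := by
    funext j
    have := congrArg Subtype.val (congrFun (congrArg (fun f => f.hat x) hg) j)
    rw [Homs.comp_hat, Homs.hat_apply _ (add_zero j), Homs.hat_apply _ (add_zero j)] at this
    rw [Homs.hat_apply _ (add_zero j), Homs.hat_apply _ (add_zero j)]
    exact this
  rw [Homs.comp_hat, ← hp', h2, Homs.comp_hat, Y.shiftOut_shiftIn]

end Lifting

/-! ### The product totalization of a complex of cdg-modules -/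

/-- A complex `⋯ → F 1 → F 0` of cdg-modules and closed morphisms. -/
structure CDGComplex {𝕜 : Type} [Field 𝕜] (A : CDGAlg.{u} 𝕜) where
  F : ℕ → CDGMod.{u} A
  del : ∀ n, Homs (F (n + 1)).toGrMod (F n).toGrMod 0
  del_closed : ∀ n, IsClosedHom (del n)
  del_del : ∀ n x, (del n).hat ((del (n + 1)).hat x) = 0

namespace CDGComplex

variable {𝕜 : Type} [Field 𝕜] {A : CDGAlg.{u} 𝕜} (X Y : CDGComplex.{u} A) (N : CDGMod.{u} A)

/-- The homogeneous components `∏ n, (F n)^(i+n)` of the product totalization. -/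
abbrev TotC (i : ℤ) : Type u := ∀ p : {p : ℕ × ℤ // i + p.1 = p.2}, (X.F p.1.1).C p.1.2

theorem del_d (n : ℕ) {i j : ℤ} (h : i + 1 = j) (x : (X.F (n + 1)).C i) :
    (X.del n).app (add_zero j) ((X.F (n + 1)).d h x) =
      (X.F n).d h ((X.del n).app (add_zero i) x) :=
  IsClosedHom.app_d (X.del_closed n) h x

theorem del_del_app (n : ℕ) {i : ℤ} (x : (X.F (n + 2)).C i) :
    (X.del n).app (add_zero i) ((X.del (n + 1)).app (add_zero i) x) = 0 := by
  have := congrFun (X.del_del n (Pi.single i x)) i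
  rwa [Homs.hat_apply _ (add_zero i), Homs.hat_apply _ (add_zero i), Pi.single_eq_same] at this

/-- The product totalization, with `d y n = (-1)^n (d (y n) + ∂ (y (n+1)))`. -/
def that : CDGMod.{u} A where
  C := X.TotC
  act {i j n} h := LinearMap.mk₂ 𝕜
    (fun y a p => (X.F p.1.1).act (by have := p.2; omega : i + p.1.1 + j = p.1.2)
      (y ⟨(p.1.1, i + p.1.1), rfl⟩) a)
    (fun y z a => by funext p; simp) (fun c y a => by funext p; simp)
    (fun y a b => by funext p; simp) (fun c y a => by funext p; simp)
  act_one {i} y := by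
    funext p
    obtain ⟨⟨n, j⟩, hp⟩ := p
    obtain rfl : i + (n : ℤ) = j := hp
    exact (X.F n).act_one _
  act_act {i j k a b n} h₁ h₂ h₃ h₄ y x z := by
    funext p
    subst h₁
    obtain ⟨⟨m, l⟩, hp⟩ := p
    obtain rfl : n + (m : ℤ) = l := hp
    exact (X.F m).act_act _ _ _ _ _ x z
  d {i j} h := LinearMap.pi fun p => sgn 𝕜 p.1.1 •
    ((X.F p.1.1).d (by have := p.2; omega : i + p.1.1 + 1 = p.1.2) ∘ₗ
        LinearMap.proj (⟨(p.1.1, i + p.1.1), rfl⟩ : {p : ℕ × ℤ // i + p.1 = p.2}) +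
      (X.del p.1.1).app (add_zero _) ∘ₗ LinearMap.proj (⟨(p.1.1 + 1, p.1.2), by
        have := p.2; push_cast; omega⟩ : {p : ℕ × ℤ // i + p.1 = p.2}))
  leibniz {i j n i' j' n'} h hn hi hj h₁ h₂ y a := by
    funext p
    subst hi hn hj h
    obtain ⟨⟨m, l⟩, hp⟩ := p
    obtain rfl : i + j + 1 + (m : ℤ) = l := hp
    -- The degree of the component with index `m + 1` is presented as `i + (m + 1)` on one side and
    -- as `i + 1 + m` on the other. With a variable degree `q` one of them can be substituted.
    have e : ∀ (q : ℤ) (hq : i + (m + 1 : ℕ) = q) (hq' : q + j = i + j + 1 + m),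
      (X.del m).app (add_zero _) ((X.F (m + 1)).act hq' (y ⟨(m + 1, q), hq⟩) a) =
        (X.F m).act (by omega : i + 1 + m + j = i + j + 1 + m)
          ((X.del m).app (add_zero _) (y ⟨(m + 1, i + 1 + m), by push_cast; omega⟩)) a := by
      intro q hq hq'
      obtain rfl : q = i + 1 + m := by push_cast at hq; omega
      exact (X.del m).app_act _ _ _ _ _ a
    have l1 := (X.F m).leibniz (by omega : i + m + j = i + j + m)
      (by omega : i + j + m + 1 = i + j + 1 + m) (by omega : i + m + 1 = i + 1 + m) rfl
      (by omega : i + 1 + m + j = i + j + 1 + m) (by omega : i + m + (j + 1) = i + j + 1 + m)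
      (y ⟨(m, i + m), rfl⟩) a
    have h1 := e _ rfl (by push_cast; omega)
    simp only [LinearMap.pi_apply, LinearMap.smul_apply, LinearMap.add_apply, LinearMap.comp_apply,
      LinearMap.proj_apply, LinearMap.mk₂_apply, Pi.add_apply, Pi.smul_apply, map_add, map_smul]
    rw [l1, h1, sgn_add]
    have e₂ : sgn 𝕜 i = sgn 𝕜 m * (sgn 𝕜 i * sgn 𝕜 m) := by
      linear_combination (-sgn 𝕜 i) * sgn_mul_sgn (𝕜 := 𝕜) m
    conv_rhs => rw [e₂]
    module
  d_d {i j k} h₁ h₂ h₃ y := by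
    funext p
    subst h₁ h₂
    obtain ⟨⟨m, l⟩, hp⟩ := p
    obtain rfl : i + 1 + 1 + (m : ℤ) = l := hp
    have hd : ∀ (q : ℤ) (hq : i + 1 + m = q) (hq' : q + 1 = i + 1 + 1 + m) ,
      (X.F m).d hq' ((X.F m).d (by omega : i + m + 1 = q) (y ⟨(m, i + m), rfl⟩)) =
        -(X.F m).act (by simp only at hq' hq ⊢; omega) (y ⟨(m, i + m), rfl⟩) A.B := fun q hq hq' => (X.F m).d_d _ _ _ _
    have hm : ∀ (q r : ℤ) (hq : i + (m + 1 : ℕ) = q) (hr : q + 1 = i + 1 + 1 + m)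
      (hr' : i + 1 + m + 1 = i + 1 + 1 + m),
      (X.del m).app (add_zero _) ((X.F (m + 1)).d hr (y ⟨(m + 1, q), hq⟩)) =
      (X.F m).d hr' ((X.del m).app (add_zero _) (y ⟨(m + 1, i + 1 + m), by push_cast; omega⟩)) := by
      intro q r hq hr hr'
      obtain rfl : q = i + 1 + m := by push_cast at hq; omega
      exact X.del_d m _ _
    -- The signs of consecutive components are opposite; this makes the terms with `d ∂` and `∂ d`
    -- cancel in the square.
    have hs : sgn 𝕜 ((m + 1 : ℕ) : ℤ) = -sgn 𝕜 m := by
      rw [Nat.cast_succ, sgn_add, sgn_one, mul_neg_one]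
    have hmm := hm (i + (m + 1 : ℕ)) 0 rfl (by push_cast; omega) (by omega)
    simp only [LinearMap.pi_apply, LinearMap.smul_apply, LinearMap.add_apply, LinearMap.comp_apply,
      LinearMap.proj_apply, LinearMap.mk₂_apply, Pi.neg_apply, map_add, map_smul, hs, hmm,
      hd _ rfl (by omega), X.del_del_app]
    have e := sgn_mul_sgn (𝕜 := 𝕜) m
    simp only [smul_add, smul_smul, smul_neg, neg_smul, e, one_smul, smul_zero]
    abel

/-- The projection `y ↦ y n`. -/
def pr (n : ℕ) : Homs X.that.toGrMod (X.F n).toGrMod n :=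
  Homs.mk' (fun {i j} h => LinearMap.proj (⟨(n, j), h⟩ : {p : ℕ × ℤ // i + p.1 = p.2})) (by
    intro i j m i' m' h hi hn h' x a
    subst hi
    rfl)

variable {X} in
theorem that_ext {x y : X.that.Tot} (h : ∀ n, (X.pr n).hat x = (X.pr n).hat y) : x = y := by
  funext i p
  obtain ⟨⟨n, j⟩, hp⟩ := p
  have h1 := congrFun (h n) j
  rw [Homs.hat_apply _ hp, Homs.hat_apply _ hp] at h1
  exact h1

theorem pr_dh (n : ℕ) (x : X.that.Tot) : (X.pr n).hat (X.that.dh x) =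
    sgn 𝕜 n • ((X.F n).dh ((X.pr n).hat x) + (X.del n).hat ((X.pr (n + 1)).hat x)) := by
  funext j
  obtain ⟨i, rfl⟩ : ∃ i, j = i + 1 + n := ⟨j - 1 - n, by omega⟩
  rw [Homs.hat_apply _ rfl, CDGMod.dh_apply _ rfl, Pi.smul_apply, Pi.add_apply,
    CDGMod.dh_apply _ (by omega : i + n + 1 = i + 1 + n), Homs.hat_apply _ rfl,
    Homs.hat_apply _ (add_zero _), Homs.hat_apply (X.pr (n + 1))
      (by push_cast; omega : i + (n + 1 : ℕ) = i + 1 + n)]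
  rfl

/-- The components of the inclusion of `F n`. -/
def incApp (n : ℕ) {i j : ℤ} (h : i + -n = j) : (X.F n).C i →ₗ[𝕜] X.TotC j :=
  LinearMap.pi fun p => if hp : n = p.1.1 then
    hp ▸ (show i = p.1.2 by have := p.2; omega) ▸ LinearMap.id else 0

theorem incApp_same (n : ℕ) {i j : ℤ} (h : i + -n = j) (x : (X.F n).C i) (h' : j + n = i) :
    X.incApp n h x ⟨(n, i), h'⟩ = x := by
  have : (if hp : n = n then (hp ▸ (rfl : i = i) ▸ LinearMap.id : (X.F n).C i →ₗ[𝕜] (X.F n).C i)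
      else 0) x = x := by rw [dif_pos rfl]; rfl
  exact this

theorem incApp_ne {m n : ℕ} (hm : m ≠ n) {i j l : ℤ} (h : i + -n = j) (x : (X.F n).C i)
    (h' : j + m = l) : X.incApp n h x ⟨(m, l), h'⟩ = 0 := by
  simp only [incApp, LinearMap.pi_apply]
  rw [dif_neg fun h => hm h.symm]
  rfl

/-- The inclusion of `F n`. -/
def inc (n : ℕ) : Homs (X.F n).toGrMod X.that.toGrMod (-n) :=
  Homs.mk' (fun h => X.incApp n h) (by
    intro i j m i' m' h hi hn h' x a
    funext p
    obtain ⟨⟨q, l⟩, hp⟩ := p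
    change X.incApp n hn _ ⟨(q, l), hp⟩ = (X.F q).act _ (X.incApp n hi x ⟨(q, i' + q), rfl⟩) a
    by_cases hq : q = n
    · subst hq
      obtain rfl : i' + (q : ℤ) = i := by omega
      obtain rfl : m = l := by simp only at hp; omega
      rw [incApp_same, incApp_same]
    · rw [incApp_ne _ hq, incApp_ne _ hq, map_zero, LinearMap.zero_apply])

theorem pr_inc_same (n : ℕ) (x : (X.F n).Tot) : (X.pr n).hat ((X.inc n).hat x) = x := by
  funext j
  rw [Homs.hat_apply _ (sub_add_cancel j n), Homs.hat_apply _ (by omega : j + -n = j - n)]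
  exact X.incApp_same n (by omega : j + -n = j - n) _ (sub_add_cancel j n)

theorem pr_inc_ne {m n : ℕ} (h : m ≠ n) (x : (X.F n).Tot) :
    (X.pr m).hat ((X.inc n).hat x) = 0 := by
  funext j
  rw [Homs.hat_apply _ (sub_add_cancel j m), Homs.hat_apply _ (by omega : j - m + n + -n = j - m)]
  exact X.incApp_ne h (by omega : j - m + n + -n = j - m) _ (sub_add_cancel j m)

theorem dh_inc_zero (x : (X.F 0).Tot) :
    X.that.dh ((X.inc 0).hat x) = (X.inc 0).hat ((X.F 0).dh x) := by
  refine that_ext fun m => ?_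
  rw [pr_dh, X.pr_inc_ne m.succ_ne_zero]
  rcases eq_or_ne m 0 with rfl | hm
  · simp [pr_inc_same, sgn_zero]
  · simp [pr_inc_ne _ hm]

theorem dh_inc_succ (n : ℕ) (x : (X.F (n + 1)).Tot) :
    X.that.dh ((X.inc (n + 1)).hat x) = sgn 𝕜 (n + 1) • (X.inc (n + 1)).hat ((X.F (n + 1)).dh x) +
      sgn 𝕜 n • (X.inc n).hat ((X.del n).hat x) := by
  refine that_ext fun m => ?_
  rw [pr_dh, map_add, map_smul, map_smul]
  rcases eq_or_ne m n with rfl | hm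
  · rw [X.pr_inc_same, X.pr_inc_same, X.pr_inc_ne (by omega), X.pr_inc_ne (by omega)]
    simp
  · rw [X.pr_inc_ne hm, X.pr_inc_ne (by omega : m + 1 ≠ n + 1)]
    rcases eq_or_ne m (n + 1) with rfl | hm'
    · rw [X.pr_inc_same, X.pr_inc_same]
      simp
    · rw [X.pr_inc_ne hm', X.pr_inc_ne hm']
      simp

variable {X N}

/-- `f` depends only on the components `y n`, `n < m`. -/
def SuppLT {N : GrMod.{u} A} {k : ℤ} (m : ℕ) (f : Homs X.that.toGrMod N k) : Prop :=
  ∀ x, (∀ n < m, (X.pr n).hat x = 0) → f.hat x = 0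

/-- The `n`-th component of `d y` involves `y n` and `y (n + 1)`, so composition with `d` raises the
bound by one. -/
theorem SuppLT.dh {N : GrMod.{u} A} {k : ℤ} {m : ℕ} {f : Homs X.that.toGrMod N k}
    (hf : SuppLT m f) {x : X.that.Tot} (hx : ∀ n < m + 1, (X.pr n).hat x = 0) :
    f.hat (X.that.dh x) = 0 :=
  hf _ fun n hn => by rw [pr_dh, hx n (by omega), hx (n + 1) (by omega)]; simp

theorem hat_sum {M N : GrMod.{u} A} {k : ℤ} {ι : Type*} (s : Finset ι) (f : ι → Homs M N k)
    (x : M.Tot) : (∑ i ∈ s, f i).hat x = ∑ i ∈ s, (f i).hat x := by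
  classical
  induction s using Finset.induction_on with
  | empty => simp
  | insert a s ha ih => rw [Finset.sum_insert ha, Finset.sum_insert ha, Homs.hat_add, ih]

/-- The difference between `x` and the sum of its first `m` components vanishes in these components,
hence is killed by `f`. So `f` is determined by its restrictions to the first `m` members. -/
theorem SuppLT.eq_sum {N : GrMod.{u} A} {k : ℤ} {m : ℕ} {f : Homs X.that.toGrMod N k}
    (hf : SuppLT m f) (x : X.that.Tot) :
    f.hat x = ∑ n ∈ Finset.range m, f.hat ((X.inc n).hat ((X.pr n).hat x)) := by
  rw [← map_sum, ← sub_eq_zero, ← map_sub]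
  refine hf _ fun n hn => ?_
  rw [map_sub, map_sum, Finset.sum_eq_single_of_mem n (Finset.mem_range.2 hn)
    fun l _ hl => X.pr_inc_ne hl.symm _, X.pr_inc_same, sub_self]

theorem SuppLT.inc_eq_zero {N : GrMod.{u} A} {k : ℤ} {m n : ℕ} {f : Homs X.that.toGrMod N k}
    (hf : SuppLT m f) (h : m ≤ n) (x : (X.F n).Tot) : f.hat ((X.inc n).hat x) = 0 :=
  hf _ fun l hl => X.pr_inc_ne (by omega) x

/-- Maps which depend on finitely many components lift. -/
theorem SuppLT.exists_lift (hX : ∀ n, IsGradedProjective (X.F n).toGrMod) {M N : GrMod.{u} A}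
    {k : ℤ} {m : ℕ} {f : Homs X.that.toGrMod N k} (hf : SuppLT m f) (p : Homs M N 0)
    (h : ∀ x, ∃ y, p.hat y = f.hat x) :
    ∃ g : Homs X.that.toGrMod M k, SuppLT m g ∧ ∀ x, p.hat (g.hat x) = f.hat x := by
  choose g hg using fun n => (hX n).exists_lift p (Homs.comp f (X.inc n) rfl) fun x => by
    rw [Homs.comp_hat]
    exact h _
  refine ⟨∑ n ∈ Finset.range m, Homs.comp (g n) (X.pr n) (by omega), fun x hx => ?_, fun x => ?_⟩
  · rw [hat_sum]
    refine Finset.sum_eq_zero fun n hn => ?_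
    rw [Homs.comp_hat, hx n (Finset.mem_range.1 hn), map_zero]
  · rw [hat_sum, map_sum, hf.eq_sum]
    refine Finset.sum_congr rfl fun n _ => ?_
    rw [Homs.comp_hat, hg, Homs.comp_hat]

end CDGComplex

/-! ### Comparison of resolutions and Ext of the second kind -/

section Exactness

variable {𝕜 : Type} [Field 𝕜] {A : CDGAlg.{u} 𝕜} {L M N : GrMod.{u} A}

theorem Homs.exists_hat_eq {p : Homs M N 0} (h : ∀ i, Function.Surjective (p.app (add_zero i)))
    (y : N.Tot) : ∃ x, p.hat x = y := by
  choose x hx using fun j => h j (y j)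
  refine ⟨x, funext fun j => ?_⟩
  rw [Homs.hat_apply _ (add_zero j), hx]

theorem Homs.exists_hat_eq_of_exact {f : Homs L M 0} {g : Homs M N 0}
    (h : ∀ i, Function.Exact (f.app (add_zero i)) (g.app (add_zero i))) (y : M.Tot)
    (hy : g.hat y = 0) : ∃ x, f.hat x = y := by
  choose x hx using fun j => (h j (y j)).1 (by
    have := congrFun hy j
    rwa [Homs.hat_apply _ (add_zero j)] at this)
  refine ⟨x, funext fun j => ?_⟩
  rw [Homs.hat_apply _ (add_zero j), hx]

end Exactness

namespace CDGComplex

variable {𝕜 : Type} [Field 𝕜] {A : CDGAlg.{u} 𝕜} {X Y Z E : CDGComplex.{u} A} {N : CDGMod.{u} A}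

/-- The complex is a resolution of its zeroth term. -/
structure Exact (E : CDGComplex.{u} A) : Prop where
  surj : ∀ y, ∃ x, (E.del 0).hat x = y
  exact : ∀ n y, (E.del n).hat y = 0 → ∃ x, (E.del (n + 1)).hat x = y

/-- The basic lemma of homological algebra for maps from a product totalization. -/
theorem Exact.exists_solution (hE : E.Exact) (hX : ∀ n, IsGradedProjective (X.F n).toGrMod)
    (r s : ℕ → ℤ) (hr : ∀ m, r m + 1 = s m) (hrs : ∀ m, r (m + 1) = s m)
    (a : ∀ m : ℕ, Homs X.that.toGrMod (E.F m).toGrMod (s m)) (hs : ∀ m, SuppLT (m + 1) (a m))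
    (ha : ∀ m x, (E.F m).dh ((a m).hat x) - sgn 𝕜 (s m) • (a m).hat (X.that.dh x) =
      (E.del m).hat ((a (m + 1)).hat x)) :
    ∃ b : ∀ m : ℕ, Homs X.that.toGrMod (E.F m).toGrMod (r m), b 0 = 0 ∧
      (∀ m, SuppLT m (b m)) ∧ ∀ m x, (E.del m).hat ((b (m + 1)).hat x) +
        ((E.F m).dh ((b m).hat x) + sgn 𝕜 (s m) • (b m).hat (X.that.dh x)) = (a m).hat x := by
  -- A state of the recursion is a map `b m` for which the equation determining `b (m + 1)` can be
  -- solved pointwise; `SuppLT.exists_lift` turns this into an `A`-linear solution.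
  let S : ℕ → Type u := fun m => {b : Homs X.that.toGrMod (E.F m).toGrMod (r m) //
    SuppLT m b ∧ ∀ x, ∃ y, (E.del m).hat y =
      (a m).hat x - ((E.F m).dh (b.hat x) + sgn 𝕜 (s m) • b.hat (X.that.dh x))}
  have step : ∀ m (b : S m), ∃ b' : S (m + 1), ∀ x, (E.del m).hat (b'.1.hat x) +
      ((E.F m).dh (b.1.hat x) + sgn 𝕜 (s m) • b.1.hat (X.that.dh x)) = (a m).hat x := by
    rintro m ⟨b, hb, hl⟩
    have e : sgn 𝕜 (s m) = -sgn 𝕜 (r m) := by rw [← hr, sgn_add, sgn_one, mul_neg_one]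
    let c := a m - homD X.that (E.F m) (hr m) b
    have hc : ∀ x, c.hat x =
        (a m).hat x - ((E.F m).dh (b.hat x) + sgn 𝕜 (s m) • b.hat (X.that.dh x)) := fun x => by
      rw [Homs.hat_sub, CDGMod.hat_homD, e, neg_smul, sub_eq_add_neg (CDGMod.dh _ _)]
    have hcs : SuppLT (m + 1) c := fun x hx => by
      rw [hc, hs m x hx, hb x fun n hn => hx n (by omega), hb.dh hx]
      simp
    obtain ⟨b', hb', hbc⟩ := hcs.exists_lift hX (E.del m) fun x => by
      rw [hc]
      exact hl x
    have hkey : ∀ x, (E.del m).hat (b'.hat x) +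
        ((E.F m).dh (b.hat x) + sgn 𝕜 (s m) • b.hat (X.that.dh x)) = (a m).hat x := fun x => by
      rw [hbc, hc, sub_add_cancel]
    -- Composition with the identity only renames the degree `s m` as `r (m + 1)`.
    let c' : Homs X.that.toGrMod (E.F (m + 1)).toGrMod (r (m + 1)) :=
      Homs.comp (Homs.id _) b' (by rw [hrs, add_zero])
    have hc' : ∀ x, c'.hat x = b'.hat x := fun x => by rw [Homs.comp_hat, Homs.id_hat]
    refine ⟨⟨c', fun x hx => by rw [hc', hb' x hx], fun x => hE.exact m _ ?_⟩, fun x => by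
      rw [← hkey, hc']⟩
    have e' : sgn 𝕜 (s (m + 1)) = -sgn 𝕜 (s m) := by
      rw [← hr, hrs, sgn_add, sgn_one, mul_neg_one]
    have h1 : ∀ x, (E.del m).hat (b'.hat x) = (a m).hat x -
        ((E.F m).dh (b.hat x) + sgn 𝕜 (s m) • b.hat (X.that.dh x)) := fun x => by
      rw [← hkey, add_sub_cancel_right]
    -- The next right-hand side is a cycle for `del m`, so exactness makes the next equation
    -- solvable: `ha` rewrites `∂ a`, and the remaining `d²` terms cancel because `b` commutes with
    -- `d²`.
    rw [map_sub, map_add, map_smul, ← ha, hc', hc', ← CDGMod.dh_hat₀ (E.del_closed m), h1, h1, e',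
      CDGMod.hat_dh_dh]
    simp only [map_sub, map_add, map_smul, smul_sub, smul_add, neg_smul, smul_smul, neg_mul,
      sgn_mul_sgn, one_smul]
    abel
  choose nxt hnxt using step
  -- The recursion starts with `b 0 = 0`, where the first equation is solvable because `del 0` is
  -- surjective.
  let t : ∀ m, S m := fun m => Nat.rec ⟨0, fun x _ => rfl, fun x => hE.surj _⟩ nxt m
  exact ⟨fun m => (t m).1, rfl, fun m => (t m).2.1, fun m x => hnxt m (t m) x⟩

/-- A map of product totalizations is filtered if its `n`-th component depends only on the
components up to `n`. -/
def Filtered {k : ℤ} (f : Homs X.that.toGrMod Y.that.toGrMod k) : Prop :=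
  ∀ m, SuppLT (m + 1) (Homs.comp (Y.pr m) f rfl)

/-- Precomposition with a filtered map does not raise the bound on the support. This lets maps
between product totalizations act on the direct sum totalization. -/
theorem SuppLT.comp_filtered {N : GrMod.{u} A} {k l n : ℤ} {m : ℕ} {φ : Homs Y.that.toGrMod N k}
    (hφ : SuppLT m φ) {f : Homs X.that.toGrMod Y.that.toGrMod l} (hf : Filtered f)
    (h : l + k = n) : SuppLT m (Homs.comp φ f h) := fun x hx => by
  rw [Homs.comp_hat]
  refine hφ _ fun i hi => ?_
  rw [← Homs.comp_hat _ _ rfl]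
  exact hf i x fun j hj => hx j (by omega)

theorem Filtered.comp {k l n : ℤ} {g : Homs Y.that.toGrMod Z.that.toGrMod k} (hg : Filtered g)
    {f : Homs X.that.toGrMod Y.that.toGrMod l} (hf : Filtered f) (h : l + k = n) :
    Filtered (Homs.comp g f h) := fun m x hx => by
  have := (hg m).comp_filtered hf rfl x hx
  rwa [Homs.comp_hat, Homs.comp_hat] at this ⊢

theorem filtered_id : Filtered (Homs.id X.that.toGrMod) := fun m x hx => by
  rw [Homs.comp_hat, Homs.id_hat]
  exact hx m m.lt_succ_self

theorem Filtered.sub {k : ℤ} {f g : Homs X.that.toGrMod Y.that.toGrMod k} (hf : Filtered f)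
    (hg : Filtered g) : Filtered (f - g) := fun m x hx => by
  have h1 := hf m x hx
  have h2 := hg m x hx
  rw [Homs.comp_hat] at h1 h2 ⊢
  rw [Homs.hat_sub, map_sub, h1, h2, sub_zero]

/-- The map to a product totalization with given components. -/
def toThat {M : GrMod.{u} A} {k : ℤ} (f : ∀ m : ℕ, Homs M (Y.F m).toGrMod (k + m)) :
    Homs M Y.that.toGrMod k :=
  Homs.mk' (fun {i j} h => LinearMap.pi fun p => (f p.1.1).app (by have := p.2; omega)) (by
    intro i j n i' n' h hi hn h' x a
    funext p
    exact (f p.1.1).app_act _ _ _ _ x a)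

theorem pr_toThat {M : GrMod.{u} A} {k : ℤ} (f : ∀ m : ℕ, Homs M (Y.F m).toGrMod (k + m)) (m : ℕ)
    (x : M.Tot) : (Y.pr m).hat ((toThat f).hat x) = (f m).hat x := by
  funext j
  rw [Homs.hat_apply _ (sub_add_cancel j m), Homs.hat_apply _ (by omega : j - m - k + k = j - m),
    Homs.hat_apply _ (by omega : j - m - k + (k + m) = j)]
  rfl

theorem toThat_filtered {k : ℤ} {f : ∀ m : ℕ, Homs X.that.toGrMod (Y.F m).toGrMod (k + m)}
    (hf : ∀ m, SuppLT (m + 1) (f m)) : Filtered (toThat f) := fun m x hx => by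
  rw [Homs.comp_hat, pr_toThat]
  exact hf m x hx

end CDGComplex

/-! ### Filtered maps between product totalizations of resolutions -/

namespace GPResolution

open CDGComplex

variable {𝕜 : Type} [Field 𝕜] {A : CDGAlg.{u} 𝕜} {M : CDGMod.{u} A} (R S : GPResolution M)
  (N : CDGMod.{u} A)

theorem aug_del (x : (R.F 1).Tot) : R.aug.hat ((R.del 0).hat x) = 0 := funext fun j => by
  rw [Homs.hat_apply _ (add_zero j), Homs.hat_apply _ (add_zero j)]
  exact (R.exact_zero j).apply_apply_eq_zero _

theorem del_del (n : ℕ) (x : (R.F (n + 2)).Tot) :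
    (R.del n).hat ((R.del (n + 1)).hat x) = 0 := funext fun j => by
  rw [Homs.hat_apply _ (add_zero j), Homs.hat_apply _ (add_zero j)]
  exact (R.exact_succ n j).apply_apply_eq_zero _

/-- The complex `⋯ → F 1 → F 0`. -/
def complex : CDGComplex.{u} A where
  F := R.F
  del := R.del
  del_closed := R.del_closed
  del_del := R.del_del

/-- The complex `⋯ → F 1 → F 0 → M`. -/
def augComplex : CDGComplex.{u} A where
  F n := match n with
    | 0 => M
    | n + 1 => R.F n
  del n := match n with
    | 0 => R.aug
    | n + 1 => R.del n
  del_closed n := match n with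
    | 0 => R.aug_closed
    | n + 1 => R.del_closed n
  del_del n := match n with
    | 0 => R.aug_del
    | n + 1 => R.del_del n

theorem augComplex_exact : R.augComplex.Exact where
  surj := Homs.exists_hat_eq R.aug_surj
  exact n := match n with
    | 0 => Homs.exists_hat_eq_of_exact R.exact_zero
    | n + 1 => Homs.exists_hat_eq_of_exact (R.exact_succ n)

/-- The projection to `F n`. -/
def pr (n : ℕ) : Homs R.complex.that.toGrMod (R.F n).toGrMod n := R.complex.pr n

theorem pr_dh (n : ℕ) (x : R.complex.that.Tot) : (R.pr n).hat (R.complex.that.dh x) =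
    sgn 𝕜 n • ((R.F n).dh ((R.pr n).hat x) + (R.del n).hat ((R.pr (n + 1)).hat x)) :=
  R.complex.pr_dh n x

/-- The augmentation of the product totalization. -/
def thatAug : Homs R.complex.that.toGrMod M.toGrMod 0 :=
  Homs.comp R.aug (R.pr 0) (by simp)

@[simp] theorem thatAug_hat (x : R.complex.that.Tot) :
    R.thatAug.hat x = R.aug.hat ((R.pr 0).hat x) :=
  Homs.comp_hat _ _ _ _

theorem thatAug_closed : IsClosedHom R.thatAug := (CDGMod.homD_eq_zero_iff _ _).2 fun x => by
  rw [thatAug_hat, thatAug_hat, pr_dh, map_smul, map_add, aug_del, CDGMod.dh_hat₀ R.aug_closed]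
  simp [sgn_zero]

variable {R S} in
/-- Closedness of a map to a product totalization, in terms of the components. -/
theorem homD_toThat_eq_zero {X : CDGMod.{u} A} (f : Homs X.toGrMod R.complex.that.toGrMod 0)
    (h : ∀ n x, (R.pr n).hat (f.hat (X.dh x)) = sgn 𝕜 n •
      ((R.F n).dh ((R.pr n).hat (f.hat x)) + (R.del n).hat ((R.pr (n + 1)).hat (f.hat x)))) :
    IsClosedHom f := (CDGMod.homD_eq_zero_iff _ _).2 fun x => that_ext fun n => by
  rw [sgn_zero, one_smul]
  exact (R.pr_dh n _).trans (h n x).symm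

/-- Resolutions map to each other. -/
theorem exists_filtered : ∃ f : Homs R.complex.that.toGrMod S.complex.that.toGrMod 0,
    IsClosedHom f ∧ Filtered f ∧ ∀ x, S.thatAug.hat (f.hat x) = R.thatAug.hat x := by
  -- In the augmented complex the index is raised by one: `b (m + 1)` is the component of the
  -- comparison map in `S.F m`, of degree `m`, and `b 0`, with values in `M`, is zero. The only
  -- non-zero right-hand side is the augmentation of `R`, at `M`.
  let r : ℕ → ℤ
    | 0 => -1
    | m + 1 => 0 + (m : ℤ)
  let a : ∀ m : ℕ, Homs R.complex.that.toGrMod (S.augComplex.F m).toGrMod (0 + (m : ℤ)) := fun m =>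
    match m with
    | 0 => R.thatAug
    | m + 1 => 0
  obtain ⟨b, hb0, hbs, hb⟩ := S.augComplex_exact.exists_solution (X := R.complex) R.proj r
    (fun m => 0 + (m : ℤ))
    (fun m => match m with
      | 0 => rfl
      | m + 1 => by simp only [r]; push_cast; ring) (fun m => rfl) a
    (fun m => match m with
      | 0 => fun x hx => (R.thatAug_hat x).trans (by
          rw [show (R.pr 0).hat x = 0 from hx 0 Nat.zero_lt_one]
          exact map_zero _)
      | m + 1 => fun x hx => rfl)
    (fun m => match m with
      | 0 => fun x => by
        have := CDGMod.dh_hat₀ R.thatAug_closed x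
        change M.dh (R.thatAug.hat x) - sgn 𝕜 0 • R.thatAug.hat _ = S.aug.hat 0
        rw [this, sgn_zero, one_smul, sub_self, map_zero]
      | m + 1 => fun x => by
        have h0 : ∀ m x, (a (m + 1)).hat x = 0 := fun _ _ => rfl
        rw [h0, h0, h0, map_zero, smul_zero, sub_zero, map_zero])
  let f : ∀ m : ℕ, Homs R.complex.that.toGrMod (S.F m).toGrMod (0 + (m : ℤ)) := fun m => b (m + 1)
  have hpr : ∀ m x, (S.pr m).hat ((toThat (Y := S.complex) f).hat x) = (f m).hat x :=
    fun m x => pr_toThat (Y := S.complex) f m x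
  refine ⟨toThat (Y := S.complex) f, homD_toThat_eq_zero _ fun n x => ?_,
    toThat_filtered fun m x hx => hbs (m + 1) x hx, fun x => ?_⟩
  · rw [hpr, hpr, hpr]
    have h1 : (S.del n).hat ((f (n + 1)).hat x) + ((S.F n).dh ((f n).hat x) +
      sgn 𝕜 (0 + (n + 1 : ℕ)) • (f n).hat (R.complex.that.dh x)) = 0 := hb (n + 1) x
    have e : sgn 𝕜 (0 + (n + 1 : ℕ)) = -sgn 𝕜 n := by
      rw [zero_add, Nat.cast_succ, sgn_add, sgn_one, mul_neg_one]
    rw [e, ← add_assoc, neg_smul, ← sub_eq_add_neg, sub_eq_zero] at h1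
    rw [add_comm ((S.F n).dh _), h1, smul_smul, sgn_mul_sgn, one_smul]
  · have h1 := hb 0 x
    rw [hb0] at h1
    simp only [Homs.hat_zero, map_zero, smul_zero, add_zero] at h1
    rw [thatAug_hat, hpr]
    exact h1

/-- Filtered maps which vanish in `M` are filtered null-homotopic. -/
theorem exists_filtered_homotopy (φ : Homs R.complex.that.toGrMod S.complex.that.toGrMod 0)
    (hφ : IsClosedHom φ) (hφs : Filtered φ) (h0 : ∀ x, S.thatAug.hat (φ.hat x) = 0) :
    ∃ h : Homs R.complex.that.toGrMod S.complex.that.toGrMod (-1), Filtered h ∧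
      homD R.complex.that S.complex.that (neg_add_cancel 1) h = φ := by
  have hφ' : ∀ n x, (S.pr n).hat (φ.hat (R.complex.that.dh x)) = sgn 𝕜 n •
      ((S.F n).dh ((S.pr n).hat (φ.hat x)) + (S.del n).hat ((S.pr (n + 1)).hat (φ.hat x))) :=
    fun n x => by rw [← CDGMod.dh_hat₀ hφ, pr_dh]
  -- As for the comparison map, with all degrees lowered by one. Now the right-hand side at `M` is
  -- zero, and at `S.F m` it is the component of `φ` with the sign `(-1)^m` of the total
  -- differential.
  let r : ℕ → ℤ
    | 0 => -2
    | m + 1 => -1 + (m : ℤ)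
  let a : ∀ m : ℕ, Homs R.complex.that.toGrMod (S.augComplex.F m).toGrMod (-1 + (m : ℤ)) := fun m =>
    match m with
    | 0 => 0
    | m + 1 => (sgn 𝕜 m • Homs.comp (S.pr m) φ (by push_cast; ring) :
        Homs R.complex.that.toGrMod (S.F m).toGrMod (-1 + (m + 1 : ℕ)))
  have ha : ∀ m x, (a (m + 1)).hat x = sgn 𝕜 m • (S.pr m).hat (φ.hat x) := fun m x => by
    change (sgn 𝕜 m • Homs.comp (S.pr m) φ _ :
        Homs R.complex.that.toGrMod (S.F m).toGrMod (-1 + (m + 1 : ℕ))).hat x = _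
    rw [Homs.hat_smul, Homs.comp_hat]
  have hsφ : ∀ m x, (∀ n < m + 1, (R.complex.pr n).hat x = 0) → (S.pr m).hat (φ.hat x) = 0 :=
    fun m x hx => by
      have := hφs m x hx
      rwa [Homs.comp_hat] at this
  obtain ⟨b, hb0, hbs, hb⟩ := S.augComplex_exact.exists_solution (X := R.complex) R.proj r
    (fun m => -1 + (m : ℤ))
    (fun m => match m with
      | 0 => rfl
      | m + 1 => by simp only [r]; push_cast; ring) (fun m => rfl) a
    (fun m => match m with
      | 0 => fun x hx => rfl
      | m + 1 => fun x hx => (ha m x).trans (by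
          rw [hsφ m x fun n hn => hx n (by omega)]
          exact smul_zero (A := (S.F m).Tot) _))
    (fun m => match m with
      | 0 => fun x => by
        have h1 := h0 x
        rw [thatAug_hat] at h1
        rw [ha 0 x]
        have h2 : ∀ x, (a 0).hat x = 0 := fun _ => rfl
        rw [h2, h2, map_zero, smul_zero, sub_zero]
        exact ((S.aug.hat.map_smul _ _).trans ((congrArg _ h1).trans
          (smul_zero (A := M.Tot) _))).symm
      | m + 1 => fun x => by
        rw [ha (m + 1) x, ha m x, ha m]
        -- The compatibility between consecutive right-hand sides is the closedness of `φ`, read in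
        -- component `m`.
        have h2 : ∀ z w : (S.F m).Tot, ∀ v : (S.F (m + 1)).Tot,
            w = sgn 𝕜 m • ((S.F m).dh z + (S.del m).hat v) →
            (S.F m).dh (sgn 𝕜 m • z) - sgn 𝕜 (-1 + (m + 1 : ℕ)) • sgn 𝕜 m • w =
              (S.del m).hat (sgn 𝕜 (m + 1 : ℕ) • v) := by
          rintro z _ v rfl
          rw [map_smul, map_smul, Nat.cast_succ, neg_add_cancel_comm_assoc, sgn_add, sgn_one,
            smul_smul (sgn 𝕜 _) (sgn 𝕜 _) (_ + _), sgn_mul_sgn]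
          module
        exact h2 _ _ _ (hφ' m x))
  let f : ∀ m : ℕ, Homs R.complex.that.toGrMod (S.F m).toGrMod (-1 + (m : ℤ)) := fun m => b (m + 1)
  have hpr : ∀ m x, (S.pr m).hat ((toThat (Y := S.complex) f).hat x) = (f m).hat x :=
    fun m x => pr_toThat (Y := S.complex) f m x
  refine ⟨toThat (Y := S.complex) f, toThat_filtered fun m x hx => hbs (m + 1) x hx,
    Homs.hat_inj fun x => that_ext fun n => ?_⟩
  have h1 : (S.del n).hat ((f (n + 1)).hat x) + ((S.F n).dh ((f n).hat x) +
    sgn 𝕜 (-1 + (n + 1 : ℕ)) • (f n).hat (R.complex.that.dh x)) =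
      sgn 𝕜 n • (S.pr n).hat (φ.hat x) := (hb (n + 1) x).trans (ha n x)
  have e : sgn 𝕜 (-1 + (n + 1 : ℕ)) = sgn 𝕜 n := by
    rw [Nat.cast_succ, neg_add_cancel_comm_assoc]
  rw [e] at h1
  have h2 := congrArg (fun z => sgn 𝕜 n • z) h1
  simp only [smul_add, smul_smul, sgn_mul_sgn, one_smul] at h2
  rw [CDGMod.hat_homD, map_sub, map_smul]
  refine Eq.trans ?_ h2
  refine (congrArg₂ (fun a b : (S.F n).Tot => a - sgn 𝕜 (-1) • b) (S.pr_dh n _)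
    (hpr n _)).trans ?_
  rw [hpr, hpr, sgn_neg, sgn_one]
  module

/-! ### The direct sum totalization as maps of finite support out of the product totalization -/

section Cohomology

variable {N} {k l : ℤ}

/-- The inclusion of `F n` into the product totalization. -/
def inc (n : ℕ) : Homs (R.F n).toGrMod R.complex.that.toGrMod (-n) := R.complex.inc n

theorem dh_inc_zero (x : (R.F 0).Tot) :
    R.complex.that.dh ((R.inc 0).hat x) = (R.inc 0).hat ((R.F 0).dh x) := R.complex.dh_inc_zero x

theorem dh_inc_succ (n : ℕ) (x : (R.F (n + 1)).Tot) :
    R.complex.that.dh ((R.inc (n + 1)).hat x) = sgn 𝕜 (n + 1) • (R.inc (n + 1)).hat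
      ((R.F (n + 1)).dh x) + sgn 𝕜 n • (R.inc n).hat ((R.del n).hat x) := R.complex.dh_inc_succ n x

/-- The family `(-1)^(kn) φ ∘ ι_n` of a map `φ` of degree `k` out of the product totalization. -/
def fam (N : CDGMod.{u} A) (k : ℤ) :
    Homs R.complex.that.toGrMod N.toGrMod k →ₗ[𝕜] R.Fam N k where
  toFun φ n := sgn 𝕜 (k * n) • Homs.comp φ (R.inc n) (by ring)
  map_add' φ ψ := funext fun n => Homs.hat_inj fun x => by
    rw [Pi.add_apply]
    simp
  map_smul' c φ := funext fun n => Homs.hat_inj fun x => by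
    rw [Pi.smul_apply]
    simp only [Homs.hat_smul, Homs.comp_hat, RingHom.id_apply]
    rw [smul_comm]

theorem fam_hat (φ : Homs R.complex.that.toGrMod N.toGrMod k) (n : ℕ) (x : (R.F n).Tot) :
    (R.fam N k φ n).hat x = sgn 𝕜 (k * n) • φ.hat ((R.inc n).hat x) := by
  refine (Homs.hat_smul _ _ _).trans ?_
  rw [Homs.comp_hat]

/-- The sign `(-1)^(kn)` in `fam` is chosen to make this hold without further signs; in component `n
+ 1` the two terms of `d ι` match the two terms of `totD`. -/
theorem totD_fam (h : k + 1 = l) (φ : Homs R.complex.that.toGrMod N.toGrMod k) :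
    R.totD N h (R.fam N k φ) = R.fam N l (homD R.complex.that N h φ) := by
  funext n
  refine Homs.hat_inj fun x => ?_
  rw [fam_hat, CDGMod.hat_homD]
  rcases n with _ | n
  · have e : ∀ q : ℤ, sgn 𝕜 (q * (0 : ℕ)) = 1 := fun q => by simp [sgn_zero]
    rw [totD_zero, CDGMod.hat_homD, fam_hat, fam_hat, e, e, dh_inc_zero, one_smul, one_smul,
      one_smul]
    simp only [CharP.cast_eq_zero, sub_zero]
  · rw [totD_succ, Homs.precomp_eq, dh_inc_succ]
    simp only [Homs.hat_add, Homs.hat_smul, CDGMod.hat_homD, Homs.comp_hat, fam_hat, map_add,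
      map_smul]
    have s1 : sgn 𝕜 (l * (n + 1 : ℕ)) = sgn 𝕜 (k * n) * sgn 𝕜 k * (sgn 𝕜 n * sgn 𝕜 1) := by
      rw [← sgn_add, ← sgn_add, ← sgn_add, ← h]
      congr 1
      push_cast
      ring
    have s2 : sgn 𝕜 (k * (n + 1 : ℕ)) = sgn 𝕜 (k * n) * sgn 𝕜 k := by
      rw [← sgn_add]
      congr 1
      push_cast
      ring
    have s3 : sgn 𝕜 (k - (n + 1 : ℕ)) = sgn 𝕜 k * (sgn 𝕜 n * sgn 𝕜 1) := by
      rw [Nat.cast_succ, sgn_sub, sgn_add]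
    rw [s1, s2, s3, sgn_add, sgn_one]
    generalize N.dh _ = u
    generalize φ.hat ((R.inc (n + 1)).hat _) = v
    generalize φ.hat _ = w
    have q1 := sgn_mul_sgn (𝕜 := 𝕜) k
    have q2 := sgn_mul_sgn (𝕜 := 𝕜) n
    match_scalars
    · ring
    · ring
    · linear_combination (-sgn 𝕜 (k * n) * sgn 𝕜 n * sgn 𝕜 n) * q1 - sgn 𝕜 (k * n) * q2

/-- By `SuppLT.eq_sum` a map of finite support is the sum of its restrictions, and these are the
members of the family up to sign. Without finite support a non-zero map could vanish on every
member. -/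
theorem fam_eq_zero {φ : Homs R.complex.that.toGrMod N.toGrMod k} {m : ℕ} (hφ : SuppLT m φ)
    (h : R.fam N k φ = 0) : φ = 0 := Homs.hat_inj fun x => by
  rw [hφ.eq_sum]
  refine Finset.sum_eq_zero fun n _ => ?_
  have h1 := congrArg (fun f => f.hat ((R.pr n).hat x)) (congrFun h n)
  rw [fam_hat] at h1
  exact (smul_eq_zero.1 h1).resolve_left (sgn_ne_zero _)

theorem fam_mem_tot {φ : Homs R.complex.that.toGrMod N.toGrMod k} {m : ℕ} (hφ : SuppLT m φ) :
    R.fam N k φ ∈ R.tot N k := (Set.finite_Iio m).subset fun n hn => by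
  by_contra hc
  refine hn (Homs.hat_inj fun x => ?_)
  rw [fam_hat]
  exact (congrArg _ (hφ.inc_eq_zero (not_lt.1 hc) x)).trans (smul_zero _)

/-- The finitely many members, composed with the projections and given the sign `(-1)^(kn)`, are
added up. Together with `fam_eq_zero` this identifies maps of finite support with the direct sum
totalization. -/
theorem exists_fam_eq {ψ : R.Fam N k} (hψ : ψ ∈ R.tot N k) :
    ∃ (φ : Homs R.complex.that.toGrMod N.toGrMod k) (m : ℕ), SuppLT m φ ∧ R.fam N k φ = ψ := by
  obtain ⟨m, hm⟩ : ∃ m : ℕ, ∀ n, m ≤ n → ψ n = 0 := by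
    obtain ⟨m, hm⟩ := Set.Finite.bddAbove hψ
    refine ⟨m + 1, fun n hn => ?_⟩
    by_contra hc
    have := hm hc
    omega
  have hs : ∀ x, (∑ n ∈ Finset.range m, sgn 𝕜 (k * n) • Homs.comp (ψ n) (R.pr n)
      (by ring : (n : ℤ) + (k - n) = k)).hat x =
      ∑ n ∈ Finset.range m, sgn 𝕜 (k * n) • (ψ n).hat ((R.pr n).hat x) := fun x => by
    rw [hat_sum]
    simp only [Homs.hat_smul, Homs.comp_hat]
  refine ⟨_, m, fun x hx => (hs x).trans (Finset.sum_eq_zero fun n hn => ?_),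
    funext fun n => Homs.hat_inj fun x => ?_⟩
  · have : (R.pr n).hat x = 0 := hx n (Finset.mem_range.1 hn)
    rw [this, map_zero, smul_zero]
  · rw [fam_hat, hs]
    have h1 : (R.pr n).hat ((R.inc n).hat x) = x := R.complex.pr_inc_same n x
    have h2 : ∀ l, l ≠ n → (R.pr l).hat ((R.inc n).hat x) = 0 := fun l hl =>
      R.complex.pr_inc_ne hl x
    rcases lt_or_ge n m with hn | hn
    · rw [Finset.sum_eq_single_of_mem n (Finset.mem_range.2 hn) fun l _ hl => by
        rw [h2 l hl, map_zero, smul_zero], h1, smul_smul, sgn_mul_sgn, one_smul]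
    · rw [Finset.sum_eq_zero fun l hl => ?_, hm n hn, smul_zero, Homs.hat_zero]
      rw [h2 l (by have := Finset.mem_range.1 hl; omega), map_zero, smul_zero]

end Cohomology

/-- The closed maps of degree `k` out of the product totalization which depend only on finitely
many components. -/
def finCocycles (N : CDGMod.{u} A) (k : ℤ) :
    Submodule 𝕜 (Homs R.complex.that.toGrMod N.toGrMod k) where
  carrier := {φ | homD R.complex.that N rfl φ = 0 ∧ ∃ m, SuppLT m φ}
  zero_mem' := ⟨map_zero _, 0, fun _ _ => rfl⟩
  add_mem' := by
    rintro a b ⟨ha, m, hm⟩ ⟨hb, n, hn⟩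
    refine ⟨by rw [map_add, ha, hb, add_zero], max m n, fun x hx => ?_⟩
    rw [Homs.hat_add, hm x fun i hi => hx i (by omega), hn x fun i hi => hx i (by omega), add_zero]
  smul_mem' := by
    rintro c a ⟨ha, m, hm⟩
    refine ⟨by rw [map_smul, ha, smul_zero], m, fun x hx => ?_⟩
    rw [Homs.hat_smul, hm x hx, smul_zero]

set_option maxHeartbeats 1600000 in
/-- Ext of the second kind in terms of any other resolution, by maps out of the product
totalization. -/
theorem exists_comparison (k : ℤ) : ∃ Ψ : S.finCocycles N k →ₗ[𝕜] R.ExtII N k,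
    Function.Surjective Ψ ∧
    (∀ φ, Ψ φ = 0 ↔ ∃ h : Homs S.complex.that.toGrMod N.toGrMod (k - 1), (∃ m, SuppLT m h) ∧
      homD S.complex.that N (sub_add_cancel k 1) h = φ.1) ∧
    ∀ (f : Homs M.toGrMod N.toGrMod k) (hf : homD M N rfl f = 0) (φ : S.finCocycles N k),
      (∀ x, φ.1.hat x = f.hat (S.thatAug.hat x)) → Ψ φ = R.classOf N f hf := by
  obtain ⟨F, hF, hFs, hFa⟩ := R.exists_filtered S
  obtain ⟨G, hG, hGs, hGa⟩ := S.exists_filtered R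
  -- The comparison maps are inverse to each other up to filtered homotopies.
  obtain ⟨h₁, h₁s, h₁e⟩ := R.exists_filtered_homotopy R
    (Homs.comp G F (zero_add 0) - Homs.id _)
    (by
      unfold IsClosedHom
      rw [map_sub, CDGMod.homD_comp_eq_zero hG hF, CDGMod.isClosedHom_id, sub_zero])
    ((hGs.comp hFs _).sub filtered_id) (fun x => by
      rw [Homs.hat_sub, Homs.comp_hat, Homs.id_hat, map_sub, hGa, hFa, sub_self])
  obtain ⟨h₂, h₂s, h₂e⟩ := S.exists_filtered_homotopy S
    (Homs.comp F G (zero_add 0) - Homs.id _)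
    (by
      unfold IsClosedHom
      rw [map_sub, CDGMod.homD_comp_eq_zero hF hG, CDGMod.isClosedHom_id, sub_zero])
    ((hFs.comp hGs _).sub filtered_id) (fun x => by
      rw [Homs.hat_sub, Homs.comp_hat, Homs.id_hat, map_sub, hFa, hGa, sub_self])
  -- a closed map composed with a homotopic map
  have hhom : ∀ {T : GPResolution M} (φ : Homs T.complex.that.toGrMod N.toGrMod k)
      (_ : homD T.complex.that N rfl φ = 0) (_ : ∃ m, SuppLT m φ)
      (h : Homs T.complex.that.toGrMod T.complex.that.toGrMod (-1)) (_ : Filtered h)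
      (a : Homs T.complex.that.toGrMod T.complex.that.toGrMod 0)
      (_ : homD T.complex.that T.complex.that (neg_add_cancel 1) h = a - Homs.id _),
      ∃ g : Homs T.complex.that.toGrMod N.toGrMod (k - 1), (∃ m, SuppLT m g) ∧
        homD T.complex.that N (sub_add_cancel k 1) g = Homs.comp φ a (zero_add k) - φ := by
    intro T φ hφ ⟨m, hm⟩ h hh a hha
    -- As `φ` is closed, `δ (φ h) = (-1)^k φ (δ h)`; this is the origin of the sign.
    refine ⟨sgn 𝕜 k • Homs.comp φ h (by ring), ⟨m, fun x hx => ?_⟩, ?_⟩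
    · rw [Homs.hat_smul, hm.comp_filtered hh _ x hx, smul_zero]
    · rw [map_smul, CDGMod.homD_comp φ h _ _ (neg_add_cancel 1) rfl (by ring) (zero_add k), hφ, hha]
      refine Homs.hat_inj fun x => ?_
      simp [smul_smul, sgn_mul_sgn]
  -- `Ψ` is induced by precomposition with `F` followed by restriction to the members of `R`.
  let pull : S.finCocycles N k →ₗ[𝕜] R.cocycles N k := LinearMap.codRestrict _
    (R.fam N k ∘ₗ
      { toFun := fun φ => Homs.comp φ.1 F (zero_add k)
        map_add' := fun a b => Homs.hat_inj fun x => by simp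
        map_smul' := fun c a => Homs.hat_inj fun x => by simp })
    (by
      rintro ⟨φ, hφ, m, hm⟩
      refine ⟨R.fam_mem_tot (hm.comp_filtered hFs (zero_add k)), LinearMap.mem_ker.2 ?_⟩
      refine (R.totD_fam rfl _).trans ?_
      change R.fam N _ (homD _ N rfl (Homs.comp φ F (zero_add k))) = 0
      rw [CDGMod.homD_comp_eq_zero hφ hF, map_zero])
  have hpull : ∀ φ, (pull φ).1 = R.fam N k (Homs.comp φ.1 F (zero_add k)) := fun φ => rfl
  refine ⟨Submodule.mkQ _ ∘ₗ pull, fun c => ?_, fun φ => ?_, fun f hf φ hφ => ?_⟩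
  · obtain ⟨⟨ψ, hψt, hψc⟩, rfl⟩ := Submodule.Quotient.mk_surjective _ c
    obtain ⟨φ, m, hm, rfl⟩ := R.exists_fam_eq hψt
    -- The cocycle condition says only that `δ φ` restricts to zero on each member. Since `δ φ` has
    -- finite support as well, with a bound larger by one, it vanishes.
    have hφ : homD R.complex.that N rfl φ = 0 := by
      refine R.fam_eq_zero (m := m + 1) (fun x hx => ?_) ((R.totD_fam rfl φ).symm.trans hψc)
      rw [CDGMod.hat_homD, hm x fun i hi => hx i (by omega), hm.dh hx, map_zero, smul_zero,
        sub_zero]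
    -- The preimage is `φ G`: the map `φ G F` differs from `φ` by the boundary of `g`.
    obtain ⟨g, ⟨m', hg⟩, hge⟩ := hhom φ hφ ⟨m, hm⟩ h₁ h₁s _ h₁e
    refine ⟨⟨Homs.comp φ G (zero_add k), CDGMod.homD_comp_eq_zero hφ hG _ _, m,
      hm.comp_filtered hGs _⟩, (Submodule.Quotient.eq _).2 ?_⟩
    refine ⟨R.fam N _ g, R.fam_mem_tot hg, (R.totD_fam _ g).trans ?_⟩
    rw [hge, map_sub]
    refine congrArg₂ _ (congrArg _ (Homs.hat_inj fun x => ?_)) rfl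
    simp
  · refine (Submodule.Quotient.mk_eq_zero _).trans ⟨?_, ?_⟩
    · rintro ⟨ψ, hψ, hψe⟩
      obtain ⟨h, m, hm, rfl⟩ := R.exists_fam_eq hψ
      have h1 : homD R.complex.that N (sub_add_cancel k 1) h = Homs.comp φ.1 F (zero_add k) := by
        rw [← sub_eq_zero]
        obtain ⟨m', hm'⟩ := φ.2.2
        refine R.fam_eq_zero (m := max (m + 1) m') (fun x hx => ?_) ?_
        · rw [Homs.hat_sub, CDGMod.hat_homD, hm x fun i hi => hx i (by omega),
            hm.dh fun i hi => hx i (by omega),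
            hm'.comp_filtered hFs _ x fun i hi => hx i (by omega)]
          simp
        · rw [map_sub, sub_eq_zero, ← R.totD_fam]
          exact hψe
      -- `φ F` is the boundary of `h`, so `φ F G` is the boundary of `h G`, and it differs from `φ`
      -- by the boundary of `g`.
      obtain ⟨g, ⟨m', hg⟩, hge⟩ := hhom φ.1 φ.2.1 φ.2.2 h₂ h₂s _ h₂e
      refine ⟨Homs.comp h G (zero_add _) - g, ⟨max m m', fun x hx => ?_⟩, ?_⟩
      · rw [Homs.hat_sub, hm.comp_filtered hGs _ x fun i hi => hx i (by omega),
          hg x fun i hi => hx i (by omega), sub_zero]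
      · have h2 := CDGMod.homD_comp h G (zero_add (k - 1)) (sub_add_cancel k 1) (zero_add 1)
          (sub_add_cancel k 1) (zero_add k) (by ring)
        have h3 : homD S.complex.that R.complex.that (zero_add 1) G = 0 := hG
        rw [map_sub, h2, hge, h1, h3]
        refine Homs.hat_inj fun x => ?_
        simp
    · rintro ⟨h, ⟨m, hm⟩, he⟩
      refine ⟨R.fam N _ (Homs.comp h F (zero_add _)), R.fam_mem_tot (hm.comp_filtered hFs _),
        (R.totD_fam _ _).trans ?_⟩
      have h2 := CDGMod.homD_comp h F (zero_add (k - 1)) (sub_add_cancel k 1) (zero_add 1)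
          (sub_add_cancel k 1) (zero_add k) (by ring)
      have h3 : homD R.complex.that S.complex.that (zero_add 1) F = 0 := hF
      change _ = R.fam N k _
      refine congrArg _ ?_
      rw [h2, he, h3]
      refine Homs.hat_inj fun x => ?_
      simp
  · suffices h : pull φ = ⟨R.ofHom N f, R.ofHom_mem N f hf⟩ from
      (congrArg Submodule.Quotient.mk h : _)
    refine Subtype.ext ((hpull φ).trans (funext fun n => Homs.hat_inj fun x => ?_))
    -- The pulled back map factors through the component `0`, so only the first member of the family
    -- is non-zero, and there the sign is `1`.
    rw [fam_hat, Homs.comp_hat, hφ, hFa, thatAug_hat]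
    rcases n with _ | n
    · have h1 : (R.pr 0).hat ((R.inc 0).hat x) = x := R.complex.pr_inc_same 0 x
      change _ = (Homs.precomp R.aug N.toGrMod _ f).hat x
      rw [h1, Homs.precomp_eq, Homs.comp_hat, CharP.cast_eq_zero, mul_zero, sgn_zero, one_smul]
    · have h1 : (R.pr 0).hat ((R.inc (n + 1)).hat x) = 0 :=
        R.complex.pr_inc_ne (Nat.succ_ne_zero n).symm x
      rw [h1, map_zero, map_zero, smul_zero]
      rfl

end GPResolution

/-! ### The finest locally convex topology -/

section Finest

variable {𝕜 : Type} [RCLike 𝕜]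

/-- Every seminorm is continuous. -/
def Finest (𝕜 : Type) [RCLike 𝕜] (E : Type*) [AddCommGroup E] [Module 𝕜 E]
    [TopologicalSpace E] : Prop :=
  ∀ p : Seminorm 𝕜 E, Continuous p

theorem Finest.continuous {E F : Type*} [AddCommGroup E] [Module 𝕜 E] [TopologicalSpace E]
    [IsTopologicalAddGroup E] [AddCommGroup F] [Module 𝕜 F] [TopologicalSpace F]
    [IsTopologicalAddGroup F] [PolynormableSpace 𝕜 F] (h : Finest 𝕜 E) (f : E →ₗ[𝕜] F) :
    Continuous f :=
  continuous_of_seminorm f fun P _ => ⟨P.comp f, h _, fun _ => le_rfl⟩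

/-! ### Weighted `ℓ¹`-seminorms -/

section Ell

variable {ι E : Type*} [AddCommGroup E] [Module 𝕜 E] (b : Module.Basis ι 𝕜 E) (w : ι → NNReal)

/-- The weighted `ℓ¹`-seminorm with respect to a basis. -/
noncomputable def ell1 : Seminorm 𝕜 E :=
  Seminorm.of (fun x => (b.repr x).sum fun i c => (w i : ℝ) * ‖c‖)
    (fun x y => by
      classical
      have h0 : ∀ z : E, ∀ s : Finset ι, (b.repr z).support ⊆ s →
          ((b.repr z).sum fun i c => (w i : ℝ) * ‖c‖) = ∑ i ∈ s, (w i : ℝ) * ‖b.repr z i‖ :=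
        fun z s hs => Finsupp.sum_of_support_subset _ hs _ (by simp)
      rw [h0 (x + y) ((b.repr x).support ∪ (b.repr y).support)
        (by rw [map_add]; exact Finsupp.support_add),
        h0 x _ Finset.subset_union_left, h0 y _ Finset.subset_union_right,
        ← Finset.sum_add_distrib]
      refine Finset.sum_le_sum fun i _ => ?_
      rw [← mul_add, map_add, Finsupp.add_apply]
      exact mul_le_mul_of_nonneg_left (norm_add_le _ _) (w i).2)
    (fun c x => by
      rw [map_smul, Finsupp.sum_of_support_subset _ Finsupp.support_smul _ (by simp), Finsupp.sum,
        Finset.mul_sum]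
      refine Finset.sum_congr rfl fun i _ => ?_
      rw [Finsupp.smul_apply, smul_eq_mul, norm_mul]
      ring)

theorem ell1_apply (x : E) :
    ell1 b w x = ∑ i ∈ (b.repr x).support, (w i : ℝ) * ‖b.repr x i‖ := rfl

theorem sum_le_ell1 (s : Finset ι) (x : E) :
    ∑ i ∈ s, (w i : ℝ) * ‖b.repr x i‖ ≤ ell1 b w x := by
  classical
  rw [ell1_apply, Finset.sum_subset (Finset.subset_union_right (s₁ := s) (s₂ := (b.repr x).support))
    (f := fun i => (w i : ℝ) * ‖b.repr x i‖) fun i _ hi => by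
      rw [Finsupp.notMem_support_iff.1 hi, norm_zero, mul_zero]]
  exact Finset.sum_le_sum_of_subset_of_nonneg Finset.subset_union_left
    fun _ _ _ => by positivity

/-- With weights `p (b i)` and `C = 1` this shows that the `ℓ¹`-seminorms dominate all seminorms.
The constant `C` allows the estimate to be applied to a bilinear map in one variable at a time. -/
theorem le_ell1 {p : Seminorm 𝕜 E} {C : ℝ} (h : ∀ i, p (b i) ≤ C * w i) (x : E) :
    p x ≤ C * ell1 b w x := by
  conv_lhs => rw [← b.linearCombination_repr x, Finsupp.linearCombination_apply, Finsupp.sum]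
  refine (seminorm_sum_le p _ _).trans ?_
  rw [ell1_apply, Finset.mul_sum]
  refine Finset.sum_le_sum fun i _ => ?_
  rw [map_smul_eq_mul]
  refine (mul_le_mul_of_nonneg_left (h i) (norm_nonneg _)).trans (le_of_eq ?_)
  ring

end Ell

theorem eq_zero_of_forall_seminorm {E : Type*} [AddCommGroup E] [Module 𝕜 E] {x : E}
    (h : ∀ p : Seminorm 𝕜 E, p x = 0) : x = 0 := by
  let b := Module.Basis.ofVectorSpace 𝕜 E
  refine b.repr.map_eq_zero_iff.1 (Finsupp.ext fun i => ?_)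
  have h1 := sum_le_ell1 b (fun _ => 1) {i} x
  rw [h, Finset.sum_singleton, NNReal.coe_one, one_mul] at h1
  simpa using h1

theorem eq_zero_of_forall_continuous_seminorm {E : Type*} [AddCommGroup E] [Module 𝕜 E]
    [TopologicalSpace E] [IsTopologicalAddGroup E] [PolynormableSpace 𝕜 E] [T1Space E] {x : E}
    (h : ∀ p : Seminorm 𝕜 E, Continuous p → p x = 0) : x = 0 := by
  by_contra hx
  have hU : ({x}ᶜ : Set E) ∈ 𝓝 (0 : E) := isOpen_compl_singleton.mem_nhds (by simpa using Ne.symm hx)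
  obtain ⟨p, hp, r, hr, hb⟩ := exists_seminorm_of_nhds (𝕜 := 𝕜) hU
  exact hb (by rw [Seminorm.mem_ball, sub_zero, h p hp]; exact hr) rfl

/-! ### Completeness of the finest locally convex topology -/

section Complete

open UniformSpace

variable {X : Type*} [AddCommGroup X] [Module 𝕜 X] [UniformSpace X] [IsUniformAddGroup X]
  [UniformContinuousConstSMul 𝕜 X] [PolynormableSpace 𝕜 X]

/-- The coordinates with respect to a basis extend to the completion. An element of the completion
has finitely many non-zero coordinates, as otherwise a suitable weighted `ℓ¹`-seminorm would be
infinite on it. Subtracting an element of `X` with the same coordinates leaves `y` with all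
coordinates zero, and such a `y` vanishes because the coordinates control approximations of it from
`X`. -/
theorem Finest.coe_surjective (h : Finest 𝕜 X) :
    Function.Surjective ((↑) : X → Completion X) := by
  classical
  let b := Module.Basis.ofVectorSpace 𝕜 X
  let ι := Module.Basis.ofVectorSpaceIndex 𝕜 X
  have hdense : DenseRange ((↑) : X → Completion X) := Completion.denseRange_coe
  have hex : ∀ i : ι, ∃ c : Completion X →L[𝕜] 𝕜, ∀ x : X, c (x : Completion X) = b.repr x i := by
    intro i
    refine ⟨ContinuousLinearMap.extend ⟨b.coord i, h.continuous _⟩ (toComplLinear (𝕜 := 𝕜)),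
      fun x => ?_⟩
    exact ContinuousLinearMap.extend_eq (e := toComplLinear (𝕜 := 𝕜) (X := X)) _ hdense
      (Completion.isUniformInducing_coe _) x
  choose c hc using hex
  have key : ∀ (w : ι → NNReal) (s : Finset ι) (z : Completion X),
      ∑ i ∈ s, (w i : ℝ) * ‖c i z‖ ≤ complSeminorm (ell1 b w) (h _) z := by
    intro w s z
    refine seminorm_le_of_dense hdense (P := fun z => ∑ i ∈ s, (w i : ℝ) * ‖c i z‖)
      (continuous_finsetSum _ fun i _ => continuous_const.mul (c i).continuous.norm)
      (continuous_complSeminorm _ _) (fun x => ?_) z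
    simp only [hc, complSeminorm_coe]
    exact sum_le_ell1 b w s x
  intro z
  have hfin : {i | c i z ≠ 0}.Finite := by
    by_contra hinf
    -- With these weights each non-zero coordinate of `z` contributes `1`, so `n` of them exceed the
    -- value of the extended seminorm.
    obtain ⟨n, hn⟩ := exists_nat_gt (complSeminorm (ell1 b fun i => ‖c i z‖₊⁻¹) (h _) z)
    obtain ⟨s, hs, hcard⟩ := Set.Infinite.exists_subset_card_eq hinf n
    refine absurd (key (fun i => ‖c i z‖₊⁻¹) s z) (not_le.2 (hn.trans_le (le_of_eq ?_)))
    rw [Finset.sum_congr rfl (g := fun _ => (1 : ℝ)) fun i hi => ?_]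
    · simp [hcard]
    · have : c i z ≠ 0 := hs hi
      simp [this]
  let x₀ : X := ∑ i ∈ hfin.toFinset, c i z • b i
  have hx₀ : ∀ i, c i (z - (x₀ : Completion X)) = 0 := by
    intro i
    rw [map_sub, hc, map_sum, Finsupp.finsetSum_apply]
    simp only [map_smul, Module.Basis.repr_self, Finsupp.smul_apply, Finsupp.single_apply,
      smul_eq_mul, mul_ite, mul_one, mul_zero, Finset.sum_ite_eq', Set.Finite.mem_toFinset,
      Set.mem_ofPred_eq]
    split_ifs with h1
    · exact sub_self _
    · rw [not_not.1 h1, sub_zero]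
  refine ⟨x₀, ?_⟩
  refine (sub_eq_zero.1 (eq_zero_of_forall_continuous_seminorm (𝕜 := 𝕜) fun P hP => ?_)).symm
  set y := z - (x₀ : Completion X)
  let p : Seminorm 𝕜 X := P.comp (toComplLinear (𝕜 := 𝕜) (X := X)).toLinearMap
  let w : ι → NNReal := fun i => ⟨p (b i), apply_nonneg _ _⟩
  have hPq : ∀ z, P z ≤ complSeminorm (ell1 b w) (h _) z := by
    refine seminorm_le_of_dense hdense hP (continuous_complSeminorm _ _) fun x => ?_
    rw [complSeminorm_coe]
    have := le_ell1 b w (p := p) (C := 1) (fun i => by rw [one_mul]; rfl) x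
    rwa [one_mul] at this
  refine le_antisymm (le_of_forall_pos_le_add fun ε hε => ?_) (apply_nonneg _ _)
  have hopen : IsOpen {v : Completion X | complSeminorm (ell1 b w) (h _) (v - y) < ε / 2} :=
    isOpen_lt ((continuous_complSeminorm _ _).comp (continuous_id.sub continuous_const))
      continuous_const
  obtain ⟨e, he⟩ := hdense.exists_mem_open hopen ⟨y, by simpa using by positivity⟩
  have he' : complSeminorm (ell1 b w) (h _) ((e : Completion X) - y) < ε / 2 := he
  -- The coordinates of `y` vanish, so those of `e` are the coordinates of `e - y`, and the
  -- `ℓ¹`-seminorm of `e` is bounded by that of `e - y`.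
  have h1 : ell1 b w e < ε / 2 := by
    refine lt_of_le_of_lt ?_ he'
    rw [ell1_apply]
    refine le_trans (le_of_eq (Finset.sum_congr rfl fun i _ => ?_))
      (key w (b.repr e).support ((e : Completion X) - y))
    rw [map_sub, hx₀, sub_zero, hc]
  have h2 : complSeminorm (ell1 b w) (h _) y ≤
      complSeminorm (ell1 b w) (h _) (y - e) + complSeminorm (ell1 b w) (h _) (e : Completion X) := by
    simpa using map_add_le_add (complSeminorm (ell1 b w) (h _)) (y - e) (e : Completion X)
  rw [complSeminorm_coe, map_sub_rev _ y] at h2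
  linarith [hPq y]

theorem Finest.completeLC [ContinuousSMul 𝕜 X] (h : Finest 𝕜 X) : CompleteLC 𝕜 X := by
  have h1 : T1Space X := by
    refine IsTopologicalAddGroup.t1Space X ?_
    have : ({0} : Set X) = ⋂ p : Seminorm 𝕜 X, p ⁻¹' {0} := by
      ext x
      simp only [Set.mem_singleton_iff, Set.mem_iInter, Set.mem_preimage]
      exact ⟨fun hx p => by rw [hx, map_zero], eq_zero_of_forall_seminorm⟩
    rw [this]
    exact isClosed_iInter fun p => isClosed_singleton.preimage (h p)
  have h2 : CompleteSpace X :=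
    (IsUniformInducing.completeSpace_congr (Completion.isUniformInducing_coe X)
      h.coe_surjective).2 inferInstance
  exact {}

end Complete

section FinestUnif

variable (𝕜 : Type) [RCLike 𝕜] (E : Type*) [AddCommGroup E] [Module 𝕜 E]

/-- The space `E`, to be equipped with its finest locally convex topology. -/
def FinestLC (_ : Type) (E : Type*) : Type _ := E

instance : AddCommGroup (FinestLC 𝕜 E) := inferInstanceAs (AddCommGroup E)
instance : Module 𝕜 (FinestLC 𝕜 E) := inferInstanceAs (Module 𝕜 E)

/-- The family of all seminorms. -/
def allSeminorms : SeminormFamily 𝕜 (FinestLC 𝕜 E) (Seminorm 𝕜 (FinestLC 𝕜 E)) := id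

noncomputable instance : TopologicalSpace (FinestLC 𝕜 E) :=
  (allSeminorms 𝕜 E).moduleFilterBasis.topology

theorem withSeminorms_allSeminorms : WithSeminorms (allSeminorms 𝕜 E) := ⟨rfl⟩

instance : IsTopologicalAddGroup (FinestLC 𝕜 E) :=
  (withSeminorms_allSeminorms 𝕜 E).topologicalAddGroup
instance : ContinuousSMul 𝕜 (FinestLC 𝕜 E) := (withSeminorms_allSeminorms 𝕜 E).continuousSMul
instance : PolynormableSpace 𝕜 (FinestLC 𝕜 E) :=
  (withSeminorms_allSeminorms 𝕜 E).toPolynormableSpace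
noncomputable instance : UniformSpace (FinestLC 𝕜 E) :=
  IsTopologicalAddGroup.rightUniformSpace (FinestLC 𝕜 E)
instance : IsUniformAddGroup (FinestLC 𝕜 E) := isUniformAddGroup_of_addCommGroup
instance : UniformContinuousConstSMul 𝕜 (FinestLC 𝕜 E) :=
  uniformContinuousConstSMul_of_continuousConstSMul 𝕜 _

theorem finest_finestLC : Finest 𝕜 (FinestLC 𝕜 E) :=
  fun p => (withSeminorms_allSeminorms 𝕜 E).continuous_seminorm p

instance : CompleteLC 𝕜 (FinestLC 𝕜 E) := Finest.completeLC (finest_finestLC 𝕜 E)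

end FinestUnif

/-! ### Bilinear maps on spaces of countable dimension -/

/-- Enumerate both index sets. Let `α i` be at least `c i j` for all `j` whose number does not
exceed that of `i`, and `β j` at least `c i j` for all `i` whose number does not exceed that of `j`;
these are finite sums. Each pair is covered by one of the two, and the summand `1` keeps the other
factor from being small. -/
theorem exists_le_mul {ι κ : Type*} [Countable ι] [Countable κ] (c : ι → κ → NNReal) :
    ∃ (α : ι → NNReal) (β : κ → NNReal), ∀ i j, c i j ≤ α i * β j := by
  obtain ⟨f, hf⟩ := exists_injective_nat ι
  obtain ⟨g, hg⟩ := exists_injective_nat κ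
  have hι : ∀ n, {i | f i ≤ n}.Finite := fun n => (Set.finite_Iic n).preimage hf.injOn
  have hκ : ∀ n, {j | g j ≤ n}.Finite := fun n => (Set.finite_Iic n).preimage hg.injOn
  refine ⟨fun i => 1 + ∑ j ∈ (hκ (f i)).toFinset, c i j,
    fun j => 1 + ∑ i ∈ (hι (g j)).toFinset, c i j, fun i j => ?_⟩
  rcases le_total (g j) (f i) with h | h
  · have h1 : c i j ≤ ∑ j ∈ (hκ (f i)).toFinset, c i j :=
      Finset.single_le_sum (f := fun j => c i j) (fun _ _ => zero_le) (by simpa using h)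
    calc c i j ≤ (1 + ∑ j ∈ (hκ (f i)).toFinset, c i j) * 1 := by
          rw [mul_one]; exact h1.trans (le_add_of_nonneg_left (zero_le))
      _ ≤ _ := mul_le_mul_right (le_add_of_nonneg_right (zero_le)) _
  · have h1 : c i j ≤ ∑ i ∈ (hι (g j)).toFinset, c i j :=
      Finset.single_le_sum (f := fun i => c i j) (fun _ _ => zero_le) (by simpa using h)
    calc c i j ≤ 1 * (1 + ∑ i ∈ (hι (g j)).toFinset, c i j) := by
          rw [one_mul]; exact h1.trans (le_add_of_nonneg_left (zero_le))
      _ ≤ _ := mul_le_mul_left (le_add_of_nonneg_right (zero_le)) _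

theorem exists_countable_basis {E : Type u} [AddCommGroup E] [Module 𝕜 E]
    (h : Module.rank 𝕜 E ≤ Cardinal.aleph0) :
    Countable (Module.Basis.ofVectorSpaceIndex 𝕜 E) := by
  rw [← Cardinal.mk_le_aleph0_iff, (Module.Basis.ofVectorSpace 𝕜 E).mk_eq_rank'']
  exact h

/-- The values on pairs of basis vectors form a countable matrix, dominated by `α i * β j`; the
`ℓ¹`-seminorms with weights `α` and `β` then bound the bilinear map. For the finest topologies this
is joint continuity. -/
theorem exists_bilinear_bound {E F : Type u} {G : Type*} [AddCommGroup E] [Module 𝕜 E]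
    [AddCommGroup F] [Module 𝕜 F] [AddCommGroup G] [Module 𝕜 G]
    (hE : Module.rank 𝕜 E ≤ Cardinal.aleph0) (hF : Module.rank 𝕜 F ≤ Cardinal.aleph0)
    (m : E →ₗ[𝕜] F →ₗ[𝕜] G) (P : Seminorm 𝕜 G) :
    ∃ (p : Seminorm 𝕜 E) (q : Seminorm 𝕜 F), ∀ x y, P (m x y) ≤ p x * q y := by
  have := exists_countable_basis hE
  have := exists_countable_basis hF
  let b := Module.Basis.ofVectorSpace 𝕜 E
  let b' := Module.Basis.ofVectorSpace 𝕜 F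
  obtain ⟨α, β, hαβ⟩ := exists_le_mul fun i j =>
    (⟨P (m (b i) (b' j)), apply_nonneg _ _⟩ : NNReal)
  refine ⟨ell1 b α, ell1 b' β, fun x y => ?_⟩
  rw [mul_comm]
  -- For fixed `y` the constant in `le_ell1` is the value of the second seminorm at `y`.
  refine le_ell1 b α (p := P.comp (m.flip y)) (fun i => ?_) x
  rw [mul_comm]
  exact le_ell1 b' β (p := P.comp (m (b i))) (fun j => hαβ i j) y

/-- Only finitely many factors are non-zero, so a seminorm is bounded by the sum of its restrictions
to these factors. -/
theorem Finest.pi {ι : Type*} {E : ι → Type*} [∀ i, AddCommGroup (E i)] [∀ i, Module 𝕜 (E i)]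
    [∀ i, UniformSpace (E i)] [∀ i, CompleteLC 𝕜 (E i)] (h : ∀ n, Finest 𝕜 (E n))
    (hfin : {n | Nontrivial (E n)}.Finite) : Finest 𝕜 (∀ n, E n) := by
  classical
  intro p
  let Q : Seminorm 𝕜 (∀ n, E n) := ∑ n ∈ hfin.toFinset,
    (p.comp (LinearMap.single 𝕜 E n)).comp (LinearMap.proj n)
  have hQ : Continuous Q := continuous_seminorm_sum _ fun n =>
    (h n (p.comp (LinearMap.single 𝕜 E n))).comp (continuous_apply n)
  refine Seminorm.continuous_of_le hQ fun x => ?_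
  have hx : x = ∑ n ∈ hfin.toFinset, Pi.single n (x n) := by
    funext k
    rw [Finset.sum_apply, Finset.sum_pi_single]
    split_ifs with hk
    · rfl
    · have : ¬ Nontrivial (E k) := by simpa using hk
      rw [not_nontrivial_iff_subsingleton] at this
      exact Subsingleton.elim _ _
  conv_lhs => rw [hx]
  refine (seminorm_sum_le p _ _).trans (le_of_eq ?_)
  rw [seminorm_sum_apply]
  rfl

/-! ### Discrete graded spaces -/

section Graded

variable {E : ℤ → Type u} [∀ i, AddCommGroup (E i)] [∀ i, Module 𝕜 (E i)]
  [∀ i, UniformSpace (E i)]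

theorem IsDiscreteLC.finest (h : IsDiscreteLC 𝕜 E) (n : ℤ) : Finest 𝕜 (E n) := by
  intro p
  have h1 : Continuous (p.comp (LinearMap.proj n : (∀ n, E n) →ₗ[𝕜] E n)) := h _
  have h2 : (p : E n → ℝ) =
      (p.comp (LinearMap.proj n : (∀ n, E n) →ₗ[𝕜] E n)) ∘ Pi.single n := by
    funext x
    simp
  rw [h2]
  exact h1.comp (continuous_single n)

/-- A continuous seminorm on a product vanishes on the elements supported outside a finite set of
factors. Applied to an `ℓ¹`-norm, this shows that the remaining factors are zero. -/
theorem IsDiscreteLC.finite [∀ i, CompleteLC 𝕜 (E i)] (h : IsDiscreteLC 𝕜 E) :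
    {n | Nontrivial (E n)}.Finite := by
  let b := Module.Basis.ofVectorSpace 𝕜 (∀ n, E n)
  obtain ⟨T, hT⟩ := exists_finset_of_seminorm (h (ell1 b fun _ => 1))
  refine T.finite_toSet.subset fun n hn => ?_
  by_contra hnT
  obtain ⟨x, hx⟩ := @exists_ne _ hn (0 : E n)
  have h1 := hT (Pi.single n x) fun k hk => Pi.single_eq_of_ne (by rintro rfl; exact hnT hk) _
  refine hx (Pi.single_eq_zero_iff.1 (b.repr.map_eq_zero_iff.1 (Finsupp.ext fun i => ?_)))
  have h2 := sum_le_ell1 b (fun _ => 1) {i} (Pi.single n x)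
  rw [h1, Finset.sum_singleton, NNReal.coe_one, one_mul] at h2
  simpa using h2

theorem isDiscreteLC_of_finest [∀ i, CompleteLC 𝕜 (E i)] (h : ∀ n, Finest 𝕜 (E n))
    (hfin : {n | Nontrivial (E n)}.Finite) : IsDiscreteLC 𝕜 E :=
  Finest.pi h hfin

end Graded

end Finest

/-! ### Modules of countable dimension over discrete algebras -/

section ToCLCT

variable {𝕜 : Type} [RCLike 𝕜] {A : CLCTAlg.{u} 𝕜}

/-- Each member is bounded by `exists_bilinear_bound`. Only finitely many members matter, since `A`
lives in finitely many degrees and the degree in `A` determines the index. -/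
theorem famBdd_of_countable (hA : IsDiscreteLC 𝕜 A.C) (hA' : IsCountableDim 𝕜 A.C)
    {E : ℤ → Type u} [∀ i, AddCommGroup (E i)] [∀ i, Module 𝕜 (E i)] [∀ i, UniformSpace (E i)]
    (hE : ∀ i, Finest 𝕜 (E i)) (hE' : IsCountableDim 𝕜 E) {n : ℤ}
    {G : Type u} [AddCommGroup G] [Module 𝕜 G] [UniformSpace G] [CompleteLC 𝕜 G]
    (m : ∀ p : {p : ℤ × ℤ // p.1 + p.2 = n}, E p.1.1 →ₗ[𝕜] A.C p.1.2 →ₗ[𝕜] G) :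
    FamBdd m := by
  classical
  intro P _
  choose p q hpq using fun k => exists_bilinear_bound (hE' k.1.1) (hA' k.1.2) (m k) P
  -- The first seminorm is set to zero where `A` vanishes. This makes the family finite and costs
  -- nothing, since the second argument is then zero.
  refine ⟨fun k => if Nontrivial (A.C k.1.2) then p k else 0, q, fun k => hE _ _,
    fun k => hA.finest _ _, ?_, fun k x y => ?_⟩
  · refine (hA.finite.preimage (f := fun k : {p : ℤ × ℤ // p.1 + p.2 = n} => k.1.2)
      fun k _ l _ h => ?_).subset fun k hk => ?_
    · have h2 : k.1.2 = l.1.2 := h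
      have h3 := k.2
      have h4 := l.2
      exact Subtype.ext (Prod.ext (by omega) h2)
    · by_contra hc
      exact hk (if_neg hc)
  · beta_reduce
    split_ifs with h
    · exact hpq k x y
    · rw [not_nontrivial_iff_subsingleton] at h
      rw [Subsingleton.elim y 0, map_zero, map_zero, map_zero, mul_zero]

/-- A module of countable dimension over a discrete algebra with finest locally convex components
is a clct module. -/
def CDGMod.ofFinest (hA : IsDiscreteLC 𝕜 A.C) (hA' : IsCountableDim 𝕜 A.C)
    (M : CDGMod.{u} A.toCDGAlg) (hM : IsCountableDim 𝕜 M.C) [U : ∀ i, UniformSpace (M.C i)]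
    [L : ∀ i, CompleteLC 𝕜 (M.C i)] (hf : ∀ i, Finest 𝕜 (M.C i)) : CLCTMod.{u} A where
  toCDGMod := M
  unif := U
  clc := L
  act_cont _ := (famBdd_of_countable hA hA' hf hM _).extendsToTensor
  d_cont h := (hf _).continuous (M.d h)

/-- A module of countable dimension over a discrete algebra, with the finest locally convex
topology. -/
noncomputable def CDGMod.toCLCT (hA : IsDiscreteLC 𝕜 A.C) (hA' : IsCountableDim 𝕜 A.C)
    (M : CDGMod.{u} A.toCDGAlg) (hM : IsCountableDim 𝕜 M.C) : CLCTMod.{u} A :=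
  M.ofFinest hA hA' hM (U := fun i => inferInstanceAs (UniformSpace (FinestLC 𝕜 (M.C i))))
    (L := fun i => inferInstanceAs (CompleteLC 𝕜 (FinestLC 𝕜 (M.C i))))
    fun i => finest_finestLC 𝕜 (M.C i)

theorem CDGMod.finest_toCLCT (hA : IsDiscreteLC 𝕜 A.C) (hA' : IsCountableDim 𝕜 A.C)
    (M : CDGMod.{u} A.toCDGAlg) (hM : IsCountableDim 𝕜 M.C) (i : ℤ) :
    Finest 𝕜 ((M.toCLCT hA hA' hM).C i) :=
  finest_finestLC 𝕜 (M.C i)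

end ToCLCT

/-! ### The free cdg-module on a cdg-module -/

section FreeModule

variable {𝕜 : Type} [Field 𝕜] (A : CDGAlg.{u} 𝕜)
  (K : ℤ → Type u) [∀ i, AddCommGroup (K i)] [∀ i, Module 𝕜 (K i)]

namespace DTensor

/-- The right action of `A` on `K ⊗ A`. -/
noncomputable def act {i j n : ℤ} (h : i + j = n) :
    DTensor 𝕜 K A.C i →ₗ[𝕜] A.C j →ₗ[𝕜] DTensor 𝕜 K A.C n :=
  lift fun {a b} hab => LinearMap.mk₂ 𝕜
    (fun v x => tm (by omega : a + (b + j) = n) v ∘ₗ A.mul rfl x)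
    (fun v v' x => by ext; simp) (fun c v x => by ext; simp)
    (fun v x x' => by ext; simp) (fun c v x => by ext; simp)

@[simp] theorem act_tm {i j n a b c : ℤ} (h : i + j = n) (hab : a + b = i) (hc : b + j = c)
    (h' : a + c = n) (v : K a) (x : A.C b) (y : A.C j) :
    act A K h (tm hab v x) y = tm h' v (A.mul hc x y) := by
  subst hc
  simp [act]

/-- The operator `v ⊗ x ↦ (-1) ^ |v| v ⊗ d x` on `K ⊗ A`. -/
noncomputable def dif {i j : ℤ} (h : i + 1 = j) :
    DTensor 𝕜 K A.C i →ₗ[𝕜] DTensor 𝕜 K A.C j :=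
  lift fun {a b} hab => sgn 𝕜 a •
    (tm (by omega : a + (b + 1) = j)).compl₁₂ LinearMap.id (A.d rfl)

theorem dif_tm {i j a b c : ℤ} (h : i + 1 = j) (hab : a + b = i) (hc : b + 1 = c) (h' : a + c = j)
    (v : K a) (x : A.C b) : dif A K h (tm hab v x) = sgn 𝕜 a • tm h' v (A.d hc x) := by
  subst hc
  simp [dif]

/-- The operator `v ⊗ x ↦ v ⊗ B x` on `K ⊗ A`. -/
noncomputable def curv {i j : ℤ} (h : i + 2 = j) :
    DTensor 𝕜 K A.C i →ₗ[𝕜] DTensor 𝕜 K A.C j :=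
  lift fun {a b} hab => (tm (by omega : a + (2 + b) = j)).compl₁₂ LinearMap.id (A.mul rfl A.B)

theorem curv_tm {i j a b c : ℤ} (h : i + 2 = j) (hab : a + b = i) (hc : 2 + b = c) (h' : a + c = j)
    (v : K a) (x : A.C b) : curv A K h (tm hab v x) = tm h' v (A.mul hc A.B x) := by
  subst hc
  simp [curv]

/-- The identification of `(K ⊗ A)^i` and `(K ⊗ A)^j` for `i = j`. -/
noncomputable def cast {i j : ℤ} (h : i = j) :
    DTensor 𝕜 K A.C i →ₗ[𝕜] DTensor 𝕜 K A.C j :=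
  lift fun hab => tm (hab.trans h)

@[simp] theorem cast_tm {i j a b : ℤ} (h : i = j) (hab : a + b = i) (v : K a) (x : A.C b) :
    cast A K h (tm hab v x) = tm (hab.trans h) v x := by
  simp [cast]

variable {A K}

theorem act_one {i : ℤ} (u : DTensor 𝕜 K A.C i) : act A K (add_zero i) u A.one = u := by
  refine LinearMap.congr_fun (f := (act A K (add_zero i)).flip A.one) (g := LinearMap.id)
    (hom_ext fun {a b} h v x => ?_) u
  simp [act_tm A K _ h (add_zero b) h, A.mul_one]

theorem act_act {i j k a b n : ℤ} (h₁ : i + j = a) (h₂ : a + k = n) (h₃ : j + k = b)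
    (h₄ : i + b = n) (u : DTensor 𝕜 K A.C i) (y : A.C j) (z : A.C k) :
    act A K h₂ (act A K h₁ u y) z = act A K h₄ u (A.mul h₃ y z) := by
  refine LinearMap.congr_fun (f := (act A K h₂).flip z ∘ₗ (act A K h₁).flip y)
    (g := (act A K h₄).flip (A.mul h₃ y z)) (hom_ext fun {c d} h v x => ?_) u
  simp only [LinearMap.comp_apply, LinearMap.flip_apply]
  rw [act_tm A K h₁ h rfl (by omega), act_tm A K h₂ _ rfl (by omega),
    act_tm A K h₄ h (c := d + j + k) (by omega) (by omega),
    A.mul_assoc rfl rfl h₃ (by omega)]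

theorem dif_act {i j n i' j' n' : ℤ} (h : i + j = n) (hn : n + 1 = n') (hi : i + 1 = i')
    (hj : j + 1 = j') (h₁ : i' + j = n') (h₂ : i + j' = n') (u : DTensor 𝕜 K A.C i) (y : A.C j) :
    dif A K hn (act A K h u y) =
      act A K h₁ (dif A K hi u) y + sgn 𝕜 i • act A K h₂ u (A.d hj y) := by
  refine LinearMap.congr_fun (f := dif A K hn ∘ₗ (act A K h).flip y)
    (g := (act A K h₁).flip y ∘ₗ dif A K hi + sgn 𝕜 i • (act A K h₂).flip (A.d hj y))
    (hom_ext fun {a b} hab v x => ?_) u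
  simp only [LinearMap.comp_apply, LinearMap.flip_apply, LinearMap.add_apply, LinearMap.smul_apply]
  rw [act_tm A K h hab rfl (by omega), dif_tm A K hn (c := b + j + 1) _ rfl (by omega),
    dif_tm A K hi (c := b + 1) hab rfl (by omega), map_smul, LinearMap.smul_apply,
    act_tm A K h₁ _ (c := b + j + 1) (by omega) (by omega),
    act_tm A K h₂ hab (c := b + j + 1) (by omega) (by omega),
    A.leibniz rfl rfl rfl hj (by omega) (by omega), map_add, map_smul, smul_add, smul_smul,
    ← sgn_add, hab]

theorem curv_act {i j n i' n' : ℤ} (h : i + j = n) (hn : n + 2 = n') (hi : i + 2 = i')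
    (h₁ : i' + j = n') (u : DTensor 𝕜 K A.C i) (y : A.C j) :
    curv A K hn (act A K h u y) = act A K h₁ (curv A K hi u) y := by
  refine LinearMap.congr_fun (f := curv A K hn ∘ₗ (act A K h).flip y)
    (g := (act A K h₁).flip y ∘ₗ curv A K hi) (hom_ext fun {a b} hab v x => ?_) u
  simp only [LinearMap.comp_apply, LinearMap.flip_apply]
  rw [act_tm A K h hab rfl (by omega), curv_tm A K hn _ rfl (by omega),
    curv_tm A K hi hab rfl (by omega), act_tm A K h₁ _ (c := 2 + (b + j)) (by omega) (by omega),
    A.mul_assoc rfl (by omega) rfl rfl]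

theorem cast_act {i j n i' n' : ℤ} (h : i + j = n) (hn : n = n') (hi : i = i')
    (h₁ : i' + j = n') (u : DTensor 𝕜 K A.C i) (y : A.C j) :
    cast A K hn (act A K h u y) = act A K h₁ (cast A K hi u) y := by
  refine LinearMap.congr_fun (f := cast A K hn ∘ₗ (act A K h).flip y)
    (g := (act A K h₁).flip y ∘ₗ cast A K hi) (hom_ext fun {a b} hab v x => ?_) u
  simp only [LinearMap.comp_apply, LinearMap.flip_apply]
  rw [act_tm A K h hab rfl (by omega), cast_tm, cast_tm, act_tm A K h₁ _ rfl (by omega)]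

/-- The two signs `(-1)^|v|` cancel, and `d² x = B x - x B` on `A`. The part `-x B` is what a
cdg-module requires; the left multiplication by `B` is the defect which the second summand of the
free module has to cancel. -/
theorem dif_dif {i j k : ℤ} (h₁ : i + 1 = j) (h₂ : j + 1 = k) (h₃ : i + 2 = k)
    (u : DTensor 𝕜 K A.C i) :
    dif A K h₂ (dif A K h₁ u) = curv A K h₃ u - act A K h₃ u A.B := by
  refine LinearMap.congr_fun (f := dif A K h₂ ∘ₗ dif A K h₁)
    (g := curv A K h₃ - (act A K h₃).flip A.B) (hom_ext fun {a b} hab v x => ?_) u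
  simp only [LinearMap.comp_apply, LinearMap.flip_apply, LinearMap.sub_apply]
  rw [dif_tm A K h₁ hab rfl (by omega), map_smul,
    dif_tm A K h₂ _ (c := b + 2) (by omega) (by omega),
    curv_tm A K h₃ hab (c := b + 2) (by omega) (by omega), act_tm A K h₃ hab rfl (by omega),
    A.d_d rfl (by omega) (by omega) rfl, smul_smul, sgn_mul_sgn, one_smul, map_sub]

/-- Since `d B = 0` and `B` has even degree, left multiplication by `B` commutes with `d`. -/
theorem dif_curv {i j k l : ℤ} (h₁ : i + 2 = j) (h₂ : j + 1 = k) (h₃ : i + 1 = l)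
    (h₄ : l + 2 = k) (u : DTensor 𝕜 K A.C i) :
    dif A K h₂ (curv A K h₁ u) = curv A K h₄ (dif A K h₃ u) := by
  refine LinearMap.congr_fun (f := dif A K h₂ ∘ₗ curv A K h₁)
    (g := curv A K h₄ ∘ₗ dif A K h₃) (hom_ext fun {a b} hab v x => ?_) u
  simp only [LinearMap.comp_apply]
  rw [curv_tm A K h₁ hab rfl (by omega), dif_tm A K h₂ _ rfl (by omega),
    dif_tm A K h₃ hab rfl (by omega), map_smul,
    curv_tm A K h₄ _ (c := 2 + b + 1) (by omega) (by omega),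
    A.leibniz (i' := 3) rfl rfl (by norm_num) rfl (by omega) (by omega), A.bianchi,
    sgn_even even_two, one_smul, map_zero, LinearMap.zero_apply, zero_add]

theorem dif_cast {i j i' j' : ℤ} (hi : i = i') (hj : j = j') (h : i + 1 = j) (h' : i' + 1 = j')
    (u : DTensor 𝕜 K A.C i) : dif A K h' (cast A K hi u) = cast A K hj (dif A K h u) := by
  refine LinearMap.congr_fun (f := dif A K h' ∘ₗ cast A K hi)
    (g := cast A K hj ∘ₗ dif A K h) (hom_ext fun {a b} hab v x => ?_) u
  simp only [LinearMap.comp_apply]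
  rw [cast_tm, dif_tm A K h hab rfl (by omega), dif_tm A K h' _ rfl (by omega), map_smul, cast_tm]

theorem curv_cast {i j i' j' : ℤ} (hi : i = i') (hj : j = j') (h : i + 2 = j) (h' : i' + 2 = j')
    (u : DTensor 𝕜 K A.C i) : curv A K h' (cast A K hi u) = cast A K hj (curv A K h u) := by
  subst hi hj
  refine LinearMap.congr_fun (f := curv A K h' ∘ₗ cast A K rfl)
    (g := cast A K rfl ∘ₗ curv A K h) (hom_ext fun {a b} hab v x => ?_) u
  simp only [LinearMap.comp_apply]
  rw [cast_tm, curv_tm A K h hab rfl (by omega), cast_tm]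

theorem cast_rfl {i : ℤ} (h : i = i) (u : DTensor 𝕜 K A.C i) : cast A K h u = u :=
  LinearMap.congr_fun (f := cast A K h) (g := LinearMap.id)
    (hom_ext fun hab v x => by simp) u

end DTensor

/-- The differential `d (x, y) = (d x - B y, x - d y)` of the free cdg-module. -/
noncomputable def freeD {i j : ℤ} (h : i + 1 = j) :
    (DTensor 𝕜 K A.C i × DTensor 𝕜 K A.C (i - 1)) →ₗ[𝕜]
      (DTensor 𝕜 K A.C j × DTensor 𝕜 K A.C (j - 1)) :=
  (DTensor.dif A K h ∘ₗ LinearMap.fst 𝕜 _ _ -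
      DTensor.curv A K (by omega : i - 1 + 2 = j) ∘ₗ LinearMap.snd 𝕜 _ _).prod
    (DTensor.cast A K (by omega : i = j - 1) ∘ₗ LinearMap.fst 𝕜 _ _ -
      DTensor.dif A K (by omega : i - 1 + 1 = j - 1) ∘ₗ LinearMap.snd 𝕜 _ _)

open DTensor in
/-- The free cdg-module on a graded vector space `K`: the free graded module on symbols `v` and
`d v` for `v ∈ K`. -/
noncomputable def freeMod : CDGMod.{u} A where
  C n := DTensor 𝕜 K A.C n × DTensor 𝕜 K A.C (n - 1)
  act {i j n} h := LinearMap.mk₂ 𝕜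
    (fun x a => (act A K h x.1 a, act A K (by omega : i - 1 + j = n - 1) x.2 a))
    (by intros; simp) (by intros; simp) (by intros; simp) (by intros; simp)
  act_one x := Prod.ext (act_one x.1) (act_one x.2)
  act_act h₁ h₂ h₃ h₄ x y z :=
    Prod.ext (act_act h₁ h₂ h₃ h₄ x.1 y z) (act_act _ _ h₃ (by omega) x.2 y z)
  d h := freeD A K h
  leibniz {i j n i' j' n'} h hn hi hj h₁ h₂ x y := by
    have e : sgn 𝕜 (i - 1) = - sgn 𝕜 i := sgn_congr' (by simp)
    have e₁ := dif_act h hn hi hj h₁ h₂ x.1 y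
    have e₂ := curv_act (by omega : i - 1 + j = n - 1) (by omega : n - 1 + 2 = n')
      (by omega : i - 1 + 2 = i') h₁ x.2 y
    have e₃ := cast_act h (by omega : n = n' - 1) (by omega : i = i' - 1) (by omega) x.1 y
    have e₄ := dif_act (by omega : i - 1 + j = n - 1) (by omega : n - 1 + 1 = n' - 1)
      (by omega : i - 1 + 1 = i' - 1) hj (by omega) (by omega) x.2 y
    refine Prod.ext ?_ ?_
    · simp [freeD, e₁, e₂]
      abel
    · simp [freeD, e₃, e₄, e]
      module
  d_d {i j k} h₁ h₂ h₃ x := by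
    have e₁ := dif_dif h₁ h₂ h₃ x.1
    have e₂ := dif_curv (by omega : i - 1 + 2 = j) h₂ (by omega : i - 1 + 1 = j - 1)
      (by omega : j - 1 + 2 = k) x.2
    have e₃ := curv_cast (by omega : i = j - 1) rfl h₃ (by omega : j - 1 + 2 = k) x.1
    have e₄ := dif_cast (by omega : i = j - 1) (by omega : j = k - 1) h₁
      (by omega : j - 1 + 1 = k - 1) x.1
    have e₅ := dif_dif (by omega : i - 1 + 1 = j - 1) (by omega : j - 1 + 1 = k - 1)
      (by omega : i - 1 + 2 = k - 1) x.2
    have e₆ := curv_cast rfl (by omega : j = k - 1) (by omega : i - 1 + 2 = j)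
      (by omega : i - 1 + 2 = k - 1) x.2
    rw [cast_rfl] at e₃ e₆
    -- In both components the left multiplication by `B` coming from `dif_dif` cancels against the
    -- one in `freeD`, and the right action of `-B` remains.
    refine Prod.ext ?_ ?_
    · simp [freeD, e₁, e₂, e₃]
    · simp [freeD, e₄, e₅, ← e₆]

theorem freeMod_act {i j n : ℤ} (h : i + j = n) (x : DTensor 𝕜 K A.C i) (y : DTensor 𝕜 K A.C (i - 1))
    (a : A.C j) : (freeMod A K).act h (x, y) a =
      (DTensor.act A K h x a, DTensor.act A K (by omega : i - 1 + j = n - 1) y a) := rfl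

/-- Free generators of a graded module: generators `e s w` of degree `deg s` such that linear maps on
the module are determined by their values on the elements `(e s w) a`, and families of linear maps on
the generators extend to `A`-linear maps. -/
structure FreeOn {A : CDGAlg.{u} 𝕜} (F : GrMod.{u} A) where
  ι : Type
  deg : ι → ℤ
  W : ι → Type u
  [grp : ∀ s, AddCommGroup (W s)]
  [mod : ∀ s, Module 𝕜 (W s)]
  e : ∀ s, W s →ₗ[𝕜] F.C (deg s)
  ext : ∀ {n : ℤ} {G : Type u} [AddCommGroup G] [Module 𝕜 G] {f g : F.C n →ₗ[𝕜] G},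
    (∀ {s : ι} {b : ℤ} (h : deg s + b = n) (w : W s) (x : A.C b),
      f (F.act h (e s w) x) = g (F.act h (e s w) x)) → f = g
  exists_lift : ∀ (X : GrMod.{u} A) (k : ℤ) (g : ∀ s, W s →ₗ[𝕜] X.C (deg s + k)),
    ∃ f : Homs F X k, ∀ s w, f.app (rfl : deg s + k = deg s + k) (e s w) = g s w

attribute [instance] FreeOn.grp FreeOn.mod

/-- Linear sections of `p` suffice: the lift is prescribed on the generators only, and both sides of
the required equation are `A`-linear. -/
theorem FreeOn.isGradedProjective {A : CDGAlg.{u} 𝕜} {F : GrMod.{u} A} (E : FreeOn F) :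
    IsGradedProjective F := by
  intro X Y p f hp
  choose s hs using fun i => LinearMap.exists_rightInverse_of_surjective
    (p.app (add_zero i)) (LinearMap.range_eq_top.2 (hp i))
  obtain ⟨g, hg⟩ := E.exists_lift X 0 fun i => s _ ∘ₗ f.app rfl ∘ₗ E.e i
  have key : ∀ {i j : ℤ} (h : i + 0 = j), p.app h ∘ₗ g.app (add_zero i) = f.app h := by
    intro i j h
    refine E.ext fun {t b} hab w x => ?_
    rw [LinearMap.comp_apply, g.app_act hab rfl (add_zero i) (by omega),
      f.app_act hab rfl h (by omega : E.deg t + 0 + b = j),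
      p.app_act (by omega : E.deg t + 0 + b = i) (add_zero _) h (by omega), hg]
    exact congrArg (fun z => Y.act (by omega : E.deg t + 0 + b = j) z x)
      (LinearMap.congr_fun (hs _) (f.app rfl (E.e t w)))
  exact ⟨g, Subtype.ext (funext fun q => key q.2)⟩

/-- The free generators `v` and `d v` of the free cdg-module. -/
noncomputable def freeOnFreeMod : FreeOn (freeMod A K).toGrMod where
  ι := ℤ × Bool
  deg
    | (i, false) => i
    | (i, true) => i + 1
  W s := K s.1
  e
    | (i, false) => LinearMap.inl 𝕜 _ _ ∘ₗ (DTensor.tm (add_zero i)).flip A.one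
    | (i, true) => LinearMap.inr 𝕜 _ _ ∘ₗ (DTensor.tm (by simp : i + 0 = i + 1 - 1)).flip A.one
  ext {n G} _ _ {f g} h := by
    refine LinearMap.prod_ext (DTensor.hom_ext fun {a b} hab v x => ?_)
      (DTensor.hom_ext fun {a b} hab v x => ?_)
    · have e₁ := h (s := (a, false)) hab v x
      have e₂ : (freeMod A K).act hab (DTensor.tm (add_zero a) v A.one, 0) x =
          (DTensor.tm hab v x, 0) := by
        rw [freeMod_act, DTensor.act_tm A K hab (add_zero a) (zero_add b) hab, A.one_mul, map_zero,
          LinearMap.zero_apply]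
      exact (congrArg f e₂).symm.trans (e₁.trans (congrArg g e₂))
    · have hab' : a + 1 + b = n := by omega
      have e₁ := h (s := (a, true)) hab' v x
      have e₂ : (freeMod A K).act hab'
          (0, DTensor.tm (by simp : a + 0 = a + 1 - 1) v A.one) x = (0, DTensor.tm hab v x) := by
        rw [freeMod_act, DTensor.act_tm A K _ _ (zero_add b) hab, A.one_mul, map_zero,
          LinearMap.zero_apply]
      exact (congrArg f e₂).symm.trans (e₁.trans (congrArg g e₂))
  exists_lift X k g := by
    let g₁ : ∀ i, K i →ₗ[𝕜] X.C (i + k) := fun i => g (i, false)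
    let g₂ : ∀ i, K i →ₗ[𝕜] X.C (i + 1 + k) := fun i => g (i, true)
    let φ : ∀ {n m : ℤ}, n + k = m → (DTensor 𝕜 K A.C n →ₗ[𝕜] X.C m) := fun {n m} h =>
      DTensor.lift fun {a b} hab =>
        (X.act (by omega : a + k + b = m)).compl₁₂ (g₁ a) LinearMap.id
    let ψ : ∀ {n m : ℤ}, n + k = m → (DTensor 𝕜 K A.C (n - 1) →ₗ[𝕜] X.C m) := fun {n m} h =>
      DTensor.lift fun {a b} hab =>
        (X.act (by omega : a + 1 + k + b = m)).compl₁₂ (g₂ a) LinearMap.id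
    have hφ : ∀ {i j n i' n' : ℤ} (h : i + j = n) (hi : i + k = i') (hn : n + k = n')
        (h' : i' + j = n') (x : DTensor 𝕜 K A.C i) (a : A.C j),
        φ hn (DTensor.act A K h x a) = X.act h' (φ hi x) a := by
      intro i j n i' n' h hi hn h' x a
      refine LinearMap.congr_fun (f := φ hn ∘ₗ (DTensor.act A K h).flip a)
        (g := (X.act h').flip a ∘ₗ φ hi) (DTensor.hom_ext fun {c b} hcb v y => ?_) x
      simp only [LinearMap.comp_apply, LinearMap.flip_apply]
      rw [DTensor.act_tm A K h hcb rfl (by omega)]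
      simp only [φ, DTensor.lift_tm, LinearMap.compl₁₂_apply, LinearMap.id_apply]
      rw [X.act_act _ _ rfl (by omega)]
    have hψ : ∀ {i j n i' n' : ℤ} (h : i + j = n) (hi : i + k = i') (hn : n + k = n')
        (h' : i' + j = n') (h'' : i - 1 + j = n - 1) (x : DTensor 𝕜 K A.C (i - 1)) (a : A.C j),
        ψ hn (DTensor.act A K h'' x a) = X.act h' (ψ hi x) a := by
      intro i j n i' n' h hi hn h' h'' x a
      refine LinearMap.congr_fun (f := ψ hn ∘ₗ (DTensor.act A K h'').flip a)
        (g := (X.act h').flip a ∘ₗ ψ hi) (DTensor.hom_ext fun {c b} hcb v y => ?_) x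
      simp only [LinearMap.comp_apply, LinearMap.flip_apply]
      rw [DTensor.act_tm A K h'' hcb rfl (by omega)]
      simp only [ψ, DTensor.lift_tm, LinearMap.compl₁₂_apply, LinearMap.id_apply]
      rw [X.act_act _ _ rfl (by omega)]
    refine ⟨⟨fun p => (φ p.2).coprod (ψ p.2), fun {i j n i' n'} h hi hn h' x a => ?_⟩, ?_⟩
    · change φ hn (DTensor.act A K h x.1 a) + ψ hn (DTensor.act A K _ x.2 a) =
        X.act h' (φ hi x.1 + ψ hi x.2) a
      rw [hφ h hi hn h', hψ h hi hn h', map_add, LinearMap.add_apply]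
    · rintro ⟨i, _ | _⟩ w
      · change φ rfl (DTensor.tm (add_zero i) w A.one) + ψ rfl 0 = g₁ i w
        rw [map_zero, add_zero]
        simp only [φ, DTensor.lift_tm, LinearMap.compl₁₂_apply, LinearMap.id_apply]
        exact X.act_one _
      · change φ rfl 0 + ψ rfl (DTensor.tm (by simp : i + 0 = i + 1 - 1) w A.one) = g₂ i w
        rw [map_zero, zero_add]
        simp only [ψ, DTensor.lift_tm, LinearMap.compl₁₂_apply, LinearMap.id_apply]
        exact X.act_one _

end FreeModule

/-! ### The free cover of a cdg-module -/

section FreeCover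

variable {𝕜 : Type} [Field 𝕜] {A : CDGAlg.{u} 𝕜} (M : CDGMod.{u} A)

/-- The map `v ⊗ x ↦ v x`. -/
noncomputable def evalMap {n m : ℤ} (h : n = m) : DTensor 𝕜 M.C A.C n →ₗ[𝕜] M.C m :=
  DTensor.lift fun hab => M.act (hab.trans h)

/-- The map `v ⊗ x ↦ (d v) x`. -/
noncomputable def evalD {n m : ℤ} (h : n + 1 = m) : DTensor 𝕜 M.C A.C n →ₗ[𝕜] M.C m :=
  DTensor.lift fun {a b} hab => M.act (by omega : a + 1 + b = m) ∘ₗ M.d rfl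

theorem evalMap_act {i j n i' n' : ℤ} (h : i + j = n) (hi : i = i') (hn : n = n')
    (h' : i' + j = n') (u : DTensor 𝕜 M.C A.C i) (a : A.C j) :
    evalMap M hn (DTensor.act A M.C h u a) = M.act h' (evalMap M hi u) a := by
  refine LinearMap.congr_fun (f := evalMap M hn ∘ₗ (DTensor.act A M.C h).flip a)
    (g := (M.act h').flip a ∘ₗ evalMap M hi) (DTensor.hom_ext fun {c b} hcb v y => ?_) u
  simp only [LinearMap.comp_apply, LinearMap.flip_apply]
  rw [DTensor.act_tm A M.C h hcb rfl (by omega)]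
  simp only [evalMap, DTensor.lift_tm]
  rw [M.act_act _ _ rfl (by omega)]

theorem evalD_act {i j n i' n' : ℤ} (h : i + j = n) (hi : i + 1 = i') (hn : n + 1 = n')
    (h' : i' + j = n') (u : DTensor 𝕜 M.C A.C i) (a : A.C j) :
    evalD M hn (DTensor.act A M.C h u a) = M.act h' (evalD M hi u) a := by
  refine LinearMap.congr_fun (f := evalD M hn ∘ₗ (DTensor.act A M.C h).flip a)
    (g := (M.act h').flip a ∘ₗ evalD M hi) (DTensor.hom_ext fun {c b} hcb v y => ?_) u
  simp only [LinearMap.comp_apply, LinearMap.flip_apply]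
  rw [DTensor.act_tm A M.C h hcb rfl (by omega)]
  simp only [evalD, DTensor.lift_tm, LinearMap.comp_apply]
  rw [M.act_act _ _ rfl (by omega)]

/-- This is the Leibniz rule for `v x`; the term `(d v) x` is the value on the second summand of the
free module, whence the component `x` in `freeD`. -/
theorem d_evalMap {i j l i' j' : ℤ} (h : i' + 1 = j') (hi : i = i') (h₁ : i + 1 = j) (hj : j = j')
    (h₂ : i = l) (h₃ : l + 1 = j') (u : DTensor 𝕜 M.C A.C i) :
    M.d h (evalMap M hi u) =
      evalMap M hj (DTensor.dif A M.C h₁ u) + evalD M h₃ (DTensor.cast A M.C h₂ u) := by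
  refine LinearMap.congr_fun (f := M.d h ∘ₗ evalMap M hi)
    (g := evalMap M hj ∘ₗ DTensor.dif A M.C h₁ + evalD M h₃ ∘ₗ DTensor.cast A M.C h₂)
    (DTensor.hom_ext fun {c b} hcb v y => ?_) u
  simp only [LinearMap.comp_apply, LinearMap.add_apply]
  rw [DTensor.cast_tm, DTensor.dif_tm A M.C h₁ hcb rfl (by omega), map_smul]
  simp only [evalMap, evalD, DTensor.lift_tm, LinearMap.comp_apply]
  rw [M.leibniz _ h rfl rfl (by omega) (by omega), add_comm]

/-- In the Leibniz rule for `(d v) x` the term `d² v = -v B` becomes `-v (B x)`. This is the reason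
for the component `-B y` of `freeD`. -/
theorem d_evalD {i j i' j' l : ℤ} (h : i' + 1 = j') (hi : i + 1 = i') (h₁ : i + 2 = j)
    (hj : j = j') (h₂ : i + 1 = l) (hl : l + 1 = j') (u : DTensor 𝕜 M.C A.C i) :
    M.d h (evalD M hi u) =
      -evalMap M hj (DTensor.curv A M.C h₁ u) - evalD M hl (DTensor.dif A M.C h₂ u) := by
  refine LinearMap.congr_fun (f := M.d h ∘ₗ evalD M hi)
    (g := -(evalMap M hj ∘ₗ DTensor.curv A M.C h₁) - evalD M hl ∘ₗ DTensor.dif A M.C h₂)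
    (DTensor.hom_ext fun {c b} hcb v y => ?_) u
  simp only [LinearMap.comp_apply, LinearMap.sub_apply, LinearMap.neg_apply]
  rw [DTensor.curv_tm A M.C h₁ hcb rfl (by omega),
    DTensor.dif_tm A M.C h₂ hcb rfl (by omega), map_smul]
  simp only [evalMap, evalD, DTensor.lift_tm, LinearMap.comp_apply]
  rw [M.leibniz (i' := c + 2) _ h (by omega) rfl (by omega) (by omega),
    M.d_d rfl (by omega) rfl, ← M.act_act rfl (by omega : c + 2 + b = j') rfl (by omega),
    sgn_congr' (m := c + 1) (n := c) (by simp)]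
  simp only [map_neg, LinearMap.neg_apply]
  module

/-- The canonical surjection from the free cdg-module. -/
noncomputable def freeCover : Homs (freeMod A M.C).toGrMod M.toGrMod 0 :=
  ⟨fun p => (evalMap M ((add_zero _).symm.trans p.2)).coprod
    (evalD M (by have := p.2; omega : p.1.1 - 1 + 1 = p.1.2)), by
    intro i j n i' n' h hi hn h' x a
    have e₁ := evalMap_act M h ((add_zero i).symm.trans hi) ((add_zero n).symm.trans hn) h' x.1 a
    have e₂ := evalD_act M (by omega : i - 1 + j = n - 1) (by omega : i - 1 + 1 = i')
      (by omega : n - 1 + 1 = n') h' x.2 a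
    exact (congrArg₂ (· + ·) e₁ e₂).trans (LinearMap.map_add₂ _ _ _ _).symm⟩

theorem freeCover_app {i j : ℤ} (h : i + 0 = j) (x : DTensor 𝕜 M.C A.C i)
    (y : DTensor 𝕜 M.C A.C (i - 1)) : (freeCover M).app h (x, y) =
      evalMap M ((add_zero _).symm.trans h) x + evalD M (by omega : i - 1 + 1 = j) y := rfl

theorem freeCover_closed : IsClosedHom (freeCover M) := by
  refine Subtype.ext (funext fun p => LinearMap.ext fun x => ?_)
  obtain ⟨⟨i, j⟩, h⟩ := p
  dsimp only at h x ⊢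
  obtain ⟨x, y⟩ := x
  refine (homD_apply (zero_add 1) (freeCover M) h (add_zero i) h h (add_zero j) (x, y)).trans ?_
  have e₁ : (freeMod A M.C).d h (x, y) = (DTensor.dif A M.C h x -
      DTensor.curv A M.C (by omega : i - 1 + 2 = j) y,
      DTensor.cast A M.C (by omega : i = j - 1) x -
        DTensor.dif A M.C (by omega : i - 1 + 1 = j - 1) y) := rfl
  rw [e₁, freeCover_app, freeCover_app, map_add, map_sub, map_sub,
    d_evalMap M h _ h rfl (by omega : i = j - 1) (by omega),
    d_evalD M h _ (by omega : i - 1 + 2 = j) rfl (by omega : i - 1 + 1 = j - 1) (by omega),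
    sgn_even Even.zero]
  refine Eq.trans ?_ (rfl : (0 : M.C j) = _)
  module

/-- The map `v ↦ v ⊗ 1` is a linear section in each degree; it splits the short exact sequence of
the cover. -/
theorem freeCover_section {i : ℤ} (v : M.C i) :
    (freeCover M).app (add_zero i) (DTensor.tm (add_zero i) v A.one, 0) = v := by
  rw [freeCover_app, map_zero, add_zero]
  simp only [evalMap, DTensor.lift_tm]
  exact M.act_one v

end FreeCover

/-! ### Kernels of closed morphisms and countable dimension -/

section Kernel

variable {𝕜 : Type} [Field 𝕜] {A : CDGAlg.{u} 𝕜} {L M : CDGMod.{u} A}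

/-- The kernel of a closed morphism. -/
def CDGMod.ker (f : Homs L.toGrMod M.toGrMod 0) (hf : IsClosedHom f) : CDGMod.{u} A where
  C i := LinearMap.ker (f.app (add_zero i))
  act {i j n} h := LinearMap.mk₂ 𝕜
    (fun x a => ⟨L.act h x.1 a, by
      rw [LinearMap.mem_ker, f.app_act h (add_zero i) (add_zero n) h, LinearMap.mem_ker.1 x.2,
        map_zero, LinearMap.zero_apply]⟩)
    (by intros; ext; simp) (by intros; ext; simp) (by intros; ext; simp) (by intros; ext; simp)
  act_one x := Subtype.ext (L.act_one x.1)
  act_act h₁ h₂ h₃ h₄ x y z := Subtype.ext (L.act_act h₁ h₂ h₃ h₄ x.1 y z)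
  d {i j} h := (L.d h ∘ₗ Submodule.subtype _).codRestrict _ fun x => by
    rw [LinearMap.mem_ker, LinearMap.comp_apply, hf.app_d]
    exact (congrArg (M.d h) (LinearMap.mem_ker.1 x.2)).trans (map_zero _)
  leibniz h hn hi hj h₁ h₂ x y := Subtype.ext (L.leibniz h hn hi hj h₁ h₂ x.1 y)
  d_d h₁ h₂ h₃ x := Subtype.ext (L.d_d h₁ h₂ h₃ x.1)

end Kernel

section Countable

variable {𝕜 : Type} [Field 𝕜]

theorem IsCountableDim.dTensor {E F : ℤ → Type u} [∀ i, AddCommGroup (E i)] [∀ i, Module 𝕜 (E i)]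
    [∀ i, AddCommGroup (F i)] [∀ i, Module 𝕜 (F i)] (hE : IsCountableDim 𝕜 E)
    (hF : IsCountableDim 𝕜 F) : IsCountableDim 𝕜 (DTensor 𝕜 E F) := by
  intro n
  rw [rank_directSum]
  refine (Cardinal.sum_le_sum _ (fun _ => Cardinal.aleph0) fun p => ?_).trans ?_
  · rw [rank_tensorProduct']
    exact (mul_le_mul' (hE _) (hF _)).trans Cardinal.aleph0_mul_aleph0.le
  · rw [Cardinal.sum_const]
    exact (mul_le_mul' (by simp) (by simp)).trans Cardinal.aleph0_mul_aleph0.le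

theorem IsCountableDim.freeMod {A : CDGAlg.{u} 𝕜} {K : ℤ → Type u} [∀ i, AddCommGroup (K i)]
    [∀ i, Module 𝕜 (K i)] (hA : IsCountableDim 𝕜 A.C) (hK : IsCountableDim 𝕜 K) :
    IsCountableDim 𝕜 (freeMod A K).C := by
  intro n
  refine (rank_prod' (R := 𝕜) (M := DTensor 𝕜 K A.C n)
    (M₁ := DTensor 𝕜 K A.C (n - 1))).le.trans ?_
  exact Cardinal.add_le_aleph0.2 ⟨hK.dTensor hA n, hK.dTensor hA (n - 1)⟩

theorem IsCountableDim.ker {A : CDGAlg.{u} 𝕜} {L M : CDGMod.{u} A} (hL : IsCountableDim 𝕜 L.C)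
    (f : Homs L.toGrMod M.toGrMod 0) (hf : IsClosedHom f) :
    IsCountableDim 𝕜 (CDGMod.ker f hf).C :=
  fun n => (Submodule.rank_le (LinearMap.ker (f.app (add_zero n)))).trans (hL n)

end Countable

/-! ### Towers of short exact sequences -/

section Tower

open CategoryTheory CLCTMod

variable {𝕜 : Type} [RCLike 𝕜] {A : CLCTAlg.{u} 𝕜}

variable (A) in
/-- A sequence of short exact sequences `0 → K (n + 1) → B n → K n → 0`. -/
structure Tower where
  K : ℕ → CLCTMod.{u} A
  B : ℕ → CLCTMod.{u} A
  S : ∀ n, SES (K (n + 1)) (B n) (K n)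

/-- The short exact sequence given by the free cover of a module with the finest topology. -/
noncomputable def freeSES (hA : IsDiscreteLC 𝕜 A.C) (hA' : IsCountableDim 𝕜 A.C)
    (M : CLCTMod.{u} A) (hM : ∀ i, Finest 𝕜 (M.C i)) (hM' : IsCountableDim 𝕜 M.C) :
    SES ((CDGMod.ker (freeCover M.toCDGMod) (freeCover_closed M.toCDGMod)).toCLCT hA hA'
        ((hA'.freeMod hM').ker _ _))
      ((freeMod A.toCDGAlg M.C).toCLCT hA hA' (hA'.freeMod hM')) M := by
  have hF := CDGMod.finest_toCLCT hA hA' (freeMod A.toCDGAlg M.C) (hA'.freeMod hM')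
  have hK := CDGMod.finest_toCLCT hA hA'
    (CDGMod.ker (freeCover M.toCDGMod) (freeCover_closed M.toCDGMod)) ((hA'.freeMod hM').ker _ _)
  -- The splitting is the algebraic one; it is continuous because every linear map out of a space
  -- with the finest topology is.
  let s : ∀ i, M.C i →ₗ[𝕜] (freeMod A.toCDGAlg M.C).C i := fun i =>
    LinearMap.inl 𝕜 _ _ ∘ₗ (DTensor.tm (add_zero i)).flip A.one
  have hs : ∀ i v, (freeCover M.toCDGMod).app (add_zero i) (s i v) = v := fun i v =>
    freeCover_section M.toCDGMod v
  let r : ∀ i, (freeMod A.toCDGAlg M.C).C i →ₗ[𝕜]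
      LinearMap.ker ((freeCover M.toCDGMod).app (add_zero i)) := fun i =>
    (LinearMap.id - s i ∘ₗ (freeCover M.toCDGMod).app (add_zero i)).codRestrict _ fun x => by
      rw [LinearMap.mem_ker, LinearMap.sub_apply, LinearMap.comp_apply, map_sub, hs]
      exact sub_self _
  exact {
    i := ⟨fun i => ⟨(LinearMap.ker ((freeCover M.toCDGMod).app (add_zero i))).subtype,
      (hK i).continuous _⟩, fun _ _ _ => rfl, fun _ _ => rfl⟩
    p := ⟨fun i => ⟨(freeCover M.toCDGMod).app (add_zero i), (hF i).continuous _⟩,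
      fun h x a => (freeCover M.toCDGMod).app_act h _ _ h x a,
      fun h x => (freeCover_closed M.toCDGMod).app_d h x⟩
    r := fun i => ⟨r i, (hF i).continuous _⟩
    s := fun i => ⟨s i, (hM i).continuous _⟩
    p_i := fun i x => LinearMap.mem_ker.1 x.2
    r_i := fun i x => Subtype.ext (by
      change x.1 - s i ((freeCover M.toCDGMod).app (add_zero i) x.1) = x.1
      rw [LinearMap.mem_ker.1 x.2, map_zero, sub_zero])
    p_s := hs
    split := fun i x => sub_add_cancel _ _ }

end Tower

/-! ### The resolution and the product totalization of a tower -/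

section TowerResolution

open CategoryTheory CLCTMod

variable {𝕜 : Type} [RCLike 𝕜] {A : CLCTAlg.{u} 𝕜}

/-- A cdg-module with a topology whose structure maps are continuous. -/
def CDGMod.ofFamBdd (M : CDGMod.{u} A.toCDGAlg) [U : ∀ i, UniformSpace (M.C i)]
    [L : ∀ i, CompleteLC 𝕜 (M.C i)]
    (h : ∀ n, FamBdd fun p : {p : ℤ × ℤ // p.1 + p.2 = n} => M.act p.2)
    (hd : ∀ {i j : ℤ} (h : i + 1 = j), Continuous (M.d h)) : CLCTMod.{u} A where
  toCDGMod := M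
  unif := U
  clc := L
  act_cont n := (h n).extendsToTensor
  d_cont := hd

/-- A module of countable dimension with the finest locally convex topology. -/
structure FinestMod (A : CLCTAlg.{u} 𝕜) where
  M : CLCTMod.{u} A
  finest : ∀ i, Finest 𝕜 (M.C i)
  countable : IsCountableDim 𝕜 M.C

section

variable (hA : IsDiscreteLC 𝕜 A.C) (hA' : IsCountableDim 𝕜 A.C)

/-- The iterated kernels of the free covers. -/
noncomputable def syzygy (M : FinestMod A) : ℕ → FinestMod A
  | 0 => M
  | n + 1 => ⟨(CDGMod.ker (freeCover (syzygy M n).M.toCDGMod)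
      (freeCover_closed (syzygy M n).M.toCDGMod)).toCLCT hA hA'
        ((hA'.freeMod (syzygy M n).countable).ker _ _),
      CDGMod.finest_toCLCT hA hA' (CDGMod.ker (freeCover (syzygy M n).M.toCDGMod)
        (freeCover_closed (syzygy M n).M.toCDGMod)) ((hA'.freeMod (syzygy M n).countable).ker _ _),
      (hA'.freeMod (syzygy M n).countable).ker (freeCover (syzygy M n).M.toCDGMod)
        (freeCover_closed (syzygy M n).M.toCDGMod)⟩

/-- The tower of free covers. -/
noncomputable def freeTower (M : FinestMod A) : Tower A where
  K n := (syzygy hA hA' M n).M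
  B n := (freeMod A.toCDGAlg (syzygy hA hA' M n).M.C).toCLCT hA hA'
    (hA'.freeMod (syzygy hA hA' M n).countable)
  S n := freeSES hA hA' _ (syzygy hA hA' M n).finest (syzygy hA hA' M n).countable

/-- The free generators of the modules in the tower of free covers. -/
noncomputable def freeTowerGen (M : FinestMod A) (n : ℕ) :
    FreeOn ((freeTower hA hA' M).B n).toGrMod :=
  freeOnFreeMod A.toCDGAlg (syzygy hA hA' M n).M.C

theorem finest_freeTower (M : FinestMod A) (n : ℕ) (i : ℤ) :
    Finest 𝕜 (((freeTower hA hA' M).B n).C i) :=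
  CDGMod.finest_toCLCT hA hA' (freeMod A.toCDGAlg (syzygy hA hA' M n).M.C)
    (hA'.freeMod (syzygy hA hA' M n).countable) i

end

namespace CLCTMod.SES

variable {K L M : CLCTMod.{u} A} (S : SES K L M)

theorem p_surjective (i : ℤ) : Function.Surjective (Hom.app S.p i) := fun y => ⟨S.s i y, S.p_s i y⟩

theorem exact (i : ℤ) : Function.Exact (Hom.app S.i i) (Hom.app S.p i) := fun x => by
  constructor
  · intro h
    refine ⟨S.r i x, ?_⟩
    have := S.split i x
    rwa [h, map_zero, add_zero] at this
  · rintro ⟨y, rfl⟩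
    exact S.p_i i y

theorem i_injective (i : ℤ) : Function.Injective (Hom.app S.i i) := fun x y h => by
  rw [← S.r_i i x, h, S.r_i]

end CLCTMod.SES

namespace Tower

variable (t : Tower A)

/-- The map `B (n + 1) → K (n + 1) → B n`. -/
def del (n : ℕ) : t.B (n + 1) ⟶ t.B n := (t.S (n + 1)).p ≫ (t.S n).i

/-- The complex `⋯ → B 1 → B 0`. -/
def complex : CDGComplex.{u} A.toCDGAlg where
  F n := (t.B n).toCDGMod
  del n := homs (t.del n)
  del_closed n := homs_closed _
  del_del n x := funext fun i => by
    rw [homs_hat, homs_hat]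
    exact (congrArg _ ((t.S (n + 1)).p_i i _)).trans (map_zero (Hom.app (t.S n).i i))

/-- The resolution given by a tower of graded-projective modules. -/
def resolution (h : ∀ n, IsGradedProjective (t.B n).toGrMod) : GPResolution (t.K 0).toCDGMod where
  F n := (t.B n).toCDGMod
  del n := homs (t.del n)
  aug := homs (t.S 0).p
  proj := h
  del_closed n := homs_closed _
  aug_closed := homs_closed _
  aug_surj i := (t.S 0).p_surjective i
  exact_zero i := by
    refine fun x => ((t.S 0).exact i x).trans ?_
    constructor
    · rintro ⟨y, rfl⟩
      obtain ⟨z, rfl⟩ := (t.S 1).p_surjective i y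
      exact ⟨z, rfl⟩
    · rintro ⟨z, rfl⟩
      exact ⟨_, rfl⟩
  exact_succ n i := by
    intro x
    have h0 : (homs (t.del n)).app (add_zero i) x = 0 ↔ Hom.app (t.S (n + 1)).p i x = 0 :=
      ⟨fun h => (t.S n).i_injective i (h.trans (map_zero (Hom.app (t.S n).i i)).symm),
        fun h => (congrArg _ h).trans (map_zero (Hom.app (t.S n).i i))⟩
    refine h0.trans (((t.S (n + 1)).exact i x).trans ?_)
    constructor
    · rintro ⟨y, rfl⟩
      obtain ⟨z, rfl⟩ := (t.S (n + 2)).p_surjective i y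
      exact ⟨z, rfl⟩
    · rintro ⟨z, rfl⟩
      exact ⟨_, rfl⟩

/-- The homogeneous components of the product totalization. -/
abbrev TotC (i : ℤ) : Type u := ∀ p : {p : ℕ × ℤ // i + p.1 = p.2}, (t.B p.1.1).C p.1.2

/-- Joint continuity into a product is tested on each factor, and there the action involves a single
component of the argument. -/
theorem famBdd_act (n : ℤ) : FamBdd (𝕜 := 𝕜) (fun p : {p : ℤ × ℤ // p.1 + p.2 = n} =>
    (show t.TotC p.1.1 →ₗ[𝕜] A.C p.1.2 →ₗ[𝕜] t.TotC n from t.complex.that.act p.2)) := by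
  refine FamBdd.pi fun c => ?_
  have h := ((t.B c.1.1).act_cont c.1.2).famBdd
  refine FamBdd.comp (FamBdd.reindex h (fun p : {p : ℤ × ℤ // p.1 + p.2 = n} =>
    (⟨(p.1.1 + c.1.1, p.1.2), by have := p.2; have := c.2; omega⟩ :
      {p : ℤ × ℤ // p.1 + p.2 = c.1.2})) ?_)
    (fun p => ContinuousLinearMap.proj
      (⟨(c.1.1, p.1.1 + c.1.1), rfl⟩ : {q : ℕ × ℤ // p.1.1 + q.1 = q.2}))
    (fun p => ContinuousLinearMap.id 𝕜 _) fun p x y => rfl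
  rintro ⟨⟨a, b⟩, h⟩ ⟨⟨a', b'⟩, h'⟩ e
  simp_all

theorem continuous_d {i j : ℤ} (h : i + 1 = j) :
    Continuous (show t.TotC i → t.TotC j from t.complex.that.d h) := by
  refine continuous_pi fun p => ?_
  have h1 : Continuous fun y : t.TotC i =>
      (t.B p.1.1).d (by have := p.2; omega : i + p.1.1 + 1 = p.1.2)
        (y ⟨(p.1.1, i + p.1.1), rfl⟩) := ((t.B p.1.1).d_cont _).comp (continuous_apply _)
  have h2 : Continuous fun y : t.TotC i =>
      Hom.app (t.del p.1.1) p.1.2 (y ⟨(p.1.1 + 1, p.1.2), by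
        have := p.2; push_cast; omega⟩) := (Hom.app (t.del p.1.1) p.1.2).continuous.comp
          (continuous_apply _)
  exact (h1.add h2).const_smul (sgn 𝕜 p.1.1)

/-- The product totalization of the complex `⋯ → B 1 → B 0`. -/
def that : CLCTMod.{u} A :=
  t.complex.that.ofFamBdd (U := fun i => inferInstanceAs (UniformSpace (t.TotC i)))
    (L := fun i => inferInstanceAs (CompleteLC 𝕜 (t.TotC i))) t.famBdd_act t.continuous_d

/-- The projection `y ↦ y n`. -/
def pr (n : ℕ) : Homs t.that.toGrMod (t.B n).toGrMod n := t.complex.pr n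

theorem cont_pr (n : ℕ) : Cont (t.pr n) := ⟨fun {i j} h =>
  (continuous_apply (⟨(n, j), h⟩ : {p : ℕ × ℤ // i + p.1 = p.2}) :
    Continuous fun y : t.TotC i => y ⟨(n, j), h⟩)⟩

variable {t} in
theorem that_ext {x y : t.that.Tot} (h : ∀ n, (t.pr n).hat x = (t.pr n).hat y) : x = y :=
  CDGComplex.that_ext h

theorem pr_dh (n : ℕ) (x : t.that.Tot) : (t.pr n).hat (t.that.dh x) =
    sgn 𝕜 n • ((t.B n).dh ((t.pr n).hat x) +
      (homs (t.S n).i).hat ((homs (t.S (n + 1)).p).hat ((t.pr (n + 1)).hat x))) := by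
  refine (t.complex.pr_dh n x).trans ?_
  refine congrArg (fun z => sgn 𝕜 n • ((t.B n).dh ((t.pr n).hat x) + z)) ?_
  refine (congrArg (fun f => f.hat ((t.pr (n + 1)).hat x)) (homs_comp (t.S (n + 1)).p
    (t.S n).i)).trans ?_
  rw [Homs.comp_hat]

/-- The tower without its first member. -/
abbrev tail : Tower A where
  K n := t.K (n + 1)
  B n := t.B (n + 1)
  S n := t.S (n + 1)

/-- The map `(y 0, y 1, …) ↦ (y 1, y 2, …)` of degree `1`. -/
def tl : Homs t.that.toGrMod t.tail.that.toGrMod 1 :=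
  Homs.mk' (fun {i j} h => show t.TotC i →ₗ[𝕜] t.tail.TotC j from LinearMap.pi fun p =>
    LinearMap.proj (⟨(p.1.1 + 1, p.1.2), by have := p.2; push_cast; omega⟩ :
      {p : ℕ × ℤ // i + p.1 = p.2})) (by
    intro i j n i' n' h hi hn h' x a
    subst hi hn
    funext p
    obtain ⟨⟨m, l⟩, hp⟩ := p
    obtain rfl : n + 1 + (m : ℤ) = l := hp
    have key : ∀ {e e' f : ℤ} (h₁ : i + (m + 1 : ℕ) = e) (h₂ : i + (m + 1 : ℕ) = e')
        (h₁' : e + j = f) (h₂' : e' + j = f) (x : t.TotC i), (t.B (m + 1)).act h₁'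
          (x ⟨(m + 1, e), h₁⟩) a = (t.B (m + 1)).act h₂' (x ⟨(m + 1, e'), h₂⟩) a := by
      intro e e' f h₁ h₂ h₁' h₂' x
      subst h₁ h₂
      rfl
    exact key _ (by push_cast; omega) _ _ x)

theorem pr_tl (n : ℕ) (x : t.that.Tot) :
    (t.tail.pr n).hat (t.tl.hat x) = (t.pr (n + 1)).hat x := by
  funext j
  rw [Homs.hat_apply _ (sub_add_cancel j n), Homs.hat_apply _ (by omega : j - n - 1 + 1 = j - n),
    Homs.hat_apply _ (by push_cast; omega : j - n - 1 + (n + 1 : ℕ) = j)]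
  rfl

/-- Removing the first member changes the parity of every index, hence the sign of the total
differential: `tl` is closed as a map of degree `1`. -/
theorem tl_dh (x : t.that.Tot) : t.tl.hat (t.that.dh x) = -t.tail.that.dh (t.tl.hat x) := by
  refine that_ext fun n => ?_
  rw [pr_tl, pr_dh, map_neg, pr_dh, pr_tl, pr_tl]
  have h : sgn 𝕜 (n + 1 : ℕ) = -sgn 𝕜 n := by
    rw [Nat.cast_succ, sgn_add, sgn_one, mul_neg_one]
  exact (congrArg (· • _) h).trans (neg_smul _ _)

theorem cont_tl : Cont t.tl := ⟨fun {i j} h => by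
  have h1 : Continuous fun (y : t.TotC i) (p : {p : ℕ × ℤ // j + p.1 = p.2}) =>
      y ⟨(p.1.1 + 1, p.1.2), by have := p.2; push_cast; omega⟩ :=
    continuous_pi fun p => continuous_apply _
  exact h1⟩

end Tower

end TowerResolution

/-! ### Limits of sequences of contraacyclic modules -/

section MittagLeffler

namespace CLCTMod

open CategoryTheory

variable {𝕜 : Type} [RCLike 𝕜] {A : CLCTAlg.{u} 𝕜} {K L M N T T' : CLCTMod.{u} A}

/-- The map of cones given by a map of the sources. -/
def coneMap {f : T ⟶ N} {f' : T' ⟶ N} (g : T ⟶ T') (h : g ≫ f' = f) : cone f ⟶ cone f' where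
  app i := (ContinuousLinearMap.id 𝕜 (N.C i)).prodMap (Hom.app g (i + 1))
  app_act hn x a := Prod.ext rfl (Hom.app_act g _ _ _)
  app_d {i j} hij x := by
    subst h hij
    refine Prod.ext rfl ?_
    change Hom.app g _ (-T.d _ x.2) = -T'.d _ (Hom.app g _ x.2)
    rw [map_neg, Hom.app_d]

@[simp] theorem coneFst_coneMap {f : T ⟶ N} {f' : T' ⟶ N} (g : T ⟶ T') (h : g ≫ f' = f)
    (z : (cone f).Tot) : (coneFst f').hat ((homs (coneMap g h)).hat z) = (coneFst f).hat z :=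
  funext fun i => by
    rw [coneFst_hat, coneFst_hat, homs_hat]
    rfl

@[simp] theorem coneSnd_coneMap {f : T ⟶ N} {f' : T' ⟶ N} (g : T ⟶ T') (h : g ≫ f' = f)
    (z : (cone f).Tot) : (coneSnd f').hat ((homs (coneMap g h)).hat z) =
      (homs g).hat ((coneSnd f).hat z) :=
  funext fun j => by
    obtain ⟨i, rfl⟩ : ∃ i, j = i + 1 := ⟨j - 1, by omega⟩
    rw [coneSnd_hat, homs_hat, homs_hat, coneSnd_hat]
    rfl

variable (M) in
-- The map `inr ∘ fst` is a contracting homotopy.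
theorem contraacyclic_cone_id : (cone (𝟙 M)).Contraacyclic := by
  refine contraacyclic_of_homotopic_zero (Homs.comp (coneInr (𝟙 M)) (coneFst (𝟙 M)) (zero_add _))
    ((cont_coneInr _).comp (cont_coneFst _) _) fun x => ?_
  refine cone_ext _ ?_ ?_ <;> simp [homs_id]

/-- A description of a module as a limit of a sequence of linearly split epimorphisms. -/
structure MLSystem (X : CLCTMod.{u} A) where
  T : ℕ → CLCTMod.{u} A
  toT : ∀ m, X ⟶ T m
  tr : ∀ m, T (m + 1) ⟶ T m
  toT_tr : ∀ m i x, Hom.app (tr m) i (Hom.app (toT (m + 1)) i x) = Hom.app (toT m) i x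
  sec : ∀ m i, (T m).C i →L[𝕜] (T (m + 1)).C i
  tr_sec : ∀ m i x, Hom.app (tr m) i (sec m i x) = x
  lim : ∀ i, (∀ m, (T m).C i) →L[𝕜] X.C i
  lim_toT : ∀ i x, lim i (fun m => Hom.app (toT m) i x) = x
  toT_lim : ∀ i x, (∀ m, Hom.app (tr m) i (x (m + 1)) = x m) →
    ∀ m, Hom.app (toT m) i (lim i x) = x m

namespace MLSystem

variable {X : CLCTMod.{u} A} (D : MLSystem X)

/-- The product of the terms of the sequence. -/
def prod : CLCTMod.{u} A := CLCTMod.pi fun c : ULift.{u} ℕ => D.T c.down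

/-- The homogeneous components of the product. -/
abbrev ProdC (i : ℤ) : Type u := ∀ c : ULift.{u} ℕ, (D.T c.down).C i

/-- The components of a linear section of `1 - tr`. -/
def secAux (i : ℤ) : ∀ m : ℕ, D.ProdC i →L[𝕜] (D.T m).C i
  | 0 => 0
  | m + 1 => (D.sec m i).comp (secAux i m - ContinuousLinearMap.proj (⟨m⟩ : ULift.{u} ℕ))

/-- `1 - tr` in degree `i`. -/
def oneSub (i : ℤ) : D.ProdC i →L[𝕜] D.ProdC i :=
  ContinuousLinearMap.pi fun c => ContinuousLinearMap.proj c -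
    (Hom.app (D.tr c.down) i).comp (ContinuousLinearMap.proj
      (φ := fun c : ULift.{u} ℕ => (D.T c.down).C i) ⟨c.down + 1⟩)

/-- A linear section of `1 - tr`. -/
def secProd (i : ℤ) : D.ProdC i →L[𝕜] D.ProdC i :=
  ContinuousLinearMap.pi fun c => D.secAux i c.down

/-- The equations `x m - tr (x (m + 1)) = y m` are solved recursively, starting from `x 0 = 0`, by
`x (m + 1) = sec (x m - y m)`. -/
theorem oneSub_secProd (i : ℤ) (y : D.ProdC i) : D.oneSub i (D.secProd i y) = y := by
  funext ⟨m⟩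
  change D.secAux i m y - Hom.app (D.tr m) i (D.sec m i (D.secAux i m y - y ⟨m⟩)) = _
  rw [D.tr_sec, sub_sub_cancel]

/-- The limit, on the product. -/
def limProd (i : ℤ) : D.ProdC i →L[𝕜] X.C i :=
  (D.lim i).comp (ContinuousLinearMap.pi fun m => ContinuousLinearMap.proj (⟨m⟩ : ULift.{u} ℕ))

/-- The map to the product. -/
def toProd (i : ℤ) : X.C i →L[𝕜] D.ProdC i :=
  ContinuousLinearMap.pi fun c => Hom.app (D.toT c.down) i

theorem oneSub_toProd (i : ℤ) (x : X.C i) : D.oneSub i (D.toProd i x) = 0 := by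
  funext ⟨m⟩
  change Hom.app (D.toT m) i x - Hom.app (D.tr m) i (Hom.app (D.toT (m + 1)) i x) = 0
  rw [D.toT_tr, sub_self]

/-- The kernel of `1 - tr` consists of the compatible sequences, and these are recovered from their
limits. -/
theorem toProd_limProd (i : ℤ) (x : D.ProdC i) (hx : D.oneSub i x = 0) :
    D.toProd i (D.limProd i x) = x := by
  funext ⟨m⟩
  exact D.toT_lim i (fun m => x ⟨m⟩) (fun m => (sub_eq_zero.1 (congrFun hx ⟨m⟩)).symm) m

/-- The sequence `0 → X → ∏ T m → ∏ T m → 0`. -/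
def ses : SES X D.prod D.prod where
  i := ⟨D.toProd, fun h x a => funext fun c => Hom.app_act (D.toT c.down) h x a,
    fun h x => funext fun c => Hom.app_d (D.toT c.down) h x⟩
  p := ⟨D.oneSub, fun {i j n} h (x : D.ProdC i) a => funext fun c => by
      change (D.T c.down).act h (x c) a -
        Hom.app (D.tr c.down) n ((D.T (c.down + 1)).act h (x ⟨c.down + 1⟩) a) =
          (D.T c.down).act h (x c - Hom.app (D.tr c.down) i (x ⟨c.down + 1⟩)) a
      rw [Hom.app_act, map_sub, LinearMap.sub_apply],
    fun {i j} h (x : D.ProdC i) => funext fun c => by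
      change (D.T c.down).d h (x c) -
        Hom.app (D.tr c.down) j ((D.T (c.down + 1)).d h (x ⟨c.down + 1⟩)) =
          (D.T c.down).d h (x c - Hom.app (D.tr c.down) i (x ⟨c.down + 1⟩))
      rw [Hom.app_d, map_sub]⟩
  -- Subtracting the section of `1 - tr` projects onto the compatible sequences; the limit then
  -- gives an element of `X`.
  r i := (D.limProd i).comp (ContinuousLinearMap.id 𝕜 (D.ProdC i) -
    (D.secProd i).comp (D.oneSub i))
  s := D.secProd
  p_i := D.oneSub_toProd
  r_i i x := by
    change D.limProd i (D.toProd i x - D.secProd i (D.oneSub i (D.toProd i x))) = x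
    rw [D.oneSub_toProd, map_zero, sub_zero]
    exact D.lim_toT i x
  p_s := D.oneSub_secProd
  split i (x : D.ProdC i) := by
    change D.toProd i (D.limProd i (x - D.secProd i (D.oneSub i x))) +
      D.secProd i (D.oneSub i x) = x
    rw [D.toProd_limProd, sub_add_cancel]
    rw [map_sub, D.oneSub_secProd, sub_self]

/-- Two of the three terms of `ses` are products of contraacyclic modules, and `X` is the left one.
-/
theorem contraacyclic (h : ∀ m, (D.T m).Contraacyclic) : X.Contraacyclic :=
  D.ses.contraacyclic_left (Contraacyclic.pi _ fun c => h c.down)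
    (Contraacyclic.pi _ fun c => h c.down)

variable {M : CLCTMod.{u} A} (eps : ∀ m, D.T m ⟶ M) (heps : ∀ m, D.tr m ≫ eps m = eps (m + 1))
  (aug : X ⟶ M) (haug : ∀ m, D.toT m ≫ eps m = aug)

/-- The cones of the maps from a sequence to a fixed module. -/
def cone : MLSystem (cone aug) where
  T m := CLCTMod.cone (eps m)
  toT m := coneMap (D.toT m) (haug m)
  tr m := coneMap (D.tr m) (heps m)
  toT_tr m i x := Prod.ext rfl (D.toT_tr m (i + 1) x.2)
  sec m i := (ContinuousLinearMap.id 𝕜 (M.C i)).prodMap (D.sec m (i + 1))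
  tr_sec m i x := Prod.ext rfl (D.tr_sec m (i + 1) x.2)
  -- The component in `M` is constant along a compatible sequence and is read off at the index `0`.
  lim i := show (∀ m, M.C i × (D.T m).C (i + 1)) →L[𝕜] M.C i × X.C (i + 1) from
    ((ContinuousLinearMap.fst 𝕜 (M.C i) ((D.T 0).C (i + 1))).comp (ContinuousLinearMap.proj 0)).prod
      ((D.lim (i + 1)).comp (ContinuousLinearMap.pi fun m =>
        (ContinuousLinearMap.snd 𝕜 (M.C i) ((D.T m).C (i + 1))).comp (ContinuousLinearMap.proj m)))
  lim_toT i x := Prod.ext rfl (D.lim_toT (i + 1) x.2)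
  toT_lim i x hx m := by
    refine Prod.ext ?_ (D.toT_lim (i + 1) (fun m => (x m).2)
      (fun m => congrArg Prod.snd (hx m)) m)
    change (x 0).1 = (x m).1
    induction m with
    | zero => rfl
    | succ m ih => exact ih.trans (congrArg Prod.fst (hx m)).symm

end MLSystem

/-- A module over `K`. -/
structure Stage (K : CLCTMod.{u} A) where
  X : CLCTMod.{u} A
  eps : X ⟶ K

/-- The map to `M` from the cone of `T → K → L`. -/
def SES.coneDesc (S : SES K L M) (e : T ⟶ K) : CLCTMod.cone (e ≫ S.i) ⟶ M where
  app i := (Hom.app S.p i).comp (ContinuousLinearMap.fst 𝕜 (L.C i) (T.C (i + 1)))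
  app_act h x a := Hom.app_act S.p h x.1 a
  app_d {i j} h x := by
    subst h
    change Hom.app S.p _ (L.d _ x.1 + Hom.app S.i _ (Hom.app e _ x.2)) =
      M.d _ (Hom.app S.p _ x.1)
    rw [map_add, S.p_i, add_zero, Hom.app_d]

@[simp] theorem SES.coneDesc_hat (S : SES K L M) (e : T ⟶ K) (z : (CLCTMod.cone (e ≫ S.i)).Tot) :
    (homs (S.coneDesc e)).hat z = (homs S.p).hat ((coneFst (e ≫ S.i)).hat z) :=
  funext fun i => by
    rw [homs_hat, homs_hat, coneFst_hat]
    rfl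

end CLCTMod

end MittagLeffler

/-! ### Replacing the kernel of a short exact sequence by a module over it -/

section StageCones

namespace CLCTMod

open CategoryTheory

variable {𝕜 : Type} [RCLike 𝕜] {A : CLCTAlg.{u} 𝕜} {K L M T : CLCTMod.{u} A}

namespace SES

variable (S : SES K L M) (e : T ⟶ K)

@[simp] theorem fromCone_hat (z : (CLCTMod.cone S.i).Tot) :
    (homs S.fromCone).hat z = (homs S.p).hat ((coneFst S.i).hat z) :=
  funext fun i => by
    rw [homs_hat, homs_hat, coneFst_hat]
    rfl

@[simp] theorem homs_p_i (x : K.Tot) : (homs S.p).hat ((homs S.i).hat x) = 0 :=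
  funext fun i => by
    rw [homs_hat, homs_hat, S.p_i]
    rfl

/-- The `K`-component of the totalization, as a degree `2` map to the cone of `e`. -/
def totConeHoms : Homs (CLCTMod.cone S.fromCone).toGrMod (CLCTMod.cone e).toGrMod 2 :=
  Homs.comp (coneInl e) (Homs.comp (coneSnd S.i) (coneSnd S.fromCone) (by omega : 1 + 1 = (2 : ℤ)))
    (by omega)

theorem totConeHoms_hat (w : (CLCTMod.cone S.fromCone).Tot) : (S.totConeHoms e).hat w =
    (coneInl e).hat ((coneSnd S.i).hat ((coneSnd S.fromCone).hat w)) := by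
  rw [totConeHoms, Homs.comp_hat, Homs.comp_hat]

theorem cont_totConeHoms : Cont (S.totConeHoms e) :=
  (cont_coneInl _).comp ((cont_coneSnd _).comp (cont_coneSnd _) _) _

theorem totConeHoms_dh (w : (CLCTMod.cone S.fromCone).Tot) : (S.totConeHoms e).hat ((CLCTMod.cone S.fromCone).dh w) =
    (CLCTMod.cone e).dh ((S.totConeHoms e).hat w) := by
  rw [totConeHoms_hat, totConeHoms_hat, dh_coneInl]
  rw [coneSnd_dh, map_neg, coneSnd_dh, neg_neg]

theorem sgn_two : sgn 𝕜 2 = 1 := sgn_even even_two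

theorem isClosedHom_totCone : IsClosedHom
    (Homs.comp (shIn (CLCTMod.cone e) 2) (S.totConeHoms e) (add_neg_cancel 2)) :=
  (CDGMod.homD_eq_zero_iff _ _).2 fun x => by
    rw [Homs.comp_hat, Homs.comp_hat, totConeHoms_dh, shIn_dh, sgn_zero, one_smul, sgn_two,
      one_smul]

/-- The `K`-component of the totalization, as a closed map to the shifted cone of `e`. -/
def totCone : (CLCTMod.cone S.fromCone) ⟶ (CLCTMod.cone e).shift 2 :=
  ofHoms (Homs.comp (shIn (CLCTMod.cone e) 2) (S.totConeHoms e) (by omega))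
    ((cont_shIn _ _).comp (S.cont_totConeHoms e) _) (S.isClosedHom_totCone e)

theorem totCone_hat (w : (CLCTMod.cone S.fromCone).Tot) : (homs (S.totCone e)).hat w =
    (shIn _ 2).hat ((coneInl e).hat ((coneSnd S.i).hat ((coneSnd S.fromCone).hat w))) := by
  rw [totCone, homs_ofHoms, Homs.comp_hat, totConeHoms_hat]

/-- The map from the cone over `M` to the totalization of the sequence. -/
def coneToTot : Homs (CLCTMod.cone (S.coneDesc e)).toGrMod (CLCTMod.cone S.fromCone).toGrMod 0 :=
  Homs.comp (coneInl S.fromCone) (coneFst (S.coneDesc e)) (add_zero 0) +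
  Homs.comp (coneInr S.fromCone) (Homs.comp
    (Homs.comp (coneInl S.i) (coneFst (e ≫ S.i)) (add_zero 0) +
      Homs.comp (coneInr S.i) (Homs.comp (homs e) (coneSnd (e ≫ S.i)) (add_zero 1))
        (add_neg_cancel 1)) (coneSnd (S.coneDesc e)) (add_zero 1)) (add_neg_cancel 1)

theorem cont_coneToTot : Cont (S.coneToTot e) :=
  ((cont_coneInl _).comp (cont_coneFst _) _).add ((cont_coneInr _).comp
    ((((cont_coneInl _).comp (cont_coneFst _) _).add ((cont_coneInr _).comp
      ((homs_cont e).comp (cont_coneSnd _) _) _)).comp (cont_coneSnd _) _) _)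

theorem coneToTot_hat (w : (CLCTMod.cone (S.coneDesc e)).Tot) : (S.coneToTot e).hat w =
    (coneInl S.fromCone).hat ((coneFst (S.coneDesc e)).hat w) +
    (coneInr S.fromCone).hat ((coneInl S.i).hat
      ((coneFst (e ≫ S.i)).hat ((coneSnd (S.coneDesc e)).hat w)) +
      (coneInr S.i).hat ((homs e).hat
        ((coneSnd (e ≫ S.i)).hat ((coneSnd (S.coneDesc e)).hat w)))) := by
  simp only [coneToTot, Homs.comp_hat, Homs.hat_add]

/-- The inclusion of the cone over `M` in a cone of the totalization. -/
def coneIncl : Homs (CLCTMod.cone (S.coneDesc e)).toGrMod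
    ((CLCTMod.cone (S.totCone e)).shift (-1)).toGrMod 0 :=
  Homs.comp (shIn (CLCTMod.cone (S.totCone e)) (-1))
    (Homs.comp (coneInr (S.totCone e)) (S.coneToTot e) (zero_add (-1)) -
      Homs.comp (coneInl (S.totCone e)) (Homs.comp (shIn (CLCTMod.cone e) 2)
        (Homs.comp (coneInr e) (Homs.comp (coneSnd (e ≫ S.i)) (coneSnd (S.coneDesc e))
          (by omega : 1 + 1 = (2 : ℤ))) (by omega : (2 : ℤ) + -1 = 1))
          (by omega : (1 : ℤ) + -2 = -1)) (add_zero (-1)))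
    (by omega)

theorem cont_coneIncl : Cont (S.coneIncl e) :=
  (cont_shIn _ _).comp (((cont_coneInr _).comp (S.cont_coneToTot e) _).sub
    ((cont_coneInl _).comp ((cont_shIn _ _).comp ((cont_coneInr _).comp
      ((cont_coneSnd _).comp (cont_coneSnd _) _) _) _) _)) _

theorem coneIncl_hat (w : (CLCTMod.cone (S.coneDesc e)).Tot) : (S.coneIncl e).hat w =
    (shIn (CLCTMod.cone (S.totCone e)) (-1)).hat
      ((coneInr (S.totCone e)).hat ((S.coneToTot e).hat w) -
      (coneInl (S.totCone e)).hat ((shIn (CLCTMod.cone e) 2).hat ((coneInr e).hat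
        ((coneSnd (e ≫ S.i)).hat ((coneSnd (S.coneDesc e)).hat w))))) := by
  simp only [coneIncl, Homs.comp_hat, Homs.hat_sub]

/-- The map from a cone of the totalization to the cone over `M`. -/
def coneRetr : Homs ((CLCTMod.cone (S.totCone e)).shift (-1)).toGrMod
    (CLCTMod.cone (S.coneDesc e)).toGrMod 0 :=
  Homs.comp
    (Homs.comp (Homs.comp (coneInl (S.coneDesc e)) (coneFst S.fromCone) (add_zero 0) +
      Homs.comp (coneInr (S.coneDesc e)) (Homs.comp (coneInl (e ≫ S.i)) (Homs.comp (coneFst S.i)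
        (coneSnd S.fromCone) (add_zero 1)) (add_zero 1)) (add_neg_cancel 1))
        (coneSnd (S.totCone e)) (add_zero 1) -
    Homs.comp (coneInr (S.coneDesc e)) (Homs.comp
        (Homs.comp (coneInl (e ≫ S.i)) (Homs.comp (homs S.i) (coneFst e) (add_zero 0)) (add_zero 0) +
          Homs.comp (coneInr (e ≫ S.i)) (coneSnd e) (add_neg_cancel 1))
        (Homs.comp (shOut (CLCTMod.cone e) 2) (coneFst (S.totCone e)) (zero_add 2)) (add_zero 2))
      (by omega : (2 : ℤ) + -1 = 1))
    (shOut (CLCTMod.cone (S.totCone e)) (-1)) (neg_add_cancel 1)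

theorem cont_coneRetr : Cont (S.coneRetr e) :=
  ((((((cont_coneInl _).comp (cont_coneFst _) _).add ((cont_coneInr _).comp
    ((cont_coneInl _).comp ((cont_coneFst _).comp (cont_coneSnd _) _) _) _)).comp
      (cont_coneSnd _) _).sub ((cont_coneInr _).comp
        (((((cont_coneInl _).comp ((homs_cont _).comp (cont_coneFst _) _) _).add
          ((cont_coneInr _).comp (cont_coneSnd _) _))).comp
            ((cont_shOut _ _).comp (cont_coneFst _) _) _) _))).comp (cont_shOut _ _) _

theorem coneRetr_shIn (g : (CLCTMod.cone (S.totCone e)).Tot) :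
    (S.coneRetr e).hat ((shIn (CLCTMod.cone (S.totCone e)) (-1)).hat g) =
    (coneInl (S.coneDesc e)).hat ((coneFst S.fromCone).hat ((coneSnd (S.totCone e)).hat g)) +
    (coneInr (S.coneDesc e)).hat ((coneInl (e ≫ S.i)).hat ((coneFst S.i).hat
      ((coneSnd S.fromCone).hat ((coneSnd (S.totCone e)).hat g)))) -
    (coneInr (S.coneDesc e)).hat
      ((coneInl (e ≫ S.i)).hat ((homs S.i).hat ((coneFst e).hat
        ((shOut (CLCTMod.cone e) 2).hat ((coneFst (S.totCone e)).hat g)))) +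
      (coneInr (e ≫ S.i)).hat ((coneSnd e).hat
        ((shOut (CLCTMod.cone e) 2).hat ((coneFst (S.totCone e)).hat g)))) := by
  simp only [coneRetr, Homs.comp_hat, Homs.hat_add, Homs.hat_sub, shOut_shIn]

theorem homs_comp_hat {L M N : CLCTMod.{u} A} (f : L ⟶ M) (g : M ⟶ N) (x : L.Tot) :
    (homs (f ≫ g)).hat x = (homs g).hat ((homs f).hat x) := by
  rw [homs_comp, Homs.comp_hat]

theorem coneToTot_dh (w : (CLCTMod.cone (S.coneDesc e)).Tot) :
    (S.coneToTot e).hat ((CLCTMod.cone (S.coneDesc e)).dh w) = (CLCTMod.cone S.fromCone).dh ((S.coneToTot e).hat w) := by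
  rw [coneToTot_hat, coneToTot_hat]
  simp only [coneFst_dh, coneSnd_dh, map_add, map_neg, dh_coneInl, dh_coneInr, fromCone_hat,
    coneDesc_hat, coneFst_coneInl, coneFst_coneInr, homs_comp_hat, homs_dh, map_sub,
    map_zero]
  abel

theorem coneRetr_coneIncl (w : (CLCTMod.cone (S.coneDesc e)).Tot) :
    (S.coneRetr e).hat ((S.coneIncl e).hat w) = w := by
  rw [coneIncl_hat, coneRetr_shIn, coneToTot_hat]
  simp only [map_sub, coneSnd_coneInr, coneSnd_coneInl, coneFst_coneInl, coneFst_coneInr,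
    shOut_shIn, map_zero, sub_zero, zero_sub, map_add, add_zero, zero_add, map_neg, neg_zero,
    sub_neg_eq_add]
  rw [add_assoc, ← map_add, cone_eta, cone_eta]

theorem coneIncl_dh (w : (CLCTMod.cone (S.coneDesc e)).Tot) :
    (S.coneIncl e).hat ((CLCTMod.cone (S.coneDesc e)).dh w) =
      ((CLCTMod.cone (S.totCone e)).shift (-1)).dh ((S.coneIncl e).hat w) := by
  rw [coneIncl_hat, coneIncl_hat, shift_dh, shOut_shIn, sgn_neg, sgn_one, neg_one_smul, ← map_neg,
    coneToTot_dh]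
  congr 1
  simp only [map_sub, dh_coneInr, dh_coneInl, totCone_hat, coneToTot_hat, map_add,
    coneSnd_dh, map_neg, shift_dh, shOut_shIn, sgn_two, one_smul, coneSnd_coneInl,
    coneSnd_coneInr, map_zero]
  abel

theorem coneRetr_dh (v : ((CLCTMod.cone (S.totCone e)).shift (-1)).Tot) :
    (S.coneRetr e).hat (((CLCTMod.cone (S.totCone e)).shift (-1)).dh v) =
      (CLCTMod.cone (S.coneDesc e)).dh ((S.coneRetr e).hat v) := by
  obtain ⟨g, rfl⟩ : ∃ g, (shIn (CLCTMod.cone (S.totCone e)) (-1)).hat g = v :=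
    ⟨_, shIn_shOut _ _ v⟩
  rw [shift_dh, shOut_shIn, map_smul, coneRetr_shIn, coneRetr_shIn, sgn_neg, sgn_one, neg_one_smul]
  simp only [map_sub, map_add, map_neg, coneFst_dh, coneSnd_dh, dh_coneInl, dh_coneInr,
    shOut_dh, sgn_two, one_smul, totCone_hat, shOut_shIn, coneFst_coneInl, coneSnd_coneInl,
    coneDesc_hat, coneFst_coneInr, fromCone_hat, homs_comp_hat, homs_dh, homs_p_i, map_zero,
    add_zero]
  abel

/-- The cone in question is the totalization of `S` with `K` replaced by `T`. It should therefore be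
the fibre of a map from the totalization to the shift by two of `cone e`, that map being given by
the `K`-component. Concretely, it is a strict retract of the cone of this map, shifted by `-1`, and
that cone is built from two contraacyclic modules. -/
theorem contraacyclic_coneDesc (h : (CLCTMod.cone e).Contraacyclic) :
    (CLCTMod.cone (S.coneDesc e)).Contraacyclic :=
  contraacyclic_of_strict_retract (S.coneIncl e) (S.cont_coneIncl e) (S.coneRetr e)
    (S.cont_coneRetr e) (fun x => (S.coneIncl_dh e x).symm) (fun x => (S.coneRetr_dh e x).symm)
    (S.coneRetr_coneIncl e)
    (Contraacyclic.shift _ _ (Contraacyclic.cone _ (Contraacyclic.tot S)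
      (Contraacyclic.shift _ _ h)))

end SES

end CLCTMod

end StageCones

/-! ### The product totalization of a tower as the limit of its truncations -/

section TowerLimit

open CategoryTheory CLCTMod

variable {𝕜 : Type} [RCLike 𝕜] {A : CLCTAlg.{u} 𝕜}

namespace Homs

variable {M N : GrMod.{u} A.toCDGAlg} {k l : ℤ}

/-- Change of the name of the degree. -/
def ofEq (h : k = l) (f : Homs M N k) : Homs M N l := h ▸ f

@[simp] theorem ofEq_hat (h : k = l) (f : Homs M N k) (x : M.Tot) :
    (ofEq h f).hat x = f.hat x := by
  subst h
  rfl

end Homs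

theorem CLCTMod.Cont.ofEq {M N : CLCTMod.{u} A} {k l : ℤ} {f : Homs M.toGrMod N.toGrMod k}
    (hf : Cont f) (h : k = l) : Cont (Homs.ofEq h f) := by
  subst h
  exact hf

namespace Tower

variable (t : Tower A)

/-- The augmentation of the product totalization. -/
def aug : t.that ⟶ t.K 0 :=
  ofHoms (Homs.comp (homs (t.S 0).p) (t.pr 0) (by simp)) ((homs_cont _).comp (t.cont_pr 0) _) <|
    show IsClosedHom _ from (CDGMod.homD_eq_zero_iff _ _).2 fun x => by
      rw [Homs.comp_hat, Homs.comp_hat, t.pr_dh, map_smul, map_add, homs_dh, SES.homs_p_i,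
        add_zero, sgn_zero, one_smul]
      exact (one_smul 𝕜 _).symm.trans (congrArg (· • _) (sgn_zero (𝕜 := 𝕜)).symm)

@[simp] theorem aug_hat (y : t.that.Tot) :
    (homs t.aug).hat y = (homs (t.S 0).p).hat ((t.pr 0).hat y) := by
  rw [aug, homs_ofHoms, Homs.comp_hat]

section ConeLift

variable {T : CLCTMod.{u} A} {e : T ⟶ t.K 1} (f : t.tail.that ⟶ T) (hf : f ≫ e = t.tail.aug)

/-- The map `y ↦ (y 0, f (y 1, y 2, …))`. -/
def coneLift : t.that ⟶ CLCTMod.cone (e ≫ (t.S 0).i) :=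
  ofHoms (Homs.comp (coneInl (e ≫ (t.S 0).i)) (Homs.ofEq Nat.cast_zero (t.pr 0)) (add_zero 0) +
      Homs.comp (coneInr (e ≫ (t.S 0).i)) (Homs.comp (homs f) t.tl (add_zero 1)) (add_neg_cancel 1))
    (((cont_coneInl _).comp ((t.cont_pr 0).ofEq _) _).add
      ((cont_coneInr _).comp ((homs_cont f).comp t.cont_tl _) _)) <|
    show IsClosedHom _ from (CDGMod.homD_eq_zero_iff _ _).2 fun x => by
      have h : (homs e).hat ((homs f).hat (t.tl.hat x)) =
          (homs (t.S 1).p).hat ((t.pr 1).hat x) := by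
        rw [← SES.homs_comp_hat, hf, aug_hat, pr_tl]
      simp only [Homs.hat_add, Homs.comp_hat, Homs.ofEq_hat, map_add, dh_coneInl, dh_coneInr,
        SES.homs_comp_hat, h, t.pr_dh, t.tl_dh, map_neg, homs_dh, Nat.cast_zero, sgn_zero, one_smul]
      abel

@[simp] theorem coneFst_coneLift (y : t.that.Tot) :
    (coneFst (e ≫ (t.S 0).i)).hat ((homs (t.coneLift f hf)).hat y) = (t.pr 0).hat y := by
  rw [coneLift, homs_ofHoms]
  simp

@[simp] theorem coneSnd_coneLift (y : t.that.Tot) :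
    (coneSnd (e ≫ (t.S 0).i)).hat ((homs (t.coneLift f hf)).hat y) =
      (homs f).hat (t.tl.hat y) := by
  rw [coneLift, homs_ofHoms]
  simp

theorem coneLift_coneDesc : t.coneLift f hf ≫ (t.S 0).coneDesc e = t.aug :=
  homs_inj (Homs.hat_inj fun y => by
    rw [SES.homs_comp_hat, aug_hat, SES.coneDesc_hat, coneFst_coneLift])

end ConeLift

/-- The iterated cones of the maps in a tower. -/
def stage : ℕ → ∀ t : Tower A, Stage (t.K 0)
  | 0, t => ⟨t.K 0, 𝟙 _⟩
  | m + 1, t => ⟨CLCTMod.cone ((stage m t.tail).eps ≫ (t.S 0).i),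
      (t.S 0).coneDesc (stage m t.tail).eps⟩

/-- Induction on the length with the tower replaced by its tail: the stage over `K 1` has a
contraacyclic cone, and splicing in one more short exact sequence preserves this. -/
theorem contraacyclic_cone_stage : ∀ (m : ℕ) (t : Tower A),
    (CLCTMod.cone (stage m t).eps).Contraacyclic
  | 0, t => contraacyclic_cone_id (t.K 0)
  | m + 1, t => (t.S 0).contraacyclic_coneDesc (stage m t.tail).eps (contraacyclic_cone_stage m t.tail)

/-- The transition maps of the stages, over the first module of the tower. -/
def trStage : ∀ (m : ℕ) (t : Tower A), {f : (stage (m + 1) t).X ⟶ (stage m t).X //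
    f ≫ (stage m t).eps = (stage (m + 1) t).eps}
  | 0, t => ⟨(t.S 0).coneDesc (𝟙 (t.K 1)), Category.comp_id _⟩
  | m + 1, t => ⟨coneMap (f := (stage (m + 1) t.tail).eps ≫ (t.S 0).i)
      (f' := (stage m t.tail).eps ≫ (t.S 0).i) (trStage m t.tail).1
      ((Category.assoc _ _ _).symm.trans (congrArg (· ≫ (t.S 0).i) (trStage m t.tail).2)),
      hom_ext fun _ _ => rfl⟩

theorem trStage_comp (m : ℕ) : (trStage m t.tail).1 ≫ (stage m t.tail).eps ≫ (t.S 0).i =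
    (stage (m + 1) t.tail).eps ≫ (t.S 0).i :=
  (Category.assoc _ _ _).symm.trans (congrArg (· ≫ (t.S 0).i) (trStage m t.tail).2)

theorem coneFst_trStage (m : ℕ) (z : (stage (m + 2) t).X.Tot) :
    (coneFst ((stage m t.tail).eps ≫ (t.S 0).i)).hat ((homs (trStage (m + 1) t).1).hat z) =
      (coneFst ((stage (m + 1) t.tail).eps ≫ (t.S 0).i)).hat z :=
  coneFst_coneMap _ (t.trStage_comp m) z

theorem coneSnd_trStage (m : ℕ) (z : (stage (m + 2) t).X.Tot) :
    (coneSnd ((stage m t.tail).eps ≫ (t.S 0).i)).hat ((homs (trStage (m + 1) t).1).hat z) =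
      (homs (trStage m t.tail).1).hat
        ((coneSnd ((stage (m + 1) t.tail).eps ≫ (t.S 0).i)).hat z) :=
  coneSnd_coneMap _ (t.trStage_comp m) z

/-- Linear sections of the transition maps. -/
def secStage : ∀ (m : ℕ) (t : Tower A) (i : ℤ),
    (stage m t).X.C i →L[𝕜] (stage (m + 1) t).X.C i
  | 0, t, i => (ContinuousLinearMap.inl 𝕜 ((t.B 0).C i) ((t.K 1).C (i + 1))).comp ((t.S 0).s i)
  | m + 1, t, i =>
    (ContinuousLinearMap.id 𝕜 ((t.B 0).C i)).prodMap (secStage m t.tail (i + 1))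

theorem trStage_secStage : ∀ (m : ℕ) (t : Tower A) (i : ℤ) (x : (stage m t).X.C i),
    Hom.app (trStage m t).1 i (secStage m t i x) = x
  | 0, t, i, x => (t.S 0).p_s i x
  | m + 1, t, i, x => Prod.ext rfl (trStage_secStage m t.tail (i + 1) x.2)

/-- The components of the stages. -/
def coord : ∀ (m : ℕ) (t : Tower A) (n : ℕ), Homs (stage m t).X.toGrMod (t.B n).toGrMod n
  | 0, _, _ => 0
  | m + 1, t, 0 => Homs.ofEq Nat.cast_zero.symm (coneFst ((stage m t.tail).eps ≫ (t.S 0).i))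
  | m + 1, t, n + 1 => Homs.comp (coord m t.tail n) (coneSnd ((stage m t.tail).eps ≫ (t.S 0).i))
      (by push_cast; omega)

theorem cont_coord : ∀ (m : ℕ) (t : Tower A) (n : ℕ), Cont (coord m t n)
  | 0, _, _ => Cont.zero
  | _ + 1, _, 0 => (cont_coneFst _).ofEq _
  | m + 1, t, n + 1 => (cont_coord m t.tail n).comp (cont_coneSnd _) _

theorem coord_succ_zero (m : ℕ) (z : (stage (m + 1) t).X.Tot) : (coord (m + 1) t 0).hat z =
    (coneFst ((stage m t.tail).eps ≫ (t.S 0).i)).hat z :=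
  Homs.ofEq_hat _ _ _

theorem coord_succ_succ (m n : ℕ) (z : (stage (m + 1) t).X.Tot) :
    (coord (m + 1) t (n + 1)).hat z =
      (coord m t.tail n).hat ((coneSnd ((stage m t.tail).eps ≫ (t.S 0).i)).hat z) :=
  Homs.comp_hat _ _ _ _

theorem coord_trStage : ∀ (m : ℕ) (t : Tower A) (n : ℕ), n < m → ∀ z : (stage (m + 1) t).X.Tot,
    (coord m t n).hat ((homs (trStage m t).1).hat z) = (coord (m + 1) t n).hat z
  | 0, _, _, h, _ => absurd h (Nat.not_lt_zero _)
  | m + 1, t, 0, _, z => by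
    rw [coord_succ_zero, coord_succ_zero]
    exact t.coneFst_trStage m z
  | m + 1, t, n + 1, h, z => by
    rw [coord_succ_succ, coord_succ_succ, ← coord_trStage m t.tail n (Nat.lt_of_succ_lt_succ h)]
    exact congrArg _ (t.coneSnd_trStage m z)

/-- The stage `m + 1` consists of `B 0, …, B m` and `K (m + 1)`. The transition map forgets the last
summand and sends `B m` to `K m`, so its value is determined by the coordinates up to `m`. -/
theorem trStage_eq_zero : ∀ (m : ℕ) (t : Tower A) (z : (stage (m + 1) t).X.Tot),
    (∀ n ≤ m, (coord (m + 1) t n).hat z = 0) → (homs (trStage m t).1).hat z = 0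
  | 0, t, z, h => by
    have h0 := h 0 le_rfl
    rw [coord_succ_zero] at h0
    exact ((t.S 0).coneDesc_hat (𝟙 (t.K 1)) z).trans
      ((congrArg _ h0).trans (map_zero (homs (t.S 0).p).hat))
  | m + 1, t, z, h => by
    have h0 := h 0 (Nat.zero_le _)
    rw [coord_succ_zero] at h0
    refine cone_ext ((stage m t.tail).eps ≫ (t.S 0).i) ?_ ?_
    · exact (t.coneFst_trStage m z).trans (h0.trans (map_zero _).symm)
    · refine (t.coneSnd_trStage m z).trans (Eq.trans ?_ (map_zero _).symm)
      refine trStage_eq_zero m t.tail _ fun n hn => ?_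
      rw [← coord_succ_succ]
      exact h (n + 1) (Nat.succ_le_succ hn)

/-- The maps from the product totalization to the stages. -/
def toStage : ∀ (m : ℕ) (t : Tower A), {f : t.that ⟶ (stage m t).X // f ≫ (stage m t).eps = t.aug}
  | 0, t => ⟨t.aug, Category.comp_id _⟩
  | m + 1, t => ⟨t.coneLift (toStage m t.tail).1 (toStage m t.tail).2,
      t.coneLift_coneDesc _ (toStage m t.tail).2⟩

theorem coneFst_toStage (m : ℕ) (y : t.that.Tot) :
    (coneFst ((stage m t.tail).eps ≫ (t.S 0).i)).hat ((homs (toStage (m + 1) t).1).hat y) =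
      (t.pr 0).hat y :=
  t.coneFst_coneLift _ (toStage m t.tail).2 y

theorem coneSnd_toStage (m : ℕ) (y : t.that.Tot) :
    (coneSnd ((stage m t.tail).eps ≫ (t.S 0).i)).hat ((homs (toStage (m + 1) t).1).hat y) =
      (homs (toStage m t.tail).1).hat (t.tl.hat y) :=
  t.coneSnd_coneLift _ (toStage m t.tail).2 y

theorem coord_toStage : ∀ (m : ℕ) (t : Tower A) (n : ℕ), n < m → ∀ y : t.that.Tot,
    (coord m t n).hat ((homs (toStage m t).1).hat y) = (t.pr n).hat y
  | 0, _, _, h, _ => absurd h (Nat.not_lt_zero _)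
  | m + 1, t, 0, _, y => by
    rw [coord_succ_zero]
    exact t.coneFst_toStage m y
  | m + 1, t, n + 1, h, y => by
    rw [coord_succ_succ, ← pr_tl, ← coord_toStage m t.tail n (Nat.lt_of_succ_lt_succ h)]
    exact congrArg _ (t.coneSnd_toStage m y)

theorem toStage_trStage : ∀ (m : ℕ) (t : Tower A) (y : t.that.Tot),
    (homs (trStage m t).1).hat ((homs (toStage (m + 1) t).1).hat y) = (homs (toStage m t).1).hat y
  | 0, t, y => by
    refine ((t.S 0).coneDesc_hat _ _).trans (Eq.trans ?_ (t.aug_hat y).symm)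
    exact congrArg _ (t.coneFst_toStage 0 y)
  | m + 1, t, y => by
    refine cone_ext ((stage m t.tail).eps ≫ (t.S 0).i) ?_ ?_
    · exact (t.coneFst_trStage m _).trans ((t.coneFst_toStage (m + 1) y).trans
        (t.coneFst_toStage m y).symm)
    · exact (t.coneSnd_trStage m _).trans ((congrArg _ (t.coneSnd_toStage (m + 1) y)).trans
        ((toStage_trStage m t.tail _).trans (t.coneSnd_toStage m y).symm))

/-- The limit of a sequence of elements of the stages. -/
def limStage (i : ℤ) : (∀ m, (stage m t).X.C i) →L[𝕜] t.TotC i :=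
  ContinuousLinearMap.pi fun p =>
    (⟨(coord (p.1.1 + 1) t p.1.1).app p.2, (cont_coord _ t _).cont p.2⟩ :
      (stage (p.1.1 + 1) t).X.C i →L[𝕜] (t.B p.1.1).C p.1.2).comp
        (ContinuousLinearMap.proj (p.1.1 + 1))

theorem pr_limStage (n : ℕ) {i : ℤ} (x : ∀ m, (stage m t).X.C i) :
    (t.pr n).hat (Pi.single i (show t.that.C i from t.limStage i x)) =
      (coord (n + 1) t n).hat (Pi.single i (x (n + 1))) := by
  funext j
  by_cases h : i + n = j
  · rw [← Homs.app_eq_hat _ h, ← Homs.app_eq_hat _ h]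
    rfl
  · rw [Homs.hat_apply _ (sub_add_cancel j n), Homs.hat_apply _ (sub_add_cancel j n),
      Pi.single_eq_of_ne (by omega), Pi.single_eq_of_ne (by omega), map_zero, map_zero]

theorem homs_single {M N : CLCTMod.{u} A} (f : M ⟶ N) {i : ℤ} (x : M.C i) :
    (homs f).hat (Pi.single i x) = Pi.single i (Hom.app f i x) := by
  funext j
  rw [homs_hat]
  by_cases h : j = i
  · subst h
    rw [Pi.single_eq_same, Pi.single_eq_same]
  · rw [Pi.single_eq_of_ne h, Pi.single_eq_of_ne h, map_zero]

/-- The product totalization as a limit of the stages. -/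
def mlSystem : MLSystem t.that where
  T m := (stage m t).X
  toT m := (toStage m t).1
  tr m := (trStage m t).1
  toT_tr m i x := by
    rw [← Pi.single_inj i, ← homs_single, ← homs_single, ← homs_single, toStage_trStage]
  sec m := secStage m t
  tr_sec m := trStage_secStage m t
  lim i := t.limStage i
  lim_toT i x := by
    rw [← Pi.single_inj i]
    refine that_ext fun n => ?_
    refine (t.pr_limStage n _).trans ?_
    rw [← homs_single, coord_toStage _ _ _ (Nat.lt_succ_self n)]
  toT_lim i x hx m := by
    -- In a compatible sequence the `n`-th coordinate is the same at all stages beyond `n`.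
    have hc : ∀ n m, n < m → (coord m t n).hat (Pi.single i (x m)) =
        (coord (n + 1) t n).hat (Pi.single i (x (n + 1))) := fun n m h => by
      induction m, h using Nat.le_induction with
      | base => rfl
      | succ m h ih => rw [← coord_trStage m t n h, homs_single, hx, ih]
    -- The coordinates do not see the last summand of a stage. Hence the two elements are compared
    -- one stage higher and then mapped down, where `trStage_eq_zero` applies.
    have h := trStage_eq_zero m t ((homs (toStage (m + 1) t).1).hat
      (Pi.single i (show t.that.C i from t.limStage i x)) - Pi.single i (x (m + 1))) fun n hn => by
        rw [map_sub, coord_toStage _ _ _ (Nat.lt_succ_of_le hn), pr_limStage,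
          hc n (m + 1) (Nat.lt_succ_of_le hn), sub_self]
    rw [map_sub, toStage_trStage, sub_eq_zero, homs_single, homs_single, hx, Pi.single_inj] at h
    exact h

/-- The cone of the augmentation is the limit of the cones of the stages over `K 0`, which are
contraacyclic. -/
theorem contraacyclic_cone_aug : (CLCTMod.cone t.aug).Contraacyclic :=
  (t.mlSystem.cone (fun m => (stage m t).eps) (fun m => (trStage m t).2) t.aug
    fun m => (toStage m t).2).contraacyclic fun m => contraacyclic_cone_stage m t

end Tower

end TowerLimit

/-! ### Relative projectivity of the product totalization -/

section Projectivity

open CategoryTheory CLCTMod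

variable {𝕜 : Type} [RCLike 𝕜] {A : CLCTAlg.{u} 𝕜}

namespace CLCTMod

variable {M N : CLCTMod.{u} A} {k : ℤ}

theorem continuous_act (M : CLCTMod.{u} A) {i j n : ℤ} (h : i + j = n) (a : A.C j) :
    Continuous fun x : M.C i => M.act h x a := by
  refine continuous_of_seminorm ((M.act h).flip a) fun P hP => ?_
  obtain ⟨p, q, hp, hq, -, hb⟩ := (M.act_cont n).famBdd P hP
  refine ⟨(q ⟨(i, j), h⟩ a).toNNReal • p ⟨(i, j), h⟩,
    continuous_const.mul (hp ⟨(i, j), h⟩), fun x => ?_⟩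
  refine (hb ⟨(i, j), h⟩ x a).trans (le_of_eq ?_)
  rw [smul_apply, NNReal.smul_def, Real.coe_toNNReal _ (apply_nonneg _ _), smul_eq_mul,
    mul_comm]

/-- The sum of a locally finite family of continuous `A`-linear maps. -/
theorem exists_hasSum {F : ℕ → Homs M.toGrMod N.toGrMod k} (hF : ∀ n, Cont (F n))
    (hloc : ∀ {i j : ℤ} (h : i + k = j) (P : Seminorm 𝕜 (N.C j)), Continuous P →
      ∃ T : Finset ℕ, ∀ n ∉ T, ∀ x, P ((F n).app h x) = 0) :
    ∃ f : Homs M.toGrMod N.toGrMod k, Cont f ∧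
      ∀ {i j : ℤ} (h : i + k = j) (x : M.C i), HasSum (fun n => (F n).app h x) (f.app h x) := by
  have hs : ∀ {i j : ℤ} (h : i + k = j) (x : M.C i), Summable fun n => (F n).app h x :=
    fun h x => summable_of_seminorm fun P hP => by
      obtain ⟨T, hT⟩ := hloc h P hP
      refine T.finite_toSet.subset fun n hn => ?_
      by_contra hc
      exact hn (hT n hc x)
  let φ : ∀ {i j : ℤ} (_ : i + k = j), M.C i →ₗ[𝕜] N.C j := fun h =>
    { toFun := fun x => ∑' n, (F n).app h x
      map_add' := fun x y => by
        rw [← (hs h x).tsum_add (hs h y)]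
        simp only [map_add]
      map_smul' := fun c x => by
        rw [RingHom.id_apply, ← (hs h x).tsum_const_smul c]
        simp only [map_smul] }
  have hφ : ∀ {i j : ℤ} (h : i + k = j) (x : M.C i), HasSum (fun n => (F n).app h x) (φ h x) :=
    fun h x => (hs h x).hasSum
  refine ⟨Homs.mk' φ fun {i j n i' n'} h hi hn h' x a => ?_, ⟨fun {i j} h => ?_⟩, hφ⟩
  · refine (hφ hn (M.act h x a)).unique ?_
    have h1 := (hφ hi x).map ((N.act h').flip a) (N.continuous_act h' a)
    refine h1.congr_fun fun n => ?_
    exact (F n).app_act h hi hn h' x a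
  · refine continuous_of_seminorm (φ h) fun P hP => ?_
    obtain ⟨T, hT⟩ := hloc h P hP
    refine ⟨∑ n ∈ T, P.comp ((F n).app h), continuous_seminorm_sum T fun n =>
      hP.comp ((hF n).cont h), fun x => ?_⟩
    rw [seminorm_sum_apply]
    exact seminorm_hasSum_le (hφ h x) hP fun n hn => hT n hn x

end CLCTMod

/-- A linear map out of a module with free generators with values in the null space of a seminorm on
the generators. -/
theorem FreeOn.seminorm_eq_zero {B : CDGAlg.{u} 𝕜} {F : GrMod.{u} B} (E : FreeOn F) {n : ℤ}
    {G : Type u} [AddCommGroup G] [Module 𝕜 G] (f : F.C n →ₗ[𝕜] G) (P : Seminorm 𝕜 G)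
    (h : ∀ {s : E.ι} {b : ℤ} (h : E.deg s + b = n) (w : E.W s) (x : B.C b),
      P (f (F.act h (E.e s w) x)) = 0) (y : F.C n) : P (f y) = 0 := by
  -- The null space of `P` is a subspace, and freeness can be applied to the linear map to the
  -- quotient by it.
  let K : Submodule 𝕜 G :=
    { carrier := {z | P z = 0}
      zero_mem' := map_zero P
      add_mem' := fun {a b} ha hb => le_antisymm ((map_add_le_add P a b).trans (by
        rw [show P a = 0 from ha, show P b = 0 from hb, add_zero])) (apply_nonneg _ _)
      smul_mem' := fun c a ha => by
        rw [Set.mem_ofPred_eq, map_smul_eq_mul, show P a = 0 from ha, mul_zero] }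
  have h1 : K.mkQ ∘ₗ f = 0 := E.ext fun h' w x => (Submodule.Quotient.mk_eq_zero K).2 (h h' w x)
  exact (Submodule.Quotient.mk_eq_zero K).1 (LinearMap.congr_fun h1 y)

namespace Tower

variable (t : Tower A) {k : ℤ}

/-- The inclusion of `B n`. -/
def inc (n : ℕ) : Homs (t.B n).toGrMod t.that.toGrMod (-n) := t.complex.inc n

theorem pr_inc_same (n : ℕ) (x : (t.B n).Tot) : (t.pr n).hat ((t.inc n).hat x) = x :=
  t.complex.pr_inc_same n x

theorem inc_apply_ne {n : ℕ} {i j : ℤ} (h : i + -n = j) (x : (t.B n).C i)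
    (p : {p : ℕ × ℤ // j + p.1 = p.2}) (hp : p.1.1 ≠ n) :
    (show t.TotC j from (t.inc n).app h x) p = 0 :=
  t.complex.incApp_ne hp h x p.2

/-- The projector to `B n`. -/
def proj (n : ℕ) : Homs t.that.toGrMod t.that.toGrMod 0 :=
  Homs.comp (t.inc n) (t.pr n) (add_neg_cancel _)

theorem proj_app_same (n : ℕ) {i l : ℤ} (h : i + 0 = i) (hp : i + n = l) (x : t.that.C i) :
    (show t.TotC i from (t.proj n).app h x) ⟨(n, l), hp⟩ = (show t.TotC i from x) ⟨(n, l), hp⟩ := by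
  have h2 := congrFun (t.pr_inc_same n ((t.pr n).hat (Pi.single i x))) l
  rw [← Homs.comp_hat (t.inc n) (t.pr n) (add_neg_cancel _), Homs.hat_apply _ hp,
    Homs.hat_apply _ hp, Pi.single_eq_same, ← Homs.app_eq_hat _ h] at h2
  exact h2

theorem proj_app (n : ℕ) {i : ℤ} (h : i + 0 = i) (x : t.that.C i) :
    (t.proj n).app h x = (t.inc n).app (by omega : i + n + -n = i) ((t.pr n).app rfl x) :=
  Homs.comp_app (t.inc n) (t.pr n) (add_neg_cancel _) h rfl _ x

theorem hasSum_proj (i : ℤ) (x : t.TotC i) :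
    HasSum (fun n => (show t.TotC i from (t.proj n).app (add_zero i) x)) x := by
  refine Pi.hasSum.2 fun p => ?_
  rw [← t.proj_app_same p.1.1 (add_zero i) p.2 x]
  exact hasSum_single p.1.1 fun n hn => (congrArg (fun y : t.TotC i => y p)
    (t.proj_app n (add_zero i) x)).trans (t.inc_apply_ne _ _ p hn.symm)

/-- A seminorm composed with a continuous map out of the product totalization vanishes on almost all
the components. -/
theorem exists_finset_inc {N : CLCTMod.{u} A} {g : Homs t.that.toGrMod N.toGrMod k} (hg : Cont g)
    {i j : ℤ} (h : i + k = j) (P : Seminorm 𝕜 (N.C j)) (hP : Continuous P) :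
    ∃ T : Finset ℕ, ∀ n ∉ T, ∀ {l : ℤ} (h' : l + -n = i) (x : (t.B n).C l),
      P (g.app h ((t.inc n).app h' x)) = 0 := by
  classical
  obtain ⟨T, hT⟩ := exists_finset_of_seminorm (𝕜 := 𝕜) (X := fun p : {p : ℕ × ℤ // i + p.1 = p.2} =>
    (t.B p.1.1).C p.1.2) (N := P.comp (g.app h : t.TotC i →ₗ[𝕜] N.C j)) (hP.comp (hg.cont h))
  refine ⟨T.image fun p => p.1.1, fun n hn l h' x => ?_⟩
  refine hT (show t.TotC i from (t.inc n).app h' x) fun p hp => ?_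
  exact t.inc_apply_ne h' x p fun hc => hn (hc ▸ Finset.mem_image_of_mem _ hp)

/-- Each restriction of `g` to `B n` is lifted on free generators through the continuous section of
`p`. The resulting maps on the product form a locally finite family, and their sum is the required
lift, since `p` is continuous and `g` is the sum of its restrictions. -/
theorem relProjective (E : ∀ n, FreeOn (t.B n).toGrMod) (hB : ∀ n i, Finest 𝕜 ((t.B n).C i)) :
    t.that.RelProjective := by
  classical
  intro K L M S k g hg
  -- The section is only linear, so `s ∘ g` serves to prescribe the values on generators; elsewhere
  -- the `A`-linear extension may differ from it.
  have hf : ∀ n, ∃ f : Homs (t.B n).toGrMod L.toGrMod (-n + k), ∀ s w,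
      f.app rfl ((E n).e s w) = S.s _ ((Homs.comp g (t.inc n) rfl).app rfl ((E n).e s w)) :=
    fun n => (E n).exists_lift L.toGrMod (-n + k) fun s => (S.s _).toLinearMap ∘ₗ
      (Homs.comp g (t.inc n) rfl).app rfl ∘ₗ (E n).e s
  choose f hf using hf
  let F : ℕ → Homs t.that.toGrMod L.toGrMod k := fun n =>
    Homs.comp (f n) (t.pr n) (add_neg_cancel_left _ _)
  have hF : ∀ n, Cont (F n) := fun n =>
    Cont.comp (M := t.B n) ⟨fun h => (hB n _).continuous _⟩ (t.cont_pr n) _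
  have hp : ∀ n, Homs.comp (homs S.p) (f n) (add_zero _) = Homs.comp g (t.inc n) rfl := fun n => by
    have key : ∀ {i j : ℤ} (h : i + (-n + k) = j), (Homs.comp (homs S.p) (f n) (add_zero _)).app h =
        (Homs.comp g (t.inc n) rfl).app h := by
      intro i j h
      refine (E n).ext fun {s b} hab w x => ?_
      rw [Homs.app_act _ hab rfl h (by omega : (E n).deg s + (-n + k) + b = j),
        Homs.app_act _ hab rfl h (by omega : (E n).deg s + (-n + k) + b = j),
        Homs.comp_app (homs S.p) (f n) _ rfl rfl (add_zero _), hf, homs_app, S.p_s]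
    exact Homs.ext' fun h x => LinearMap.congr_fun (key h) x
  -- Joint continuity of the action bounds `P` by finitely many products of seminorms. The first
  -- factor of each, composed with `s ∘ g`, is a continuous seminorm on the product totalization,
  -- hence zero on almost all `B n`. For the remaining `n` the seminorm `P` vanishes on multiples of
  -- the generators, hence on the whole image.
  have hloc : ∀ {i j : ℤ} (h : i + k = j) (P : Seminorm 𝕜 (L.C j)), Continuous P →
      ∃ T : Finset ℕ, ∀ n ∉ T, ∀ x, P ((F n).app h x) = 0 := by
    intro i j h P hP
    obtain ⟨p, q, hp, hq, hfin, hb⟩ := (L.act_cont j).famBdd P hP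
    have hT : ∀ c : {c : ℤ × ℤ // c.1 + c.2 = j}, ∃ T : Finset ℕ, ∀ n ∉ T,
        ∀ {l : ℤ} (h' : l + -n = c.1.1 - k) (x : (t.B n).C l),
          p c (S.s _ (g.app (sub_add_cancel c.1.1 k) ((t.inc n).app h' x))) = 0 := fun c =>
      t.exists_finset_inc hg (sub_add_cancel c.1.1 k)
        ((p c).comp (S.s c.1.1).toLinearMap) ((hp c).comp (S.s c.1.1).continuous)
    choose T hT using hT
    refine ⟨hfin.toFinset.biUnion T, fun n hn x => ?_⟩
    have h1 : ∀ y : (t.B n).C (i + n), P ((f n).app (by omega : i + n + (-n + k) = j) y) = 0 := by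
      refine (E n).seminorm_eq_zero _ P fun {s b} hab w x => ?_
      rw [Homs.app_act _ hab rfl _ (by omega : (E n).deg s + (-n + k) + b = j)]
      refine le_antisymm ((hb ⟨((E n).deg s + (-n + k), b), by omega⟩ _ x).trans (le_of_eq ?_))
        (apply_nonneg _ _)
      rw [mul_eq_zero]
      left
      by_cases h0 : p ⟨((E n).deg s + (-n + k), b), by omega⟩ = 0
      · rw [h0]
        rfl
      · have hn' : n ∉ T ⟨((E n).deg s + (-n + k), b), by omega⟩ := fun hc =>
          hn (Finset.mem_biUnion.2 ⟨_, by simpa using h0, hc⟩)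
        have h2 := hT _ n hn' (l := (E n).deg s)
          (by simp only; omega) ((E n).e s w)
        rw [hf, Homs.comp_app g (t.inc n) rfl rfl (by omega)
          (sub_add_cancel ((E n).deg s + (-n + k)) k)]
        exact h2
    change P ((Homs.comp (f n) (t.pr n) _).app h x) = 0
    rw [Homs.comp_app (f n) (t.pr n) _ h rfl (by omega)]
    exact h1 _
  obtain ⟨φ, hφ, hsum⟩ := exists_hasSum hF hloc
  refine ⟨φ, hφ, fun x => ?_⟩
  have hpF : ∀ n, Homs.comp (homs S.p) (F n) (add_zero k) = Homs.comp g (t.proj n) (zero_add k) :=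
    fun n => Homs.hat_inj fun y => by
      have h3 := congrArg (fun f => f.hat ((t.pr n).hat y)) (hp n)
      simp only [Homs.comp_hat] at h3
      rw [Homs.comp_hat, Homs.comp_hat, Homs.comp_hat, h3]
      exact congrArg _ (Homs.comp_hat _ _ _ _).symm
  have he : Homs.comp (homs S.p) φ (add_zero k) = g := by
    refine Homs.ext' fun {i j} h x => ?_
    have h1 := (hsum h x).map (Hom.app S.p j) (Hom.app S.p j).continuous
    have h2 := (t.hasSum_proj i x).map (g.app h : t.TotC i →ₗ[𝕜] M.C j) (hg.cont h)
    rw [Homs.comp_app _ _ (add_zero k) h h (add_zero j)]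
    refine h1.unique (h2.congr_fun fun n => ?_)
    have h3 := congrArg (fun f => f.app h x) (hpF n)
    simp only [Homs.comp_app _ _ (add_zero k) h h (add_zero j),
      Homs.comp_app _ _ (zero_add k) h (add_zero i) h] at h3
    exact h3
  rw [← Homs.comp_hat _ _ (add_zero k), he]

end Tower

end Projectivity

/-! ### Continuous maps to discrete modules and the comparison with Ext -/

section ComparisonOfMorphisms

open CategoryTheory CLCTMod

variable {𝕜 : Type} [RCLike 𝕜] {A : CLCTAlg.{u} 𝕜}

theorem exists_seminorm_eq_zero_imp (𝕜 : Type) [RCLike 𝕜] (E : Type*) [AddCommGroup E]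
    [Module 𝕜 E] : ∃ P : Seminorm 𝕜 E, ∀ x, P x = 0 → x = 0 := by
  let b := Module.Basis.ofVectorSpace 𝕜 E
  refine ⟨ell1 b fun _ => 1, fun x hx => b.repr.map_eq_zero_iff.1 (Finsupp.ext fun i => ?_)⟩
  have h1 := sum_le_ell1 b (fun _ => 1) {i} x
  rw [hx, Finset.sum_singleton, NNReal.coe_one, one_mul] at h1
  simpa using h1

namespace CLCTMod

variable {L M N : CLCTMod.{u} A} {k : ℤ}

theorem Cont.sum {ι : Type*} (s : Finset ι) {f : ι → Homs M.toGrMod N.toGrMod k}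
    (hf : ∀ i, Cont (f i)) : Cont (∑ i ∈ s, f i) := by
  classical
  induction s using Finset.induction_on with
  | empty => exact Cont.zero
  | insert a s ha ih =>
    rw [Finset.sum_insert ha]
    exact (hf a).add ih

theorem toHoms_hat (f : M ⟶ N.shift k) (x : M.Tot) :
    (toHoms f).hat x = (shOut N k).hat ((homs f).hat x) := funext fun j => by
  obtain ⟨i, rfl⟩ : ∃ i, j = i + k := ⟨j - k, by omega⟩
  rw [Homs.hat_apply _ rfl, toHoms_app, shOut_hat, homs_hat]

theorem toHoms_eq (f : M ⟶ N.shift k) :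
    toHoms f = Homs.comp (shOut N k) (homs f) (zero_add k) :=
  Homs.hat_inj fun x => by rw [toHoms_hat, Homs.comp_hat]

theorem cont_toHoms (f : M ⟶ N.shift k) : Cont (toHoms f) := by
  rw [toHoms_eq]
  exact (cont_shOut _ _).comp (homs_cont f) _

/-- The morphism `M → N[k]` given by a closed map of degree `k`. -/
theorem exists_toHoms_eq (f : Homs M.toGrMod N.toGrMod k) (hc : Cont f)
    (hf : homD M.toCDGMod N.toCDGMod rfl f = 0) : ∃ g : M ⟶ N.shift k, toHoms g = f := by
  have hf' : IsClosedHom (Homs.comp (shIn N k) f (add_neg_cancel k)) :=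
    (CDGMod.homD_eq_zero_iff _ _).2 fun x => by
      rw [Homs.comp_hat, Homs.comp_hat, CDGMod.hat_dh hf, map_smul, sgn_zero, one_smul, shIn_dh,
        smul_smul, sgn_mul_sgn, one_smul]
  refine ⟨ofHoms (Homs.comp (shIn N k) f (add_neg_cancel k)) ((cont_shIn N k).comp hc _) hf',
    Homs.hat_inj fun x => ?_⟩
  rw [toHoms_hat, homs_ofHoms, Homs.comp_hat, shOut_shIn]

/-- The degree `-1` homotopies to `N[k]` and the degree `k - 1` maps to `N` correspond under the
identity `N[k] → N`; the sign `(-1)^k` of the shifted differential is absorbed in the homotopy. -/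
theorem homotopic_iff_toHoms {f g : M ⟶ N.shift k} : Homotopic f g ↔
    ∃ h : Homs M.toGrMod N.toGrMod (k - 1), Cont h ∧
      homD M.toCDGMod N.toCDGMod (sub_add_cancel k 1) h = toHoms f - toHoms g := by
  have hs : sgn 𝕜 (k - 1) = -sgn 𝕜 k := by rw [sgn_sub, sgn_one, mul_neg_one]
  rw [homotopic_iff]
  constructor
  · rintro ⟨h, hc, hh⟩
    refine ⟨sgn 𝕜 k • Homs.comp (shOut N k) h (by omega), ((cont_shOut N k).comp hc _).smul _,
      Homs.hat_inj fun x => ?_⟩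
    have h1 := congrArg (fun f => (shOut N k).hat (f.hat x)) hh
    simp only [CDGMod.hat_homD, Homs.hat_sub, map_sub, sgn_neg, sgn_one, neg_one_smul,
      sub_neg_eq_add, map_add, shOut_dh] at h1
    rw [Homs.hat_sub, toHoms_hat, toHoms_hat, ← h1]
    simp only [CDGMod.hat_homD, Homs.hat_smul, Homs.comp_hat, map_smul, hs, neg_smul, smul_smul,
      sgn_mul_sgn, one_smul, sub_neg_eq_add, smul_add]
  · rintro ⟨h, hc, hh⟩
    refine ⟨sgn 𝕜 k • Homs.comp (shIn N k) h (by omega), ((cont_shIn N k).comp hc _).smul _,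
      Homs.hat_inj fun x => ?_⟩
    have h1 := congrArg (fun f => (shIn N k).hat (f.hat x)) hh
    simp only [CDGMod.hat_homD, Homs.hat_sub, map_sub, toHoms_hat, shIn_shOut, hs, neg_smul,
      sub_neg_eq_add, map_add, shIn_dh, map_smul] at h1
    rw [Homs.hat_sub, ← h1]
    simp only [CDGMod.hat_homD, Homs.hat_smul, Homs.comp_hat, map_smul, sgn_neg, sgn_one,
      neg_one_smul, sub_neg_eq_add, smul_add]

theorem toHoms_comp (f : L ⟶ M) (g : M ⟶ N.shift k) (x : L.Tot) :
    (toHoms (f ≫ g)).hat x = (toHoms g).hat ((homs f).hat x) := by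
  rw [toHoms_hat, toHoms_hat, SES.homs_comp_hat]

theorem toHoms_add (f g : M ⟶ N.shift k) : toHoms (f + g) = toHoms f + toHoms g :=
  Homs.hat_inj fun x => by
    rw [Homs.hat_add, toHoms_hat, toHoms_hat, toHoms_hat, homs_add, Homs.hat_add, map_add]

theorem toHoms_smul (c : 𝕜) (f : M ⟶ N.shift k) : toHoms (c • f) = c • toHoms f :=
  Homs.hat_inj fun x => by
    rw [Homs.hat_smul, toHoms_hat, toHoms_hat, homs_smul, Homs.hat_smul, map_smul]

end CLCTMod

namespace Tower

variable (t : Tower A) {N : CLCTMod.{u} A} {k : ℤ}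

/-- Such a map is a finite sum of maps through the factors `B n`, and all linear maps out of `B n`
are continuous. -/
theorem cont_of_suppLT (hB : ∀ n i, Finest 𝕜 ((t.B n).C i)) {m : ℕ}
    {f : Homs t.that.toGrMod N.toGrMod k} (hf : CDGComplex.SuppLT (X := t.complex) m f) :
    Cont f := by
  have h : f = ∑ n ∈ Finset.range m, Homs.comp (Homs.comp f (t.inc n) rfl) (t.pr n)
      (add_neg_cancel_left _ _) := Homs.hat_inj fun x => by
    refine (hf.eq_sum x).trans (Eq.trans (Finset.sum_congr rfl fun n _ => ?_)
      (CDGComplex.hat_sum _ _ x).symm)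
    exact ((Homs.comp_hat _ _ _ _).trans (Homs.comp_hat _ _ _ _)).symm
  rw [h]
  exact Cont.sum _ fun n => Cont.comp (M := t.B n) ⟨fun h => (hB n _).continuous _⟩ (t.cont_pr n) _

/-- Each `N^j` has a continuous norm. Composed with `f` it is a continuous seminorm on a product, so
the component of `f` in degree `j` ignores almost all factors. As `N` lives in finitely many
degrees, there is a common bound. This is where the product totalization turns into a direct sum of
Hom spaces. -/
theorem exists_suppLT (hN : IsDiscreteLC 𝕜 N.C) {f : Homs t.that.toGrMod N.toGrMod k}
    (hf : Cont f) : ∃ m, CDGComplex.SuppLT (X := t.complex) m f := by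
  classical
  have h1 : ∀ j : ℤ, ∃ T : Finset {p : ℕ × ℤ // j - k + p.1 = p.2}, ∀ x : t.TotC (j - k),
      (∀ p ∈ T, x p = 0) → f.app (sub_add_cancel j k) x = 0 := fun j => by
    obtain ⟨P, hP⟩ := exists_seminorm_eq_zero_imp 𝕜 (N.C j)
    obtain ⟨T, hT⟩ := exists_finset_of_seminorm (𝕜 := 𝕜)
      (X := fun p : {p : ℕ × ℤ // j - k + p.1 = p.2} => (t.B p.1.1).C p.1.2)
      (N := P.comp (f.app (sub_add_cancel j k) : t.TotC (j - k) →ₗ[𝕜] N.C j))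
      ((hN.finest j P).comp (hf.cont (sub_add_cancel j k)))
    exact ⟨T, fun x hx => hP _ (hT x hx)⟩
  choose T hT using h1
  obtain ⟨m, hm⟩ : ∃ m, ∀ j ∈ hN.finite.toFinset, ∀ p ∈ T j, p.1.1 < m := by
    refine ⟨(hN.finite.toFinset.sup fun j => (T j).sup fun p => p.1.1) + 1, fun j hj p hp => ?_⟩
    refine Nat.lt_succ_of_le ((Finset.le_sup (f := fun p : {p : ℕ × ℤ // j - k + p.1 = p.2} =>
      p.1.1) hp).trans (Finset.le_sup (f := fun j => (T j).sup fun p => p.1.1) hj))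
  refine ⟨m, fun x hx => funext fun j => ?_⟩
  by_cases hj : j ∈ hN.finite.toFinset
  · refine (f.hat_apply (sub_add_cancel j k) x).trans (hT j (x (j - k)) fun p hp => ?_)
    have h2 := congrFun (hx p.1.1 (hm j hj p hp)) p.1.2
    rw [Homs.hat_apply _ p.2] at h2
    exact h2
  · have : Subsingleton (N.C j) := not_nontrivial_iff_subsingleton.1 (by simpa using hj)
    exact Subsingleton.elim _ _

/-- A morphism `α` is represented by a closed continuous map `f` out of the product totalization
with `aug ≫ α = Q f`, unique up to homotopy, and it is sent to the value of `Ψ` on `f`. Continuity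
and finite support are the same condition for cocycles and for homotopies, so this is well defined
and bijective. -/
theorem exists_isComparison (E : ∀ n, FreeOn (t.B n).toGrMod)
    (hB : ∀ n i, Finest 𝕜 ((t.B n).C i)) (hN : IsDiscreteLC 𝕜 N.C) {V : Type u} [AddCommGroup V]
    [Module 𝕜 V] (S : GPResolution (t.K 0).toCDGMod)
    (hS : S = t.resolution fun n => (E n).isGradedProjective)
    (Ψ : S.finCocycles N.toCDGMod k →ₗ[𝕜] V) (hΨ : Function.Surjective Ψ)
    (hΨ' : ∀ φ, Ψ φ = 0 ↔ ∃ h : Homs S.complex.that.toGrMod N.toGrMod (k - 1),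
      (∃ m, CDGComplex.SuppLT m h) ∧
        homD S.complex.that N.toCDGMod (sub_add_cancel k 1) h = φ.1)
    (cls : (t.K 0 ⟶ N.shift k) → V)
    (hcls : ∀ f φ, (∀ x, φ.1.hat x = (toHoms f).hat (S.thatAug.hat x)) → Ψ φ = cls f) :
    ∃ Φ : ((DCtr.Q A).obj (t.K 0) ⟶ (DCtr.Q A).obj (N.shift k)) ≃ V, IsComparison cls Φ := by
  subst hS
  have hP := t.relProjective E hB
  have hb := DCtr.bijective_precomp hP t.aug t.contraacyclic_cone_aug
  -- `χ` reads a morphism to `N[k]` as a closed map of degree `k`, which has finite support because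
  -- `N` is discrete.
  have hχ : ∀ f : t.that ⟶ N.shift k, ∃ φ : (t.resolution fun n =>
      (E n).isGradedProjective).finCocycles N.toCDGMod k, φ.1 = toHoms f := fun f =>
    ⟨⟨toHoms f, toHoms_closed f, t.exists_suppLT hN (cont_toHoms f)⟩, rfl⟩
  choose χ hχ using hχ
  have hχ' : ∀ φ, ∃ f, χ f = φ := fun φ => by
    obtain ⟨m, hm⟩ := φ.2.2
    obtain ⟨f, hf⟩ := exists_toHoms_eq (M := t.that) (N := N) φ.1 (t.cont_of_suppLT hB hm) φ.2.1
    exact ⟨f, Subtype.ext ((hχ f).trans hf)⟩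
  have hΨχ : ∀ f g, Ψ (χ f) = Ψ (χ g) ↔ (DCtr.Q A).map f = (DCtr.Q A).map g := fun f g => by
    rw [(hb (N.shift k)).2.2.2, homotopic_iff_toHoms, ← sub_eq_zero, ← map_sub, hΨ']
    constructor
    · rintro ⟨h, ⟨m, hm⟩, hh⟩
      refine ⟨h, t.cont_of_suppLT hB hm, hh.trans ?_⟩
      rw [← hχ, ← hχ]
      rfl
    · rintro ⟨h, hc, hh⟩
      refine ⟨h, t.exists_suppLT hN hc, hh.trans ?_⟩
      rw [← hχ, ← hχ]
      rfl
  choose lift hlift using (hb (N.shift k)).1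
  -- The value does not depend on the chosen representative.
  have key : ∀ α f, (DCtr.Q A).map t.aug ≫ α = (DCtr.Q A).map f → Ψ (χ (lift α)) = Ψ (χ f) :=
    fun α f h => (hΨχ _ _).2 ((hlift α).symm.trans h)
  have hinj : Function.Injective fun α => Ψ (χ (lift α)) := fun α β h => by
    refine (hb _).2.2.1 α β ?_
    rw [hlift, hlift, ← hΨχ]
    exact h
  have hadd : ∀ f g, χ (f + g) = χ f + χ g := fun f g => Subtype.ext ((hχ _).trans (by
    rw [toHoms_add, ← hχ, ← hχ]
    rfl))
  have hsmul : ∀ (c : 𝕜) f, χ (c • f) = c • χ f := fun c f => Subtype.ext ((hχ _).trans (by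
    rw [toHoms_smul, ← hχ]
    rfl))
  refine ⟨Equiv.ofBijective (fun α => Ψ (χ (lift α))) ⟨hinj, fun v => ?_⟩, ⟨fun α β γ => ?_,
    fun c α => ?_, fun f => ?_⟩⟩
  · obtain ⟨φ, rfl⟩ := hΨ v
    obtain ⟨f, rfl⟩ := hχ' φ
    obtain ⟨α, hα⟩ := (hb _).2.1 f
    exact ⟨α, key α f hα⟩
  · change DCtr.IsSum α β γ ↔ Ψ (χ (lift α)) + Ψ (χ (lift β)) = Ψ (χ (lift γ))
    have hp : ∀ (d : t.that ⟶ CLCTMod.pi fun _ : ULift.{u} Bool => N.shift k)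
        (δ : (DCtr.Q A).obj (t.K 0) ⟶ (DCtr.Q A).obj (CLCTMod.pi fun _ : ULift.{u} Bool =>
          N.shift k)), (DCtr.Q A).map t.aug ≫ δ = (DCtr.Q A).map d → ∀ q : _ ⟶ N.shift k,
        (DCtr.Q A).map t.aug ≫ δ ≫ (DCtr.Q A).map q = (DCtr.Q A).map (d ≫ q) := fun d δ h q => by
      rw [← Category.assoc, h, ← Functor.map_comp]
    have hd : ∀ d : t.that ⟶ CLCTMod.pi fun _ : ULift.{u} Bool => N.shift k,
        d ≫ (piProj _ ⟨true⟩ + piProj _ ⟨false⟩) = d ≫ piProj _ ⟨true⟩ + d ≫ piProj _ ⟨false⟩ :=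
      fun d => hom_ext fun i x => rfl
    constructor
    · rintro ⟨δ, rfl, rfl, rfl⟩
      obtain ⟨d, hδ⟩ := (hb _).1 δ
      rw [key _ _ (hp d δ hδ _), key _ _ (hp d δ hδ _), key _ _ (hp d δ hδ _), hd, hadd, map_add]
    · intro h
      -- Conversely, the representatives of `α` and `β` are the components of a map to the product,
      -- and `δ` is the morphism represented by it.
      let d : t.that ⟶ CLCTMod.pi fun _ : ULift.{u} Bool => N.shift k :=
        ⟨fun i => ContinuousLinearMap.pi fun c =>
            Hom.app (if c.down then lift α else lift β) i,
          fun h x a => funext fun c => Hom.app_act _ h x a, fun h x => funext fun c =>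
            Hom.app_d _ h x⟩
      obtain ⟨δ, hδ⟩ := (hb _).2.1 d
      refine ⟨δ, (hb _).2.2.1 _ _ ?_, (hb _).2.2.1 _ _ ?_, hinj ?_⟩
      · rw [hp d δ hδ, hlift]
        rfl
      · rw [hp d δ hδ, hlift]
        rfl
      · refine (key _ _ (hp d δ hδ _)).trans ?_
        rw [hd, hadd, map_add]
        exact h
  · change Ψ (χ (lift _)) = c • Ψ (χ (lift α))
    have h : lift α ≫ (c • 𝟙 (N.shift k)) = c • lift α := hom_ext fun i x => rfl
    rw [key _ (lift α ≫ (c • 𝟙 (N.shift k))) (by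
      rw [← Category.assoc, hlift, ← Functor.map_comp]), h, hsmul, map_smul]
  · change Ψ (χ (lift _)) = _
    -- The morphism `Q f` is represented by `aug ≫ f`, on which `Ψ` is known.
    rw [key _ (t.aug ≫ f) (Functor.map_comp _ _ _).symm]
    refine hcls f _ fun x => ?_
    rw [hχ]
    refine (toHoms_comp t.aug f x).trans (congrArg _ ?_)
    exact (t.aug_hat x).trans ((t.resolution fun n =>
      (E n).isGradedProjective).thatAug_hat x).symm

end Tower

theorem exists_tower (hA : IsDiscreteLC 𝕜 A.C) (hA' : IsCountableDim 𝕜 A.C) (M : CLCTMod.{u} A)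
    (hM : IsDiscreteLC 𝕜 M.C) (hM' : IsCountableDim 𝕜 M.C) : ∃ t : Tower A, t.K 0 = M ∧
      Nonempty (∀ n, FreeOn (t.B n).toGrMod) ∧ ∀ n i, Finest 𝕜 ((t.B n).C i) :=
  ⟨freeTower hA hA' ⟨M, hM.finest, hM'⟩, rfl, ⟨freeTowerGen hA hA' _⟩, finest_freeTower hA hA' _⟩

theorem nonempty_gpResolution (hA : IsDiscreteLC 𝕜 A.C) (hA' : IsCountableDim 𝕜 A.C)
    (M : CLCTMod.{u} A) (hM : IsDiscreteLC 𝕜 M.C) (hM' : IsCountableDim 𝕜 M.C) :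
    Nonempty (GPResolution M.toCDGMod) := by
  obtain ⟨t, rfl, ⟨E⟩, -⟩ := exists_tower hA hA' M hM hM'
  exact ⟨t.resolution fun n => (E n).isGradedProjective⟩

theorem exists_isComparison_extII (hA : IsDiscreteLC 𝕜 A.C) (hA' : IsCountableDim 𝕜 A.C)
    (M : CLCTMod.{u} A) (hM : IsDiscreteLC 𝕜 M.C) (hM' : IsCountableDim 𝕜 M.C)
    (R : GPResolution M.toCDGMod) (N : CLCTMod.{u} A) (hN : IsDiscreteLC 𝕜 N.C) (n : ℤ) :
    ∃ Φ : ((DCtr.Q A).obj M ⟶ (DCtr.Q A).obj (N.shift n)) ≃ R.ExtII N.toCDGMod n,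
      IsComparison (fun f => R.classOf N.toCDGMod (toHoms f) (toHoms_closed f)) Φ := by
  obtain ⟨t, rfl, ⟨E⟩, hB⟩ := exists_tower hA hA' M hM hM'
  obtain ⟨Ψ, hΨ, hΨ', hcls⟩ := R.exists_comparison
    (t.resolution fun n => (E n).isGradedProjective) N.toCDGMod n
  exact t.exists_isComparison E hB hN _ rfl Ψ hΨ hΨ' _ fun f φ h => hcls _ _ φ h

end ComparisonOfMorphisms

/-! ### Completed tensor products of spaces with the finest locally convex topology -/

section FinestTensor

variable {𝕜 : Type} [RCLike 𝕜]

/-- By countability a seminorm on the tensor product is bounded on elementary tensors by some `p x *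
q y`, hence everywhere by the projective seminorm of `p` and `q`, which is continuous. -/
theorem Finest.preProj {E F : Type u} [AddCommGroup E] [Module 𝕜 E] [UniformSpace E]
    [AddCommGroup F] [Module 𝕜 F] [UniformSpace F] (hE : Finest 𝕜 E) (hF : Finest 𝕜 F)
    (hE' : Module.rank 𝕜 E ≤ Cardinal.aleph0) (hF' : Module.rank 𝕜 F ≤ Cardinal.aleph0) :
    Finest 𝕜 (PreProj 𝕜 E F) := fun N => by
  obtain ⟨p, q, h⟩ := exists_bilinear_bound hE' hF' (PreProj.mk 𝕜 E F) N
  refine Seminorm.continuous_of_le (continuous_preSeminorm (hE p) (hF q)) fun u => ?_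
  have := le_projSeminorm (p := p) (q := q) (N := N) zero_le_one
    (fun x y => by rw [one_mul]; exact h x y) u
  rwa [one_mul] at this

section Completion

open UniformSpace

variable {X : Type*} [AddCommGroup X] [Module 𝕜 X] [UniformSpace X] [IsUniformAddGroup X]
  [UniformContinuousConstSMul 𝕜 X] [PolynormableSpace 𝕜 X]

/-- The completion adds no elements, so each seminorm on it is the extension of its restriction to
`X`. -/
theorem Finest.completion (h : Finest 𝕜 X) : Finest 𝕜 (Completion X) := fun N => by
  have h1 : N = complSeminorm (N.comp (toComplLinear (𝕜 := 𝕜) (X := X)).toLinearMap) (h _) := by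
    refine Seminorm.ext fun z => ?_
    obtain ⟨x, rfl⟩ := h.coe_surjective z
    exact (complSeminorm_coe (N.comp (toComplLinear (𝕜 := 𝕜) (X := X)).toLinearMap) (h _) x).symm
  rw [h1]
  exact continuous_complSeminorm _ _

theorem Finest.coe_bijective [ContinuousSMul 𝕜 X] (h : Finest 𝕜 X) :
    Function.Bijective ((↑) : X → Completion X) :=
  have := h.completeLC
  ⟨Completion.coe_injective X, h.coe_surjective⟩

end Completion

theorem GTensor.finite_nontrivial {E : ℤ → Type u} {n : ℤ} (hfin : {i | Nontrivial (E i)}.Finite) :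
    {p : {p : ℤ × ℤ // p.1 + p.2 = n} | Nontrivial (E p.1.1)}.Finite :=
  Set.Finite.preimage (f := fun p : {p : ℤ × ℤ // p.1 + p.2 = n} => p.1.1)
    (fun p _ q _ (h : p.1.1 = q.1.1) => Subtype.ext (Prod.ext h (by
    have := p.2
    have := q.2
    omega))) hfin

namespace GTensor

variable {E F : ℤ → Type u} [∀ i, AddCommGroup (E i)] [∀ i, Module 𝕜 (E i)]
  [∀ i, UniformSpace (E i)] [∀ i, AddCommGroup (F i)] [∀ i, Module 𝕜 (F i)]
  [∀ i, UniformSpace (F i)] (n : ℤ)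

variable (𝕜 E F) in
/-- The canonical map from the algebraic to the completed tensor product. -/
noncomputable def ofDTensor : DTensor 𝕜 E F n →ₗ[𝕜] GTensor 𝕜 E F n :=
  DTensor.lift fun h => gtm h

@[simp] theorem ofDTensor_tm {a b : ℤ} (h : a + b = n) (x : E a) (y : F b) :
    ofDTensor 𝕜 E F n (DTensor.tm h x y) = gtm h x y :=
  DTensor.lift_tm _ _ _ _

/-- In each bidegree the comparison map is the map from the algebraic tensor product to its
completion; both are linear and agree on elementary tensors. -/
theorem ofDTensor_apply (u : DTensor 𝕜 E F n) (p : {p : ℤ × ℤ // p.1 + p.2 = n}) :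
    ofDTensor 𝕜 E F n u p =
      ((show PreProj 𝕜 (E p.1.1) (F p.1.2) from u p : PreProj 𝕜 (E p.1.1) (F p.1.2)) :
        ProjTensor 𝕜 (E p.1.1) (F p.1.2)) := by
  classical
  let c : E p.1.1 ⊗[𝕜] F p.1.2 →ₗ[𝕜] ProjTensor 𝕜 (E p.1.1) (F p.1.2) :=
    (toComplLinear (𝕜 := 𝕜) (X := PreProj 𝕜 (E p.1.1) (F p.1.2))).toLinearMap
  refine LinearMap.congr_fun (f := LinearMap.proj p ∘ₗ ofDTensor 𝕜 E F n)
    (g := c ∘ₗ DirectSum.component 𝕜 {p : ℤ × ℤ // p.1 + p.2 = n}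
      (fun p => E p.1.1 ⊗[𝕜] F p.1.2) p) (DTensor.hom_ext fun {a b} h x y => ?_) u
  refine (congrFun (ofDTensor_tm n h x y) p).trans ?_
  by_cases hp : p = ⟨(a, b), h⟩
  · subst hp
    have e₁ : DirectSum.component 𝕜 {p : ℤ × ℤ // p.1 + p.2 = n} (fun p => E p.1.1 ⊗[𝕜] F p.1.2)
        ⟨(a, b), h⟩ (DTensor.tm h x y) = x ⊗ₜ[𝕜] y := DirectSum.component.lof_self 𝕜 _ _
    rw [gtm_same, LinearMap.comp_apply, e₁]
    rfl
  · have e₁ : DirectSum.component 𝕜 {p : ℤ × ℤ // p.1 + p.2 = n} (fun p => E p.1.1 ⊗[𝕜] F p.1.2)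
        p (DTensor.tm h x y) = 0 := DFinsupp.single_eq_of_ne hp
    rw [gtm_ne h x y fun e => hp (Subtype.ext e), LinearMap.comp_apply, e₁, map_zero]

variable {n}

theorem finest (hE : ∀ i, Finest 𝕜 (E i)) (hF : ∀ i, Finest 𝕜 (F i)) (hE' : IsCountableDim 𝕜 E)
    (hF' : IsCountableDim 𝕜 F) (p : {p : ℤ × ℤ // p.1 + p.2 = n}) :
    Finest 𝕜 (PreProj 𝕜 (E p.1.1) (F p.1.2)) :=
  (hE _).preProj (hF _) (hE' _) (hF' _)

/-- In each bidegree the projective topology is the finest one, hence already complete. Only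
finitely many bidegrees of total degree `n` are non-zero, so the direct sum is the product. -/
theorem ofDTensor_bijective (hE : ∀ i, Finest 𝕜 (E i)) (hF : ∀ i, Finest 𝕜 (F i))
    (hE' : IsCountableDim 𝕜 E) (hF' : IsCountableDim 𝕜 F)
    (hfin : {i | Nontrivial (E i)}.Finite) : Function.Bijective (ofDTensor 𝕜 E F n) := by
  classical
  have hb := fun p => (finest hE hF hE' hF' (n := n) p).coe_bijective
  constructor
  · intro u v h
    refine DFinsupp.ext fun p => (hb p).1 ?_
    have := congrFun h p
    rwa [ofDTensor_apply, ofDTensor_apply] at this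
  · intro v
    choose w hw using fun p => (hb p).2 (v p)
    refine ⟨DFinsupp.mk (finite_nontrivial hfin).toFinset fun p => w p.1, funext fun p => ?_⟩
    rw [ofDTensor_apply]
    refine Eq.trans (congrArg _ ?_) (hw p)
    refine DFinsupp.mk_apply.trans ?_
    by_cases hp : p ∈ (finite_nontrivial hfin).toFinset
    · exact dif_pos hp
    · refine (dif_neg hp).trans ?_
      have h1 : Subsingleton (E p.1.1) := not_nontrivial_iff_subsingleton.1 (by simpa using hp)
      exact Subsingleton.elim (α := E p.1.1 ⊗[𝕜] F p.1.2) _ _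

theorem isCountableDim (hE : ∀ i, Finest 𝕜 (E i)) (hF : ∀ i, Finest 𝕜 (F i))
    (hE' : IsCountableDim 𝕜 E) (hF' : IsCountableDim 𝕜 F)
    (hfin : {i | Nontrivial (E i)}.Finite) : IsCountableDim 𝕜 (GTensor 𝕜 E F) := fun n =>
  (LinearEquiv.ofBijective _ (ofDTensor_bijective hE hF hE' hF' hfin)).rank_eq.symm.le.trans
    (hE'.dTensor hF' n)

theorem subsingleton_projTensor {E F : Type u} [AddCommGroup E] [Module 𝕜 E] [UniformSpace E]
    [AddCommGroup F] [Module 𝕜 F] [UniformSpace F] (h : Subsingleton E ∨ Subsingleton F) :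
    Subsingleton (ProjTensor 𝕜 E F) := by
  have : ContinuousLinearMap.id 𝕜 (ProjTensor 𝕜 E F) = 0 := ProjTensor.hom_ext fun x y => by
    rcases h with h | h
    · rw [Subsingleton.elim x 0]
      simp [ptmul]
    · rw [Subsingleton.elim y 0]
      simp [ptmul]
  exact ⟨fun u v => by rw [← ContinuousLinearMap.id_apply (R₁ := 𝕜) u, 
    ← ContinuousLinearMap.id_apply (R₁ := 𝕜) v, this]; rfl⟩

/-- In each degree there is a finite product of spaces with the finest topology, and a non-zero
degree is a sum of non-zero degrees of `E` and `F`, of which there are finitely many. -/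
theorem isDiscreteLC [∀ i, CompleteLC 𝕜 (E i)] [∀ i, CompleteLC 𝕜 (F i)]
    (hE : IsDiscreteLC 𝕜 E) (hF : IsDiscreteLC 𝕜 F)
    (hE' : IsCountableDim 𝕜 E) (hF' : IsCountableDim 𝕜 F) :
    IsDiscreteLC 𝕜 (GTensor 𝕜 E F) := by
  refine isDiscreteLC_of_finest (fun n => Finest.pi
    (fun p => (finest hE.finest hF.finest hE' hF' p).completion) ?_) ?_
  · refine (finite_nontrivial hE.finite).subset fun p hp => ?_
    by_contra hc
    rw [Set.mem_ofPred_eq, not_nontrivial_iff_subsingleton] at hc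
    exact not_nontrivial_iff_subsingleton.2 (subsingleton_projTensor (.inl hc)) hp
  · refine ((hE.finite.prod hF.finite).image fun p => p.1 + p.2).subset fun n hn => ?_
    by_contra hc
    refine not_nontrivial_iff_subsingleton.2 (?_ : Subsingleton (GTensor 𝕜 E F n)) hn
    refine ⟨fun u v => funext fun p => ?_⟩
    refine (subsingleton_projTensor ?_).elim _ _
    by_contra h
    rw [not_or, not_subsingleton_iff_nontrivial, not_subsingleton_iff_nontrivial] at h
    exact hc ⟨p.1, h, p.2⟩

end GTensor

end FinestTensor

/-! ### Restriction of scalars along isomorphisms of cdg-algebras -/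

section Restriction

variable {𝕜 : Type} [Field 𝕜]

/-- An isomorphism of cdg-algebras. -/
structure CDGAlg.Iso (A' A : CDGAlg.{u} 𝕜) where
  e : ∀ i, A'.C i ≃ₗ[𝕜] A.C i
  map_one : e 0 A'.one = A.one
  map_mul : ∀ {i j n : ℤ} (h : i + j = n) (x : A'.C i) (y : A'.C j),
    e n (A'.mul h x y) = A.mul h (e i x) (e j y)
  map_d : ∀ {i j : ℤ} (h : i + 1 = j) (x : A'.C i), e j (A'.d h x) = A.d h (e i x)
  map_B : e 2 A'.B = A.B

namespace CDGAlg.Iso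

variable {A' A : CDGAlg.{u} 𝕜}

/-- The inverse isomorphism. -/
def symm (θ : CDGAlg.Iso A' A) : CDGAlg.Iso A A' where
  e i := (θ.e i).symm
  map_one := by rw [← θ.map_one, LinearEquiv.symm_apply_apply]
  map_mul h x y := (θ.e _).injective (by simp [θ.map_mul])
  map_d h x := (θ.e _).injective (by simp [θ.map_d])
  map_B := by rw [← θ.map_B, LinearEquiv.symm_apply_apply]

end CDGAlg.Iso

/-- The isomorphism between two tensor products of cdg-algebras which is the identity on elementary
tensors. -/
def TensorData.iso {A B : CDGAlg.{u} 𝕜} (D' D : TensorData A B)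
    (hext : ∀ {i j : ℤ} {f g : D'.T i →ₗ[𝕜] D.T j},
      (∀ {a b : ℤ} (h : a + b = i) (x : A.C a) (y : B.C b), f (D'.tm h x y) = g (D'.tm h x y)) →
      f = g)
    (φ : ∀ n, D'.T n ≃ₗ[𝕜] D.T n)
    (hφ : ∀ {a b n : ℤ} (h : a + b = n) (x : A.C a) (y : B.C b),
      φ n (D'.tm h x y) = D.tm h x y) : CDGAlg.Iso D'.toCDGAlg D.toCDGAlg where
  e := φ
  map_one := hφ _ _ _
  map_mul {i j n} h u v := by
    refine LinearMap.congr_fun (f := (φ n).toLinearMap ∘ₗ (D'.mul h).flip v)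
      (g := (D.mul h).flip (φ j v) ∘ₗ (φ i).toLinearMap) (hext fun {a b} hi x y => ?_) u
    refine LinearMap.congr_fun (f := (φ n).toLinearMap ∘ₗ D'.mul h (D'.tm hi x y))
      (g := D.mul h (φ i (D'.tm hi x y)) ∘ₗ (φ j).toLinearMap) (hext fun {a' b'} hj x' y' => ?_) v
    simp only [LinearMap.comp_apply, LinearEquiv.coe_coe]
    rw [D'.mul_tm hi hj h rfl rfl (by omega), map_smul, hφ, hφ, hφ,
      D.mul_tm hi hj h rfl rfl (by omega)]
  map_d {i j} h u := by
    refine LinearMap.congr_fun (f := (φ j).toLinearMap ∘ₗ D'.d h)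
      (g := D.d h ∘ₗ (φ i).toLinearMap) (hext fun {a b} hi x y => ?_) u
    simp only [LinearMap.comp_apply, LinearEquiv.coe_coe]
    rw [D'.d_tm hi h rfl rfl (by omega) (by omega), map_add, map_smul, hφ, hφ, hφ,
      D.d_tm hi h rfl rfl (by omega) (by omega)]
  map_B := (map_add (φ 2) _ _).trans (congrArg₂ _ (hφ _ _ _) (hφ _ _ _))

variable {A' A : CDGAlg.{u} 𝕜} (θ : CDGAlg.Iso A' A)

/-- The restriction of scalars of a graded module. -/
def GrMod.restrict (M : GrMod.{u} A)
    (act : ∀ {i j n : ℤ}, i + j = n → (M.C i →ₗ[𝕜] A'.C j →ₗ[𝕜] M.C n))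
    (h : ∀ {i j n : ℤ} (h : i + j = n) x a, act h x a = M.act h x (θ.e j a)) : GrMod.{u} A' where
  C := M.C
  act := act
  act_one x := by rw [h, θ.map_one, M.act_one]
  act_act h₁ h₂ h₃ h₄ x y z := by rw [h, h, h, θ.map_mul, M.act_act h₁ h₂ h₃ h₄]

/-- The restriction of scalars of a cdg-module. -/
def CDGMod.restrict (M : CDGMod.{u} A)
    (act : ∀ {i j n : ℤ}, i + j = n → (M.C i →ₗ[𝕜] A'.C j →ₗ[𝕜] M.C n))
    (h : ∀ {i j n : ℤ} (h : i + j = n) x a, act h x a = M.act h x (θ.e j a)) : CDGMod.{u} A' where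
  toGrMod := M.toGrMod.restrict θ act h
  d := M.d
  leibniz h₀ hn hi hj h₁ h₂ x y :=
    (congrArg (M.d hn) (h h₀ x y)).trans ((M.leibniz h₀ hn hi hj h₁ h₂ x (θ.e _ y)).trans
      (congrArg₂ _ (h _ _ _).symm (congrArg _ ((congrArg _ (θ.map_d hj y).symm).trans
        (h _ _ _).symm))))
  d_d h₁ h₂ h₃ x := (M.d_d h₁ h₂ h₃ x).trans
    (congrArg _ ((congrArg _ θ.map_B.symm).trans (h _ _ _).symm))

/-- `A`-linear maps as linear maps over an isomorphic algebra. -/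
def Homs.restrict {M N : GrMod.{u} A} {k : ℤ} 
    {a : ∀ {i j n : ℤ}, i + j = n → (M.C i →ₗ[𝕜] A'.C j →ₗ[𝕜] M.C n)}
    (ha : ∀ {i j n : ℤ} (h : i + j = n) x y, a h x y = M.act h x (θ.e j y))
    {b : ∀ {i j n : ℤ}, i + j = n → (N.C i →ₗ[𝕜] A'.C j →ₗ[𝕜] N.C n)}
    (hb : ∀ {i j n : ℤ} (h : i + j = n) x y, b h x y = N.act h x (θ.e j y)) :
    Homs M N k ≃ₗ[𝕜] Homs (M.restrict θ a ha) (N.restrict θ b hb) k where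
  toFun f := ⟨f.1, fun {i j n i' n'} h hi hn h' x y =>
    (congrArg (f.app hn) (ha h x y)).trans ((f.app_act h hi hn h' x _).trans (hb _ _ _).symm)⟩
  invFun f := ⟨f.1, fun {i j n i' n'} h hi hn h' x y => by
    obtain ⟨y, rfl⟩ := (θ.e j).surjective y
    exact (congrArg (f.app hn) (ha h x y).symm).trans ((f.app_act h hi hn h' x y).trans (hb _ _ _))⟩
  map_add' _ _ := rfl
  map_smul' _ _ := rfl
  left_inv _ := rfl
  right_inv _ := rfl

/-- A lifting problem over `A'` is moved to `A` by the inverse isomorphism, solved there, and moved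
back. Because `restrict` takes the action as an argument, restricting twice returns the original
modules without any transport. -/
theorem IsGradedProjective.restrict {P : GrMod.{u} A} (hP : IsGradedProjective P)
    {a : ∀ {i j n : ℤ}, i + j = n → (P.C i →ₗ[𝕜] A'.C j →ₗ[𝕜] P.C n)}
    (ha : ∀ {i j n : ℤ} (h : i + j = n) x y, a h x y = P.act h x (θ.e j y)) :
    IsGradedProjective (P.restrict θ a ha) := by
  intro X Y p f hp
  let ext : ∀ X : GrMod.{u} A', ∀ {i j n : ℤ}, i + j = n → (X.C i →ₗ[𝕜] A.C j →ₗ[𝕜] X.C n) :=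
    fun X {i j n} h => (X.act h).compl₁₂ LinearMap.id (θ.symm.e j).toLinearMap
  have hP' : ∀ {i j n : ℤ} (h : i + j = n) x y, P.act h x y = (P.restrict θ a ha).act h x
      (θ.symm.e j y) := fun {i j n} h x y => by
    refine Eq.trans ?_ (ha h x _).symm
    exact congrArg _ ((θ.e j).apply_symm_apply y).symm
  have hX : ∀ X : GrMod.{u} A', ∀ {i j n : ℤ} (h : i + j = n) x y, X.act h x y =
      (X.restrict θ.symm (ext X) fun _ _ _ => rfl).act h x (θ.e j y) := fun X {i j n} h x y =>
    congrArg _ ((θ.e j).symm_apply_apply y).symm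
  let X' := X.restrict θ.symm (ext X) fun _ _ _ => rfl
  let Y' := Y.restrict θ.symm (ext Y) fun _ _ _ => rfl
  let f' : Homs ((P.restrict θ a ha).restrict θ.symm P.act hP') Y' 0 :=
    Homs.restrict θ.symm hP' (fun _ _ _ => rfl) f
  obtain ⟨g, hg⟩ := hP X' Y' (Homs.restrict θ.symm (fun _ _ _ => rfl) (fun _ _ _ => rfl) p) f' hp
  let g' : Homs (P.restrict θ a ha) (X'.restrict θ X.act (hX X)) 0 := Homs.restrict θ ha (hX X) g
  have h : (Homs.precomp g Y' rfl (Homs.restrict θ.symm (fun _ _ _ => rfl) (fun _ _ _ => rfl) p)).1 =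
      f'.1 := congrArg Subtype.val hg
  exact ⟨g', Subtype.ext h⟩

/-- The restriction of scalars of a resolution. -/
def GPResolution.restrict {M : CDGMod.{u} A} (S : GPResolution M)
    {a : ∀ {i j n : ℤ}, i + j = n → (M.C i →ₗ[𝕜] A'.C j →ₗ[𝕜] M.C n)}
    (ha : ∀ {i j n : ℤ} (h : i + j = n) x y, a h x y = M.act h x (θ.e j y)) :
    GPResolution (M.restrict θ a ha) where
  F n := (S.F n).restrict θ (fun h => ((S.F n).act h).compl₁₂ LinearMap.id (θ.e _).toLinearMap)
    fun _ _ _ => rfl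
  del n := Homs.restrict θ (fun _ _ _ => rfl) (fun _ _ _ => rfl) (S.del n)
  aug := Homs.restrict θ (fun _ _ _ => rfl) ha S.aug
  proj n := (S.proj n).restrict θ fun _ _ _ => rfl
  del_closed n := Subtype.ext (congrArg Subtype.val (S.del_closed n) : _)
  aug_closed := Subtype.ext (congrArg Subtype.val S.aug_closed : _)
  aug_surj := S.aug_surj
  exact_zero := S.exact_zero
  exact_succ := S.exact_succ

namespace GPResolution

variable {M N : CDGMod.{u} A} (S : GPResolution M)
  {a : ∀ {i j n : ℤ}, i + j = n → (M.C i →ₗ[𝕜] A'.C j →ₗ[𝕜] M.C n)}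
  (ha : ∀ {i j n : ℤ} (h : i + j = n) x y, a h x y = M.act h x (θ.e j y))
  {b : ∀ {i j n : ℤ}, i + j = n → (N.C i →ₗ[𝕜] A'.C j →ₗ[𝕜] N.C n)}
  (hb : ∀ {i j n : ℤ} (h : i + j = n) x y, b h x y = N.act h x (θ.e j y)) {k : ℤ}

/-- Maps out of the totalization of a resolution and maps out of the totalization of its
restriction of scalars. -/
def restrictThat : Homs S.complex.that.toGrMod N.toGrMod k ≃ₗ[𝕜]
    Homs (S.restrict θ ha).complex.that.toGrMod (N.restrict θ b hb).toGrMod k :=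
  Homs.restrict θ (M := S.complex.that.toGrMod) (a := (S.restrict θ ha).complex.that.act)
    (fun _ _ _ => rfl) hb

/-- Ext of the second kind over an isomorphic algebra. -/
theorem exists_comparison_restrict (R : GPResolution (M.restrict θ a ha)) :
    ∃ Ψ : S.finCocycles N k →ₗ[𝕜] R.ExtII (N.restrict θ b hb) k, Function.Surjective Ψ ∧
    (∀ φ, Ψ φ = 0 ↔ ∃ h : Homs S.complex.that.toGrMod N.toGrMod (k - 1),
      (∃ m, CDGComplex.SuppLT m h) ∧
        homD S.complex.that N (sub_add_cancel k 1) h = φ.1) ∧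
    ∀ (f : Homs M.toGrMod N.toGrMod k)
      (f' : Homs (M.restrict θ a ha).toGrMod (N.restrict θ b hb).toGrMod k)
      (hf' : homD (M.restrict θ a ha) (N.restrict θ b hb) rfl f' = 0) (φ : S.finCocycles N k),
      (∀ x, f'.hat x = f.hat x) → (∀ x, φ.1.hat x = f.hat (S.thatAug.hat x)) →
        Ψ φ = R.classOf (N.restrict θ b hb) f' hf' := by
  obtain ⟨Ψ, hΨ, hΨ', hcls⟩ := R.exists_comparison (S.restrict θ ha) (N.restrict θ b hb) k
  -- Restriction of scalars changes neither the underlying maps nor the differentials, so both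
  -- spaces of cocycles of finite support have the same elements.
  let c : S.finCocycles N k →ₗ[𝕜] (S.restrict θ ha).finCocycles (N.restrict θ b hb) k :=
    (((S.restrictThat θ ha hb).toLinearMap ∘ₗ (S.finCocycles N k).subtype).codRestrict _
      fun φ => ⟨Subtype.ext (congrArg Subtype.val φ.2.1 : _), φ.2.2⟩)
  refine ⟨Ψ ∘ₗ c, hΨ.comp fun φ => ?_, fun φ => (hΨ' (c φ)).trans ⟨?_, ?_⟩,
    fun f f' hf' φ hff hφ => hcls f' hf' (c φ) fun x => ?_⟩
  · exact ⟨⟨(S.restrictThat θ ha hb).symm φ.1, Subtype.ext (congrArg Subtype.val φ.2.1 : _),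
      φ.2.2⟩, rfl⟩
  · rintro ⟨h, hm, hh⟩
    exact ⟨(S.restrictThat θ ha hb).symm h, hm, Subtype.ext (congrArg Subtype.val hh : _)⟩
  · rintro ⟨h, hm, hh⟩
    exact ⟨S.restrictThat θ ha hb h, hm, Subtype.ext (congrArg Subtype.val hh : _)⟩
  · exact (hφ x).trans (hff _).symm

end GPResolution

end Restriction

/-! ### Hochschild cohomology -/

section Hochschild

open CategoryTheory CLCTMod

variable {𝕜 : Type} [RCLike 𝕜] {A : CLCTAlg.{u} 𝕜}

theorem CLCTAlg.isDiscreteLC_env (hA : IsDiscreteLC 𝕜 A.C) (hA' : IsCountableDim 𝕜 A.C) :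
    IsDiscreteLC 𝕜 A.env.C :=
  GTensor.isDiscreteLC (E := A.op.C) (F := A.C) hA hA hA' hA'

theorem CLCTAlg.isCountableDim_env (hA : IsDiscreteLC 𝕜 A.C) (hA' : IsCountableDim 𝕜 A.C) :
    IsCountableDim 𝕜 A.env.C :=
  GTensor.isCountableDim (E := A.op.C) (F := A.C) hA.finest hA.finest hA' hA' hA.finite

/-- For a discrete algebra `A` of countable dimension, the algebraic enveloping algebra is
isomorphic to the completed one. -/
noncomputable def CLCTAlg.envIso (hA : IsDiscreteLC 𝕜 A.C) (hA' : IsCountableDim 𝕜 A.C) :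
    CDGAlg.Iso A.toCDGAlg.discreteEnv A.env.toCDGAlg :=
  TensorData.iso (A.toCDGAlg.op.discreteTensorData A.toCDGAlg) (A.op.tensorData A)
    (fun {i j f g} h => DTensor.hom_ext (E := A.op.C) (F := A.C) (n := i)
      (G := GTensor 𝕜 A.op.C A.C j) (f := f) (g := g) h)
    (fun n => LinearEquiv.ofBijective (GTensor.ofDTensor 𝕜 A.op.C A.C n)
      (GTensor.ofDTensor_bijective hA.finest hA.finest hA' hA' hA.finite))
    (fun {_ _ n} h x y => GTensor.ofDTensor_tm (E := A.op.C) (F := A.C) n h x y)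

/-- Both actions are linear in `u` and given by the same formula on elementary tensors. Thus the
algebraic diagonal module is the restriction of scalars of the completed one. -/
theorem CLCTAlg.discreteDiag_act (hA : IsDiscreteLC 𝕜 A.C) (hA' : IsCountableDim 𝕜 A.C)
    {i j n : ℤ} (h : i + j = n) (z : A.C i) (u : A.toCDGAlg.discreteEnv.C j) :
    A.toCDGAlg.discreteDiag.act h z u =
      A.diag.act h z ((CLCTAlg.envIso hA hA').e j u) := by
  refine LinearMap.congr_fun (f := A.toCDGAlg.diagAct h z)
    (g := diagMul A i j n z ∘ₗ GTensor.ofDTensor 𝕜 A.op.C A.C j)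
    (DTensor.hom_ext fun {a b} hab x y => ?_) u
  rw [A.diagAct_tm h hab rfl (by omega)]
  refine (diagMul_gtm A h hab rfl (by omega) z x y).symm.trans ?_
  exact congrArg (diagMul A i j n z) (GTensor.ofDTensor_tm (E := A.op.C) (F := A.C) j hab x y).symm

theorem CLCTAlg.diagHoms_hat {k : ℤ} (f : A.diag ⟶ A.diag.shift k)
    (x : A.toCDGAlg.discreteDiag.Tot) : (A.diagHoms f).hat x = (toHoms f).hat x := funext fun j => by
  obtain ⟨i, rfl⟩ : ∃ i, i + k = j := ⟨j - k, by omega⟩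
  exact (Homs.hat_apply (A.diagHoms f) (rfl : i + k = i + k) x).trans
    (Homs.hat_apply (toHoms f) (rfl : i + k = i + k) x).symm

theorem nonempty_gpResolution_discreteDiag (hA : IsDiscreteLC 𝕜 A.C)
    (hA' : IsCountableDim 𝕜 A.C) : Nonempty (GPResolution A.toCDGAlg.discreteDiag) := by
  obtain ⟨S⟩ := nonempty_gpResolution (CLCTAlg.isDiscreteLC_env hA hA')
    (CLCTAlg.isCountableDim_env hA hA') A.diag hA hA'
  exact ⟨S.restrict (CLCTAlg.envIso hA hA') (a := A.toCDGAlg.discreteDiag.act)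
    (CLCTAlg.discreteDiag_act hA hA')⟩

/-- The tower of free covers is formed over the completed enveloping algebra, where the
contraderived category lives. Its resolution is restricted to the algebraic enveloping algebra and
compared there with the given one. -/
theorem exists_isComparison_discreteDiag (hA : IsDiscreteLC 𝕜 A.C) (hA' : IsCountableDim 𝕜 A.C)
    (R : GPResolution A.toCDGAlg.discreteDiag) (n : ℤ) :
    ∃ Φ : ((DCtr.Q A.env).obj A.diag ⟶ (DCtr.Q A.env).obj (A.diag.shift n)) ≃
        R.ExtII A.toCDGAlg.discreteDiag n,
      IsComparison (fun f => R.classOf A.toCDGAlg.discreteDiag (A.diagHoms f)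
        (A.diagHoms_closed f)) Φ := by
  have hE := CLCTAlg.isDiscreteLC_env hA hA'
  have hE' := CLCTAlg.isCountableDim_env hA hA'
  let t := freeTower hE hE' ⟨A.diag, fun i => hA.finest i, hA'⟩
  let gen := freeTowerGen hE hE' ⟨A.diag, fun i => hA.finest i, hA'⟩
  let S : GPResolution A.diag.toCDGMod := t.resolution fun n => (gen n).isGradedProjective
  obtain ⟨Ψ, hΨ, hΨ', hcls⟩ := S.exists_comparison_restrict (CLCTAlg.envIso hA hA')
    (a := A.toCDGAlg.discreteDiag.act) (CLCTAlg.discreteDiag_act hA hA')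
    (N := A.diag.toCDGMod) (b := A.toCDGAlg.discreteDiag.act) (CLCTAlg.discreteDiag_act hA hA')
    (k := n) R
  exact t.exists_isComparison gen (finest_freeTower hE hE' _) hA S rfl Ψ hΨ hΨ'
    (fun f => R.classOf A.toCDGAlg.discreteDiag (A.diagHoms f) (A.diagHoms_closed f))
    fun f φ h => hcls (toHoms f) (A.diagHoms f) (A.diagHoms_closed f) φ
      (CLCTAlg.diagHoms_hat f) h

end Hochschild

open CategoryTheory in
theorem mainTheorem4 {𝕜 : Type} [RCLike 𝕜] (A : CLCTAlg.{u} 𝕜) (hA : IsDiscreteLC 𝕜 A.C)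
    (hA' : IsCountableDim 𝕜 A.C) :
    (∀ M : CLCTMod.{u} A, IsDiscreteLC 𝕜 M.C → IsCountableDim 𝕜 M.C →
      Nonempty (GPResolution M.toCDGMod) ∧
      ∀ (R : GPResolution M.toCDGMod) (N : CLCTMod.{u} A), IsDiscreteLC 𝕜 N.C → ∀ n : ℤ,
        ∃ Φ : ((DCtr.Q A).obj M ⟶ (DCtr.Q A).obj (N.shift n)) ≃ R.ExtII N.toCDGMod n,
          IsComparison
            (fun f => R.classOf N.toCDGMod (CLCTMod.toHoms f) (CLCTMod.toHoms_closed f)) Φ) ∧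
    (Nonempty (GPResolution A.discreteDiag) ∧
      ∀ (R : GPResolution A.discreteDiag) (n : ℤ),
        ∃ Φ : ((DCtr.Q A.env).obj A.diag ⟶ (DCtr.Q A.env).obj (A.diag.shift n)) ≃
            R.ExtII A.discreteDiag n,
          IsComparison
            (fun f => R.classOf A.discreteDiag (A.diagHoms f) (A.diagHoms_closed f)) Φ) := by
  exact ⟨fun M hM hM' => ⟨nonempty_gpResolution hA hA' M hM hM', fun R N hN n =>
      exists_isComparison_extII hA hA' M hM hM' R N hN n⟩,
    nonempty_gpResolution_discreteDiag hA hA', fun R n =>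
      exists_isComparison_discreteDiag hA hA' R n⟩
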